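/- The model is the word RAM: words have $w$ bits, memory cells are addressed by words, and addition, subtraction, multiplication, integer division, bitwise Boolean operations, shifts, loads, stores and comparisons/jumps take one unit of time each. The space of a data structure is the number of memory cells in use, i.e. holding a nonzero word (uniform cost criterion). Let $\varepsilon>0$. There are a constant $K$ and two fixed deterministic programs, for queries and for color-reassignments, depending only on $\varepsilon$, such that the following holds for all $n$, all $\sigma\le n$, and every word length $w\ge(1+\varepsilon)\log_2 n+K$. Let $T=(V,E)$ be a rooted tree with $V=\{0,\dots,n-1\}$ and let $c:V\to C$ be a coloring of its vertices, where $|C|=\sigma$. Some initial memory content represents $(T,c)$, and from it every finite sequence of the following operations is carried out correctly: - query$(v,\gamma)$, for $v\in V$, $\gamma\in C$: return the nearest ancestor of $v$ (possibly $v$ itself) whose subtree contains a vertex that currently has color $\gamma$, or report that there is none; - recolor$(v,\gamma)$, for $v\in V$, $\gamma\in C$: change the color of $v$ to $\gamma$. Every single operation takes at most $K(1+\lfloor\log_2\log_2 n\rfloor)$ time in the worst case (read the floor as $0$ for $n<4$), and the space never exceeds $Kn$. Thus both operations take $O(\log\log n)$ worst-case time, and the structure requires $O(n)$ space. -/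

import Mathlib

/-! ## The word RAM

Words are bit vectors of length `w`. The machine has registers and a random access memory whose
cells are addressed by words. A program is a fixed finite list of instructions; it does not depend
on `w`, and it mentions only finitely many registers. -/

/-- Unit-cost operations on words: arithmetic modulo `2 ^ w`, integer division, bitwise Boolean
operations and shifts. -/
inductive WordOp where
  | add | sub | mul | div | and | or | xor | shl | shr

/-- The value of an operation on two words. -/
def WordOp.eval {w : ℕ} : WordOp → BitVec w → BitVec w → BitVec w
  | .add, x, y => x + y
  | .sub, x, y => x - y
  | .mul, x, y => x * y
  | .div, x, y => x / y
  | .and, x, y => x &&& y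
  | .or, x, y => x ||| y
  | .xor, x, y => x ^^^ y
  | .shl, x, y => x <<< y
  | .shr, x, y => x >>> y

/-- Instructions; `d`, `a`, `b` are register names and `l` is the position of an instruction. -/
inductive Instr where
  /-- `R[d] := k` -/
  | const (d k : ℕ)
  /-- `R[d] := R[a] f R[b]` -/
  | op (f : WordOp) (d a b : ℕ)
  /-- `R[d] := M[R[a]]` -/
  | load (d a : ℕ)
  /-- `M[R[a]] := R[b]` -/
  | store (a b : ℕ)
  /-- go to `l` if `R[a] = R[b]` -/
  | jumpEq (a b l : ℕ)
  /-- go to `l` if `R[a] < R[b]` -/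
  | jumpLt (a b l : ℕ)
  /-- stop -/
  | halt

/-- A program. -/
abbrev RamProgram := List Instr

/-- The memory of a word RAM with word length `w`. -/
abbrev RamMemory (w : ℕ) := BitVec w → BitVec w

/-- The number of cells in use, that is, of cells holding a nonzero word: the space of the uniform
cost criterion for random access machines. -/
noncomputable def RamMemory.space {w : ℕ} (m : RamMemory w) : ℕ := Nat.card {a : BitVec w // m a ≠ 0}

/-- A configuration: program counter, registers, memory. -/
structure RamConfig (w : ℕ) where
  pc : ℕ
  reg : ℕ → BitVec w
  mem : RamMemory w

/-- The effect of one instruction (`none`: the machine stops). -/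
def Instr.exec {w : ℕ} (x : RamConfig w) : Instr → Option (RamConfig w)
  | .const d k =>
      some { x with pc := x.pc + 1, reg := Function.update x.reg d (BitVec.ofNat w k) }
  | .op f d a b =>
      some { x with pc := x.pc + 1, reg := Function.update x.reg d (f.eval (x.reg a) (x.reg b)) }
  | .load d a =>
      some { x with pc := x.pc + 1, reg := Function.update x.reg d (x.mem (x.reg a)) }
  | .store a b =>
      some { x with pc := x.pc + 1, mem := Function.update x.mem (x.reg a) (x.reg b) }
  | .jumpEq a b l => some { x with pc := if x.reg a = x.reg b then l else x.pc + 1 }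
  | .jumpLt a b l => some { x with pc := if x.reg a < x.reg b then l else x.pc + 1 }
  | .halt => none

/-- One step of a program; the machine also stops when there is no instruction at the program
counter. -/
def RamProgram.step {w : ℕ} (P : RamProgram) (x : RamConfig w) : Option (RamConfig w) :=
  match P[x.pc]? with
  | some i => i.exec x
  | none => none

/-- `P.HaltsIn s t x y`: started in `x`, the program `P` stops after exactly `t` steps in the
configuration `y`, and the space never exceeds `s` on the way. -/
inductive RamProgram.HaltsIn {w : ℕ} (P : RamProgram) (s : ℕ) :
    ℕ → RamConfig w → RamConfig w → Prop
  | done {x : RamConfig w} (hs : x.mem.space ≤ s) (hx : P.step x = none) : HaltsIn P s 0 x x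
  | step {t : ℕ} {x y z : RamConfig w} (hs : x.mem.space ≤ s) (hx : P.step x = some y)
      (hy : HaltsIn P s t y z) : HaltsIn P s (t + 1) x z

/-- The configuration in which an operation with two arguments starts: the arguments stand in the
registers `0` and `1`, all other registers are `0`, and the memory is as the previous operation
left it. -/
def RamConfig.call {w : ℕ} (m : RamMemory w) (i j : ℕ) : RamConfig w where
  pc := 0
  reg := Function.update (Function.update 0 0 (BitVec.ofNat w i)) 1 (BitVec.ofNat w j)
  mem := m

/-! ## Rooted trees with colored vertices -/

/-- `u` is an ancestor of `v` in the tree `T` with root `r`: it lies on the path from `r` to `v`.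
Every vertex is an ancestor of itself. -/
def IsAncestor {n : ℕ} (T : SimpleGraph (Fin n)) (r u v : Fin n) : Prop :=
  ∃ p : T.Walk r v, p.IsPath ∧ u ∈ p.support

/-- `a` is an ancestor of `v` whose subtree (the set of vertices of which `a` is an ancestor)
contains a vertex of color `c`. -/
def IsColoredAncestor {n σ : ℕ} (T : SimpleGraph (Fin n)) (r : Fin n) (col : Fin n → Fin σ)
    (v : Fin n) (c : Fin σ) (a : Fin n) : Prop :=
  IsAncestor T r a v ∧ ∃ u, IsAncestor T r a u ∧ col u = c

/-- `a` is the nearest ancestor of `v` whose subtree contains a vertex of color `c`. -/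
def IsNearestColoredAncestor {n σ : ℕ} (T : SimpleGraph (Fin n)) (r : Fin n)
    (col : Fin n → Fin σ) (v : Fin n) (c : Fin σ) (a : Fin n) : Prop :=
  IsColoredAncestor T r col v c a ∧
    ∀ b, IsColoredAncestor T r col v c b → T.dist v a ≤ T.dist v b

/-- The word `y` answers the query `(v, c)`: it is the nearest ancestor of `v` whose subtree
contains a vertex of color `c`, or the number `n`, which is not a vertex, if there is none. -/
def IsQueryAnswer {n σ w : ℕ} (T : SimpleGraph (Fin n)) (r : Fin n) (col : Fin n → Fin σ)
    (v : Fin n) (c : Fin σ) (y : BitVec w) : Prop :=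
  (∃ a, IsNearestColoredAncestor T r col v c a ∧ y.toNat = a) ∨
    ((¬ ∃ a, IsColoredAncestor T r col v c a) ∧ y.toNat = n)

/-- The operations on a tree with `n` vertices and `σ` colors. -/
inductive TreeOp (n σ : ℕ) where
  /-- find the nearest ancestor of `v` whose subtree contains a vertex of color `c` -/
  | query (v : Fin n) (c : Fin σ)
  /-- give `v` the color `c` -/
  | recolor (v : Fin n) (c : Fin σ)

/-- The programs `Q` (queries) and `U` (color reassignments), started with the memory `m`
representing the coloring `col`, serve the given sequence of operations correctly: every single
operation stops after at most `t` steps, the space never exceeds `s`, and every query leaves its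
answer in register `0`. -/
def Serves {n σ w : ℕ} (T : SimpleGraph (Fin n)) (r : Fin n) (Q U : RamProgram) (t s : ℕ) :
    (Fin n → Fin σ) → RamMemory w → List (TreeOp n σ) → Prop
  | _, m, [] => m.space ≤ s
  | col, m, .query v c :: ops =>
      ∃ k ≤ t, ∃ y : RamConfig w, Q.HaltsIn s k (RamConfig.call m v c) y ∧
        IsQueryAnswer T r col v c (y.reg 0) ∧ Serves T r Q U t s col y.mem ops
  | col, m, .recolor v c :: ops =>
      ∃ k ≤ t, ∃ y : RamConfig w, U.HaltsIn s k (RamConfig.call m v c) y ∧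
        Serves T r Q U t s (Function.update col v c) y.mem ops

/-!
Number the vertices in preorder. An ancestor of `v` whose subtree contains a vertex of color `γ` is
an ancestor of the last such vertex up to `v` or of the first one from `v` on, so the answer is the
deeper one of the nearest common ancestors of `v` with these two (`Nca.IsPreorder.isBest`). The
nearest common ancestor of `p < v` is the least parent of the vertices in `(p, v]`
(`Nca.IsPreorder.nca`); such a minimum is found in constant time from tables of linear size, with
blocks of length about `log n`, a bit mask for each place inside a block and a sparse table for
whole blocks (`Nca.wp_rmq`).

What remains is a predecessor structure for each color, of total size `O(n)`, with operations in
time `O(log log n)` in the worst case. Hashing is not needed: cells that hold zero do not count, and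
there are at least `n ^ (1 + ε)` addresses. Each color has a trie of constant height `D`, over
digits of `b = 2 ^ J` bits, where `b` is about `log n / D`. The pointers to the children of a node
are addressed directly by the digit, which takes `O(n * 2 ^ b)` addresses (`Nca.exists_params`), and
each inner node has a van Emde Boas structure for its set of digits, which takes a further
`O(n * 2 ^ b * b ^ 2)` addresses. The elements of a color form a linked list, so that it suffices
to find a neighbor on one side, and updates know both neighbors in advance.

In a van Emde Boas structure (`Veb.VebRep`) the minimum is kept out of the recursion, and a group
of digits with equal upper halves gets a cluster only if it has at least two elements. A group of
one element is represented in the summary, by the element itself. Then a set of `m` digits has at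
most `4 * m` nonzero cells (`Veb.exists_cover`), each operation recurses on one side only
(`Veb.insert_spec`, `Veb.erase_spec`, `Veb.neighbor_spec`), and its time is proportional to the
number `J` of levels, which is `O(log log n)`. Summing over the nodes, of which there are at most
`n * D` below the roots, gives linear space (`Nca.Data.space_le`).

The programs are written in a small structured language with arrays, weakest preconditions
(`Ram.Wp`) and a clock, and compiled to machine code (`Ram.Run.steps`, `Ram.Wp.haltsIn`). Thus a
bound for the clock is, up to a constant factor, a bound for the running time. The initial memory
contains the tables and empty tries (`Nca.exists_rep_zero`); from there, recoloring the vertices one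
by one leads to the memory for any coloring.
-/

open Function (update update_self update_of_ne update_apply update_idem update_eq_self)

/-! ### Van Emde Boas structures -/

/-- The cells of one node of the trie, as a function of `(s, e, l, ρ)`: the field `s` (`0` for the
minimum, `1` for the maximum) of the van Emde Boas structure for the digits `z` with
`z / 2 ^ (e + l) = ρ`, considered up to their last `e` bits. The content of a cell is `0` or a digit
plus one. -/
abbrev NodeCells := ℕ × ℕ × ℕ × ℕ → ℕ

namespace Veb

variable {j e ρ s π q κ x a b y p m v o d : ℕ} {C R : Set ℕ} {V V' : ℕ → Prop} {c c' : NodeCells}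
  {k : ℕ × ℕ × ℕ × ℕ}

/-- The field `s` of the structure with window `[e, e + 2 ^ j)` to which the digit `x` belongs. -/
def key (s e j x : ℕ) : ℕ × ℕ × ℕ × ℕ := (s, e, 2 ^ j, x / 2 ^ (e + 2 ^ j))

/-- The cells that belong to the structure with window `[e, e + 2 ^ j)` and prefix `ρ`, including
its substructures. -/
def InSub : (j e ρ : ℕ) → ℕ × ℕ × ℕ × ℕ → Prop
  | 0, e, ρ, k => k.1 < 2 ∧ k.2 = (e, 2 ^ 0, ρ)
  | j + 1, e, ρ, k => (k.1 < 2 ∧ k.2 = (e, 2 ^ (j + 1), ρ)) ∨ InSub j (e + 2 ^ j) ρ k ∨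
      ∃ π, π / 2 ^ 2 ^ j = ρ ∧ InSub j e π k

/-- The elements of a set of classes except for its minimum. -/
def Rest (C : Set ℕ) : Set ℕ := {κ | κ ∈ C ∧ ∃ κ' ∈ C, κ' < κ}

/-- The group with head `π`, if it has at least two elements, and otherwise the empty set. -/
def Multi (q : ℕ) (R : Set ℕ) (π : ℕ) : Set ℕ :=
  {κ | κ ∈ R ∧ κ / q = π ∧ ∃ κ' ∈ R, κ' / q = π ∧ κ' ≠ κ}

/-- The heads of the nonempty groups. -/
def Heads (q : ℕ) (R : Set ℕ) : Set ℕ := (· / q) '' R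

/-- The digit `z` may represent its group in the summary: if the group has only one element, then
`z` represents this element. -/
def HeadValid (e q : ℕ) (R : Set ℕ) (V : ℕ → Prop) (z : ℕ) : Prop :=
  ∀ κ ∈ R, κ / q = z / 2 ^ e / q → (∀ κ' ∈ R, κ' / q = κ / q → κ' = κ) → V z ∧ z / 2 ^ e = κ

/-- The two cells of a structure hold valid digits of the least and of the greatest class. -/
def NodeRep (j e ρ : ℕ) (C : Set ℕ) (V : ℕ → Prop) (c : NodeCells) : Prop :=
  (∀ κ ∈ C, κ / 2 ^ 2 ^ j = ρ) ∧
    ((C = ∅ ∧ c (0, e, 2 ^ j, ρ) = 0 ∧ c (1, e, 2 ^ j, ρ) = 0) ∨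
      ∃ a b, c (0, e, 2 ^ j, ρ) = a + 1 ∧ c (1, e, 2 ^ j, ρ) = b + 1 ∧ V a ∧ V b ∧
        IsLeast C (a / 2 ^ e) ∧ IsGreatest C (b / 2 ^ e))

/-- The cells represent the set `C` of classes `z / 2 ^ e` of digits `z` with
`z / 2 ^ (e + 2 ^ j) = ρ`; the digits in the cells satisfy `V`. The minimum is kept out of the
recursion. A group of the remaining classes has a cluster only if it has at least two elements; the
summary holds one digit of each group. -/
def VebRep : (j e ρ : ℕ) → (C : Set ℕ) → (V : ℕ → Prop) → (c : NodeCells) → Prop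
  | 0, e, ρ, C, V, c => NodeRep 0 e ρ C V c
  | j + 1, e, ρ, C, V, c => NodeRep (j + 1) e ρ C V c ∧
      VebRep j (e + 2 ^ j) ρ (Heads (2 ^ 2 ^ j) (Rest C))
        (HeadValid e (2 ^ 2 ^ j) (Rest C) V) c ∧
      ∀ π, π / 2 ^ 2 ^ j = ρ → VebRep j e π (Multi (2 ^ 2 ^ j) (Rest C) π) V c

/-- The summary and the clusters represent the set `R`. -/
def RestRep (j e ρ : ℕ) (R : Set ℕ) (V : ℕ → Prop) (c : NodeCells) : Prop :=
  VebRep j (e + 2 ^ j) ρ (Heads (2 ^ 2 ^ j) R) (HeadValid e (2 ^ 2 ^ j) R V) c ∧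
    ∀ π, π / 2 ^ 2 ^ j = ρ → VebRep j e π (Multi (2 ^ 2 ^ j) R π) V c

/-- The cells of the summary and of the clusters. -/
def InRest (j e ρ : ℕ) (k : ℕ × ℕ × ℕ × ℕ) : Prop :=
  InSub j (e + 2 ^ j) ρ k ∨ ∃ π, π / 2 ^ 2 ^ j = ρ ∧ InSub j e π k

theorem vebRep_succ :
    VebRep (j + 1) e ρ C V c ↔ NodeRep (j + 1) e ρ C V c ∧ RestRep j e ρ (Rest C) V c := Iff.rfl

theorem VebRep.nodeRep (h : VebRep j e ρ C V c) : NodeRep j e ρ C V c := by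
  cases j with
  | zero => exact h
  | succ j => exact h.1

/-! ### Heads and windows -/

theorem div_window (z e l : ℕ) : z / 2 ^ e / 2 ^ l = z / 2 ^ (e + l) := by
  rw [Nat.div_div_eq_div_mul, ← pow_add]

theorem div_window_succ (z e j : ℕ) :
    z / 2 ^ (e + 2 ^ j) / 2 ^ 2 ^ j = z / 2 ^ (e + 2 ^ (j + 1)) := by
  rw [div_window]; congr 2; rw [pow_succ]; ring

theorem div_sq (κ j : ℕ) : κ / 2 ^ 2 ^ j / 2 ^ 2 ^ j = κ / 2 ^ 2 ^ (j + 1) := by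
  rw [div_window]; congr 2; rw [pow_succ]; ring

theorem InSub.bounds (h : InSub j e ρ k) :
    k.1 < 2 ∧ e ≤ k.2.1 ∧ 1 ≤ k.2.2.1 ∧ k.2.1 + k.2.2.1 ≤ e + 2 ^ j ∧
      k.2.2.2 / 2 ^ (e + 2 ^ j - (k.2.1 + k.2.2.1)) = ρ := by
  induction j generalizing e ρ with
  | zero =>
    obtain ⟨h1, h2⟩ := h; simp [h1, h2]
  | succ j ih =>
    have e2 : 2 ^ (j + 1) = 2 ^ j + 2 ^ j := by rw [pow_succ]; ring
    rcases h with ⟨h1, h2⟩ | h | ⟨π, rfl, h⟩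
    · simp [h1, h2, Nat.one_le_two_pow]
    · obtain ⟨h0, h1, h2, h3, h4⟩ := ih h
      exact ⟨h0, by omega, h2, by omega, by rw [e2, ← add_assoc]; exact h4⟩
    · obtain ⟨h0, h1, h2, h3, h4⟩ := ih h
      refine ⟨h0, h1, h2, by omega, ?_⟩
      rw [← h4, div_window]
      congr 2; omega

theorem InSub.cell (hs : s < 2) : InSub j e ρ (s, e, 2 ^ j, ρ) := by
  cases j with
  | zero => exact ⟨hs, rfl⟩
  | succ j => exact .inl ⟨hs, rfl⟩

theorem InSub.summary (h : InSub j (e + 2 ^ j) ρ k) : InSub (j + 1) e ρ k := .inr (.inl h)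

theorem InSub.cluster (h : InSub j e π k) :
    InSub (j + 1) e (π / 2 ^ 2 ^ j) k := .inr (.inr ⟨π, rfl, h⟩)

theorem InRest.inSub (h : InRest j e ρ k) : InSub (j + 1) e ρ k := .inr h

theorem not_inRest_cell {ρ' : ℕ} : ¬ InRest j e ρ (s, e, 2 ^ (j + 1), ρ') := by
  have h2 := Nat.one_le_two_pow (n := j)
  have e2 : 2 ^ (j + 1) = 2 ^ j + 2 ^ j := by rw [pow_succ]; ring
  rintro (h | ⟨π, -, h⟩)
  · have := h.bounds.2.1
    simp only at this; omega
  · have := h.bounds.2.2.2.1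
    simp only at this; omega

theorem InSub.not_cluster (h : InSub j (e + 2 ^ j) ρ k) : ¬ InSub j e π k := by
  intro h'
  obtain ⟨-, -, -, h3, -⟩ := h'.bounds
  obtain ⟨-, h1, h2, -, -⟩ := h.bounds; omega

theorem InSub.prefix_unique {π' : ℕ} (h : InSub j e π k)
    (h' : InSub j e π' k) : π = π' := h.bounds.2.2.2.2.symm.trans h'.bounds.2.2.2.2

theorem mem_heads_multi (h : κ ∈ Multi q R π) : π ∈ Heads q R :=
  ⟨κ, h.1, h.2.1⟩

/-! ### Dependence on the cells and on the valid digits -/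

theorem NodeRep.congr
    (h : NodeRep j e ρ C V c) (hc : ∀ s < 2, c' (s, e, 2 ^ j, ρ) = c (s, e, 2 ^ j, ρ))
    (hV : ∀ z, z / 2 ^ e ∈ C → V z → V' z) : NodeRep j e ρ C V' c' := by
  refine ⟨h.1, ?_⟩
  rcases h.2 with ⟨h1, h2, h3⟩ | ⟨a, b, h1, h2, h3, h4, h5, h6⟩
  · exact .inl ⟨h1, by rw [hc 0 (by simp), h2], by rw [hc 1 (by simp), h3]⟩
  · exact .inr ⟨a, b, by rw [hc 0 (by simp), h1], by rw [hc 1 (by simp), h2], hV a h5.1 h3, hV b h6.1 h4, h5, h6⟩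

theorem VebRep.congr (h : VebRep j e ρ C V c) (hc : ∀ k, InSub j e ρ k → c' k = c k)
    (hV : ∀ z, z / 2 ^ e ∈ C → V z → V' z) : VebRep j e ρ C V' c' := by
  induction j generalizing e ρ C V V' with
  | zero => exact NodeRep.congr h (fun s hs => hc _ (InSub.cell hs)) hV
  | succ j ih =>
    obtain ⟨h1, h2, h3⟩ := h
    refine ⟨h1.congr (fun s hs => hc _ (InSub.cell hs)) hV, ?_, ?_⟩
    · refine ih h2 (fun k hk => hc k hk.summary) ?_
      intro z hz h κ hκ hh ha
      obtain ⟨hv, he⟩ := h κ hκ hh ha; exact ⟨hV z (he ▸ hκ.1) hv, he⟩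
    · intro π hπ
      refine ih (h3 π hπ) (fun k hk => hc k (hπ ▸ hk.cluster)) ?_
      intro z hz hv; exact hV z hz.1.1 hv

theorem VebRep.frame
    (h : VebRep j e ρ C V c) (hc : ∀ k, InSub j e ρ k → c' k = c k) : VebRep j e ρ C V c' :=
  h.congr hc fun _ _ => id

theorem RestRep.frame
    (h : RestRep j e ρ C V c) (hc : ∀ k, InRest j e ρ k → c' k = c k) : RestRep j e ρ C V c' :=
  ⟨h.1.frame fun k hk => hc k (.inl hk), fun π hπ => (h.2 π hπ).frame fun k hk =>
    hc k (.inr ⟨π, hπ, hk⟩)⟩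

/-! ### The empty set -/

@[simp] theorem rest_empty : Rest ∅ = ∅ := by simp [Rest]
@[simp] theorem heads_empty : Heads q ∅ = ∅ := by simp [Heads]
@[simp] theorem multi_empty : Multi q ∅ π = ∅ := by simp [Multi]

theorem VebRep.of_zero (hc : ∀ k, InSub j e ρ k → c k = 0) : VebRep j e ρ ∅ V c := by
  induction j generalizing e ρ V with
  | zero => exact ⟨by simp, .inl ⟨rfl, hc _ (InSub.cell (by simp)), hc _ (InSub.cell (by simp))⟩⟩
  | succ j ih =>
    refine ⟨⟨by simp, .inl ⟨rfl, hc _ (InSub.cell (by simp)), hc _ (InSub.cell (by simp))⟩⟩, ?_, ?_⟩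
    · simp only [rest_empty, heads_empty]; exact ih fun k hk => hc k hk.summary
    · intro π hπ
      simp only [rest_empty, multi_empty]; exact ih fun k hk => hc k (hπ ▸ hk.cluster)

theorem VebRep.cell_eq_zero (h : VebRep j e ρ C V c) : c (0, e, 2 ^ j, ρ) = 0 ↔ C = ∅ := by
  rcases h.nodeRep.2 with ⟨h1, h2, h3⟩ | ⟨a, b, h1, h2, h3, h4, h5, h6⟩
  · simp [h1, h2]
  · have := h5.1
    refine ⟨fun h => by omega, fun h => by simp [h] at this⟩

theorem VebRep.cell_ne_zero
    (h : VebRep j e ρ C V c) (hC : C.Nonempty) : ∃ a b, c (0, e, 2 ^ j, ρ) = a + 1 ∧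
      c (1, e, 2 ^ j, ρ) = b + 1 ∧ V a ∧ V b ∧ IsLeast C (a / 2 ^ e) ∧
        IsGreatest C (b / 2 ^ e) := by
  rcases h.nodeRep.2 with ⟨h1, h2, h3⟩ | h
  · simp [h1] at hC
  · exact h

/-! ### Insertion -/

/-- The least class of the summary and clusters at level `j` (as a digit plus one, or `0`). -/
def restMin (j e x : ℕ) (c : NodeCells) : ℕ :=
  let r := c (key 0 (e + 2 ^ j) j x)
  if r = 0 then 0 else
    let a := c (key 0 e j (r - 1))
    if a = 0 then r else a

/-- Store a set of two classes, given by the digits `a < b`. -/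
def pair : (j e a b : ℕ) → NodeCells → NodeCells
  | 0, e, a, b, c =>
      update (update c (key 0 e 0 a) (a + 1)) (key 1 e 0 a) (b + 1)
  | j + 1, e, a, b, c =>
      update (update (update (update c
        (key 0 e (j + 1) a) (a + 1)) (key 1 e (j + 1) a) (b + 1))
        (key 0 (e + 2 ^ j) j a) (b + 1)) (key 1 (e + 2 ^ j) j a) (b + 1)

/-- Insert the digit `x` into the summary and the clusters, where `f` inserts into one of them. -/
def insertRest (f : (e x p s : ℕ) → NodeCells → NodeCells) (j e x p s : ℕ) (c : NodeCells) :
    NodeCells :=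
  if c (key 0 e j x) ≠ 0 then f e x p s c
  else if p ≠ 0 ∧ (p - 1) / 2 ^ (e + 2 ^ j) = x / 2 ^ (e + 2 ^ j) then pair j e (p - 1) x c
  else if s ≠ 0 ∧ (s - 1) / 2 ^ (e + 2 ^ j) = x / 2 ^ (e + 2 ^ j) then pair j e x (s - 1) c
  else f (e + 2 ^ j) x p s c

/-- Insert the digit `x`; `p` and `s` tell its neighbors in the set. -/
def insert : (j e x p s : ℕ) → NodeCells → NodeCells
  | 0, e, x, _, _, c =>
      if c (key 0 e 0 x) = 0 then
        update (update c (key 0 e 0 x) (x + 1)) (key 1 e 0 x) (x + 1)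
      else if x + 1 < c (key 0 e 0 x) then update c (key 0 e 0 x) (x + 1)
      else update c (key 1 e 0 x) (x + 1)
  | j + 1, e, x, p, s, c =>
      let m := c (key 0 e (j + 1) x)
      if m = 0 then
        update (update c (key 0 e (j + 1) x) (x + 1)) (key 1 e (j + 1) x) (x + 1)
      else if x + 1 < m then
        insertRest (insert j) j e (m - 1) 0 (restMin j e x c)
          (update c (key 0 e (j + 1) x) (x + 1))
      else
        insertRest (insert j) j e x (if p ≠ 0 ∧ (p - 1) / 2 ^ e = (m - 1) / 2 ^ e then 0 else p) s
          (if c (key 1 e (j + 1) x) < x + 1 then update c (key 1 e (j + 1) x) (x + 1)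
            else c)

/-- If `C` has elements below the class of `x`, then `p - 1` is a valid digit of the greatest one of
them. In any case, `p` is no digit plus one in the window of `C` unless it is one of that kind. This
makes `p` usable for the clusters and for the summary too. -/
def PredOk (j e ρ : ℕ) (C : Set ℕ) (V : ℕ → Prop) (x p : ℕ) : Prop :=
  (∀ κ ∈ C, κ < x / 2 ^ e → (∀ κ' ∈ C, κ' < x / 2 ^ e → κ' ≤ κ) →
    ∃ d, p = d + 1 ∧ d / 2 ^ e = κ ∧ V d) ∧
  ∀ d, p = d + 1 → d / 2 ^ (e + 2 ^ j) = ρ → d / 2 ^ e ∈ C ∧ d / 2 ^ e < x / 2 ^ e ∧ V d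

/-- The analogue of `PredOk` for the elements above the class of `x`. -/
def SuccOk (j e ρ : ℕ) (C : Set ℕ) (V : ℕ → Prop) (x s : ℕ) : Prop :=
  (∀ κ ∈ C, x / 2 ^ e < κ → (∀ κ' ∈ C, x / 2 ^ e < κ' → κ ≤ κ') →
    ∃ d, s = d + 1 ∧ d / 2 ^ e = κ ∧ V d) ∧
  ∀ d, s = d + 1 → d / 2 ^ (e + 2 ^ j) = ρ → d / 2 ^ e ∈ C ∧ x / 2 ^ e < d / 2 ^ e ∧ V d

theorem exists_max_lt (hκ : κ ∈ C) (hx : κ < x) :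
    ∃ m ∈ C, m < x ∧ κ ≤ m ∧ ∀ κ' ∈ C, κ' < x → κ' ≤ m := by
  classical
  have hne : ((Finset.range x).filter (· ∈ C)).Nonempty := ⟨κ, by simp [hκ, hx]⟩
  obtain ⟨m, hm, hmax⟩ := Finset.exists_max_image _ id hne
  simp only [Finset.mem_filter, Finset.mem_range, id] at hm hmax
  exact ⟨m, hm.2, hm.1, hmax κ ⟨hx, hκ⟩, fun κ' h1 h2 => hmax κ' ⟨h2, h1⟩⟩

theorem exists_min_gt (hκ : κ ∈ C) (hx : x < κ) :
    ∃ m ∈ C, x < m ∧ m ≤ κ ∧ ∀ κ' ∈ C, x < κ' → m ≤ κ' := by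
  classical
  have hex : ∃ m, m ∈ C ∧ x < m := ⟨κ, hκ, hx⟩
  obtain ⟨h1, h2⟩ := Nat.find_spec hex
  exact ⟨_, h1, h2, Nat.find_min' hex ⟨hκ, hx⟩, fun κ' h3 h4 => Nat.find_min' hex ⟨h3, h4⟩⟩

theorem nodeRep_pair
    (ha : a / 2 ^ (e + 2 ^ j) = ρ) (hb : b / 2 ^ (e + 2 ^ j) = ρ) (hab : a / 2 ^ e < b / 2 ^ e)
    (hVa : V a) (hVb : V b) (h0 : c (0, e, 2 ^ j, ρ) = a + 1) (h1 : c (1, e, 2 ^ j, ρ) = b + 1) :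
    NodeRep j e ρ {a / 2 ^ e, b / 2 ^ e} V c := by
  refine ⟨?_, .inr ⟨a, b, h0, h1, hVa, hVb, ⟨by simp, ?_⟩, ⟨by simp, ?_⟩⟩⟩
  · rintro κ (rfl | rfl)
    · rw [div_window, ha]
    · rw [div_window, hb]
  · rintro κ (rfl | rfl) <;> omega
  · rintro κ (rfl | rfl) <;> omega

theorem rest_pair (h : a < b) : Rest {a, b} = {b} := by
  ext κ
  simp only [Rest, Set.mem_insert_iff, Set.mem_singleton_iff, Set.mem_ofPred_eq, exists_eq_or_imp,
    exists_eq_left]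
  omega

theorem rest_singleton : Rest {a} = ∅ := by
  ext κ
  simp only [Rest, Set.mem_singleton_iff, Set.mem_ofPred_eq, Set.mem_empty_iff_false, iff_false]
  rintro ⟨rfl, _, rfl, h⟩; omega

theorem multi_singleton : Multi q {a} π = ∅ := by
  ext κ
  simp only [Multi, Set.mem_singleton_iff, Set.mem_ofPred_eq, Set.mem_empty_iff_false, iff_false]
  rintro ⟨rfl, -, _, rfl, -, h⟩; exact h rfl

theorem heads_singleton : Heads q {a} = {a / q} := by simp [Heads]

theorem vebRep_singleton (ha : a / 2 ^ (e + 2 ^ j) = ρ) (hV : V a) (h0 : c (0, e, 2 ^ j, ρ) = a + 1)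
    (h1 : c (1, e, 2 ^ j, ρ) = a + 1)
    (hc : ∀ k, InSub j e ρ k → k.2 ≠ (e, 2 ^ j, ρ) → c k = 0) : VebRep j e ρ {a / 2 ^ e} V c := by
  have hn : NodeRep j e ρ {a / 2 ^ e} V c := by
    refine ⟨?_, .inr ⟨a, a, h0, h1, hV, hV, isLeast_singleton, isGreatest_singleton⟩⟩
    rintro κ rfl
    rw [div_window, ha]
  cases j with
  | zero => exact hn
  | succ j =>
    refine ⟨hn, ?_, fun π hπ => ?_⟩
    · rw [rest_singleton, heads_empty]
      refine VebRep.of_zero fun k hk => hc k hk.summary ?_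
      rintro h
      have : k = (k.1, e, 2 ^ (j + 1), ρ) := by rw [← h]
      exact not_inRest_cell (this ▸ .inl hk : InRest j e ρ (k.1, e, 2 ^ (j + 1), ρ))
    · rw [rest_singleton, multi_empty]
      refine VebRep.of_zero fun k hk => hc k (hπ ▸ hk.cluster) ?_
      rintro h
      have : k = (k.1, e, 2 ^ (j + 1), ρ) := by rw [← h]
      exact not_inRest_cell (this ▸ .inr ⟨π, hπ, hk⟩ : InRest j e ρ (k.1, e, 2 ^ (j + 1), ρ))

theorem NodeRep.zero_of_empty (h : NodeRep j e ρ ∅ V c) (h1 : k.1 < 2) (h2 : k.2 = (e, 2 ^ j, ρ)) :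
    c k = 0 := by
  obtain ⟨k1, k2⟩ := k
  simp only at h1 h2
  subst h2
  rcases h.2 with ⟨-, h0, h1'⟩ | ⟨a, b, -, -, -, -, h, -⟩
  · interval_cases k1 <;> assumption
  · exact absurd h.1 (by simp)

theorem VebRep.zero_of_empty (h : VebRep j e ρ ∅ V c) (hk : InSub j e ρ k) : c k = 0 := by
  induction j generalizing e ρ V with
  | zero => exact NodeRep.zero_of_empty h hk.1 hk.2
  | succ j ih =>
    obtain ⟨h1, h2, h3⟩ := h
    rw [rest_empty, heads_empty] at h2
    rcases hk with hk | hk | ⟨π, hπ, hk⟩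
    · exact h1.zero_of_empty hk.1 hk.2
    · exact ih h2 hk
    · have h3 := h3 π hπ
      rw [rest_empty, multi_empty] at h3; exact ih h3 hk

/-! ### Groups under insertion -/

theorem multi_insert_of_ne (h : x / q ≠ π) : Multi q (Insert.insert x R) π = Multi q R π := by
  ext κ
  simp only [Multi, Set.mem_insert_iff, Set.mem_ofPred_eq]
  grind

theorem multi_insert_of_nonempty (hx : x ∉ R) (h : (Multi q R (x / q)).Nonempty) :
    Multi q (Insert.insert x R) (x / q) = Insert.insert x (Multi q R (x / q)) := by
  obtain ⟨κ, h1, h2, h3⟩ := h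
  ext κ
  simp only [Multi, Set.mem_insert_iff, Set.mem_ofPred_eq]
  grind

theorem multi_insert_of_single (hx : x ∉ R) (hy : y ∈ R)
    (hq : y / q = x / q) (h : Multi q R (x / q) = ∅) :
    Multi q (Insert.insert x R) (x / q) = {y, x} := by
  have h' : ∀ κ ∈ R, κ / q = x / q → κ = y := by
    intro κ hκ h1
    by_contra hne
    exact Set.notMem_empty κ (h ▸ ⟨hκ, h1, y, hy, hq, Ne.symm hne⟩)
  ext κ
  simp only [Multi, Set.mem_insert_iff, Set.mem_ofPred_eq, Set.mem_singleton_iff]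
  grind

theorem multi_insert_of_notMem (h : x / q ∉ Heads q R) :
    Multi q (Insert.insert x R) (x / q) = ∅ := by
  have h' : ∀ κ ∈ R, κ / q ≠ x / q := fun κ hκ h1 => h ⟨κ, hκ, h1⟩
  ext κ
  simp only [Multi, Set.mem_insert_iff, Set.mem_ofPred_eq, Set.mem_empty_iff_false, iff_false]
  grind

theorem heads_insert :
    Heads q (Insert.insert x R) = Insert.insert (x / q) (Heads q R) := Set.image_insert_eq

theorem multi_eq_empty_of_notMem (h : π ∉ Heads q R) : Multi q R π = ∅ := by
  ext κ
  simp only [Set.mem_empty_iff_false, iff_false]; exact fun hκ => h (mem_heads_multi hκ)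

/-! ### Correctness of the insertion -/

theorem pair_frame (hk : ¬ InSub j e (a / 2 ^ (e + 2 ^ j)) k) : pair j e a b c k = c k := by
  cases j with
  | zero =>
    have h0 : k ≠ key 0 e 0 a := by rintro rfl; exact hk (InSub.cell (by simp))
    have h1 : k ≠ key 1 e 0 a := by rintro rfl; exact hk (InSub.cell (by simp))
    simp [pair, h0, h1]
  | succ j =>
    have h0 : k ≠ key 0 e (j + 1) a := by rintro rfl; exact hk (InSub.cell (by simp))
    have h1 : k ≠ key 1 e (j + 1) a := by rintro rfl; exact hk (InSub.cell (by simp))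
    have h2 : k ≠ key 0 (e + 2 ^ j) j a := by
      rintro rfl
      rw [← div_window_succ, div_window] at hk
      exact hk (InSub.summary (InSub.cell (by simp)))
    have h3 : k ≠ key 1 (e + 2 ^ j) j a := by
      rintro rfl
      rw [← div_window_succ, div_window] at hk
      exact hk (InSub.summary (InSub.cell (by simp)))
    simp [pair, h0, h1, h2, h3]

theorem vebRep_pair (h : ∀ k, InSub j e ρ k → c k = 0) (ha : a / 2 ^ (e + 2 ^ j) = ρ)
    (hb : b / 2 ^ (e + 2 ^ j) = ρ) (hab : a / 2 ^ e < b / 2 ^ e) (hVa : V a) (hVb : V b) :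
    VebRep j e ρ {a / 2 ^ e, b / 2 ^ e} V (pair j e a b c) := by
  cases j with
  | zero =>
    refine nodeRep_pair ha hb hab hVa hVb ?_ ?_ <;> simp [pair, key, ← ha]
  | succ j =>
    have ha' : a / 2 ^ (e + 2 ^ j + 2 ^ j) = ρ := by
      rw [← ha, ← div_window_succ, div_window]
    have hb' : b / 2 ^ (e + 2 ^ j + 2 ^ j) = ρ := by
      rw [← hb, ← div_window_succ, div_window]
    refine ⟨nodeRep_pair ha hb hab hVa hVb ?_ ?_, ?_, fun π hπ => ?_⟩
    · simp [pair, key, ← ha]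
    · simp [pair, key, ← ha]
    · rw [rest_pair hab, heads_singleton, div_window]
      refine vebRep_singleton hb' ?_ ?_ ?_ fun k hk hne => ?_
      · rintro κ rfl - -; exact ⟨hVb, rfl⟩
      · simp [pair, key, ← ha']
      · simp [pair, key, ← ha']
      · have hz := h k hk.summary
        have hn : ∀ s, k ≠ (s, e, 2 ^ (j + 1), ρ) := by
          rintro s rfl; exact not_inRest_cell (.inl hk)
        have hn' : ∀ s, k ≠ (s, e + 2 ^ j, 2 ^ j, ρ) := by
          rintro s rfl; exact hne rfl
        have hn0 := hn 0
        have hn1 := hn 1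
        have hn2 := hn' 0
        have hn3 := hn' 1
        simp only [pair, key, update_apply, ha, ha', hn0, hn1, hn2, hn3, if_false, hz]
    · rw [rest_pair hab, multi_singleton]
      refine VebRep.of_zero fun k hk => ?_
      have hz := h k (hπ ▸ hk.cluster)
      have hn : ∀ s, k ≠ (s, e, 2 ^ (j + 1), ρ) := by
        rintro s rfl; exact not_inRest_cell (.inr ⟨π, hπ, hk⟩)
      have hn' : ∀ s < 2, k ≠ (s, e + 2 ^ j, 2 ^ j, ρ) := by
        rintro s hs rfl
        exact (InSub.cell hs : InSub j (e + 2 ^ j) ρ _).not_cluster hk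
      have hn0 := hn 0
      have hn1 := hn 1
      have hn2 := hn' 0 (by simp)
      have hn3 := hn' 1 (by simp)
      simp only [pair, key, update_apply, ha, ha', hn0, hn1, hn2, hn3, if_false, hz]

theorem restMin_spec (h : RestRep j e ρ R V c) (hx : x / 2 ^ (e + 2 ^ (j + 1)) = ρ)
    (hR : ∀ κ ∈ R, κ / 2 ^ 2 ^ (j + 1) = ρ) :
    (R = ∅ ∧ restMin j e x c = 0) ∨ ∃ d, restMin j e x c = d + 1 ∧ V d ∧ IsLeast R (d / 2 ^ e) := by
  have hx' : key 0 (e + 2 ^ j) j x = (0, e + 2 ^ j, 2 ^ j, ρ) := by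
    simp only [key, Prod.mk.injEq, true_and]
    rw [← div_window, div_window_succ, hx]
  rcases Set.eq_empty_or_nonempty R with rfl | hne
  · left
    have := h.1.cell_eq_zero.2 heads_empty; simp [restMin, hx', this]
  · right
    obtain ⟨r, -, hr, -, hv, -, hl, -⟩ := h.1.cell_ne_zero (hne.image _)
    obtain ⟨⟨κ, hκ, hκr⟩, hl⟩ := hl
    simp only at hκr
    have hmin : ∀ κ' ∈ R, r / 2 ^ (e + 2 ^ j) ≤ κ' / 2 ^ 2 ^ j := fun κ' hκ' => hl ⟨κ', hκ', rfl⟩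
    have hpre : r / 2 ^ (e + 2 ^ j) / 2 ^ 2 ^ j = ρ := by rw [← hκr, div_sq, hR κ hκ]
    have hcl := h.2 _ hpre
    rw [restMin]
    simp only [hx', hr, Nat.add_sub_cancel, Nat.add_one_ne_zero, if_false]
    rcases Set.eq_empty_or_nonempty (Multi (2 ^ 2 ^ j) R (r / 2 ^ (e + 2 ^ j))) with hm | hm
    · have h0 : c (key 0 e j r) = 0 := hcl.cell_eq_zero.2 hm
      simp only [h0, if_true]
      have hsing : ∀ κ' ∈ R, κ' / 2 ^ 2 ^ j = κ / 2 ^ 2 ^ j → κ' = κ := by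
        intro κ' hκ' hq
        by_contra hne
        have : κ ∈ Multi (2 ^ 2 ^ j) R (r / 2 ^ (e + 2 ^ j)) := ⟨hκ, hκr, κ', hκ', hq.trans hκr, hne⟩
        rw [hm] at this; exact this
      obtain ⟨hV, he⟩ := hv κ hκ (by rw [hκr, div_window]) hsing
      refine ⟨r, rfl, hV, he ▸ hκ, fun κ' hκ' => ?_⟩
      by_contra hlt
      rw [he] at hlt
      have h1 := hmin κ' hκ'
      rw [← hκr] at h1
      have h2 := Nat.div_le_div_right (c := 2 ^ 2 ^ j) (not_le.1 hlt).le
      have := hsing κ' hκ' (le_antisymm h2 h1); omega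
    · obtain ⟨a, -, ha, -, hV, -, hl', -⟩ := hcl.cell_ne_zero hm
      have ha' : c (key 0 e j r) = a + 1 := ha
      simp only [ha', Nat.add_one_ne_zero, if_false]
      refine ⟨a, rfl, hV, hl'.1.1, fun κ' hκ' => ?_⟩
      by_contra hlt
      have h1 := hmin κ' hκ'
      have h2 := Nat.div_le_div_right (c := 2 ^ 2 ^ j) (not_le.1 hlt).le
      have h3 := hl'.1.2.1
      have h4 : κ' / 2 ^ 2 ^ j = r / 2 ^ (e + 2 ^ j) := by omega
      exact hlt (hl'.2 ⟨hκ', h4, _, hl'.1.1, h3, by omega⟩)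

theorem headValid_insert_of_mem {z : ℕ} (hx : x ∉ R)
    (hq : x / q ∈ Heads q R) (h : HeadValid e q R V z) : HeadValid e q (Insert.insert x R) V z := by
  rintro κ (rfl | hκ) hh ha
  · obtain ⟨κ', hκ', hq⟩ := hq; exact absurd (ha κ' (.inr hκ') hq ▸ hκ') hx
  · exact h κ hκ hh fun κ' hκ' => ha κ' (.inr hκ')

/-- The specification of an insertion at level `j`. -/
def InsertSpec (j : ℕ) (f : (e x p s : ℕ) → NodeCells → NodeCells) : Prop :=
  ∀ {e ρ x p s : ℕ} {C : Set ℕ} {V : ℕ → Prop} {c : NodeCells}, VebRep j e ρ C V c →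
    x / 2 ^ (e + 2 ^ j) = ρ → x / 2 ^ e ∉ C → V x → PredOk j e ρ C V x p → SuccOk j e ρ C V x s →
    VebRep j e ρ (Insert.insert (x / 2 ^ e) C) V (f e x p s c) ∧
      ∀ k, ¬ InSub j e ρ k → f e x p s c k = c k

/-- At most one recursive call is needed: either the group of `x` has a cluster, or it gets one, made by
`pair`, or `x` founds a new group and is inserted into the summary. -/
theorem insertRest_spec
    {f : (e x p s : ℕ) → NodeCells → NodeCells} (ih : InsertSpec j f) (h : RestRep j e ρ R V c)
    (hx : x / 2 ^ (e + 2 ^ (j + 1)) = ρ) (hxR : x / 2 ^ e ∉ R) (hV : V x)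
    (hp : PredOk (j + 1) e ρ R V x p) (hs : SuccOk (j + 1) e ρ R V x s) :
    RestRep j e ρ (Insert.insert (x / 2 ^ e) R) V (insertRest f j e x p s c) ∧
      ∀ k, ¬ InRest j e ρ k → insertRest f j e x p s c k = c k := by
  have hq : ∀ z, z / 2 ^ e / 2 ^ 2 ^ j = z / 2 ^ (e + 2 ^ j) := fun z => div_window _ _ _
  have hqq : ∀ z, z / 2 ^ (e + 2 ^ j) / 2 ^ 2 ^ j = z / 2 ^ (e + 2 ^ (j + 1)) :=
    fun z => div_window_succ _ _ _
  have hq2 : ∀ z, z / 2 ^ (e + 2 ^ j + 2 ^ j) = z / 2 ^ (e + 2 ^ (j + 1)) := fun z => by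
    rw [← hqq, div_window]
  have hpre : x / 2 ^ (e + 2 ^ j) / 2 ^ 2 ^ j = ρ := by rw [hqq, hx]
  have hcl := h.2 _ hpre
  unfold insertRest
  rcases Set.eq_empty_or_nonempty (Multi (2 ^ 2 ^ j) R (x / 2 ^ (e + 2 ^ j))) with hm | hm
  · have h0 : c (key 0 e j x) = 0 := hcl.cell_eq_zero.2 hm
    have hzero : ∀ k, InSub j e (x / 2 ^ (e + 2 ^ j)) k → c k = 0 := fun k hk =>
      (hm ▸ hcl).zero_of_empty hk
    -- the group of `x` has exactly one element, with the digit `d`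
    have hpair : ∀ a b d, (a = d ∧ b = x ∨ a = x ∧ b = d) → d / 2 ^ e ∈ R → V d →
        d / 2 ^ (e + 2 ^ j) = x / 2 ^ (e + 2 ^ j) → a / 2 ^ e < b / 2 ^ e →
        RestRep j e ρ (Insert.insert (x / 2 ^ e) R) V (pair j e a b c) ∧
        ∀ k, ¬ InRest j e ρ k → pair j e a b c k = c k := by
      intro a b d hab hdR hVd hd hlt
      have hah : a / 2 ^ (e + 2 ^ j) = x / 2 ^ (e + 2 ^ j) := by
        rcases hab with ⟨rfl, rfl⟩ | ⟨rfl, rfl⟩ <;> simp [hd]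
      have hbh : b / 2 ^ (e + 2 ^ j) = x / 2 ^ (e + 2 ^ j) := by
        rcases hab with ⟨rfl, rfl⟩ | ⟨rfl, rfl⟩ <;> simp [hd]
      have hfr : ∀ k, ¬ InSub j e (x / 2 ^ (e + 2 ^ j)) k → pair j e a b c k = c k := fun k hk =>
        pair_frame (hah ▸ hk)
      have hmem : x / 2 ^ e / 2 ^ 2 ^ j ∈ Heads (2 ^ 2 ^ j) R :=
        ⟨_, hdR, by simp only [hq, hd]⟩
      refine ⟨⟨?_, fun π hπ => ?_⟩, fun k hk => hfr k fun h' => hk (.inr ⟨_, hpre, h'⟩)⟩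
      · rw [heads_insert, Set.insert_eq_of_mem hmem]
        exact h.1.congr (fun k hk => hfr k hk.not_cluster) fun z _ hz =>
          headValid_insert_of_mem hxR hmem hz
      · by_cases hπx : x / 2 ^ (e + 2 ^ j) = π
        · subst hπx
          have hmi := multi_insert_of_single (q := 2 ^ 2 ^ j) hxR hdR (by rw [hq, hq, hd])
            (by rw [hq]; exact hm)
          rw [hq] at hmi
          have hset : ({d / 2 ^ e, x / 2 ^ e} : Set ℕ) = {a / 2 ^ e, b / 2 ^ e} := by
            rcases hab with ⟨rfl, rfl⟩ | ⟨rfl, rfl⟩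
            · rfl
            · exact Set.pair_comm _ _
          rw [hmi, hset]
          refine vebRep_pair hzero hah hbh hlt ?_ ?_ <;>
            rcases hab with ⟨rfl, rfl⟩ | ⟨rfl, rfl⟩ <;> assumption
        · rw [multi_insert_of_ne (by rwa [hq])]
          exact (h.2 π hπ).frame fun k hk => hfr k fun h' => hπx (h'.prefix_unique hk)
    have hsingle : ∀ κ ∈ R, κ / 2 ^ 2 ^ j = x / 2 ^ (e + 2 ^ j) → ∀ κ' ∈ R,
        κ' / 2 ^ 2 ^ j = x / 2 ^ (e + 2 ^ j) → κ' = κ := by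
      intro κ hκ h1 κ' hκ' h2
      by_contra hne
      have : κ ∈ Multi (2 ^ 2 ^ j) R (x / 2 ^ (e + 2 ^ j)) := ⟨hκ, h1, κ', hκ', h2, hne⟩
      rw [hm] at this; exact this
    simp only [h0, ne_eq, not_true_eq_false, if_false]
    split_ifs with h1 h2
    · obtain ⟨d, rfl⟩ := Nat.exists_eq_succ_of_ne_zero h1.1
      have hd : d / 2 ^ (e + 2 ^ j) = x / 2 ^ (e + 2 ^ j) := h1.2
      obtain ⟨hdR, hlt, hVd⟩ := hp.2 d rfl (by rw [← hqq, hd, hpre])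
      exact hpair d x d (.inl ⟨rfl, rfl⟩) hdR hVd hd hlt
    · obtain ⟨d, rfl⟩ := Nat.exists_eq_succ_of_ne_zero h2.1
      have hd : d / 2 ^ (e + 2 ^ j) = x / 2 ^ (e + 2 ^ j) := h2.2
      obtain ⟨hdR, hlt, hVd⟩ := hs.2 d rfl (by rw [← hqq, hd, hpre])
      exact hpair x d d (.inr ⟨rfl, rfl⟩) hdR hVd hd hlt
    · -- the group of `x` is empty
      have hnot : x / 2 ^ (e + 2 ^ j) ∉ Heads (2 ^ 2 ^ j) R := by
        rintro ⟨κ, hκ, hκx⟩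
        simp only at hκx
        have hnex : κ ≠ x / 2 ^ e := fun h => hxR (h ▸ hκ)
        rcases lt_or_gt_of_ne hnex with hlt | hlt
        · obtain ⟨d, rfl, hd, -⟩ := hp.1 κ hκ hlt fun κ' hκ' hlt' => by
            by_contra hn
            have a1 := Nat.div_le_div_right (c := 2 ^ 2 ^ j) (not_le.1 hn).le
            have a2 := Nat.div_le_div_right (c := 2 ^ 2 ^ j) hlt'.le
            rw [hq] at a2
            have := hsingle κ hκ hκx κ' hκ' (by omega); omega
          exact h1 ⟨by simp, by rw [Nat.add_sub_cancel, ← hκx, ← hd, hq]⟩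
        · obtain ⟨d, rfl, hd, -⟩ := hs.1 κ hκ hlt fun κ' hκ' hlt' => by
            by_contra hn
            have a1 := Nat.div_le_div_right (c := 2 ^ 2 ^ j) (not_le.1 hn).le
            have a2 := Nat.div_le_div_right (c := 2 ^ 2 ^ j) hlt'.le
            rw [hq] at a2
            have := hsingle κ hκ hκx κ' hκ' (by omega); omega
          exact h2 ⟨by simp, by rw [Nat.add_sub_cancel, ← hκx, ← hd, hq]⟩
      have hVold : ∀ z, z / 2 ^ (e + 2 ^ j) ∈ Heads (2 ^ 2 ^ j) R →
          HeadValid e (2 ^ 2 ^ j) R V z →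
          HeadValid e (2 ^ 2 ^ j) (Insert.insert (x / 2 ^ e) R) V z := by
        intro z hz hv κ hκ hh ha
        rw [hq] at hh
        rcases hκ with rfl | hκ
        · rw [hq] at hh; exact absurd (hh ▸ hz) hnot
        · exact hv κ hκ (by rw [hh, hq]) fun κ' hκ' => ha κ' (.inr hκ')
      -- a digit of a class of `R` is valid in the summary
      have hVd : ∀ d, d / 2 ^ e ∈ R → V d →
          HeadValid e (2 ^ 2 ^ j) (Insert.insert (x / 2 ^ e) R) V d := fun d hd hv κ hκ hh ha =>
        ⟨hv, ha _ (.inr hd) hh.symm⟩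
      have hmono : ∀ {a b : ℕ}, a < b → a / 2 ^ 2 ^ j ≠ b / 2 ^ 2 ^ j →
          a / 2 ^ 2 ^ j < b / 2 ^ 2 ^ j := fun hab hne =>
        lt_of_le_of_ne (Nat.div_le_div_right hab.le) hne
      have hxq : ∀ κ ∈ R, κ / 2 ^ 2 ^ j ≠ x / 2 ^ (e + 2 ^ j) := fun κ hκ h => hnot ⟨κ, hκ, h⟩
      obtain ⟨hrep, hfr⟩ := ih (e := e + 2 ^ j) (x := x) (p := p) (s := s)
        (V := HeadValid e (2 ^ 2 ^ j) (Insert.insert (x / 2 ^ e) R) V)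
        (h.1.congr (fun _ _ => rfl) hVold) (by rw [hq2, hx]) hnot
        (by
          rintro κ (rfl | hκ) hh ha
          · exact ⟨hV, rfl⟩
          · rw [hq] at hh; exact absurd hh (hxq κ hκ))
        ⟨by
          rintro _ ⟨κ, hκ, rfl⟩ hlt hmax
          simp only at hlt hmax ⊢
          have hκx : κ < x / 2 ^ e := by
            by_contra hn
            have := Nat.div_le_div_right (c := 2 ^ 2 ^ j) (not_lt.1 hn)
            rw [hq] at this; omega
          obtain ⟨m, hmR, hmx, hκm, hmmax⟩ := exists_max_lt hκ hκx
          obtain ⟨d, hd, hdm, hdV⟩ := hp.1 m hmR hmx hmmax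
          refine ⟨d, hd, ?_, hVd d (hdm ▸ hmR) hdV⟩
          rw [← hq, hdm]
          refine le_antisymm (hmax _ ⟨m, hmR, rfl⟩ ?_) (Nat.div_le_div_right hκm)
          rw [← hq]
          exact hmono hmx (by rw [hq]; exact hxq m hmR), by
          intro d hd hdρ
          rw [hq2] at hdρ
          obtain ⟨hdR, hlt, hdV⟩ := hp.2 d hd hdρ
          refine ⟨⟨_, hdR, hq d⟩, ?_, hVd d hdR hdV⟩
          rw [← hq, ← hq]
          exact hmono hlt (by rw [hq x]; exact hxq _ hdR)⟩
        ⟨by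
          rintro _ ⟨κ, hκ, rfl⟩ hlt hmin
          simp only at hlt hmin ⊢
          have hκx : x / 2 ^ e < κ := by
            by_contra hn
            have := Nat.div_le_div_right (c := 2 ^ 2 ^ j) (not_lt.1 hn)
            rw [hq] at this; omega
          obtain ⟨m, hmR, hmx, hκm, hmmin⟩ := exists_min_gt hκ hκx
          obtain ⟨d, hd, hdm, hdV⟩ := hs.1 m hmR hmx hmmin
          refine ⟨d, hd, ?_, hVd d (hdm ▸ hmR) hdV⟩
          rw [← hq, hdm]
          refine le_antisymm (Nat.div_le_div_right hκm) (hmin _ ⟨m, hmR, rfl⟩ ?_)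
          rw [← hq]
          exact hmono hmx (by rw [hq]; exact (hxq m hmR).symm), by
          intro d hd hdρ
          rw [hq2] at hdρ
          obtain ⟨hdR, hlt, hdV⟩ := hs.2 d hd hdρ
          refine ⟨⟨_, hdR, hq d⟩, ?_, hVd d hdR hdV⟩
          rw [← hq, ← hq]
          exact hmono hlt (by rw [hq x]; exact (hxq _ hdR).symm)⟩
      refine ⟨⟨?_, fun π hπ => ?_⟩, fun k hk => hfr k fun h' => hk (.inl h')⟩
      · rw [heads_insert, hq]; exact hrep
      · have heq : Multi (2 ^ 2 ^ j) (Insert.insert (x / 2 ^ e) R) π = Multi (2 ^ 2 ^ j) R π := by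
          by_cases hπx : x / 2 ^ (e + 2 ^ j) = π
          · subst hπx
            have := multi_insert_of_notMem (q := 2 ^ 2 ^ j) (x := x / 2 ^ e) (R := R)
              (by rw [hq]; exact hnot)
            rw [hq] at this
            rw [this, multi_eq_empty_of_notMem hnot]
          · exact multi_insert_of_ne (by rwa [hq])
        rw [heq]
        exact (h.2 π hπ).frame fun k hk => hfr k fun h' => h'.not_cluster hk
  · have h0 : c (key 0 e j x) ≠ 0 := fun h => hm.ne_empty (hcl.cell_eq_zero.1 h)
    simp only [ne_eq, h0, not_false_eq_true, if_true]
    have hmem : x / 2 ^ e / 2 ^ 2 ^ j ∈ Heads (2 ^ 2 ^ j) R := by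
      rw [hq]; exact mem_heads_multi hm.some_mem
    have hmm : ∀ κ ∈ R, κ / 2 ^ 2 ^ j = x / 2 ^ (e + 2 ^ j) →
        κ ∈ Multi (2 ^ 2 ^ j) R (x / 2 ^ (e + 2 ^ j)) := by
      intro κ hκ h1
      obtain ⟨κ', h2, h3, κ'', h4, h5, h6⟩ := hm
      by_cases hne : κ' = κ
      · exact ⟨hκ, h1, κ'', h4, h5, hne ▸ h6⟩
      · exact ⟨hκ, h1, κ', h2, h3, hne⟩
    obtain ⟨hrep, hfr⟩ := ih (x := x) (p := p) (s := s) hcl rfl (fun h => hxR h.1) hV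
      ⟨fun κ hκ hlt hmax => hp.1 κ hκ.1 hlt fun κ' hκ' hlt' => by
          by_contra hn
          have a1 := Nat.div_le_div_right (c := 2 ^ 2 ^ j) (not_le.1 hn).le
          have a2 := Nat.div_le_div_right (c := 2 ^ 2 ^ j) hlt'.le
          rw [hq] at a2
          rw [hκ.2.1] at a1
          exact hn (hmax κ' (hmm κ' hκ' (by omega)) hlt'),
        fun d hd hdx => by
          obtain ⟨h1, h2⟩ := hp.2 d hd (by rw [← hqq, hdx, hpre])
          exact ⟨hmm _ h1 (by rw [hq, hdx]), h2⟩⟩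
      ⟨fun κ hκ hlt hmax => hs.1 κ hκ.1 hlt fun κ' hκ' hlt' => by
          by_contra hn
          have a1 := Nat.div_le_div_right (c := 2 ^ 2 ^ j) (not_le.1 hn).le
          have a2 := Nat.div_le_div_right (c := 2 ^ 2 ^ j) hlt'.le
          rw [hq] at a2
          rw [hκ.2.1] at a1
          exact hn (hmax κ' (hmm κ' hκ' (by omega)) hlt'),
        fun d hd hdx => by
          obtain ⟨h1, h2⟩ := hs.2 d hd (by rw [← hqq, hdx, hpre])
          exact ⟨hmm _ h1 (by rw [hq, hdx]), h2⟩⟩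
    refine ⟨⟨?_, fun π hπ => ?_⟩, fun k hk => hfr k fun h' => hk (.inr ⟨_, hpre, h'⟩)⟩
    · rw [heads_insert, Set.insert_eq_of_mem hmem]
      exact h.1.congr (fun k hk => hfr k hk.not_cluster) fun z _ hz =>
        headValid_insert_of_mem hxR hmem hz
    · by_cases hπx : x / 2 ^ (e + 2 ^ j) = π
      · subst hπx
        have := multi_insert_of_nonempty (q := 2 ^ 2 ^ j) hxR (by rw [hq]; exact hm)
        rw [hq] at this
        rw [this]; exact hrep
      · rw [multi_insert_of_ne (by rwa [hq])]
        exact (h.2 π hπ).frame fun k hk => hfr k fun h' => hπx (h'.prefix_unique hk)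

theorem rest_insert_lt (h : ∀ κ ∈ C, x < κ) : Rest (Insert.insert x C) = C := by
  ext κ
  simp only [Rest, Set.mem_insert_iff, Set.mem_ofPred_eq]
  constructor
  · rintro ⟨rfl | hκ, κ', rfl | h1, h2⟩
    · omega
    · have := h _ h1; omega
    · exact hκ
    · exact hκ
  · exact fun hκ => ⟨.inr hκ, x, .inl rfl, h κ hκ⟩

theorem insert_rest (h : IsLeast C m) : Insert.insert m (Rest C) = C := by
  ext κ
  simp only [Rest, Set.mem_insert_iff, Set.mem_ofPred_eq]
  have h1 := h.1
  have h2 : ∀ κ ∈ C, m ≤ κ := fun κ hκ => h.2 hκ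
  grind

theorem notMem_rest (h : IsLeast C m) : m ∉ Rest C := by
  rintro ⟨-, κ, h1, h2⟩
  have := h.2 h1; omega

theorem rest_insert_gt (h : IsLeast C m) (hx : m < x) :
    Rest (Insert.insert x C) = Insert.insert x (Rest C) := by
  ext κ
  simp only [Rest, Set.mem_insert_iff, Set.mem_ofPred_eq]
  have h1 := h.1
  have h2 : ∀ κ ∈ C, m ≤ κ := fun κ hκ => h.2 hκ
  grind

theorem mem_rest (h : IsLeast C m) : κ ∈ Rest C ↔ κ ∈ C ∧ m < κ := by
  simp only [Rest, Set.mem_ofPred_eq]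
  have h1 := h.1
  have h2 : ∀ κ ∈ C, m ≤ κ := fun κ hκ => h.2 hκ
  grind

theorem vebRep_insert_empty (h : VebRep j e ρ ∅ V c) (hx : x / 2 ^ (e + 2 ^ j) = ρ) (hV : V x) :
    VebRep j e ρ (Insert.insert (x / 2 ^ e) ∅) V
      (update (update c (key 0 e j x) (x + 1)) (key 1 e j x) (x + 1)) ∧
    ∀ k, ¬ InSub j e ρ k →
      (update (update c (key 0 e j x) (x + 1)) (key 1 e j x) (x + 1)) k =
        c k := by
  constructor
  · rw [insert_empty_eq]
    refine vebRep_singleton hx hV ?_ ?_ fun k hk hne => ?_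
    · simp [key, ← hx]
    · simp [key, ← hx]
    · have h0 : ∀ s, k ≠ key s e j x := by
        rintro s rfl; exact hne (by simp [key, hx])
      simp [h0, h.zero_of_empty hk]
  · intro k hk
    have h0 : ∀ s < 2, k ≠ key s e j x := by
      rintro s hs rfl; exact hk (hx ▸ InSub.cell hs)
    simp [h0 0, h0 1]

theorem update_cell_frame (hs : s < 2) (hx : x / 2 ^ (e + 2 ^ j) = ρ) (hk : ¬ InSub j e ρ k) :
    update c (key s e j x) v k = c k := by
  rw [update_of_ne]
  rintro rfl; exact hk (hx ▸ InSub.cell hs)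

theorem update_cell_rest
    (hk : InRest j e ρ k) : update c (key s e (j + 1) x) v k = c k := by
  rw [update_of_ne]
  rintro rfl; exact not_inRest_cell hk

theorem key_eq (hx : x / 2 ^ (e + 2 ^ j) = ρ) : key s e j x = (s, e, 2 ^ j, ρ) := by rw [key, hx]

/-- A new minimum takes the place of the old one, which is inserted into the rest; its successor is the
minimum of the rest. -/
theorem insert_spec (j : ℕ) : InsertSpec j (insert j) := by
  induction j with
  | zero =>
    intro e ρ x p s C V c h hx hxC hV _ _
    rcases Set.eq_empty_or_nonempty C with rfl | hne
    · have h0 : c (key 0 e 0 x) = 0 := by rw [key_eq hx]; exact h.cell_eq_zero.2 rfl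
      simp only [insert, h0, if_true]; exact vebRep_insert_empty h hx hV
    · obtain ⟨a, b, ha, hb, hVa, hVb, hl, hg⟩ := h.cell_ne_zero hne
      have hpre := h.nodeRep.1
      have h0 : c (key 0 e 0 x) = a + 1 := by rw [key_eq hx]; exact ha
      have hx1 : x / 2 ^ e / 2 ^ 2 ^ 0 = ρ := by rw [div_window, hx]
      have hne1 : x / 2 ^ e ≠ a / 2 ^ e := fun h => hxC (h ▸ hl.1)
      -- there are only two classes in a window of one bit
      have hC : C = {a / 2 ^ e} := by
        ext κ
        refine ⟨fun hκ => ?_, fun hκ => hκ ▸ hl.1⟩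
        have h1 := hpre κ hκ
        have h2 := hpre _ hl.1
        have h3 : κ ≠ x / 2 ^ e := fun h => hxC (h ▸ hκ)
        simp only [pow_zero, pow_one] at h1 h2 hx1
        simp only [Set.mem_singleton_iff]; omega
      have hba : b / 2 ^ e = a / 2 ^ e := by simpa [hC] using hg.1
      have hpa : a / 2 ^ (e + 2 ^ 0) = ρ := by rw [← div_window]; exact hpre _ hl.1
      have hk : ∀ s, key s e 0 x = (s, e, 2 ^ 0, ρ) := fun s => key_eq hx
      simp only [insert, h0, Nat.add_one_ne_zero, if_false]
      split_ifs with hlt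
      · refine ⟨?_, fun k => update_cell_frame (by simp) hx⟩
        have hlt' : x / 2 ^ e < a / 2 ^ e :=
          lt_of_le_of_ne (Nat.div_le_div_right (by omega)) hne1
        have := nodeRep_pair (V := V) (j := 0) (b := b) (c := update c (key 0 e 0 x) (x + 1)) hx
          (by rw [← div_window]; exact hpre _ hg.1) (by rw [hba]; exact hlt') hV hVb
          (by rw [hk]; simp) (by rw [hk]; simpa using hb)
        rw [hba] at this
        rw [hC]; exact this
      · refine ⟨?_, fun k => update_cell_frame (by simp) hx⟩
        have hlt' : a / 2 ^ e < x / 2 ^ e :=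
          lt_of_le_of_ne (Nat.div_le_div_right (by omega)) (Ne.symm hne1)
        rw [hC, Set.pair_comm]
        exact nodeRep_pair (V := V) hpa hx hlt' hVa hV (by rw [hk]; simpa using ha)
          (by rw [hk]; simp)
  | succ j ih =>
    intro e ρ x p s C V c h hx hxC hV hp hs
    rcases Set.eq_empty_or_nonempty C with rfl | hne
    · have h0 : c (key 0 e (j + 1) x) = 0 := by rw [key_eq hx]; exact h.cell_eq_zero.2 rfl
      simp only [insert, h0, if_true]; exact vebRep_insert_empty h hx hV
    · obtain ⟨a, b, ha, hb, hVa, hVb, hl, hg⟩ := h.cell_ne_zero hne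
      obtain ⟨hn, hr⟩ := vebRep_succ.1 h
      have hpre := hn.1
      have h0 : c (key 0 e (j + 1) x) = a + 1 := by rw [key_eq hx]; exact ha
      have h1 : c (key 1 e (j + 1) x) = b + 1 := by rw [key_eq hx]; exact hb
      have hx1 : x / 2 ^ e / 2 ^ 2 ^ (j + 1) = ρ := by rw [div_window, hx]
      have hne1 : x / 2 ^ e ≠ a / 2 ^ e := fun h => hxC (h ▸ hl.1)
      have hpa : a / 2 ^ (e + 2 ^ (j + 1)) = ρ := by rw [← div_window]; exact hpre _ hl.1
      have hk : ∀ s, key s e (j + 1) x = (s, e, 2 ^ (j + 1), ρ) := fun s => key_eq hx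
      have hfr : ∀ {c' c'' : NodeCells}, (∀ k, ¬ InSub (j + 1) e ρ k → c' k = c k) →
          (∀ k, ¬ InRest j e ρ k → c'' k = c' k) →
          ∀ k, ¬ InSub (j + 1) e ρ k → c'' k = c k := fun h1 h2 k hk =>
        (h2 k fun h => hk h.inSub).trans (h1 k hk)
      have hpre' : ∀ κ ∈ Insert.insert (x / 2 ^ e) C, κ / 2 ^ 2 ^ (j + 1) = ρ := by
        rintro κ (rfl | hκ)
        · exact hx1
        · exact hpre κ hκ
      simp only [insert, h0, h1, Nat.add_one_ne_zero, if_false, Nat.add_sub_cancel]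
      by_cases hlt : x + 1 < a + 1
      · rw [if_pos hlt]
        have hlt' : x / 2 ^ e < a / 2 ^ e :=
          lt_of_le_of_ne (Nat.div_le_div_right (by omega)) hne1
        have hall : ∀ κ ∈ C, x / 2 ^ e < κ := fun κ hκ => hlt'.trans_le (hl.2 hκ)
        have hmin := restMin_spec hr hx fun κ hκ => hpre κ hκ.1
        obtain ⟨g1, g2⟩ := insertRest_spec (x := a) (p := 0) (s := restMin j e x c) ih
          (hr.frame (c' := update c (key 0 e (j + 1) x) (x + 1))
            fun k hk => update_cell_rest hk)
          hpa (notMem_rest hl) hVa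
          ⟨fun κ hκ hlt => absurd (hl.2 hκ.1) (not_le.2 hlt), fun d hd => by simp at hd⟩
          (by
            rcases hmin with ⟨h1, h2⟩ | ⟨d, h1, h2, h3⟩
            · rw [h1, h2]
              exact ⟨fun κ hκ => absurd hκ (by simp), fun d hd => by simp at hd⟩
            · rw [h1]
              refine ⟨fun κ hκ hlt hmin => ⟨d, rfl, ?_, h2⟩, fun d' hd' hρ => ?_⟩
              · exact le_antisymm (h3.2 hκ) (hmin _ h3.1 ((mem_rest hl).1 h3.1).2)
              · obtain rfl : d = d' := by omega
                exact ⟨h3.1, ((mem_rest hl).1 h3.1).2, h2⟩)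
        rw [insert_rest hl] at g1
        refine ⟨vebRep_succ.2 ⟨⟨hpre', .inr ⟨x, b, ?_, ?_, hV, hVb, ?_, ?_⟩⟩, ?_⟩,
          hfr (fun k => update_cell_frame (by simp) hx) g2⟩
        · rw [g2 _ not_inRest_cell, hk]; simp
        · rw [g2 _ not_inRest_cell, hk]; simpa using hb
        · refine ⟨by simp, ?_⟩
          rintro κ (rfl | hκ)
          · exact le_rfl
          · exact (hall κ hκ).le
        · refine ⟨.inr hg.1, ?_⟩
          rintro κ (rfl | hκ)
          · exact (hall _ hg.1).le
          · exact hg.2 hκ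
        · rw [rest_insert_lt hall]; exact g1
      · rw [if_neg hlt]
        have hlt' : a / 2 ^ e < x / 2 ^ e :=
          lt_of_le_of_ne (Nat.div_le_div_right (by omega)) (Ne.symm hne1)
        have hsucc : SuccOk (j + 1) e ρ (Rest C) V x s := by
          refine ⟨fun κ hκ hlt hmin => hs.1 κ hκ.1 hlt fun κ' hκ' hlt' =>
            hmin κ' ((mem_rest hl).2 ⟨hκ', by omega⟩) hlt', fun d hd hρ => ?_⟩
          obtain ⟨h1, h2, h3⟩ := hs.2 d hd hρ; exact ⟨(mem_rest hl).2 ⟨h1, by omega⟩, h2, h3⟩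
        set c' : NodeCells := if b + 1 < x + 1 then
          update c (key 1 e (j + 1) x) (x + 1) else c with hc'
        have hc'fr : ∀ k, ¬ InSub (j + 1) e ρ k → c' k = c k := by
          intro k hk
          rw [hc']
          split_ifs
          · exact update_cell_frame (by simp) hx hk
          · rfl
        have hc'r : ∀ k, InRest j e ρ k → c' k = c k := by
          intro k hk
          rw [hc']
          split_ifs
          · exact update_cell_rest hk
          · rfl
        have hnode : NodeRep (j + 1) e ρ (Insert.insert (x / 2 ^ e) C) V c' := by
          have hleast : IsLeast (Insert.insert (x / 2 ^ e) C) (a / 2 ^ e) := by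
            refine ⟨.inr hl.1, ?_⟩
            rintro κ (rfl | hκ)
            · exact hlt'.le
            · exact hl.2 hκ
          have hneb : b / 2 ^ e ≠ x / 2 ^ e := fun h => hxC (h ▸ hg.1)
          rw [hc']
          split_ifs with hbx
          · refine ⟨hpre', .inr ⟨a, x, ?_, ?_, hVa, hV, hleast, by simp, ?_⟩⟩
            · rw [hk]; simpa using ha
            · rw [hk]; simp
            · have : b / 2 ^ e ≤ x / 2 ^ e := Nat.div_le_div_right (by omega)
              rintro κ (rfl | hκ)
              · exact le_rfl
              · exact (hg.2 hκ).trans this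
          · refine ⟨hpre', .inr ⟨a, b, ha, hb, hVa, hVb, hleast, .inr hg.1, ?_⟩⟩
            have : x / 2 ^ e ≤ b / 2 ^ e := Nat.div_le_div_right (by omega)
            rintro κ (rfl | hκ)
            · exact this
            · exact hg.2 hκ
        have hfin : ∀ {p'}, PredOk (j + 1) e ρ (Rest C) V x p' →
            VebRep (j + 1) e ρ (Insert.insert (x / 2 ^ e) C) V
              (insertRest (insert j) j e x p' s c') ∧
            ∀ k, ¬ InSub (j + 1) e ρ k → insertRest (insert j) j e x p' s c' k = c k := by
          intro p' hp'
          obtain ⟨g1, g2⟩ := insertRest_spec (x := x) (p := p') (s := s) ih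
            (hr.frame hc'r) hx (fun h => hxC h.1) hV hp' hsucc
          refine ⟨vebRep_succ.2 ⟨hnode.congr (fun s _ => g2 _ not_inRest_cell) fun _ _ => id, ?_⟩,
            hfr hc'fr g2⟩
          rw [rest_insert_gt hl hlt']; exact g1
        by_cases hcond : p ≠ 0 ∧ (p - 1) / 2 ^ e = a / 2 ^ e
        · rw [if_pos hcond]
          refine hfin ⟨fun κ hκ hlt hmax => ?_, fun d hd => by simp at hd⟩
          -- `p` is the minimum, so there is no smaller class among the others
          obtain ⟨m, hm, hmx, hκm, hmm⟩ := exists_max_lt hκ.1 hlt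
          obtain ⟨d, rfl, hd, -⟩ := hp.1 m hm hmx hmm
          have h2 := hcond.2
          simp only [Nat.add_sub_cancel] at h2
          have h3 := ((mem_rest hl).1 hκ).2; omega
        · rw [if_neg hcond]
          refine hfin ⟨fun κ hκ hlt hmax => hp.1 κ hκ.1 hlt fun κ' hκ' hlt'' => ?_,
            fun d hd hρ => ?_⟩
          · have h3 := ((mem_rest hl).1 hκ).2
            by_cases hh : a / 2 ^ e < κ'
            · exact hmax κ' ((mem_rest hl).2 ⟨hκ', hh⟩) hlt''
            · omega
          · obtain ⟨h2, h3, h4⟩ := hp.2 d hd hρ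
            subst hd
            simp only [ne_eq, Nat.add_one_ne_zero, not_false_eq_true, Nat.add_sub_cancel, true_and]
              at hcond
            have := hl.2 h2; exact ⟨(mem_rest hl).2 ⟨h2, by omega⟩, h3, h4⟩

/-! ### Deletion -/

/-- Forget a set of two classes to which the digit `x` belongs. -/
def clear : (j e x : ℕ) → NodeCells → NodeCells
  | 0, e, x, c => update (update c (key 0 e 0 x) 0) (key 1 e 0 x) 0
  | j + 1, e, x, c =>
      update (update (update (update c
        (key 0 e (j + 1) x) 0) (key 1 e (j + 1) x) 0)
        (key 0 (e + 2 ^ j) j x) 0) (key 1 (e + 2 ^ j) j x) 0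

/-- The set to which `x` belongs has exactly two elements, if it has at least two. -/
def IsPair : (j e x : ℕ) → NodeCells → Prop
  | 0, _, _, _ => True
  | j + 1, e, x, c => (restMin j e x c - 1) / 2 ^ e = (c (key 1 e (j + 1) x) - 1) / 2 ^ e

instance (j e x : ℕ) (c : NodeCells) : Decidable (IsPair j e x c) := by
  cases j <;> unfold IsPair <;> infer_instance

/-- Let the digit `o` represent its class in the two cells of the structure. -/
def relabelCells (j e o : ℕ) (c : NodeCells) : NodeCells :=
  let c' := if (c (key 1 e j o) - 1) / 2 ^ e = o / 2 ^ e then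
    update c (key 1 e j o) (o + 1) else c
  if (c (key 0 e j o) - 1) / 2 ^ e = o / 2 ^ e then
    update c' (key 0 e j o) (o + 1) else c'

/-- Let the digit `o` represent its class. -/
def relabel : (j e o : ℕ) → NodeCells → NodeCells
  | 0, e, o, c => relabelCells 0 e o c
  | j + 1, e, o, c =>
      let c' := relabelCells (j + 1) e o c
      if (c (key 0 e (j + 1) o) - 1) / 2 ^ e = o / 2 ^ e then c'
      else if c' (key 0 e j o) ≠ 0 then relabel j e o c'
      else relabel j (e + 2 ^ j) o c'

/-- Delete the digit `x` from the summary and the clusters, where `f` deletes from one of them. If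
a cluster is left with a single class, then it is dissolved, and the digit of this class represents
it in the summary. -/
def eraseRest (f : (e x p : ℕ) → NodeCells → NodeCells) (j e x p : ℕ) (c : NodeCells) :
    NodeCells :=
  let a := c (key 0 e j x)
  if a ≠ 0 then
    if IsPair j e x c then
      relabel j (e + 2 ^ j) ((if x / 2 ^ e = (a - 1) / 2 ^ e then c (key 1 e j x) else a) - 1)
        (clear j e x c)
    else f e x p c
  else f (e + 2 ^ j) x p c

/-- Delete the digit `x`; `p` tells its predecessor. -/
def erase : (j e x p : ℕ) → NodeCells → NodeCells
  | 0, e, x, _, c =>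
      let m := c (key 0 e 0 x)
      let M := c (key 1 e 0 x)
      if (m - 1) / 2 ^ e = (M - 1) / 2 ^ e then
        update (update c (key 0 e 0 x) 0) (key 1 e 0 x) 0
      else if x / 2 ^ e = (m - 1) / 2 ^ e then update c (key 0 e 0 x) M
      else update c (key 1 e 0 x) m
  | j + 1, e, x, p, c =>
      let m := c (key 0 e (j + 1) x)
      let M := c (key 1 e (j + 1) x)
      if (m - 1) / 2 ^ e = (M - 1) / 2 ^ e then
        update (update c (key 0 e (j + 1) x) 0) (key 1 e (j + 1) x) 0
      else if x / 2 ^ e = (m - 1) / 2 ^ e then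
        eraseRest (erase j) j e (restMin j e x c - 1) p
          (update c (key 0 e (j + 1) x) (restMin j e x c))
      else
        eraseRest (erase j) j e x p
          (if x / 2 ^ e = (M - 1) / 2 ^ e then update c (key 1 e (j + 1) x) p else c)

/-! ### Groups under deletion -/

theorem multi_diff_of_ne (h : x / q ≠ π) : Multi q (R \ {x}) π = Multi q R π := by
  ext κ
  simp only [Multi, Set.mem_sdiff, Set.mem_singleton_iff, Set.mem_ofPred_eq]
  grind

theorem multi_diff_of_two (ha : a ∈ R) (hb : b ∈ R)
    (hax : a ≠ x) (hbx : b ≠ x) (hab : a ≠ b) (haq : a / q = x / q) (hbq : b / q = x / q) :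
    Multi q (R \ {x}) (x / q) = Multi q R (x / q) \ {x} := by
  ext κ
  simp only [Multi, Set.mem_sdiff, Set.mem_singleton_iff, Set.mem_ofPred_eq]
  grind

theorem multi_diff_of_pair
    (h : ∀ κ ∈ R, κ / q = x / q → κ = x ∨ κ = a) : Multi q (R \ {x}) (x / q) = ∅ := by
  ext κ
  simp only [Multi, Set.mem_sdiff, Set.mem_singleton_iff, Set.mem_ofPred_eq,
    Set.mem_empty_iff_false, iff_false]
  grind

theorem heads_diff_of_mem (ha : a ∈ R) (hax : a ≠ x)
    (hq : a / q = x / q) : Heads q (R \ {x}) = Heads q R := by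
  ext κ
  simp only [Heads, Set.mem_image, Set.mem_sdiff, Set.mem_singleton_iff]
  grind

theorem heads_diff_of_single (h : ∀ κ ∈ R, κ / q = x / q → κ = x) :
    Heads q (R \ {x}) = Heads q R \ {x / q} := by
  ext κ
  simp only [Heads, Set.mem_image, Set.mem_sdiff, Set.mem_singleton_iff]
  grind

/-! ### Correctness of the deletion -/

theorem NodeRep.key_eq
    (h : NodeRep j e ρ C V c) (ho : o / 2 ^ e ∈ C) : o / 2 ^ (e + 2 ^ j) = ρ := by
  rw [← div_window]; exact h.1 _ ho

theorem VebRep.zero_of_singleton (h : VebRep j e ρ {κ} V c) (hk : InSub j e ρ k)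
    (hne : k.2 ≠ (e, 2 ^ j, ρ)) : c k = 0 := by
  cases j with
  | zero => exact absurd hk.2 hne
  | succ j =>
    obtain ⟨-, h2, h3⟩ := h
    rcases hk with hk | hk | ⟨π, hπ, hk⟩
    · exact absurd hk.2 hne
    · rw [rest_singleton, heads_empty] at h2; exact h2.zero_of_empty hk
    · have := h3 π hπ
      rw [rest_singleton, multi_empty] at this; exact this.zero_of_empty hk

theorem clear_frame (hk : ¬ InSub j e (x / 2 ^ (e + 2 ^ j)) k) : clear j e x c k = c k := by
  cases j with
  | zero =>
    have h0 : k ≠ key 0 e 0 x := by rintro rfl; exact hk (InSub.cell (by simp))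
    have h1 : k ≠ key 1 e 0 x := by rintro rfl; exact hk (InSub.cell (by simp))
    simp [clear, h0, h1]
  | succ j =>
    have h0 : k ≠ key 0 e (j + 1) x := by rintro rfl; exact hk (InSub.cell (by simp))
    have h1 : k ≠ key 1 e (j + 1) x := by rintro rfl; exact hk (InSub.cell (by simp))
    have h2 : ∀ s < 2, k ≠ key s (e + 2 ^ j) j x := by
      rintro s hs rfl
      rw [← div_window_succ, div_window] at hk; exact hk (InSub.summary (InSub.cell hs))
    simp [clear, h0, h1, h2 0, h2 1]

theorem clear_zero
    (h : VebRep j e ρ {a, b} V c) (hab : a < b) (hx : x / 2 ^ (e + 2 ^ j) = ρ) (hk : InSub j e ρ k) : clear j e x c k = 0 := by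
  cases j with
  | zero =>
    obtain ⟨k1, k2⟩ := k
    obtain ⟨h1, h2⟩ := hk
    simp only at h1 h2
    subst h2
    simp only [clear, key, hx]
    interval_cases k1 <;> simp
  | succ j =>
    have hx' : x / 2 ^ (e + 2 ^ j + 2 ^ j) = ρ := by
      rw [← hx, ← div_window_succ, div_window]
    obtain ⟨-, h2, h3⟩ := h
    rw [rest_pair hab, heads_singleton] at h2
    rw [rest_pair hab] at h3
    simp only [clear, key, hx, hx', update_apply]
    by_cases e1 : k.2 = (e, 2 ^ (j + 1), ρ)
    · obtain ⟨k1, k2⟩ := k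
      have := hk.bounds.1
      simp only at e1 this
      subst e1
      interval_cases k1 <;> simp
    · by_cases e2 : k.2 = (e + 2 ^ j, 2 ^ j, ρ)
      · obtain ⟨k1, k2⟩ := k
        have := hk.bounds.1
        simp only at e2 this
        subst e2
        interval_cases k1 <;> simp
      · have : c k = 0 := by
          rcases hk with hk | hk | ⟨π, hπ, hk⟩
          · exact absurd hk.2 e1
          · exact h2.zero_of_singleton hk e2
          · have := h3 π hπ
            rw [multi_singleton] at this; exact this.zero_of_empty hk
        split_ifs <;> first | rfl | exact this

theorem isPair_spec (h : VebRep j e ρ C V c) (hx : x / 2 ^ (e + 2 ^ j) = ρ) (ha : IsLeast C a)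
    (hb : IsGreatest C b) (hab : a < b) :
    (IsPair j e x c ∧ C = {a, b}) ∨ (¬ IsPair j e x c ∧ ∃ κ ∈ C, κ ≠ a ∧ κ ≠ b) := by
  cases j with
  | zero =>
    left
    refine ⟨trivial, ?_⟩
    have hpre := h.nodeRep.1
    ext κ
    simp only [Set.mem_insert_iff, Set.mem_singleton_iff]
    refine ⟨fun hκ => ?_, ?_⟩
    · have h1 := hpre κ hκ
      have h2 := hpre _ ha.1
      have h3 := hpre _ hb.1
      have h4 := ha.2 hκ
      have h5 := hb.2 hκ
      simp only [pow_zero, pow_one] at h1 h2 h3; omega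
    · rintro (rfl | rfl)
      · exact ha.1
      · exact hb.1
  | succ j =>
    obtain ⟨hn, hr⟩ := vebRep_succ.1 h
    obtain ⟨a', b', -, hb', -, -, -, hg⟩ := h.cell_ne_zero ⟨a, ha.1⟩
    obtain rfl : b = b' / 2 ^ e := hb.unique hg
    have hk : key 1 e (j + 1) x = (1, e, 2 ^ (j + 1), ρ) := key_eq hx
    have hbr : b' / 2 ^ e ∈ Rest C := (mem_rest ha).2 ⟨hb.1, hab⟩
    rcases restMin_spec hr hx fun κ hκ => hn.1 κ hκ.1 with ⟨h1, -⟩ | ⟨d, h1, -, h3⟩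
    · rw [h1] at hbr; exact absurd hbr (by simp)
    · simp only [IsPair, h1, hk, hb', Nat.add_sub_cancel]
      by_cases hdb : d / 2 ^ e = b' / 2 ^ e
      · left
        refine ⟨hdb, ?_⟩
        ext κ
        simp only [Set.mem_insert_iff, Set.mem_singleton_iff]
        refine ⟨fun hκ => ?_, ?_⟩
        · have h4 := ha.2 hκ
          have h5 := hb.2 hκ
          by_contra hcon
          have := h3.2 ((mem_rest ha).2 ⟨hκ, by omega⟩); omega
        · rintro (rfl | rfl)
          · exact ha.1
          · exact hb.1
      · right
        obtain ⟨h4, h5⟩ := (mem_rest ha).1 h3.1; exact ⟨hdb, _, h4, by omega, hdb⟩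

theorem relabelCells_frame (hk : ∀ s < 2, k ≠ key s e j o) : relabelCells j e o c k = c k := by
  simp only [relabelCells]
  split_ifs <;> simp [hk 0, hk 1]

theorem relabelCells_nodeRep (h : NodeRep j e ρ C V c) (ho : o / 2 ^ e ∈ C)
    (hV : ∀ z, z / 2 ^ e ∈ C → z / 2 ^ e ≠ o / 2 ^ e → V z → V' z) (hVo : V' o) :
    NodeRep j e ρ C V' (relabelCells j e o c) := by
  refine ⟨h.1, .inr ?_⟩
  have hk : ∀ s, key s e j o = (s, e, 2 ^ j, ρ) := fun s => Veb.key_eq (h.key_eq ho)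
  rcases h.2 with ⟨h1, -⟩ | ⟨a, b, h1, h2, h3, h4, h5, h6⟩
  · rw [h1] at ho; exact absurd ho (by simp)
  · refine ⟨if a / 2 ^ e = o / 2 ^ e then o else a, if b / 2 ^ e = o / 2 ^ e then o else b,
      ?_, ?_, ?_, ?_, ?_, ?_⟩
    · simp only [relabelCells, hk, h1, h2, Nat.add_sub_cancel]
      split_ifs <;> simp [h1]
    · simp only [relabelCells, hk, h1, h2, Nat.add_sub_cancel]
      split_ifs <;> simp [h2]
    · split_ifs with hh
      · exact hVo
      · exact hV a h5.1 hh h3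
    · split_ifs with hh
      · exact hVo
      · exact hV b h6.1 hh h4
    · split_ifs with hh
      · exact hh ▸ h5
      · exact h5
    · split_ifs with hh
      · exact hh ▸ h6
      · exact h6

theorem relabel_spec (h : VebRep j e ρ C V c) (ho : o / 2 ^ e ∈ C)
    (hV : ∀ z, z / 2 ^ e ∈ C → z / 2 ^ e ≠ o / 2 ^ e → V z → V' z) (hVo : V' o) :
    VebRep j e ρ C V' (relabel j e o c) ∧ ∀ k, ¬ InSub j e ρ k → relabel j e o c k = c k := by
  induction j generalizing e ρ C V V' c with
  | zero =>
    refine ⟨relabelCells_nodeRep h ho hV hVo, fun k hk => relabelCells_frame ?_⟩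
    rintro s hs rfl
    exact hk (Veb.key_eq (h.nodeRep.key_eq ho) ▸ InSub.cell hs)
  | succ j ih =>
    obtain ⟨hn, hr⟩ := vebRep_succ.1 h
    have hoρ := hn.key_eq ho
    have hn' := relabelCells_nodeRep hn ho hV hVo
    set c' := relabelCells (j + 1) e o c with hc'
    have hfr : ∀ k, ¬ InSub (j + 1) e ρ k → c' k = c k := fun k hk => relabelCells_frame (by
      rintro s hs rfl; exact hk (Veb.key_eq hoρ ▸ InSub.cell hs))
    have hfr' : ∀ k, InRest j e ρ k → c' k = c k := fun k hk => relabelCells_frame (by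
      rintro s hs rfl; exact not_inRest_cell hk)
    have hr' := hr.frame hfr'
    have hk : key 0 e (j + 1) o = (0, e, 2 ^ (j + 1), ρ) := Veb.key_eq hoρ
    obtain ⟨a, b, h1, h2, h3, h4, h5, h6⟩ := h.cell_ne_zero ⟨_, ho⟩
    simp only [relabel, ← hc', hk, h1, Nat.add_sub_cancel]
    -- the summary stays valid if the group of `o` has another element or is absent
    have hsum : (o / 2 ^ e ∈ Rest C → ∃ κ ∈ Rest C, κ / 2 ^ 2 ^ j = o / 2 ^ e / 2 ^ 2 ^ j ∧
        κ ≠ o / 2 ^ e) → ∀ z, HeadValid e (2 ^ 2 ^ j) (Rest C) V z →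
        HeadValid e (2 ^ 2 ^ j) (Rest C) V' z := by
      intro hex z hz κ hκ hh ha
      obtain ⟨hv, he⟩ := hz κ hκ hh ha
      have hne : κ ≠ o / 2 ^ e := by
        rintro rfl
        obtain ⟨κ', h1, h2, h3⟩ := hex hκ; exact h3 (ha κ' h1 h2)
      exact ⟨hV z (he ▸ hκ.1) (he ▸ hne) hv, he⟩
    split_ifs with hmin hcl
    · refine ⟨vebRep_succ.2 ⟨hn', ?_, fun π hπ => ?_⟩, hfr⟩
      · have hno : o / 2 ^ e ∉ Rest C := hmin ▸ notMem_rest h5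
        exact hr'.1.congr (fun _ _ => rfl) fun z _ => hsum (fun h => absurd h hno) z
      · refine (hr'.2 π hπ).congr (fun _ _ => rfl) fun z hz => hV z hz.1.1 ?_
        rintro heq
        rw [heq, ← hmin] at hz; exact notMem_rest h5 hz.1
    all_goals
      have hoR : o / 2 ^ e ∈ Rest C := (mem_rest h5).2 ⟨ho, lt_of_le_of_ne (h5.2 ho) hmin⟩
      have hpre : o / 2 ^ (e + 2 ^ j) / 2 ^ 2 ^ j = ρ := by rw [div_window_succ, hoρ]
      have hq : ∀ z, z / 2 ^ e / 2 ^ 2 ^ j = z / 2 ^ (e + 2 ^ j) := fun z => div_window _ _ _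
      have hclr := hr'.2 _ hpre
    · have hm : (Multi (2 ^ 2 ^ j) (Rest C) (o / 2 ^ (e + 2 ^ j))).Nonempty := by
        by_contra hemp
        exact hcl (hclr.cell_eq_zero.2 (Set.not_nonempty_iff_eq_empty.1 hemp))
      have hom : ∃ κ ∈ Rest C, κ / 2 ^ 2 ^ j = o / 2 ^ (e + 2 ^ j) ∧ κ ≠ o / 2 ^ e := by
        obtain ⟨κ', h2, h3, κ'', h4, h5, h6⟩ := hm
        by_cases hne : κ' = o / 2 ^ e
        · exact ⟨κ'', h4, h5, fun h => h6 (h.trans hne.symm)⟩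
        · exact ⟨κ', h2, h3, hne⟩
      obtain ⟨g1, g2⟩ := ih (V' := V') hclr ⟨hoR, hq o, hom⟩
        (fun z hz hne hv => hV z hz.1.1 hne hv) hVo
      refine ⟨vebRep_succ.2 ⟨hn'.congr (fun s _ => g2 _ fun hk =>
        not_inRest_cell (.inr ⟨_, hpre, hk⟩)) fun _ _ => id, ?_, fun π hπ => ?_⟩,
        fun k hk => (g2 k fun h' => hk (hpre ▸ h'.cluster)).trans (hfr k hk)⟩
      · exact hr'.1.congr (fun k hk => g2 k hk.not_cluster) fun z _ =>
          hsum (fun _ => by simpa only [hq] using hom) z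
      · by_cases hπx : o / 2 ^ (e + 2 ^ j) = π
        · subst hπx; exact g1
        · refine (hr'.2 π hπ).congr (fun k hk => g2 k fun h' => hπx (h'.prefix_unique hk))
            fun z hz => hV z hz.1.1 fun heq => hπx ?_
          rw [← hz.2.1, heq, hq]
    · have hm : Multi (2 ^ 2 ^ j) (Rest C) (o / 2 ^ (e + 2 ^ j)) = ∅ :=
        hclr.cell_eq_zero.1 (not_not.1 hcl)
      have hsingle : ∀ κ ∈ Rest C, κ / 2 ^ 2 ^ j = o / 2 ^ (e + 2 ^ j) → κ = o / 2 ^ e := by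
        intro κ hκ h1
        by_contra hne
        have : κ ∈ Multi (2 ^ 2 ^ j) (Rest C) (o / 2 ^ (e + 2 ^ j)) :=
          ⟨hκ, h1, _, hoR, hq o, fun h => hne h.symm⟩
        rw [hm] at this; exact this
      obtain ⟨g1, g2⟩ := ih (V' := HeadValid e (2 ^ 2 ^ j) (Rest C) V') hr'.1
        ⟨_, hoR, hq o⟩ (fun z hz hne hv κ hκ hh ha => by
          obtain ⟨hv, he⟩ := hv κ hκ hh ha
          refine ⟨hV z (he ▸ hκ.1) (fun h => hne ?_) hv, he⟩
          rw [← hq, ← hq, h])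
        (fun κ hκ hh ha => ⟨hVo, (hsingle κ hκ (by rw [hh, hq])).symm⟩)
      refine ⟨vebRep_succ.2 ⟨hn'.congr (fun s _ => g2 _ fun hk =>
        not_inRest_cell (.inl hk)) fun _ _ => id, g1, fun π hπ => ?_⟩,
        fun k hk => (g2 k fun h' => hk h'.summary).trans (hfr k hk)⟩
      refine (hr'.2 π hπ).congr (fun k hk => g2 k fun h' => h'.not_cluster hk)
        fun z hz => hV z hz.1.1 fun heq => ?_
      have h1 : π = o / 2 ^ (e + 2 ^ j) := by rw [← hz.2.1, heq, hq]
      rw [h1, hm] at hz; exact hz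

/-- `p` is a digit plus one of the greatest class below that of `x`, if there is one. -/
def EraseOk (e : ℕ) (C : Set ℕ) (V : ℕ → Prop) (x p : ℕ) : Prop :=
  ∀ κ ∈ C, κ < x / 2 ^ e → (∀ κ' ∈ C, κ' < x / 2 ^ e → κ' ≤ κ) →
    ∃ d, p = d + 1 ∧ d / 2 ^ e = κ ∧ V d

/-- The specification of a deletion at level `j`. -/
def EraseSpec (j : ℕ) (f : (e x p : ℕ) → NodeCells → NodeCells) : Prop :=
  ∀ {e ρ x p : ℕ} {C : Set ℕ} {V : ℕ → Prop} {c : NodeCells}, VebRep j e ρ C V c →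
    x / 2 ^ e ∈ C → EraseOk e C V x p →
    VebRep j e ρ (C \ {x / 2 ^ e}) V (f e x p c) ∧
      ∀ k, ¬ InSub j e ρ k → f e x p c k = c k

/-- When a cluster is dissolved, there is no recursive deletion, only a relabeling in the summary. When
a group vanishes, it had no cluster, and only the summary changes. -/
theorem eraseRest_spec
    {f : (e x p : ℕ) → NodeCells → NodeCells} (ih : EraseSpec j f) (h : RestRep j e ρ R V c)
    (hx : x / 2 ^ (e + 2 ^ (j + 1)) = ρ) (hxR : x / 2 ^ e ∈ R) (hp : EraseOk e R V x p) :
    RestRep j e ρ (R \ {x / 2 ^ e}) V (eraseRest f j e x p c) ∧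
      ∀ k, ¬ InRest j e ρ k → eraseRest f j e x p c k = c k := by
  have hq : ∀ z, z / 2 ^ e / 2 ^ 2 ^ j = z / 2 ^ (e + 2 ^ j) := fun z => div_window _ _ _
  have hpre : x / 2 ^ (e + 2 ^ j) / 2 ^ 2 ^ j = ρ := by rw [div_window_succ, hx]
  have hcl := h.2 _ hpre
  have hkey : ∀ s, key s e j x = (s, e, 2 ^ j, x / 2 ^ (e + 2 ^ j)) := fun s => rfl
  rcases Set.eq_empty_or_nonempty (Multi (2 ^ 2 ^ j) R (x / 2 ^ (e + 2 ^ j))) with hm | hm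
  · have h0 : c (key 0 e j x) = 0 := hcl.cell_eq_zero.2 hm
    have hsingle : ∀ κ ∈ R, κ / 2 ^ 2 ^ j = x / 2 ^ e / 2 ^ 2 ^ j → κ = x / 2 ^ e := by
      intro κ hκ h1
      rw [hq] at h1
      by_contra hne
      have : κ ∈ Multi (2 ^ 2 ^ j) R (x / 2 ^ (e + 2 ^ j)) :=
        ⟨hκ, h1, _, hxR, hq x, fun h => hne h.symm⟩
      rw [hm] at this; exact this
    simp only [eraseRest, h0, ne_eq, not_true_eq_false, if_false]
    obtain ⟨g1, g2⟩ := ih (x := x) (p := p) h.1 ⟨_, hxR, hq x⟩ (by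
      rintro _ ⟨κ, hκ, rfl⟩ hlt hmax
      simp only at hlt hmax ⊢
      have hκx : κ < x / 2 ^ e := by
        by_contra hn
        have := Nat.div_le_div_right (c := 2 ^ 2 ^ j) (not_lt.1 hn)
        rw [hq] at this; omega
      obtain ⟨m, hmR, hmx, hκm, hmmax⟩ := exists_max_lt hκ hκx
      obtain ⟨d, hd, hdm, hdV⟩ := hp m hmR hmx hmmax
      refine ⟨d, hd, ?_, fun κ' hκ' hh ha => ⟨hdV, ha _ (hdm ▸ hmR) hh.symm⟩⟩
      rw [← hq, hdm]
      refine le_antisymm (hmax _ ⟨m, hmR, rfl⟩ ?_) (Nat.div_le_div_right hκm)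
      rw [← hq]
      refine lt_of_le_of_ne (Nat.div_le_div_right hmx.le) fun h => ?_
      have := hsingle m hmR h
      omega)
    refine ⟨⟨?_, fun π hπ => ?_⟩, fun k hk => g2 k fun h' => hk (.inl h')⟩
    · rw [heads_diff_of_single hsingle, hq]
      refine g1.congr (fun _ _ => rfl) fun z hz hv κ hκ hh ha => hv κ hκ.1 hh fun κ' hκ' hh' => ?_
      by_cases hne : κ' = x / 2 ^ e
      · rw [hh, hne, hq, hq] at hh'; exact absurd hh'.symm hz.2
      · exact ha κ' ⟨hκ', hne⟩ hh'
    · have : Multi (2 ^ 2 ^ j) (R \ {x / 2 ^ e}) π = Multi (2 ^ 2 ^ j) R π := by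
        by_cases hπx : x / 2 ^ (e + 2 ^ j) = π
        · subst hπx
          have := multi_diff_of_pair (q := 2 ^ 2 ^ j) (a := x / 2 ^ e) fun κ hκ h1 =>
            .inl (hsingle κ hκ h1)
          rw [hq] at this
          rw [this, hm]
        · exact multi_diff_of_ne (by rwa [hq])
      rw [this]
      exact (h.2 π hπ).frame fun k hk => g2 k fun h' => h'.not_cluster hk
  · obtain ⟨a, b, ha, hb, hVa, hVb, hl, hg⟩ := hcl.cell_ne_zero hm
    have hxm : x / 2 ^ e ∈ Multi (2 ^ 2 ^ j) R (x / 2 ^ (e + 2 ^ j)) := by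
      obtain ⟨κ, h1, h2, κ', h3, h4, h5⟩ := hm
      by_cases hne : κ = x / 2 ^ e
      · exact ⟨hxR, hq x, κ', h3, h4, hne ▸ h5⟩
      · exact ⟨hxR, hq x, κ, h1, h2, hne⟩
    have hmm : ∀ κ ∈ R, κ / 2 ^ 2 ^ j = x / 2 ^ (e + 2 ^ j) →
        κ ∈ Multi (2 ^ 2 ^ j) R (x / 2 ^ (e + 2 ^ j)) := by
      intro κ hκ h1
      by_cases hne : κ = x / 2 ^ e
      · exact hne ▸ hxm
      · exact ⟨hκ, h1, _, hxR, hq x, fun h => hne h.symm⟩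
    have hab : a / 2 ^ e < b / 2 ^ e := by
      obtain ⟨κ, h1, h2, κ', h3, h4, h5⟩ := hm
      have g1 := hl.2 (hmm κ h1 h2)
      have g2 := hg.2 (hmm κ h1 h2)
      have g3 := hl.2 (hmm κ' h3 h4)
      have g4 := hg.2 (hmm κ' h3 h4); omega
    have h1 : c (key 0 e j x) = a + 1 := ha
    have h2 : c (key 1 e j x) = b + 1 := hb
    -- another element of the group represents it
    have hother : ∃ κ ∈ R, κ ≠ x / 2 ^ e ∧ κ / 2 ^ 2 ^ j = x / 2 ^ e / 2 ^ 2 ^ j := by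
      by_cases hne : a / 2 ^ e = x / 2 ^ e
      · exact ⟨_, hg.1.1, by omega, by rw [hg.1.2.1, hq]⟩
      · exact ⟨_, hl.1.1, hne, by rw [hl.1.2.1, hq]⟩
    obtain ⟨κo, hκo, hκox, hκoq⟩ := hother
    have hheads := heads_diff_of_mem hκo hκox hκoq
    have hother' : ∀ π, π ≠ x / 2 ^ (e + 2 ^ j) →
        Multi (2 ^ 2 ^ j) (R \ {x / 2 ^ e}) π = Multi (2 ^ 2 ^ j) R π := fun π hπ =>
      multi_diff_of_ne (by rw [hq]; exact hπ.symm)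
    simp only [eraseRest, h1, h2, Nat.add_one_ne_zero, ne_eq, not_false_eq_true, if_true,
      Nat.add_sub_cancel]
    rcases isPair_spec (x := x) hcl rfl hl hg hab with ⟨hpair, hset⟩ | ⟨hpair, κ', hκ', hne1, hne2⟩
    · rw [if_pos hpair]
      -- the class that remains
      obtain ⟨o, ho, hVo, hox, hon⟩ : ∃ o, (if x / 2 ^ e = a / 2 ^ e then b + 1 else a + 1) - 1 = o ∧
          V o ∧ o / 2 ^ e ∈ Multi (2 ^ 2 ^ j) R (x / 2 ^ (e + 2 ^ j)) ∧
          ∀ κ ∈ Multi (2 ^ 2 ^ j) R (x / 2 ^ (e + 2 ^ j)), κ = x / 2 ^ e ∨ κ = o / 2 ^ e := by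
        have hcases : ∀ κ ∈ Multi (2 ^ 2 ^ j) R (x / 2 ^ (e + 2 ^ j)),
            κ = a / 2 ^ e ∨ κ = b / 2 ^ e := by
          rw [hset]; exact fun κ hκ => hκ
        split_ifs with hxa
        · exact ⟨b, rfl, hVb, hg.1, fun κ hκ => hxa ▸ hcases κ hκ⟩
        · have hxb : x / 2 ^ e = b / 2 ^ e := (hcases _ hxm).resolve_left hxa
          exact ⟨a, rfl, hVa, hl.1, fun κ hκ => hxb ▸ (hcases κ hκ).symm⟩
      rw [ho]
      have hoq : o / 2 ^ (e + 2 ^ j) = x / 2 ^ (e + 2 ^ j) := by rw [← hq, hox.2.1]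
      have hclr : ∀ k, ¬ InSub j e (x / 2 ^ (e + 2 ^ j)) k → clear j e x c k = c k := fun k =>
        clear_frame
      have hz : ∀ k, InSub j e (x / 2 ^ (e + 2 ^ j)) k → clear j e x c k = 0 := fun k hk =>
        clear_zero (hset ▸ hcl) hab rfl hk
      obtain ⟨g1, g2⟩ := relabel_spec (o := o)
        (V' := HeadValid e (2 ^ 2 ^ j) (R \ {x / 2 ^ e}) V)
        (h.1.frame (c' := clear j e x c) fun k hk => hclr k hk.not_cluster)
        ⟨_, hox.1, hq o⟩
        (fun z _ hne hv κ hκ hh hal => hv κ hκ.1 hh fun κ' hκ' hh' => by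
          refine hal κ' ⟨hκ', ?_⟩ hh'
          rintro rfl
          rw [hq, hh, hq] at hh'; exact hne (by rw [hoq, hh']))
        (fun κ hκ hh _ => by
          refine ⟨hVo, ?_⟩
          rcases hon κ (hmm κ hκ.1 (by rw [hh, hq, hoq])) with h | h
          · exact absurd h hκ.2
          · exact h.symm)
      refine ⟨⟨?_, fun π hπ => ?_⟩, fun k hk => (g2 k fun h' => hk (.inl h')).trans
        (hclr k fun h' => hk (.inr ⟨_, hpre, h'⟩))⟩
      · rw [hheads]; exact g1
      · by_cases hπx : π = x / 2 ^ (e + 2 ^ j)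
        · subst hπx
          have := multi_diff_of_pair (q := 2 ^ 2 ^ j) (x := x / 2 ^ e) (a := o / 2 ^ e) (R := R)
            fun κ hκ h1 => hon κ (hmm κ hκ (by rw [h1, hq]))
          rw [hq] at this
          rw [this]
          exact VebRep.of_zero fun k hk => (g2 k fun h' => h'.not_cluster hk).trans (hz k hk)
        · rw [hother' π hπx]
          exact (h.2 π hπ).frame fun k hk => (g2 k fun h' => h'.not_cluster hk).trans
            (hclr k fun h' => hπx (hk.prefix_unique h'))
    · rw [if_neg hpair]
      obtain ⟨g1, g2⟩ := ih (x := x) (p := p) hcl hxm fun κ hκ hlt hmax => hp κ hκ.1 hlt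
        fun κ' hκ' hlt' => by
          by_contra hn
          have a1 := Nat.div_le_div_right (c := 2 ^ 2 ^ j) (not_le.1 hn).le
          have a2 := Nat.div_le_div_right (c := 2 ^ 2 ^ j) hlt'.le
          rw [hq] at a2
          rw [hκ.2.1] at a1
          exact hn (hmax κ' (hmm κ' hκ' (by omega)) hlt')
      -- two other elements of the group
      obtain ⟨u, v, hu, hv, hux, hvx, huv⟩ : ∃ u v,
          u ∈ Multi (2 ^ 2 ^ j) R (x / 2 ^ (e + 2 ^ j)) ∧
          v ∈ Multi (2 ^ 2 ^ j) R (x / 2 ^ (e + 2 ^ j)) ∧ u ≠ x / 2 ^ e ∧ v ≠ x / 2 ^ e ∧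
          u ≠ v := by
        by_cases hxa : a / 2 ^ e = x / 2 ^ e
        · exact ⟨_, _, hκ', hg.1, by omega, by omega, hne2⟩
        · by_cases hxb : b / 2 ^ e = x / 2 ^ e
          · exact ⟨_, _, hκ', hl.1, by omega, by omega, hne1⟩
          · exact ⟨_, _, hl.1, hg.1, hxa, hxb, by omega⟩
      refine ⟨⟨?_, fun π hπ => ?_⟩, fun k hk => g2 k fun h' => hk (.inr ⟨_, hpre, h'⟩)⟩
      · rw [hheads]
        refine h.1.congr (fun k hk => g2 k hk.not_cluster) fun z _ hz κ hκ hh hal =>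
          hz κ hκ.1 hh fun κ' hκ' hh' => ?_
        by_cases hne : κ' = x / 2 ^ e
        · exfalso
          rw [hne, hq] at hh'
          have e1 := hal u ⟨hu.1, hux⟩ (by rw [hu.2.1, hh'])
          have e2 := hal v ⟨hv.1, hvx⟩ (by rw [hv.2.1, hh']); exact huv (e1.trans e2.symm)
        · exact hal κ' ⟨hκ', hne⟩ hh'
      · by_cases hπx : π = x / 2 ^ (e + 2 ^ j)
        · subst hπx
          have := multi_diff_of_two (q := 2 ^ 2 ^ j) hu.1 hv.1 hux hvx huv
            (by rw [hu.2.1, hq]) (by rw [hv.2.1, hq])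
          rw [hq] at this
          rw [this]; exact g1
        · rw [hother' π hπx]
          exact (h.2 π hπ).frame fun k hk => g2 k fun h' => hπx (hk.prefix_unique h')

theorem vebRep_erase_single
    (h : VebRep j e ρ C V c) (hx : x / 2 ^ e ∈ C) (hl : IsLeast C a) (hg : IsGreatest C a) :
    VebRep j e ρ (C \ {x / 2 ^ e}) V
      (update (update c (key 0 e j x) 0) (key 1 e j x) 0) ∧ ∀ k, ¬ InSub j e ρ k →
      update (update c (key 0 e j x) 0) (key 1 e j x) 0 k = c k := by
  have hk := fun s => Veb.key_eq (s := s) (h.nodeRep.key_eq hx)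
  have hall : ∀ κ ∈ C, κ = a := fun κ hκ => le_antisymm (hg.2 hκ) (hl.2 hκ)
  have hxa := hall _ hx
  have hC : C = {x / 2 ^ e} := by
    ext κ
    exact ⟨fun hκ => (hall κ hκ).trans hxa.symm, fun hκ => hκ ▸ hx⟩
  constructor
  · rw [hC, Set.sdiff_self]
    refine VebRep.of_zero fun k hk' => ?_
    by_cases hne : k.2 = (e, 2 ^ j, ρ)
    · obtain ⟨k1, k2⟩ := k
      have := hk'.bounds.1
      simp only at hne this
      subst hne
      rw [hk, hk]
      interval_cases k1 <;> simp
    · have hz := (hC ▸ h).zero_of_singleton hk' hne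
      simp only [update_apply, hz, ite_self]
  · intro k hk'
    rw [update_cell_frame (by simp) (h.nodeRep.key_eq hx) hk',
      update_cell_frame (by simp) (h.nodeRep.key_eq hx) hk']

theorem rest_diff (h : IsLeast C a) (hx : a < x) : Rest (C \ {x}) = Rest C \ {x} := by
  have h1 := h.1
  have h2 : ∀ κ ∈ C, a ≤ κ := fun κ hκ => h.2 hκ
  ext κ
  simp only [Rest, Set.mem_sdiff, Set.mem_singleton_iff, Set.mem_ofPred_eq]
  grind

theorem diff_least (h : IsLeast C a) : C \ {a} = Rest C := by
  have h2 : ∀ κ ∈ C, a ≤ κ := fun κ hκ => h.2 hκ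
  ext κ
  rw [mem_rest h]
  simp only [Set.mem_sdiff, Set.mem_singleton_iff]
  grind

/-- If the minimum is deleted, then the minimum of the rest takes its place and is deleted there. -/
theorem erase_spec (j : ℕ) : EraseSpec j (erase j) := by
  induction j with
  | zero =>
    intro e ρ x p C V c h hxC _
    obtain ⟨a, b, ha, hb, hVa, hVb, hl, hg⟩ := h.cell_ne_zero ⟨_, hxC⟩
    have hx := h.nodeRep.key_eq hxC
    have hk : ∀ s, key s e 0 x = (s, e, 2 ^ 0, ρ) := fun s => key_eq hx
    have h0 : c (key 0 e 0 x) = a + 1 := by rw [hk]; exact ha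
    have h1 : c (key 1 e 0 x) = b + 1 := by rw [hk]; exact hb
    have hpre := h.nodeRep.1
    simp only [erase, h0, h1, Nat.add_sub_cancel]
    by_cases hab : a / 2 ^ e = b / 2 ^ e
    · rw [if_pos hab]; exact vebRep_erase_single h hxC hl (hab ▸ hg)
    · rw [if_neg hab]
      have hcases : ∀ κ ∈ C, κ = a / 2 ^ e ∨ κ = b / 2 ^ e := by
        intro κ hκ
        have e1 := hpre κ hκ
        have e2 := hpre _ hl.1
        have e3 := hpre _ hg.1
        have e4 := hl.2 hκ
        have e5 := hg.2 hκ
        simp only [pow_zero, pow_one] at e1 e2 e3; omega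
      have hfr : ∀ {s v}, s < 2 → ∀ k, ¬ InSub 0 e ρ k →
          update c (key s e 0 x) v k = c k := fun hs k hk' => update_cell_frame hs hx hk'
      split_ifs with hxa
      · refine ⟨⟨fun κ hκ => hpre κ hκ.1, .inr ⟨b, b, ?_, ?_, hVb, hVb, ⟨⟨hg.1, ?_⟩, ?_⟩,
          ⟨⟨hg.1, ?_⟩, fun κ hκ => hg.2 hκ.1⟩⟩⟩, hfr (by simp)⟩
        · rw [hk]; simp
        · rw [hk]; simpa using hb
        · simp only [Set.mem_singleton_iff]; omega
        · rintro κ ⟨h1, h2⟩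
          simp only [Set.mem_singleton_iff] at h2
          rcases hcases κ h1 with h | h <;> omega
        · simp only [Set.mem_singleton_iff]; omega
      · have hxb := (hcases _ hxC).resolve_left hxa
        refine ⟨⟨fun κ hκ => hpre κ hκ.1, .inr ⟨a, a, ?_, ?_, hVa, hVa,
          ⟨⟨hl.1, ?_⟩, fun κ hκ => hl.2 hκ.1⟩, ⟨⟨hl.1, ?_⟩, ?_⟩⟩⟩, hfr (by simp)⟩
        · rw [hk]; simpa using ha
        · rw [hk]; simp
        · simp only [Set.mem_singleton_iff]; omega
        · simp only [Set.mem_singleton_iff]; omega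
        · rintro κ ⟨h1, h2⟩
          simp only [Set.mem_singleton_iff] at h2
          rcases hcases κ h1 with h | h <;> omega
  | succ j ih =>
    intro e ρ x p C V c h hxC hp
    obtain ⟨a, b, ha, hb, hVa, hVb, hl, hg⟩ := h.cell_ne_zero ⟨_, hxC⟩
    obtain ⟨hn, hr⟩ := vebRep_succ.1 h
    have hx := hn.key_eq hxC
    have hk : ∀ s, key s e (j + 1) x = (s, e, 2 ^ (j + 1), ρ) := fun s => key_eq hx
    have h0 : c (key 0 e (j + 1) x) = a + 1 := by rw [hk]; exact ha
    have h1 : c (key 1 e (j + 1) x) = b + 1 := by rw [hk]; exact hb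
    have hpre := hn.1
    simp only [erase, h0, h1, Nat.add_sub_cancel]
    by_cases hab : a / 2 ^ e = b / 2 ^ e
    · rw [if_pos hab]; exact vebRep_erase_single h hxC hl (hab ▸ hg)
    · rw [if_neg hab]
      have hab' : a / 2 ^ e < b / 2 ^ e := lt_of_le_of_ne (hl.2 hg.1) hab
      by_cases hxa : x / 2 ^ e = a / 2 ^ e
      · rw [if_pos hxa]
        rcases restMin_spec hr hx fun κ hκ => hpre κ hκ.1 with ⟨hr0, -⟩ | ⟨d, hd, hVd, hdl⟩
        · exact absurd (hr0 ▸ (mem_rest hl).2 ⟨hg.1, hab'⟩) (by simp)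
        · rw [hd, Nat.add_sub_cancel, hxa, diff_least hl]
          obtain ⟨g1, g2⟩ := eraseRest_spec (x := d) (p := p) ih
            (hr.frame (c' := update c (key 0 e (j + 1) x) (d + 1))
              fun k hk => update_cell_rest hk)
            (by rw [← div_window]; exact hpre _ hdl.1.1) hdl.1
            fun κ hκ hlt => absurd (hdl.2 hκ) (not_le.2 hlt)
          refine ⟨vebRep_succ.2 ⟨⟨fun κ hκ => hpre κ hκ.1, .inr ⟨d, b, ?_, ?_, hVd, hVb, hdl,
            (mem_rest hl).2 ⟨hg.1, hab'⟩, fun κ hκ => hg.2 hκ.1⟩⟩, ?_⟩,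
            fun k hk' => (g2 k fun h' => hk' h'.inSub).trans
              (update_cell_frame (by simp) hx hk')⟩
          · rw [g2 _ not_inRest_cell, hk]; simp
          · rw [g2 _ not_inRest_cell, hk]; simpa using hb
          · rw [← diff_least hdl]; exact g1
      · rw [if_neg hxa]
        have hax : a / 2 ^ e < x / 2 ^ e := lt_of_le_of_ne (hl.2 hxC) (Ne.symm hxa)
        set c' : NodeCells := if x / 2 ^ e = b / 2 ^ e then
          update c (key 1 e (j + 1) x) p else c with hc'
        have hc'fr : ∀ k, ¬ InSub (j + 1) e ρ k → c' k = c k := by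
          intro k hk'
          rw [hc']
          split_ifs
          · exact update_cell_frame (by simp) hx hk'
          · rfl
        have hc'r : ∀ k, InRest j e ρ k → c' k = c k := by
          intro k hk'
          rw [hc']
          split_ifs
          · exact update_cell_rest hk'
          · rfl
        have hleast : IsLeast (C \ {x / 2 ^ e}) (a / 2 ^ e) :=
          ⟨⟨hl.1, by simp only [Set.mem_singleton_iff]; omega⟩, fun κ hκ => hl.2 hκ.1⟩
        have hnode : NodeRep (j + 1) e ρ (C \ {x / 2 ^ e}) V c' := by
          refine ⟨fun κ hκ => hpre κ hκ.1, .inr ?_⟩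
          by_cases hxb : x / 2 ^ e = b / 2 ^ e
          · obtain ⟨m, hm, hmx, -, hmm⟩ := exists_max_lt hl.1 hax
            obtain ⟨d, hd, hdm, hdV⟩ := hp m hm hmx hmm
            refine ⟨a, d, ?_, ?_, hVa, hdV, hleast, ⟨⟨hdm ▸ hm, ?_⟩, ?_⟩⟩
            · rw [hc', if_pos hxb, hk]; simpa using ha
            · rw [hc', if_pos hxb, hk]; simpa using hd
            · simp only [Set.mem_singleton_iff]; omega
            · rintro κ ⟨hκ, hκx⟩
              simp only [Set.mem_singleton_iff] at hκx
              rw [hdm]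
              exact hmm κ hκ (lt_of_le_of_ne (hxb ▸ hg.2 hκ) hκx)
          · rw [hc', if_neg hxb]
            exact ⟨a, b, ha, hb, hVa, hVb, hleast,
              ⟨⟨hg.1, by simp only [Set.mem_singleton_iff]; omega⟩, fun κ hκ => hg.2 hκ.1⟩⟩
        obtain ⟨g1, g2⟩ := eraseRest_spec (x := x) (p := p) ih (hr.frame hc'r) hx
          ((mem_rest hl).2 ⟨hxC, hax⟩) fun κ hκ hlt hmax => hp κ hκ.1 hlt fun κ' hκ' hlt' => by
            by_cases hh : a / 2 ^ e < κ'
            · exact hmax κ' ((mem_rest hl).2 ⟨hκ', hh⟩) hlt'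
            · have := ((mem_rest hl).1 hκ).2; omega
        refine ⟨vebRep_succ.2 ⟨hnode.congr (fun s _ => g2 _ not_inRest_cell) fun _ _ => id, ?_⟩,
          fun k hk' => (g2 k fun h' => hk' h'.inSub).trans (hc'fr k hk')⟩
        rw [rest_diff hl hax]; exact g1

/-! ### Neighbors -/

/-- Pass from a digit `z` of the summary to a digit of the set: the end of its cluster that is
closer to `y`, or `z` itself if its group has only one element. -/
def liftNeighbor (j e y z : ℕ) (c : NodeCells) : ℕ :=
  if c (key 0 e j z) = 0 then z
  else if z / 2 ^ (e + 2 ^ j) < y / 2 ^ (e + 2 ^ j) then c (key 1 e j z) - 1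
  else c (key 0 e j z) - 1

/-- The predecessor or the successor of the class of `y`. -/
def neighbor : (j e y : ℕ) → NodeCells → ℕ
  | 0, e, y, c =>
      if y / 2 ^ e ≤ (c (key 0 e 0 y) - 1) / 2 ^ e then c (key 0 e 0 y) - 1
      else c (key 1 e 0 y) - 1
  | j + 1, e, y, c =>
      if y / 2 ^ e ≤ (c (key 0 e (j + 1) y) - 1) / 2 ^ e then c (key 0 e (j + 1) y) - 1
      else if (c (key 1 e (j + 1) y) - 1) / 2 ^ e ≤ y / 2 ^ e then c (key 1 e (j + 1) y) - 1
      else if c (key 0 e j y) ≠ 0 then neighbor j e y c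
      else liftNeighbor j e y (neighbor j (e + 2 ^ j) y c) c

/-- The class `d` belongs to `C` and there is no element of `C` closer to `y` on its side. -/
def IsNeighbor (C : Set ℕ) (y d : ℕ) : Prop :=
  d ∈ C ∧ ((d ≤ y ∧ ∀ κ ∈ C, κ ≤ y → κ ≤ d) ∨ (y ≤ d ∧ ∀ κ ∈ C, y ≤ κ → d ≤ κ))

theorem IsNeighbor.of_group (hy : y / q = π)
    (h : IsNeighbor {κ | κ ∈ R ∧ κ / q = π} y d) : IsNeighbor R y d := by
  obtain ⟨⟨h1, h2⟩, h3⟩ := h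
  refine ⟨h1, h3.imp ?_ ?_⟩
  · rintro ⟨h4, h5⟩
    refine ⟨h4, fun κ hκ hle => ?_⟩
    by_contra hn
    have a1 := Nat.div_le_div_right (c := q) (not_le.1 hn).le
    have a2 := Nat.div_le_div_right (c := q) hle; exact hn (h5 κ ⟨hκ, by omega⟩ hle)
  · rintro ⟨h4, h5⟩
    refine ⟨h4, fun κ hκ hle => ?_⟩
    by_contra hn
    have a1 := Nat.div_le_div_right (c := q) (not_le.1 hn).le
    have a2 := Nat.div_le_div_right (c := q) hle; exact hn (h5 κ ⟨hκ, by omega⟩ hle)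

theorem multi_eq_group (h : (Multi q R π).Nonempty) : Multi q R π = {κ | κ ∈ R ∧ κ / q = π} := by
  obtain ⟨κ, h1, h2, κ', h3, h4, h5⟩ := h
  ext κ''
  simp only [Multi, Set.mem_ofPred_eq]
  grind

theorem IsNeighbor.of_rest (hl : IsLeast C a) (hy : a < y)
    (h : IsNeighbor (Rest C) y d) : IsNeighbor C y d := by
  obtain ⟨h1, h2⟩ := h
  rw [mem_rest hl] at h1
  have hmem : ∀ κ, κ ∈ Rest C ↔ κ ∈ C ∧ a < κ := fun κ => mem_rest hl
  refine ⟨h1.1, h2.imp ?_ ?_⟩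
  · rintro ⟨h4, h5⟩
    refine ⟨h4, fun κ hκ hle => ?_⟩
    by_cases hh : a < κ
    · exact h5 κ ((hmem κ).2 ⟨hκ, hh⟩) hle
    · omega
  · rintro ⟨h4, h5⟩
    exact ⟨h4, fun κ hκ hle => h5 κ ((hmem κ).2 ⟨hκ, by omega⟩) hle⟩

/-- If the class of `y` lies strictly between the minimum and the maximum, then the search continues in
its cluster, if there is one, and otherwise in the summary. -/
theorem neighbor_spec (h : VebRep j e ρ C V c) (hC : C.Nonempty) (hy : y / 2 ^ (e + 2 ^ j) = ρ) :
    V (neighbor j e y c) ∧ IsNeighbor C (y / 2 ^ e) (neighbor j e y c / 2 ^ e) := by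
  have hleast : ∀ {C : Set ℕ} {y a : ℕ}, IsLeast C a → y ≤ a → IsNeighbor C y a := fun hl hle =>
    ⟨hl.1, .inr ⟨hle, fun κ hκ _ => hl.2 hκ⟩⟩
  have hgreatest : ∀ {C : Set ℕ} {y a : ℕ}, IsGreatest C a → a ≤ y → IsNeighbor C y a :=
    fun hl hle => ⟨hl.1, .inl ⟨hle, fun κ hκ _ => hl.2 hκ⟩⟩
  induction j generalizing e ρ C V with
  | zero =>
    obtain ⟨a, b, ha, hb, hVa, hVb, hl, hg⟩ := h.cell_ne_zero hC
    have hk : ∀ s, key s e 0 y = (s, e, 2 ^ 0, ρ) := fun s => key_eq hy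
    simp only [neighbor, hk, ha, hb, Nat.add_sub_cancel]
    split_ifs with h1
    · exact ⟨hVa, hleast hl h1⟩
    · refine ⟨hVb, hgreatest hg ?_⟩
      have e1 := h.nodeRep.1 _ hl.1
      have e2 := h.nodeRep.1 _ hg.1
      have e3 := div_window y e (2 ^ 0)
      rw [hy] at e3
      simp only [pow_zero, pow_one] at e1 e2 e3; omega
  | succ j ih =>
    obtain ⟨a, b, ha, hb, hVa, hVb, hl, hg⟩ := h.cell_ne_zero hC
    obtain ⟨hn, hr⟩ := vebRep_succ.1 h
    have hk : ∀ s, key s e (j + 1) y = (s, e, 2 ^ (j + 1), ρ) := fun s => key_eq hy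
    have hq : ∀ z, z / 2 ^ e / 2 ^ 2 ^ j = z / 2 ^ (e + 2 ^ j) := fun z => div_window _ _ _
    simp only [neighbor, hk, ha, hb, Nat.add_sub_cancel]
    split_ifs with h1 h2 h3
    · exact ⟨hVa, hleast hl h1⟩
    · exact ⟨hVb, hgreatest hg h2⟩
    all_goals
      have hay : a / 2 ^ e < y / 2 ^ e := not_le.1 h1
      have hbR : b / 2 ^ e ∈ Rest C := (mem_rest hl).2 ⟨hg.1, by omega⟩
      have hpre : y / 2 ^ (e + 2 ^ j) / 2 ^ 2 ^ j = ρ := by rw [div_window_succ, hy]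
      have hcl := hr.2 _ hpre
    · have hm : (Multi (2 ^ 2 ^ j) (Rest C) (y / 2 ^ (e + 2 ^ j))).Nonempty := by
        by_contra hemp
        exact h3 (hcl.cell_eq_zero.2 (Set.not_nonempty_iff_eq_empty.1 hemp))
      obtain ⟨g1, g2⟩ := ih hcl hm rfl
      rw [multi_eq_group hm] at g2
      exact ⟨g1, IsNeighbor.of_rest hl hay (g2.of_group (hq y))⟩
    · have hm : Multi (2 ^ 2 ^ j) (Rest C) (y / 2 ^ (e + 2 ^ j)) = ∅ :=
        hcl.cell_eq_zero.1 (not_not.1 h3)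
      obtain ⟨g1, ⟨κ, hκ, hκz⟩, g3⟩ := ih hr.1 ⟨_, _, hbR, rfl⟩
        (by rw [← hy, ← div_window, div_window_succ])
      simp only at hκz
      set z := neighbor j (e + 2 ^ j) y c
      have hzpre : z / 2 ^ (e + 2 ^ j) / 2 ^ 2 ^ j = ρ := by
        rw [← hκz, div_sq, hn.1 κ hκ.1]
      have hclz := hr.2 _ hzpre
      rw [liftNeighbor]
      -- heads on the two sides of `y`
      have hside : ∀ κ' ∈ Rest C, κ' / 2 ^ 2 ^ j ∈ Heads (2 ^ 2 ^ j) (Rest C) := fun κ' hκ' =>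
        ⟨κ', hκ', rfl⟩
      have hdl : ∀ {u v : ℕ}, u ≤ v → u / 2 ^ 2 ^ j ≤ v / 2 ^ 2 ^ j := fun h =>
        Nat.div_le_div_right h
      have hlift : ∀ d, d / 2 ^ e ∈ Rest C → d / 2 ^ (e + 2 ^ j) = z / 2 ^ (e + 2 ^ j) →
          (z / 2 ^ (e + 2 ^ j) < y / 2 ^ (e + 2 ^ j) → ∀ κ' ∈ Rest C,
            κ' / 2 ^ 2 ^ j = z / 2 ^ (e + 2 ^ j) → κ' ≤ d / 2 ^ e) →
          (y / 2 ^ (e + 2 ^ j) < z / 2 ^ (e + 2 ^ j) → ∀ κ' ∈ Rest C,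
            κ' / 2 ^ 2 ^ j = z / 2 ^ (e + 2 ^ j) → d / 2 ^ e ≤ κ') →
          z / 2 ^ (e + 2 ^ j) ≠ y / 2 ^ (e + 2 ^ j) →
          IsNeighbor C (y / 2 ^ e) (d / 2 ^ e) := by
        intro d hd hdz hmax hmin hne
        refine IsNeighbor.of_rest hl hay ⟨hd, ?_⟩
        have hdq : d / 2 ^ e / 2 ^ 2 ^ j = z / 2 ^ (e + 2 ^ j) := by rw [hq, hdz]
        rcases lt_or_gt_of_ne hne with hlt | hlt
        · left
          refine ⟨?_, fun κ' hκ' hle => ?_⟩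
          · by_contra hcon
            have := hdl (not_le.1 hcon).le
            rw [hdq, hq] at this; omega
          · by_contra hcon
            have e1 := hdl hle
            have e2 := hdl (not_le.1 hcon).le
            rw [hdq] at e2
            rw [hq] at e1
            have e3 : κ' / 2 ^ 2 ^ j ≤ z / 2 ^ (e + 2 ^ j) := by
              rcases g3 with ⟨-, h⟩ | ⟨h, -⟩
              · exact h _ (hside κ' hκ') e1
              · omega
            exact hcon (hmax hlt κ' hκ' (by omega))
        · right
          refine ⟨?_, fun κ' hκ' hle => ?_⟩
          · by_contra hcon
            have := hdl (not_le.1 hcon).le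
            rw [hdq, hq] at this; omega
          · by_contra hcon
            have e1 := hdl hle
            have e2 := hdl (not_le.1 hcon).le
            rw [hdq] at e2
            rw [hq] at e1
            have e3 : z / 2 ^ (e + 2 ^ j) ≤ κ' / 2 ^ 2 ^ j := by
              rcases g3 with ⟨h, -⟩ | ⟨-, h⟩
              · omega
              · exact h _ (hside κ' hκ') e1
            exact hcon (hmin hlt κ' hκ' (by omega))
      rcases Set.eq_empty_or_nonempty (Multi (2 ^ 2 ^ j) (Rest C) (z / 2 ^ (e + 2 ^ j))) with
        hmz | hmz
      · have h0 : c (key 0 e j z) = 0 := hclz.cell_eq_zero.2 hmz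
        rw [if_pos h0]
        have hsingle : ∀ κ' ∈ Rest C, κ' / 2 ^ 2 ^ j = z / 2 ^ (e + 2 ^ j) → κ' = κ := by
          intro κ' hκ' h1
          by_contra hne
          have : κ ∈ Multi (2 ^ 2 ^ j) (Rest C) (z / 2 ^ (e + 2 ^ j)) := ⟨hκ, hκz, κ', hκ', h1, hne⟩
          rw [hmz] at this; exact this
        obtain ⟨hVz, hzκ⟩ := g1 κ hκ (by rw [hκz, hq]) fun κ' hκ' hh =>
          hsingle κ' hκ' (hh.trans hκz)
        refine ⟨hVz, ?_⟩
        by_cases hne : z / 2 ^ (e + 2 ^ j) = y / 2 ^ (e + 2 ^ j)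
        · -- the group of `y` has only the element `z`
          refine IsNeighbor.of_rest hl hay (IsNeighbor.of_group (hq y) ?_)
          have hmem : ∀ κ', κ' ∈ Rest C ∧ κ' / 2 ^ 2 ^ j = y / 2 ^ (e + 2 ^ j) → κ' = z / 2 ^ e :=
            fun κ' hκ' => (hsingle κ' hκ'.1 (hκ'.2.trans hne.symm)).trans hzκ.symm
          refine ⟨⟨hzκ ▸ hκ, by rw [hq, hne]⟩, ?_⟩
          rcases le_total (z / 2 ^ e) (y / 2 ^ e) with hle | hle
          · exact .inl ⟨hle, fun κ' hκ' _ => (hmem κ' hκ').le⟩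
          · exact .inr ⟨hle, fun κ' hκ' _ => (hmem κ' hκ').ge⟩
        · refine hlift z (hzκ ▸ hκ) rfl (fun _ κ' hκ' hh => ?_) (fun _ κ' hκ' hh => ?_) hne
          · rw [hsingle κ' hκ' hh, hzκ]
          · rw [hsingle κ' hκ' hh, hzκ]
      · obtain ⟨a', b', ha', hb', hVa', hVb', hl', hg'⟩ := hclz.cell_ne_zero hmz
        have e0 : c (key 0 e j z) = a' + 1 := ha'
        have e1 : c (key 1 e j z) = b' + 1 := hb'
        have hne : z / 2 ^ (e + 2 ^ j) ≠ y / 2 ^ (e + 2 ^ j) := by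
          intro heq
          rw [heq, hm] at hmz; exact Set.not_nonempty_empty hmz
        have hmem : ∀ κ' ∈ Rest C, κ' / 2 ^ 2 ^ j = z / 2 ^ (e + 2 ^ j) →
            κ' ∈ Multi (2 ^ 2 ^ j) (Rest C) (z / 2 ^ (e + 2 ^ j)) := by
          rw [multi_eq_group hmz]; exact fun κ' h1 h2 => ⟨h1, h2⟩
        simp only [e0, e1, Nat.add_one_ne_zero, if_false, Nat.add_sub_cancel]
        split_ifs with hlt
        · exact ⟨hVb', hlift b' hg'.1.1 (by rw [← hq]; exact hg'.1.2.1)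
            (fun _ κ' hκ' hh => hg'.2 (hmem κ' hκ' hh)) (fun h => by omega) hne⟩
        · exact ⟨hVa', hlift a' hl'.1.1 (by rw [← hq]; exact hl'.1.2.1)
            (fun h => by omega) (fun _ κ' hκ' hh => hl'.2 (hmem κ' hκ' hh)) hne⟩

/-! ### Space -/

/-- A structure with `m ≥ 2` elements has at most `4 (m - 1)` nonzero cells: the minimum is not
passed on, and a cluster exists only for groups with at least two elements. -/
theorem exists_cover {C : Finset ℕ} (h : VebRep j e ρ C V c) : ∃ F : Finset (ℕ × ℕ × ℕ × ℕ),
      (∀ k, InSub j e ρ k → c k ≠ 0 → k ∈ F) ∧ (C.card ≤ 1 → F.card ≤ 2 * C.card) ∧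
        (2 ≤ C.card → F.card + 4 ≤ 4 * C.card) := by
  classical
  induction j generalizing e ρ C V with
  | zero =>
    rcases Finset.eq_empty_or_nonempty C with rfl | hne
    · refine ⟨∅, fun k hk hc => absurd (VebRep.zero_of_empty (j := 0) (by simpa using h) hk) hc,
        by simp, by simp⟩
    · refine ⟨{(0, e, 2 ^ 0, ρ), (1, e, 2 ^ 0, ρ)}, ?_, ?_, ?_⟩
      · rintro ⟨k1, k2⟩ ⟨h1, h2⟩ -
        simp only at h1 h2
        subst h2
        interval_cases k1 <;> simp
      · have := hne.card_pos
        intro _; exact Finset.card_le_two.trans (by omega)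
      · have := Finset.card_le_two (a := (0, e, 2 ^ 0, ρ)) (b := (1, e, 2 ^ 0, ρ)); omega
  | succ j ih =>
    rcases Finset.eq_empty_or_nonempty C with rfl | hne
    · refine ⟨∅, fun k hk hc => absurd (VebRep.zero_of_empty (j := j + 1) (by simpa using h) hk) hc,
        by simp, by simp⟩
    obtain ⟨hn, hr⟩ := vebRep_succ.1 h
    set a := C.min' hne with ha
    have hl : IsLeast (C : Set ℕ) a := C.isLeast_min' hne
    have hR : Rest C = (C.erase a : Finset ℕ) := by
      rw [← diff_least hl, Finset.coe_erase]
    set R := C.erase a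
    have hRc : R.card + 1 = C.card := Finset.card_erase_add_one hl.1
    set H := R.image (· / 2 ^ 2 ^ j) with hH
    have hHR : Heads (2 ^ 2 ^ j) (Rest C) = H := by
      rw [hR, hH, Finset.coe_image]; rfl
    have hcount : R.card = ∑ π ∈ H, (R.filter (· / 2 ^ 2 ^ j = π)).card :=
      Finset.card_eq_sum_card_image _ _
    have hHRle : H.card ≤ R.card := Finset.card_image_le
    obtain ⟨F1, hF1, hF1a, hF1b⟩ := ih (hHR ▸ hr.1)
    have hcl : ∀ π ∈ H, ∃ F : Finset (ℕ × ℕ × ℕ × ℕ), (∀ k, InSub j e π k → c k ≠ 0 → k ∈ F) ∧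
        F.card + 4 ≤ 4 * (R.filter (· / 2 ^ 2 ^ j = π)).card := by
      intro π hπ
      obtain ⟨κ, hκ, rfl⟩ := Finset.mem_image.1 hπ
      have hκC : κ ∈ C := Finset.mem_of_mem_erase hκ
      have hrep := hr.2 (κ / 2 ^ 2 ^ j) (by rw [div_sq]; exact hn.1 κ hκC)
      have hpos : 0 < (R.filter (· / 2 ^ 2 ^ j = κ / 2 ^ 2 ^ j)).card :=
        Finset.card_pos.2 ⟨κ, by simp [hκ]⟩
      rcases Set.eq_empty_or_nonempty (Multi (2 ^ 2 ^ j) (Rest C) (κ / 2 ^ 2 ^ j)) with hm | hm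
      · rw [hm] at hrep
        exact ⟨∅, fun k hk hc => absurd (hrep.zero_of_empty hk) hc, by rw [Finset.card_empty]; omega⟩
      · have heq : Multi (2 ^ 2 ^ j) (Rest C) (κ / 2 ^ 2 ^ j) =
            (R.filter (· / 2 ^ 2 ^ j = κ / 2 ^ 2 ^ j) : Finset ℕ) := by
          rw [multi_eq_group hm, hR]
          ext; simp
        obtain ⟨F, hF, -, hFb⟩ := ih (heq ▸ hrep)
        refine ⟨F, hF, hFb ?_⟩
        obtain ⟨u, h1, h2, v, h3, h4, h5⟩ := hm
        rw [hR] at h1 h3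
        exact Finset.one_lt_card.2 ⟨u, by simpa using ⟨h1, h2⟩, v, by simpa using ⟨h3, h4⟩, h5.symm⟩
    choose! G hG hGc using hcl
    have hsum : (H.biUnion G).card + 4 * H.card ≤ 4 * R.card := by
      have h1 : (H.biUnion G).card ≤ ∑ π ∈ H, (G π).card := Finset.card_biUnion_le
      have h2 : ∑ π ∈ H, ((G π).card + 4) ≤ ∑ π ∈ H, 4 * (R.filter (· / 2 ^ 2 ^ j = π)).card :=
        Finset.sum_le_sum hGc
      rw [Finset.sum_add_distrib, ← Finset.mul_sum, ← hcount, Finset.sum_const, smul_eq_mul] at h2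
      omega
    have hcard := Finset.card_union_le (({(0, e, 2 ^ (j + 1), ρ), (1, e, 2 ^ (j + 1), ρ)} :
      Finset (ℕ × ℕ × ℕ × ℕ)) ∪ F1) (H.biUnion G)
    have hcard2 := Finset.card_union_le ({(0, e, 2 ^ (j + 1), ρ), (1, e, 2 ^ (j + 1), ρ)} :
      Finset (ℕ × ℕ × ℕ × ℕ)) F1
    have hcard3 := Finset.card_le_two (a := (0, e, 2 ^ (j + 1), ρ)) (b := (1, e, 2 ^ (j + 1), ρ))
    refine ⟨({(0, e, 2 ^ (j + 1), ρ), (1, e, 2 ^ (j + 1), ρ)} ∪ F1) ∪ H.biUnion G, ?_, ?_, ?_⟩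
    · rintro ⟨k1, k2⟩ (⟨h1, h2⟩ | hk | ⟨π, hπ, hk⟩) hc
      · simp only at h1 h2
        subst h2
        interval_cases k1 <;> simp
      · exact Finset.mem_union_left _ (Finset.mem_union_right _ (hF1 _ hk hc))
      · refine Finset.mem_union_right _ (Finset.mem_biUnion.2 ?_)
        have hne : (Multi (2 ^ 2 ^ j) (Rest C) π).Nonempty := by
          by_contra hemp
          have := hr.2 π hπ
          rw [Set.not_nonempty_iff_eq_empty.1 hemp] at this; exact hc (this.zero_of_empty hk)
        obtain ⟨κ, hκ⟩ := hne
        have hπH : π ∈ H := by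
          have := mem_heads_multi hκ
          rw [hHR] at this; exact this
        exact ⟨π, hπH, hG π hπH _ hk hc⟩
    · intro h1
      have := hne.card_pos
      have hR0 : R.card = 0 := by omega
      have hH0 : H.card = 0 := by omega
      have := hF1a (by omega); omega
    · intro h2
      have hRne : R.Nonempty := Finset.card_pos.1 (by omega)
      have hHpos : 0 < H.card := (hRne.image _).card_pos
      rcases Nat.lt_or_ge H.card 2 with hlt | hge
      · have := hF1a (by omega); omega
      · have := hF1b hge; omega

end Veb

/-! ### A structured programming language -/

namespace Ram

/-- Binary operations on numbers. -/
inductive BinOp where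
  | add | sub | mul | div | mod | shr

/-- The value of an operation; subtraction is truncated. -/
def BinOp.eval : BinOp → ℕ → ℕ → ℕ
  | .add, a, b => a + b
  | .sub, a, b => a - b
  | .mul, a, b => a * b
  | .div, a, b => a / b
  | .mod, a, b => a % b
  | .shr, a, b => a / 2 ^ b

/-- Word arithmetic with words below `W` gives the value of the operation. -/
def BinOp.Fits (W : ℕ) : BinOp → ℕ → ℕ → Prop
  | .add, a, b => a + b < W
  | .mul, a, b => a * b < W
  | _, _, _ => True

/-- Expressions of the programming language. The memory consists of arrays, which are named by
numbers, and of the cells of the nodes of the tries. -/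
inductive Exp where
  | reg (i : ℕ)
  | const (k : ℕ)
  | bin (f : BinOp) (a b : Exp)
  | arr (k : ℕ) (i : Exp)
  | cell (s v e l q : Exp)

instance : Add Exp := ⟨.bin .add⟩
instance : Sub Exp := ⟨.bin .sub⟩
instance : Mul Exp := ⟨.bin .mul⟩
instance : Div Exp := ⟨.bin .div⟩
instance : Mod Exp := ⟨.bin .mod⟩
instance : HShiftRight Exp Exp Exp := ⟨.bin .shr⟩
instance (k : ℕ) : OfNat Exp k := ⟨.const k⟩

/-- A state: the registers, the arrays, the cells of the nodes and a clock. -/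
structure State where
  r : ℕ → ℕ
  m : ℕ → ℕ → ℕ
  nd : ℕ → NodeCells
  t : ℕ

/-- The sizes of words, arrays, the number of nodes, and the bounds for the arguments of a node
cell. -/
structure Layout where
  W : ℕ
  N : ℕ
  I : ℕ
  T : ℕ
  U : ℕ

/-- The value of an expression. -/
def Exp.val (s : State) : Exp → ℕ
  | .reg i => s.r i
  | .const k => k
  | .bin f a b => f.eval (a.val s) (b.val s)
  | .arr k i => s.m k (i.val s)
  | .cell f v e l q => s.nd (v.val s) (f.val s, e.val s, l.val s, q.val s)

/-- The cell with these arguments has an address. -/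
def Layout.HasCell (Y : Layout) (f v e l q : ℕ) : Prop :=
  f < 2 ∧ v < Y.I ∧ e < Y.T ∧ l < Y.T ∧ q < Y.U

/-- The evaluation of an expression needs neither numbers too large for a word nor memory cells that
do not exist. -/
def Exp.Ok (Y : Layout) (s : State) : Exp → Prop
  | .reg i => i < 100
  | .const k => k < 16
  | .bin f a b => a.Ok Y s ∧ b.Ok Y s ∧ f.Fits Y.W (a.val s) (b.val s)
  | .arr k i => (k < 16 ∧ k ≠ 5) ∧ i.Ok Y s ∧ i.val s < Y.N
  | .cell f v e l q => f.Ok Y s ∧ v.Ok Y s ∧ e.Ok Y s ∧ l.Ok Y s ∧ q.Ok Y s ∧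
      Y.HasCell (f.val s) (v.val s) (e.val s) (l.val s) (q.val s)

/-- Conditions. -/
structure Cond where ne ::
  a : Exp
  b : Exp

/-- A comparison in terms of truncated subtraction. -/
def Cond.lt (a b : Exp) : Cond := .ne (b - a) 0

/-- A comparison in terms of truncated subtraction. -/
def Cond.le (a b : Exp) : Cond := .ne (1 - (a - b)) 0

/-- Equality in terms of truncated subtraction. -/
def Cond.eq (a b : Exp) : Cond := .lt (b - a) (1 - (a - b))

/-- The truth of a condition. -/
def Cond.Holds (s : State) (b : Cond) : Prop := b.a.val s ≠ b.b.val s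

/-- Both sides of a condition can be evaluated. -/
def Cond.Ok (Y : Layout) (s : State) (b : Cond) : Prop := b.a.Ok Y s ∧ b.b.Ok Y s

/-- Commands. -/
inductive Cmd where
  | skip
  | set (d : ℕ) (a : Exp)
  | put (k : ℕ) (i a : Exp)
  | putCell (f v e l q a : Exp)
  | seq (c d : Cmd)
  | ite (b : Cond) (c d : Cmd)
  | whl (b : Cond) (c : Cmd)

infixr:50 " ;; " => Cmd.seq

namespace State

/-- Assign to a register. -/
def set (s : State) (d v : ℕ) : State := { s with r := update s.r d v, t := s.t + 1 }

/-- Assign to an array. -/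
def put (s : State) (k i v : ℕ) : State :=
  { s with m := update s.m k (update (s.m k) i v), t := s.t + 1 }

/-- Assign to a cell of a node. -/
def putCell (s : State) (f v e l q a : ℕ) : State :=
  { s with nd := update s.nd v (update (s.nd v) (f, e, l, q) a), t := s.t + 1 }

/-- Let the clock tick. -/
def tick (s : State) : State := { s with t := s.t + 1 }

variable (s : State) (d v k i f e l q a : ℕ)

@[simp] theorem set_r : (s.set d v).r i = if i = d then v else s.r i := by
  simp [set, update_apply]
@[simp] theorem set_m : (s.set d v).m = s.m := rfl
@[simp] theorem set_nd : (s.set d v).nd = s.nd := rfl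
@[simp] theorem set_t : (s.set d v).t = s.t + 1 := rfl
@[simp] theorem put_r : (s.put k i v).r = s.r := rfl
@[simp] theorem put_nd : (s.put k i v).nd = s.nd := rfl
@[simp] theorem put_t : (s.put k i v).t = s.t + 1 := rfl
@[simp] theorem put_m {k' i' : ℕ} :
    (s.put k i v).m k' i' = if k' = k ∧ i' = i then v else s.m k' i' := by
  simp only [put, update_apply]
  grind
@[simp] theorem putCell_r : (s.putCell f v e l q a).r = s.r := rfl
@[simp] theorem putCell_m : (s.putCell f v e l q a).m = s.m := rfl
@[simp] theorem putCell_t : (s.putCell f v e l q a).t = s.t + 1 := rfl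
@[simp] theorem putCell_nd : (s.putCell f v e l q a).nd =
    update s.nd v (update (s.nd v) (f, e, l, q) a) := rfl
@[simp] theorem tick_r : s.tick.r = s.r := rfl
@[simp] theorem tick_m : s.tick.m = s.m := rfl
@[simp] theorem tick_nd : s.tick.nd = s.nd := rfl
@[simp] theorem tick_t : s.tick.t = s.t + 1 := rfl

end State

/-- Execution of a command, under the condition that nothing overflows. The arrays with numbers `0`
and `5` cannot be written to: the first holds constants, and the second one is replaced by the cells
of the nodes. -/
inductive Run (Y : Layout) : Cmd → State → State → Prop
  | skip {s} : Run Y .skip s s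
  | set {s d a} (hd : d < 100) (ha : a.Ok Y s) : Run Y (.set d a) s (s.set d (a.val s))
  | put {s k i a} (hk : k < 16 ∧ k ≠ 5 ∧ k ≠ 0) (hi : i.Ok Y s) (ha : a.Ok Y s)
      (hN : i.val s < Y.N) : Run Y (.put k i a) s (s.put k (i.val s) (a.val s))
  | putCell {s f v e l q a} (hf : f.Ok Y s) (hv : v.Ok Y s) (he : e.Ok Y s) (hl : l.Ok Y s)
      (hq : q.Ok Y s) (ha : a.Ok Y s)
      (hc : Y.HasCell (f.val s) (v.val s) (e.val s) (l.val s) (q.val s)) :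
      Run Y (.putCell f v e l q a) s
        (s.putCell (f.val s) (v.val s) (e.val s) (l.val s) (q.val s) (a.val s))
  | seq {s s' s'' c d} (hc : Run Y c s s') (hd : Run Y d s' s'') : Run Y (c ;; d) s s''
  | iteTrue {s s' b c d} (hb : b.Ok Y s) (h : b.Holds s) (hc : Run Y c s.tick s') :
      Run Y (.ite b c d) s s'
  | iteFalse {s s' b c d} (hb : b.Ok Y s) (h : ¬ b.Holds s) (hd : Run Y d s.tick s') :
      Run Y (.ite b c d) s s'
  | whlTrue {s s' s'' b c} (hb : b.Ok Y s) (h : b.Holds s) (hc : Run Y c s.tick s')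
      (hw : Run Y (.whl b c) s' s'') : Run Y (.whl b c) s s''
  | whlFalse {s b c} (hb : b.Ok Y s) (h : ¬ b.Holds s) : Run Y (.whl b c) s s.tick

/-- The execution of the command ends in a state with the property `Q`. -/
def Wp (Y : Layout) (c : Cmd) (Q : State → Prop) (s : State) : Prop := ∃ s', Run Y c s s' ∧ Q s'

section Wp

variable {Y : Layout} {s : State} {Q Q' : State → Prop}

theorem Wp.mono {c : Cmd} (h : Wp Y c Q s) (hQ : ∀ s', Q s' → Q' s') : Wp Y c Q' s := by
  obtain ⟨s', h1, h2⟩ := h; exact ⟨s', h1, hQ s' h2⟩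

@[simp] theorem wp_skip : Wp Y .skip Q s ↔ Q s :=
  ⟨by rintro ⟨_, ⟨⟩, h⟩; exact h, fun h => ⟨_, .skip, h⟩⟩

@[simp] theorem wp_set {d : ℕ} {a : Exp} :
    Wp Y (.set d a) Q s ↔ d < 100 ∧ a.Ok Y s ∧ Q (s.set d (a.val s)) :=
  ⟨by rintro ⟨_, ⟨⟩, h⟩; exact ⟨‹_›, ‹_›, h⟩, fun ⟨h1, h2, h3⟩ => ⟨_, .set h1 h2, h3⟩⟩

@[simp] theorem wp_put {k : ℕ} {i a : Exp} : Wp Y (.put k i a) Q s ↔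
    (k < 16 ∧ k ≠ 5 ∧ k ≠ 0) ∧ i.Ok Y s ∧ a.Ok Y s ∧ i.val s < Y.N ∧
      Q (s.put k (i.val s) (a.val s)) :=
  ⟨by rintro ⟨_, ⟨⟩, h⟩; exact ⟨‹_›, ‹_›, ‹_›, ‹_›, h⟩,
    fun ⟨h1, h2, h3, h4, h5⟩ => ⟨_, .put h1 h2 h3 h4, h5⟩⟩

@[simp] theorem wp_putCell {f v e l q a : Exp} : Wp Y (.putCell f v e l q a) Q s ↔
    f.Ok Y s ∧ v.Ok Y s ∧ e.Ok Y s ∧ l.Ok Y s ∧ q.Ok Y s ∧ a.Ok Y s ∧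
      Y.HasCell (f.val s) (v.val s) (e.val s) (l.val s) (q.val s) ∧
      Q (s.putCell (f.val s) (v.val s) (e.val s) (l.val s) (q.val s) (a.val s)) :=
  ⟨by rintro ⟨_, ⟨⟩, h⟩; exact ⟨‹_›, ‹_›, ‹_›, ‹_›, ‹_›, ‹_›, ‹_›, h⟩,
    fun ⟨h1, h2, h3, h4, h5, h6, h7, h8⟩ => ⟨_, .putCell h1 h2 h3 h4 h5 h6 h7, h8⟩⟩

@[simp] theorem wp_seq {c d : Cmd} : Wp Y (c ;; d) Q s ↔ Wp Y c (Wp Y d Q) s :=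
  ⟨by rintro ⟨_, h1, h⟩; cases h1; exact ⟨_, ‹_›, _, ‹_›, h⟩,
    fun ⟨_, h1, _, h2, h3⟩ => ⟨_, .seq h1 h2, h3⟩⟩

@[simp] theorem wp_ite {b : Cond} {c d : Cmd} : Wp Y (.ite b c d) Q s ↔
    b.Ok Y s ∧ (b.Holds s → Wp Y c Q s.tick) ∧ (¬ b.Holds s → Wp Y d Q s.tick) := by
  constructor
  · rintro ⟨_, h1, h⟩
    cases h1
    · exact ⟨‹_›, fun _ => ⟨_, ‹_›, h⟩, fun h => absurd ‹_› h⟩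
    · exact ⟨‹_›, fun h => absurd h ‹_›, fun _ => ⟨_, ‹_›, h⟩⟩
  · rintro ⟨h0, h1, h2⟩
    by_cases hb : b.Holds s
    · obtain ⟨s', h3, h4⟩ := h1 hb; exact ⟨s', .iteTrue h0 hb h3, h4⟩
    · obtain ⟨s', h3, h4⟩ := h2 hb; exact ⟨s', .iteFalse h0 hb h3, h4⟩

theorem wp_whl {b : Cond} {c : Cmd} : Wp Y (.whl b c) Q s ↔
    b.Ok Y s ∧ (b.Holds s → Wp Y c (Wp Y (.whl b c) Q) s.tick) ∧ (¬ b.Holds s → Q s.tick) := by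
  constructor
  · rintro ⟨_, h1, h⟩
    cases h1
    · exact ⟨‹_›, fun _ => ⟨_, ‹_›, _, ‹_›, h⟩, fun h => absurd ‹_› h⟩
    · exact ⟨‹_›, fun h => absurd h ‹_›, fun _ => h⟩
  · rintro ⟨h0, h1, h2⟩
    by_cases hb : b.Holds s
    · obtain ⟨s', h3, s'', h4, h5⟩ := h1 hb; exact ⟨s'', .whlTrue h0 hb h3 h4, h5⟩
    · exact ⟨_, .whlFalse h0 hb, h2 hb⟩

variable {a b : Exp} {i k : ℕ}

@[simp] theorem val_reg : (Exp.reg i).val s = s.r i := rfl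
@[simp] theorem val_add : (a + b).val s = a.val s + b.val s := rfl
@[simp] theorem val_sub : (a - b).val s = a.val s - b.val s := rfl
@[simp] theorem val_mul : (a * b).val s = a.val s * b.val s := rfl
@[simp] theorem val_div : (a / b).val s = a.val s / b.val s := rfl
@[simp] theorem val_mod : (a % b).val s = a.val s % b.val s := rfl
@[simp] theorem val_shr : (a >>> b).val s = a.val s / 2 ^ b.val s := rfl
@[simp] theorem val_ofNat : Exp.val s (no_index (OfNat.ofNat k)) = OfNat.ofNat k := rfl
@[simp] theorem val_arr : (Exp.arr k a).val s = s.m k (a.val s) := rfl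
@[simp] theorem val_cell {f v e l q : Exp} : (Exp.cell f v e l q).val s =
    s.nd (v.val s) (f.val s, e.val s, l.val s, q.val s) := rfl
@[simp] theorem ok_reg : (Exp.reg i).Ok Y s ↔ i < 100 := Iff.rfl
@[simp] theorem ok_add : (a + b).Ok Y s ↔ a.Ok Y s ∧ b.Ok Y s ∧ a.val s + b.val s < Y.W := Iff.rfl
@[simp] theorem ok_mul : (a * b).Ok Y s ↔ a.Ok Y s ∧ b.Ok Y s ∧ a.val s * b.val s < Y.W := Iff.rfl
@[simp] theorem ok_sub : (a - b).Ok Y s ↔ a.Ok Y s ∧ b.Ok Y s :=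
  ⟨fun h => ⟨h.1, h.2.1⟩, fun h => ⟨h.1, h.2, trivial⟩⟩
@[simp] theorem ok_div : (a / b).Ok Y s ↔ a.Ok Y s ∧ b.Ok Y s :=
  ⟨fun h => ⟨h.1, h.2.1⟩, fun h => ⟨h.1, h.2, trivial⟩⟩
@[simp] theorem ok_mod : (a % b).Ok Y s ↔ a.Ok Y s ∧ b.Ok Y s :=
  ⟨fun h => ⟨h.1, h.2.1⟩, fun h => ⟨h.1, h.2, trivial⟩⟩
@[simp] theorem ok_shr : (a >>> b).Ok Y s ↔ a.Ok Y s ∧ b.Ok Y s :=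
  ⟨fun h => ⟨h.1, h.2.1⟩, fun h => ⟨h.1, h.2, trivial⟩⟩
@[simp] theorem ok_ofNat : Exp.Ok Y s (no_index (OfNat.ofNat k)) ↔ k < 16 := Iff.rfl
@[simp] theorem ok_arr :
    (Exp.arr k a).Ok Y s ↔ (k < 16 ∧ k ≠ 5) ∧ a.Ok Y s ∧ a.val s < Y.N := Iff.rfl
@[simp] theorem ok_cell {f v e l q : Exp} : (Exp.cell f v e l q).Ok Y s ↔
    f.Ok Y s ∧ v.Ok Y s ∧ e.Ok Y s ∧ l.Ok Y s ∧ q.Ok Y s ∧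
      Y.HasCell (f.val s) (v.val s) (e.val s) (l.val s) (q.val s) := Iff.rfl

@[simp] theorem holds_ne : (Cond.ne a b).Holds s ↔ a.val s ≠ b.val s := Iff.rfl
@[simp] theorem ok_ne : (Cond.ne a b).Ok Y s ↔ a.Ok Y s ∧ b.Ok Y s := Iff.rfl
@[simp] theorem holds_lt : (Cond.lt a b).Holds s ↔ a.val s < b.val s := by simp [Cond.lt]; omega
@[simp] theorem ok_lt : (Cond.lt a b).Ok Y s ↔ a.Ok Y s ∧ b.Ok Y s := by simp [Cond.lt]; tauto
@[simp] theorem holds_le : (Cond.le a b).Holds s ↔ a.val s ≤ b.val s := by simp [Cond.le]; omega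
@[simp] theorem ok_le : (Cond.le a b).Ok Y s ↔ a.Ok Y s ∧ b.Ok Y s := by simp [Cond.le]
@[simp] theorem holds_eq : (Cond.eq a b).Holds s ↔ a.val s = b.val s := by simp [Cond.eq]; omega
@[simp] theorem ok_eq : (Cond.eq a b).Ok Y s ↔ a.Ok Y s ∧ b.Ok Y s := by simp [Cond.eq]; tauto

end Wp

/-! ### Machine code for expressions -/

/-- Expressions with a flat memory. -/
inductive Raw where
  | reg (i : ℕ)
  | const (k : ℕ)
  | bin (f : BinOp) (a b : Raw)
  | load (a : Raw)

/-- The value, given the contents `r` of the registers and `μ` of the memory. -/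
def Raw.val (r μ : ℕ → ℕ) : Raw → ℕ
  | .reg i => r i
  | .const k => k
  | .bin f a b => f.eval (a.val r μ) (b.val r μ)
  | .load a => μ (a.val r μ)

/-- The evaluation involves no number too large for a word. -/
def Raw.Ok (W : ℕ) (r μ : ℕ → ℕ) : Raw → Prop
  | .reg i => i < 100
  | .const k => k < W
  | .bin f a b => a.Ok W r μ ∧ b.Ok W r μ ∧ f.Fits W (a.val r μ) (b.val r μ)
  | .load a => a.Ok W r μ ∧ a.val r μ < W

/-- Code for `R[d] := R[d] f R[d + 1]` that starts at position `p`. -/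
def BinOp.code (d p : ℕ) : BinOp → List Instr
  | .add => [.op .add d d (d + 1)]
  | .mul => [.op .mul d d (d + 1)]
  | .div => [.op .div d d (d + 1)]
  | .shr => [.op .shr d d (d + 1)]
  | .sub => [.jumpLt d (d + 1) (p + 3), .op .sub d d (d + 1), .jumpEq d d (p + 4), .const d 0]
  | .mod => [.op .div (d + 2) d (d + 1), .op .mul (d + 2) (d + 2) (d + 1), .op .sub d d (d + 2)]

/-- Code that starts at position `p` and evaluates an expression into register `d`. -/
def Raw.code : Raw → (d p : ℕ) → List Instr
  | .reg i, d, _ => [.const d 0, .op .add d i d]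
  | .const k, d, _ => [.const d k]
  | .bin f a b, d, p =>
      a.code d p ++ (b.code (d + 1) (p + (a.code d p).length) ++
        f.code d (p + (a.code d p).length + (b.code (d + 1) (p + (a.code d p).length)).length))
  | .load a, d, p => a.code d p ++ [.load d d]

/-- The list `l` of instructions stands in the program at position `p`. -/
def Seg (P : RamProgram) : ℕ → List Instr → Prop
  | _, [] => True
  | p, i :: l => P[p]? = some i ∧ Seg P (p + 1) l

theorem seg_append {P : RamProgram} {p : ℕ} {l l' : List Instr} :
    Seg P p (l ++ l') ↔ Seg P p l ∧ Seg P (p + l.length) l' := by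
  induction l generalizing p with
  | nil => simp [Seg]
  | cons i l ih =>
    simp only [List.cons_append, Seg, ih, List.length_cons, and_assoc]
    rw [show p + 1 + l.length = p + (l.length + 1) by omega]

theorem seg_self_append (l l' : List Instr) : Seg (l ++ l') l.length l' := by
  induction l' generalizing l with
  | nil => trivial
  | cons i l' ih =>
    refine ⟨by simp, ?_⟩
    have := ih (l ++ [i]); simpa using this

theorem seg_self (P : RamProgram) : Seg P 0 P := seg_self_append [] P

/-- The program leads from one configuration to another one in exactly `k` steps. -/
inductive Steps {w : ℕ} (P : RamProgram) : ℕ → RamConfig w → RamConfig w → Prop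
  | refl {x} : Steps P 0 x x
  | head {k x y z} (h : P.step x = some y) (h' : Steps P k y z) : Steps P (k + 1) x z

section

variable {w : ℕ} {P : RamProgram} {x y z : RamConfig w}

theorem Steps.trans {k l : ℕ} (h : Steps P k x y) (h' : Steps P l y z) : Steps P (k + l) x z := by
  induction h with
  | refl => simpa using h'
  | head h _ ih =>
    have := Steps.head h (ih h')
    rwa [Nat.add_right_comm] at this

theorem Steps.one {i : Instr} (hi : P[x.pc]? = some i) (h : i.exec x = some y) : Steps P 1 x y :=
  .head (by rw [RamProgram.step, hi]; exact h) .refl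

/-- From `x`, code of length `n` at position `p` leads to a configuration behind this code, with
the property `Q`, without a change of the memory or of the registers below `d`. -/
def Evals (P : RamProgram) (n d : ℕ) (x : RamConfig w) (Q : BitVec w → Prop) : Prop :=
  ∃ k ≤ n, ∃ y : RamConfig w, Steps P k x y ∧ y.pc = x.pc + n ∧ y.mem = x.mem ∧
    (∀ i < d, y.reg i = x.reg i) ∧ Q (y.reg d)

theorem toNat_lt_iff {u v : BitVec w} : u < v ↔ u.toNat < v.toNat := BitVec.lt_def

theorem BinOp.evals {f : BinOp} {d : ℕ} {r₁ r₂ : ℕ} (hP : Seg P x.pc (f.code d x.pc))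
    (h₁ : (x.reg d).toNat = r₁) (h₂ : (x.reg (d + 1)).toNat = r₂) (hf : f.Fits (2 ^ w) r₁ r₂) :
    Evals P (f.code d x.pc).length d x fun v => v.toNat = f.eval r₁ r₂ := by
  subst h₁ h₂
  have hlt : ∀ i < d, i ≠ d := fun i hi => by omega
  have hlt2 : ∀ i < d, i ≠ d + 2 := fun i hi => by omega
  cases f with
  | add =>
    refine ⟨1, le_rfl, _, .one hP.1 rfl, rfl, rfl, fun i hi => by simp [hlt i hi], ?_⟩
    simp only [update_self, WordOp.eval, BitVec.toNat_add, BinOp.eval]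
    exact Nat.mod_eq_of_lt hf
  | mul =>
    refine ⟨1, le_rfl, _, .one hP.1 rfl, rfl, rfl, fun i hi => by simp [hlt i hi], ?_⟩
    simp only [update_self, WordOp.eval, BitVec.toNat_mul, BinOp.eval]
    exact Nat.mod_eq_of_lt hf
  | div =>
    refine ⟨1, le_rfl, _, .one hP.1 rfl, rfl, rfl, fun i hi => by simp [hlt i hi], ?_⟩
    simp [WordOp.eval, BinOp.eval]
  | shr =>
    refine ⟨1, le_rfl, _, .one hP.1 rfl, rfl, rfl, fun i hi => by simp [hlt i hi], ?_⟩
    simp [WordOp.eval, BinOp.eval, Nat.shiftRight_eq_div_pow]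
  | sub =>
    obtain ⟨h1, h2, h3, h4, -⟩ := hP
    by_cases hab : x.reg d < x.reg (d + 1)
    · have s1 := Steps.one (x := x) h1 rfl
      rw [if_pos hab] at s1
      have s2 := s1.trans (Steps.one (x := { x with pc := x.pc + 3 }) h4 rfl)
      refine ⟨_, by simp [BinOp.code], _, s2, by simp [BinOp.code], rfl,
        fun i hi => by simp [hlt i hi], ?_⟩
      have := toNat_lt_iff.1 hab
      simp only [update_self, BinOp.eval, BitVec.toNat_ofNat, Nat.zero_mod]; omega
    · have s1 := Steps.one (x := x) h1 rfl
      rw [if_neg hab] at s1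
      have s2 := s1.trans (Steps.one (x := { x with pc := x.pc + 1 }) h2 rfl)
      have s3 := s2.trans (Steps.one h3 rfl)
      refine ⟨_, by simp [BinOp.code], _, s3, by simp [BinOp.code], rfl,
        fun i hi => by simp [hlt i hi], ?_⟩
      have := mt toNat_lt_iff.2 hab
      simp only [update_self, BinOp.eval, WordOp.eval]
      rw [BitVec.toNat_sub_of_le (BitVec.le_def.2 (by omega))]
  | mod =>
    obtain ⟨h1, h2, h3, -⟩ := hP
    have s1 := Steps.one (x := x) h1 rfl
    have s2 := s1.trans (Steps.one h2 rfl)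
    have s3 := s2.trans (Steps.one h3 rfl)
    refine ⟨_, by simp [BinOp.code], _, s3, by simp [BinOp.code], rfl,
        fun i hi => by simp [hlt i hi, hlt2 i hi], ?_⟩
    have e1 := Nat.div_mul_le_self (x.reg d).toNat (x.reg (d + 1)).toNat
    have e2 := (x.reg d).isLt
    have e4 := Nat.div_add_mod' (x.reg d).toNat (x.reg (d + 1)).toNat
    have e3 : (x.reg d / x.reg (d + 1) * x.reg (d + 1)).toNat =
        (x.reg d).toNat / (x.reg (d + 1)).toNat * (x.reg (d + 1)).toNat := by
      rw [BitVec.toNat_mul, BitVec.toNat_udiv, Nat.mod_eq_of_lt (by omega)]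
    simp only [update_self, BinOp.eval, WordOp.eval, ne_eq, not_false_eq_true, update_of_ne, OfNat.one_ne_ofNat,
      Nat.left_eq_add, OfNat.ofNat_ne_zero, Nat.add_left_cancel_iff]
    rw [BitVec.toNat_sub_of_le (BitVec.le_def.2 (by rw [e3]; exact e1)), e3]; omega

theorem Evals.seq {n n' d d' : ℕ} {Q Q' : BitVec w → Prop} (h : Evals P n d x Q) (hd : d ≤ d')
    (h' : ∀ y : RamConfig w, y.pc = x.pc + n → y.mem = x.mem → (∀ i < d, y.reg i = x.reg i) →
      Q (y.reg d) → Evals P n' d' y Q') :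
    ∃ k ≤ n + n', ∃ z : RamConfig w, Steps P k x z ∧ z.pc = x.pc + n + n' ∧ z.mem = x.mem ∧
      (∀ i < d, z.reg i = x.reg i) ∧ (d < d' → Q (z.reg d)) ∧ Q' (z.reg d') := by
  obtain ⟨k, hk, y, h1, h2, h3, h4, h5⟩ := h
  obtain ⟨k', hk', z, g1, g2, g3, g4, g5⟩ := h' y h2 h3 h4 h5
  exact ⟨k + k', by omega, z, h1.trans g1, by rw [g2, h2], by rw [g3, h3],
    fun i hi => by rw [g4 i (by omega), h4 i hi], fun hdd => by rw [g4 d hdd]; exact h5, g5⟩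

theorem Raw.evals {r μ : ℕ → ℕ} {e : Raw} {d : ℕ} (hd : 100 ≤ d)
    (hP : Seg P x.pc (e.code d x.pc)) (hr : ∀ i < 100, (x.reg i).toNat = r i)
    (hμ : ∀ a, (x.mem a).toNat = μ a.toNat) (he : e.Ok (2 ^ w) r μ) :
    Evals P (e.code d x.pc).length d x fun v => v.toNat = e.val r μ := by
  induction e generalizing x d with
  | reg i =>
    have hi : i < 100 := he
    refine ⟨1 + 1, le_rfl, _, (Steps.one hP.1 rfl).trans (.one hP.2.1 rfl), rfl, rfl,
      fun j hj => by simp [show j ≠ d by omega], ?_⟩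
    simp [WordOp.eval, show i ≠ d by omega, hr i hi, Raw.val]
  | const k =>
    refine ⟨1, le_rfl, _, .one hP.1 rfl, rfl, rfl, fun j hj => by simp [show j ≠ d by omega], ?_⟩
    simp only [update_self, BitVec.toNat_ofNat, Raw.val]; exact Nat.mod_eq_of_lt he
  | load a ih =>
    obtain ⟨h1, h2⟩ := seg_append.1 hP
    obtain ⟨k, hk, z, g1, g2, g3, g4, -, g5⟩ := (ih hd h1 hr hμ he.1).seq (n' := 1) le_rfl
      (Q' := fun v => v.toNat = Raw.val r μ (.load a)) (by
        intro y hy1 hy2 hy3 hy4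
        have s1 := Steps.one (x := y) (by rw [hy1]; exact h2.1) rfl
        refine ⟨1, le_rfl, _, s1, rfl, rfl, fun j hj => by simp [show j ≠ d by omega], ?_⟩
        simp only [update_self, hy2, hμ, hy4]; rfl)
    refine ⟨k, by simpa [Raw.code] using hk, z, g1, ?_, g3, g4, g5⟩
    rw [g2]; simp [Raw.code]; omega
  | bin f a b iha ihb =>
    obtain ⟨h1, h2⟩ := seg_append.1 hP
    obtain ⟨h2, h3⟩ := seg_append.1 h2
    obtain ⟨k, hk, z, g1, g2, g3, g4, g6, g5⟩ := (iha hd h1 hr hμ he.1).seq (d' := d + 1)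
      (n' := (b.code (d + 1) (x.pc + (a.code d x.pc).length)).length)
      (by omega) (Q' := fun v => v.toNat = b.val r μ) (by
        intro y hy1 hy2 hy3 hy4
        have := ihb (x := y) (d := d + 1) (by omega) (by rwa [hy1])
          (fun i hi => by rw [hy3 i (by omega), hr i hi]) (by rwa [hy2]) he.2.1
        rwa [hy1] at this)
    obtain ⟨k', hk', z', g1', g2', g3', g4', g5'⟩ :=
      BinOp.evals (x := z) (f := f) (d := d) (by rw [g2]; exact h3) (g6 (by omega)) g5 he.2.2
    rw [g2] at hk' g2'
    refine ⟨k + k', ?_, z', g1.trans g1', ?_, by rw [g3', g3],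
      fun i hi => by rw [g4' i hi, g4 i hi], g5'⟩
    · simp only [Raw.code, List.length_append]; omega
    · rw [g2']; simp only [Raw.code, List.length_append]; omega

end

/-! ### The memory layout -/

/-- The content of the memory cell with address `a`. The remainder modulo `16` is the number of the
array. -/
def flat (Y : Layout) (s : State) (a : ℕ) : ℕ :=
  if a % 16 = 5 then
    s.nd (a / 16 / 2 / Y.U / Y.T / Y.T)
      (a / 16 % 2, a / 16 / 2 / Y.U / Y.T % Y.T, a / 16 / 2 / Y.U % Y.T, a / 16 / 2 % Y.U)
  else s.m (a % 16) (a / 16)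

/-- The address of a cell of a node. -/
def Layout.addr (Y : Layout) (f v e l q : ℕ) : ℕ :=
  ((((v * Y.T + e) * Y.T + l) * Y.U + q) * 2 + f) * 16 + 5

/-- The layout fits into a memory with words of length `w`. -/
structure Layout.Fits (Y : Layout) (w : ℕ) : Prop where
  size : Y.W = 2 ^ w
  le_size : 32 ≤ Y.W
  arr : 16 * Y.N ≤ Y.W
  cell : 32 * (Y.I * Y.T * Y.T * Y.U) ≤ Y.W

/-- The constants by which cells of nodes are addressed are stored in the memory. -/
def Layout.Stored (Y : Layout) (s : State) : Prop := s.m 0 0 = Y.T ∧ s.m 0 1 = Y.U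

/-- The address of an array cell. -/
def Raw.arrAddr (k : ℕ) (i : Raw) : Raw := .bin .add (.bin .mul i (.const 16)) (.const k)

/-- The address of a cell of a node. -/
def Raw.cellAddr (f v e l q : Raw) : Raw :=
  let step (a x b : Raw) : Raw := .bin .add (.bin .mul a x) b
  step (step (step (step (step v (.load (.const 0)) e) (.load (.const 0)) l)
    (.load (.const 16)) q) (.const 2) f) (.const 16) (.const 5)

/-- The expression with addresses spelled out. -/
def Exp.raw : Exp → Raw
  | .reg i => .reg i
  | .const k => .const k
  | .bin f a b => .bin f a.raw b.raw
  | .arr k i => .load (.arrAddr k i.raw)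
  | .cell f v e l q => .load (.cellAddr f.raw v.raw e.raw l.raw q.raw)

section

variable {Y : Layout} {s : State} {w : ℕ} {f v e l q : ℕ}

theorem Layout.HasCell.addr_lt (h : Y.HasCell f v e l q) :
    (v * Y.T + e) * Y.T + l < Y.I * Y.T * Y.T ∧
      ((v * Y.T + e) * Y.T + l) * Y.U + q < Y.I * Y.T * Y.T * Y.U := by
  obtain ⟨h0, h1, h2, h3, h4⟩ := h
  have key : ∀ {a A x B : ℕ}, a < A → x < B → a * B + x < A * B := by
    intro a A x B h1 h2
    calc a * B + x < a * B + B := by omega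
      _ = (a + 1) * B := by ring
      _ ≤ A * B := Nat.mul_le_mul_right _ h1
  exact ⟨key (key h1 h2) h3, key (key (key h1 h2) h3) h4⟩

theorem flat_addr (h : Y.HasCell f v e l q) : flat Y s (Y.addr f v e l q) = s.nd v (f, e, l, q) := by
  obtain ⟨h0, h1, h2, h3, h4⟩ := h
  have hT : 0 < Y.T := by omega
  have hU : 0 < Y.U := by omega
  have key : ∀ {a x B : ℕ}, x < B → (a * B + x) / B = a ∧ (a * B + x) % B = x := by
    intro a x B h
    constructor
    · rw [mul_comm, Nat.mul_add_div (by omega), Nat.div_eq_of_lt h, add_zero]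
    · rw [mul_comm, Nat.mul_add_mod, Nat.mod_eq_of_lt h]
  unfold flat Layout.addr
  rw [(key (by omega : 5 < 16)).2, (key (by omega : 5 < 16)).1, (key h0).1, (key h0).2, (key h4).1,
    (key h4).2, (key h3).1, (key h3).2, (key h2).1, (key h2).2, if_pos rfl]

theorem eq_addr {a : ℕ} (h5 : a % 16 = 5) (hv : a / 16 / 2 / Y.U / Y.T / Y.T = v)
    (hk : (a / 16 % 2, a / 16 / 2 / Y.U / Y.T % Y.T, a / 16 / 2 / Y.U % Y.T, a / 16 / 2 % Y.U) =
      (f, e, l, q)) : a = Y.addr f v e l q := by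
  simp only [Prod.mk.injEq] at hk
  obtain ⟨rfl, rfl, rfl, rfl⟩ := hk
  subst hv
  unfold Layout.addr
  have key : ∀ a B : ℕ, a / B * B + a % B = a := fun a B => Nat.div_add_mod' a B
  rw [key, key, key, key]; omega

theorem flat_put {k i a x : ℕ} (hk : k < 16 ∧ k ≠ 5) :
    flat Y (s.put k i x) a = if a = i * 16 + k then x else flat Y s a := by
  unfold flat
  by_cases h5 : a % 16 = 5
  · rw [if_pos h5, if_pos h5, if_neg (by omega)]; rfl
  · rw [if_neg h5, if_neg h5, State.put_m]
    split_ifs <;> first | rfl | omega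

theorem flat_putCell {a x : ℕ} (h : Y.HasCell f v e l q) :
    flat Y (s.putCell f v e l q x) a = if a = Y.addr f v e l q then x else flat Y s a := by
  by_cases ha : a = Y.addr f v e l q
  · rw [if_pos ha, ha, flat_addr h]; simp
  · rw [if_neg ha]
    unfold flat
    by_cases h5 : a % 16 = 5
    · rw [if_pos h5, if_pos h5, State.putCell_nd]
      by_cases hv : a / 16 / 2 / Y.U / Y.T / Y.T = v
      · rw [hv, update_self, update_of_ne]; exact fun hk => ha (eq_addr h5 hv hk)
      · rw [update_of_ne hv]
    · rw [if_neg h5, if_neg h5]; rfl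

theorem Raw.arrAddr_spec {r μ : ℕ → ℕ} {i : Raw} {k : ℕ} (hY : Y.Fits w) (hk : k < 16)
    (hi : i.Ok (2 ^ w) r μ) (hN : i.val r μ < Y.N) :
    (Raw.arrAddr k i).Ok (2 ^ w) r μ ∧ (Raw.arrAddr k i).val r μ = i.val r μ * 16 + k ∧
      i.val r μ * 16 + k < 2 ^ w := by
  have h1 := hY.arr
  have h2 := hY.le_size
  rw [hY.size] at h1 h2
  simp only [Raw.arrAddr, Raw.Ok, Raw.val, BinOp.Fits, BinOp.eval, hi, true_and]; omega

theorem Raw.cellAddr_spec {r : ℕ → ℕ} {f v e l q : Raw} (hY : Y.Fits w) (hs : Y.Stored s)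
    (hf : f.Ok (2 ^ w) r (flat Y s)) (hv : v.Ok (2 ^ w) r (flat Y s))
    (he : e.Ok (2 ^ w) r (flat Y s)) (hl : l.Ok (2 ^ w) r (flat Y s))
    (hq : q.Ok (2 ^ w) r (flat Y s))
    (hc : Y.HasCell (f.val r (flat Y s)) (v.val r (flat Y s)) (e.val r (flat Y s))
      (l.val r (flat Y s)) (q.val r (flat Y s))) :
    (Raw.cellAddr f v e l q).Ok (2 ^ w) r (flat Y s) ∧
      (Raw.cellAddr f v e l q).val r (flat Y s) = Y.addr (f.val r (flat Y s))
        (v.val r (flat Y s)) (e.val r (flat Y s)) (l.val r (flat Y s)) (q.val r (flat Y s)) ∧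
      (Raw.cellAddr f v e l q).val r (flat Y s) < 2 ^ w := by
  have h0 : flat Y s 0 = Y.T := hs.1
  have h1 : flat Y s 16 = Y.U := hs.2
  have h2 := hY.le_size
  have h3 := hY.cell
  rw [hY.size] at h2 h3
  obtain ⟨c0, c1⟩ := hc.addr_lt
  obtain ⟨d0, d1, d2, d3, d4⟩ := hc
  simp only [Raw.cellAddr, Raw.Ok, Raw.val, BinOp.Fits, BinOp.eval, h0, h1, Layout.addr, hf, hv,
    he, hl, hq, true_and]
  have hU : 0 < Y.U := by omega
  have hT : 0 < Y.T := by omega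
  generalize v.val r (flat Y s) = v' at *
  generalize e.val r (flat Y s) = e' at *
  generalize l.val r (flat Y s) = l' at *
  generalize q.val r (flat Y s) = q' at *
  have b1 : v' * Y.T + e' ≤ (v' * Y.T + e') * Y.T := Nat.le_mul_of_pos_right _ hT
  have b2 : (v' * Y.T + e') * Y.T + l' ≤ ((v' * Y.T + e') * Y.T + l') * Y.U :=
    Nat.le_mul_of_pos_right _ hU
  omega

theorem Exp.raw_spec (hY : Y.Fits w) (hs : Y.Stored s) {a : Exp} (ha : a.Ok Y s) :
    a.raw.Ok (2 ^ w) s.r (flat Y s) ∧ a.raw.val s.r (flat Y s) = a.val s := by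
  have h2 := hY.le_size
  rw [hY.size] at h2
  induction a with
  | reg i => exact ⟨ha, rfl⟩
  | const k =>
    have : k < 16 := ha; exact ⟨show k < 2 ^ w by omega, rfl⟩
  | bin f a b iha ihb =>
    obtain ⟨h1, h2, h3⟩ := ha
    refine ⟨⟨(iha h1).1, (ihb h2).1, ?_⟩, ?_⟩
    · rwa [(iha h1).2, (ihb h2).2, ← hY.size]
    · simp only [Exp.raw, Raw.val, (iha h1).2, (ihb h2).2]; rfl
  | arr k i ih =>
    obtain ⟨⟨h1, h5⟩, h2, h3⟩ := ha
    obtain ⟨i1, i2⟩ := ih h2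
    rw [← i2] at h3
    obtain ⟨g1, g2, g3⟩ := Raw.arrAddr_spec hY h1 i1 h3
    refine ⟨⟨g1, by rwa [g2]⟩, ?_⟩
    simp only [Exp.raw, Raw.val, g2, i2, Exp.val, flat]
    rw [if_neg (by omega)]
    congr 1 <;> omega
  | cell f v e l q hf hv he hl hq =>
    obtain ⟨h1, h2, h3, h4, h5, h6⟩ := ha
    have e1 := (hf h1).2
    have e2 := (hv h2).2
    have e3 := (he h3).2
    have e4 := (hl h4).2
    have e5 := (hq h5).2
    have h6' := h6
    rw [← e1, ← e2, ← e3, ← e4, ← e5] at h6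
    obtain ⟨g1, g2, g3⟩ := Raw.cellAddr_spec hY hs (hf h1).1 (hv h2).1 (he h3).1 (hl h4).1
      (hq h5).1 h6
    refine ⟨⟨g1, g3⟩, ?_⟩
    simp only [Exp.raw, Raw.val, g2, e1, e2, e3, e4, e5, Exp.val]; exact flat_addr h6'

end

/-! ### Machine code for commands -/

/-- Code that goes to position `l` if the condition does not hold. -/
def Cond.code (p l : ℕ) (c : Cond) : List Instr :=
  let ca := c.a.raw.code 100 p
  ca ++ (c.b.raw.code 101 (p + ca.length) ++ [.jumpEq 100 101 l])

/-- Code that starts at position `p` and executes a command. -/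
def Cmd.code : Cmd → (p : ℕ) → List Instr
  | .skip, _ => []
  | .set d a, p => a.raw.code 100 p ++ [.const 101 0, .op .add d 100 101]
  | .put k i a, p =>
      let ci := (Raw.arrAddr k i.raw).code 100 p
      ci ++ (a.raw.code 101 (p + ci.length) ++ [.store 100 101])
  | .putCell f v e l q a, p =>
      let ci := (Raw.cellAddr f.raw v.raw e.raw l.raw q.raw).code 100 p
      ci ++ (a.raw.code 101 (p + ci.length) ++ [.store 100 101])
  | .seq c d, p => c.code p ++ d.code (p + (c.code p).length)
  | .ite b c d, p =>
      let nb := (b.code p 0).length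
      let cc := c.code (p + nb)
      let cd := d.code (p + nb + cc.length + 1)
      b.code p (p + nb + cc.length + 1) ++ (cc ++
        (.jumpEq 0 0 (p + nb + cc.length + 1 + cd.length) :: cd))
  | .whl b c, p =>
      let nb := (b.code p 0).length
      let cc := c.code (p + nb)
      b.code p (p + nb + cc.length + 1) ++ (cc ++ [.jumpEq 0 0 p])

theorem Cond.length_code (b : Cond) (p l : ℕ) : (b.code p l).length = (b.code p 0).length := by
  simp [Cond.code]

/-- The configuration represents the state. -/
structure Rel (Y : Layout) {w : ℕ} (x : RamConfig w) (s : State) : Prop where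
  reg : ∀ i < 100, (x.reg i).toNat = s.r i
  mem : ∀ a, (x.mem a).toNat = flat Y s a.toNat
  stored : Y.Stored s

section

variable {Y : Layout} {s s' : State} {w : ℕ} {P : RamProgram} {x : RamConfig w}

theorem Rel.evals (hY : Y.Fits w) (hx : Rel Y x s) {a : Exp} (ha : a.Ok Y s) {d : ℕ}
    (hd : 100 ≤ d) (hP : Seg P x.pc (a.raw.code d x.pc)) :
    Evals P (a.raw.code d x.pc).length d x fun v => v.toNat = a.val s := by
  have := Raw.evals hd hP hx.reg hx.mem (Exp.raw_spec hY hx.stored ha).1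
  rwa [(Exp.raw_spec hY hx.stored ha).2] at this

theorem Rel.of_eq (hx : Rel Y x s) {y : RamConfig w} (hm : y.mem = x.mem)
    (hr : ∀ i < 100, y.reg i = x.reg i) : Rel Y y s :=
  ⟨fun i hi => by rw [hr i hi, hx.reg i hi], fun a => by rw [hm, hx.mem a], hx.stored⟩

theorem Rel.tick (hx : Rel Y x s) : Rel Y x s.tick := ⟨hx.reg, hx.mem, hx.stored⟩

/-- The evaluation of two expressions. -/
theorem Rel.evals_two (hY : Y.Fits w) (hx : Rel Y x s) {u : Raw} {r : ℕ} {b : Exp}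
    (hu : Seg P x.pc (u.code 100 x.pc) →
      Evals P (u.code 100 x.pc).length 100 x fun v => v.toNat = r) (hb : b.Ok Y s) {l : List Instr}
    (hP : Seg P x.pc (u.code 100 x.pc ++ (b.raw.code 101 (x.pc + (u.code 100 x.pc).length) ++ l))) :
    ∃ k ≤ (u.code 100 x.pc).length + (b.raw.code 101 (x.pc + (u.code 100 x.pc).length)).length,
      ∃ y : RamConfig w, Steps P k x y ∧ y.pc = x.pc + (u.code 100 x.pc).length +
        (b.raw.code 101 (x.pc + (u.code 100 x.pc).length)).length ∧ Rel Y y s ∧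
      (y.reg 100).toNat = r ∧ (y.reg 101).toNat = b.val s ∧ Seg P y.pc l := by
  obtain ⟨h1, h2⟩ := seg_append.1 hP
  obtain ⟨h2, h3⟩ := seg_append.1 h2
  obtain ⟨k, hk, z, g1, g2, g3, g4, g5, g6⟩ := (hu h1).seq (d' := 101)
    (n' := (b.raw.code 101 (x.pc + (u.code 100 x.pc).length)).length)
    (Q' := fun v => v.toNat = b.val s) (by omega) (by
      intro y hy1 hy2 hy3 hy4
      have := (hx.of_eq hy2 hy3).evals hY hb (d := 101) (by omega) (by rwa [hy1])
      rwa [hy1] at this)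
  exact ⟨k, hk, z, g1, g2, hx.of_eq g3 g4, g5 (by omega), g6, by rwa [g2]⟩

theorem toNat_eq_iff {u v : BitVec w} : u = v ↔ u.toNat = v.toNat := BitVec.toNat_inj.symm

theorem Cond.code_spec (hY : Y.Fits w) (hx : Rel Y x s) {b : Cond} (hb : b.Ok Y s) {l : ℕ}
    (hP : Seg P x.pc (b.code x.pc l)) :
    ∃ k ≤ (b.code x.pc 0).length, ∃ y : RamConfig w, Steps P k x y ∧ Rel Y y s ∧
      (b.Holds s → y.pc = x.pc + (b.code x.pc 0).length) ∧ (¬ b.Holds s → y.pc = l) := by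
  rw [← b.length_code x.pc l]
  obtain ⟨k, hk, y, g1, g2, g3, g4, g5, g6⟩ := hx.evals_two hY (hx.evals hY hb.1 le_rfl) hb.2 hP
  have s1 := g1.trans (Steps.one (x := y) g6.1 rfl)
  refine ⟨_, ?_, _, s1, g3.of_eq rfl fun _ _ => rfl, fun hn => ?_, fun hn => ?_⟩
  · simp [Cond.code]; omega
  · rw [Cond.Holds, ← g4, ← g5, ne_eq, ← toNat_eq_iff] at hn
    simp [Cond.code, hn]; omega
  · rw [Cond.Holds, ← g4, ← g5, ne_eq, ← toNat_eq_iff, not_not] at hn; simp [hn]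

theorem Rel.put (hx : Rel Y x s) {k i v : ℕ} {a b : BitVec w} (hk : k < 16 ∧ k ≠ 5 ∧ k ≠ 0)
    (ha : a.toNat = i * 16 + k) (hb : b.toNat = v) {y : RamConfig w} (hr : y.reg = x.reg)
    (hm : y.mem = update x.mem a b) : Rel Y y (s.put k i v) := by
  refine ⟨fun i hi => by rw [hr, hx.reg i hi]; rfl, fun c => ?_, ?_⟩
  · rw [hm, flat_put ⟨hk.1, hk.2.1⟩, ← ha]
    by_cases hca : c = a
    · rw [hca, update_self, if_pos rfl, hb]
    · rw [update_of_ne hca, if_neg (mt toNat_eq_iff.2 hca), hx.mem c]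
  · simp [Layout.Stored, hk.2.2.symm, hx.stored.1, hx.stored.2]

theorem Rel.putCell (hx : Rel Y x s) {f v e l q r : ℕ} {a b : BitVec w}
    (hc : Y.HasCell f v e l q) (ha : a.toNat = Y.addr f v e l q) (hb : b.toNat = r)
    {y : RamConfig w} (hr : y.reg = x.reg) (hm : y.mem = update x.mem a b) :
    Rel Y y (s.putCell f v e l q r) := by
  refine ⟨fun i hi => by rw [hr, hx.reg i hi]; rfl, fun c => ?_, hx.stored⟩
  rw [hm, flat_putCell hc, ← ha]
  by_cases hca : c = a
  · rw [hca, update_self, if_pos rfl, hb]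
  · rw [update_of_ne hca, if_neg (mt toNat_eq_iff.2 hca), hx.mem c]

/-- The machine code executes the command; each tick of the clock takes a bounded number of
steps. -/
theorem Run.steps (hY : Y.Fits w) {c : Cmd} (h : Run Y c s s') {B : ℕ} :
    ∀ {x : RamConfig w}, (c.code x.pc).length ≤ B → Seg P x.pc (c.code x.pc) → Rel Y x s →
      ∃ k, k + B * s.t ≤ B * s'.t ∧ ∃ y : RamConfig w, Steps P k x y ∧
        y.pc = x.pc + (c.code x.pc).length ∧ Rel Y y s' := by
  induction h with
  | skip =>
    intro x _ _ hx; exact ⟨0, by omega, x, .refl, rfl, hx⟩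
  | @set s d a hd ha =>
    intro x hB hP hx
    obtain ⟨h1, h2⟩ := seg_append.1 hP
    obtain ⟨k, hk, y, g1, g2, g3, g4, g5⟩ := hx.evals hY ha le_rfl h1
    have s1 := g1.trans (Steps.one (x := y) (by rw [g2]; exact h2.1) rfl)
    have s2 := s1.trans (Steps.one (by simp only [g2]; exact h2.2.1) rfl)
    simp only [Cmd.code, List.length_append, List.length_cons, List.length_nil] at hB
    refine ⟨_, ?_, _, s2, ?_, ?_, g3 ▸ hx.mem, hx.stored⟩
    · rw [State.set_t, mul_add]; omega
    · simp [Cmd.code, g2]; omega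
    · intro i hi
      by_cases hid : i = d
      · subst hid; simp [WordOp.eval, g5]
      · simp [hid, show i ≠ 101 by omega, g4 i hi, hx.reg i hi]
  | @put s k i a hk hi ha hN =>
    intro x hB hP hx
    obtain ⟨i1, i2⟩ := Exp.raw_spec hY hx.stored hi
    obtain ⟨j1, j2, j3⟩ := Raw.arrAddr_spec hY hk.1 i1 (by rwa [i2])
    obtain ⟨k, hk', y, g1, g2, g3, g4, g5, g6⟩ := hx.evals_two hY (r := i.val s * 16 + k)
      (fun hP => by
        have := Raw.evals le_rfl hP hx.reg hx.mem j1
        rwa [j2, i2] at this) ha hP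
    have s1 := g1.trans (Steps.one (x := y) g6.1 rfl)
    simp only [Cmd.code, List.length_append, List.length_cons, List.length_nil] at hB
    refine ⟨_, ?_, _, s1, ?_, g3.put hk g4 g5 rfl rfl⟩
    · rw [State.put_t, mul_add]; omega
    · simp [Cmd.code, g2]; omega
  | @putCell s f v e l q a hf hv he hl hq ha hc =>
    intro x hB hP hx
    obtain ⟨f1, f2⟩ := Exp.raw_spec hY hx.stored hf
    obtain ⟨v1, v2⟩ := Exp.raw_spec hY hx.stored hv
    obtain ⟨e1, e2⟩ := Exp.raw_spec hY hx.stored he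
    obtain ⟨l1, l2⟩ := Exp.raw_spec hY hx.stored hl
    obtain ⟨q1, q2⟩ := Exp.raw_spec hY hx.stored hq
    have hc' := hc
    rw [← f2, ← v2, ← e2, ← l2, ← q2] at hc'
    obtain ⟨j1, j2, j3⟩ := Raw.cellAddr_spec hY hx.stored f1 v1 e1 l1 q1 hc'
    obtain ⟨k, hk', y, g1, g2, g3, g4, g5, g6⟩ := hx.evals_two hY
      (r := Y.addr (f.val s) (v.val s) (e.val s) (l.val s) (q.val s))
      (fun hP => by
        have := Raw.evals le_rfl hP hx.reg hx.mem j1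
        rwa [j2, f2, v2, e2, l2, q2] at this) ha hP
    have s1 := g1.trans (Steps.one (x := y) g6.1 rfl)
    simp only [Cmd.code, List.length_append, List.length_cons, List.length_nil] at hB
    refine ⟨_, ?_, _, s1, ?_, g3.putCell hc g4 g5 rfl rfl⟩
    · rw [State.putCell_t, mul_add]; omega
    · simp [Cmd.code, g2]; omega
  | seq hc hd ihc ihd =>
    intro x hB hP hx
    obtain ⟨h1, h2⟩ := seg_append.1 hP
    simp only [Cmd.code, List.length_append] at hB
    obtain ⟨k, hk, y, g1, g2, g3⟩ := ihc (by omega) h1 hx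
    obtain ⟨k', hk', z, g1', g2', g3'⟩ := ihd (x := y) (by rw [g2]; omega) (by rwa [g2]) g3
    refine ⟨k + k', by omega, z, g1.trans g1', ?_, g3'⟩
    rw [g2', g2, Cmd.code, List.length_append]; omega
  | @iteTrue s s' b c d hb h hc ih =>
    intro x hB hP hx
    obtain ⟨h1, h2⟩ := seg_append.1 hP
    obtain ⟨h2, h3⟩ := seg_append.1 h2
    rw [b.length_code] at h2 h3
    simp only [Cmd.code, List.length_append, List.length_cons, b.length_code] at hB
    obtain ⟨k, hk, y, g1, g2, g3, -⟩ := Cond.code_spec hY hx hb h1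
    have g4 := g3 h
    obtain ⟨k', hk', z, g1', g2', g3'⟩ := ih (x := y) (by rw [g4]; omega) (by rwa [g4]) g2.tick
    rw [g4] at g2'
    have s1 := (g1.trans g1').trans (Steps.one (x := z) (by rw [g2']; exact h3.1) rfl)
    refine ⟨_, ?_, _, s1, ?_, g3'.of_eq rfl fun _ _ => rfl⟩
    · rw [State.tick_t, mul_add] at hk'; omega
    · simp [Cmd.code, b.length_code]; omega
  | @iteFalse s s' b c d hb h hd ih =>
    intro x hB hP hx
    obtain ⟨h1, h2⟩ := seg_append.1 hP
    obtain ⟨h2, h3⟩ := seg_append.1 h2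
    rw [b.length_code] at h2 h3
    simp only [Cmd.code, List.length_append, List.length_cons, b.length_code] at hB
    obtain ⟨k, hk, y, g1, g2, -, g3⟩ := Cond.code_spec hY hx hb h1
    have g4 := g3 h
    obtain ⟨k', hk', z, g1', g2', g3'⟩ := ih (x := y) (by rw [g4]; omega)
      (by rw [g4]; exact h3.2) g2.tick
    rw [g4] at g2'
    refine ⟨_, ?_, _, g1.trans g1', ?_, g3'⟩
    · rw [State.tick_t, mul_add] at hk'; omega
    · rw [g2']; simp [Cmd.code, b.length_code]; omega
  | @whlTrue s s' s'' b c hb h hc hw ihc ihw =>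
    intro x hB hP hx
    have hP' := hP
    obtain ⟨h1, h2⟩ := seg_append.1 hP
    obtain ⟨h2, h3⟩ := seg_append.1 h2
    rw [b.length_code] at h2 h3
    have hB' := hB
    simp only [Cmd.code, List.length_append, List.length_cons, b.length_code] at hB
    obtain ⟨k, hk, y, g1, g2, g3, -⟩ := Cond.code_spec hY hx hb h1
    have g4 := g3 h
    obtain ⟨k', hk', z, g1', g2', g3'⟩ := ihc (x := y) (by rw [g4]; omega) (by rwa [g4]) g2.tick
    rw [g4] at g2'
    have s1 := (g1.trans g1').trans (Steps.one (x := z) (by rw [g2']; exact h3.1) rfl)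
    simp only [if_true] at s1
    obtain ⟨k'', hk'', u, g1'', g2'', g3''⟩ := ihw (x := { z with pc := x.pc }) hB' hP'
      (g3'.of_eq rfl fun _ _ => rfl)
    refine ⟨_, ?_, _, s1.trans g1'', g2'', g3''⟩
    rw [State.tick_t, mul_add] at hk'; omega
  | @whlFalse s b c hb h =>
    intro x hB hP hx
    obtain ⟨h1, h2⟩ := seg_append.1 hP
    simp only [Cmd.code, List.length_append, List.length_cons, b.length_code] at hB
    obtain ⟨k, hk, y, g1, g2, -, g3⟩ := Cond.code_spec hY hx hb h1
    refine ⟨k, ?_, y, g1, ?_, g2.tick⟩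
    · rw [State.tick_t, mul_add]; omega
    · rw [g3 h]; simp [Cmd.code, b.length_code]; omega

end

/-! ### Running the machine code -/

section

variable {Y : Layout} {s : State} {w : ℕ} {P : RamProgram} {x y : RamConfig w}

/-- The state in which an operation with two arguments starts. -/
def State.call (s : State) (i j : ℕ) : State :=
  { s with r := fun d => if d = 0 then i else if d = 1 then j else 0, t := 0 }

/-- The memory represents the memory part of the state. -/
def MemRel (Y : Layout) {w : ℕ} (μ : RamMemory w) (s : State) : Prop :=
  (∀ a, (μ a).toNat = flat Y s a.toNat) ∧ Y.Stored s

theorem space_le_card {μ : RamMemory w} {F : Finset (BitVec w)} (h : ∀ a, μ a ≠ 0 → a ∈ F) :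
    μ.space ≤ F.card := by
  have := Nat.card_mono (s := {a | μ a ≠ 0}) F.finite_toSet h
  rwa [Nat.card_coe_set_eq (F : Set (BitVec w)), Set.ncard_coe_finset] at this

theorem space_update_le (μ : RamMemory w) (a b : BitVec w) :
    RamMemory.space (update μ a b) ≤ μ.space + 1 := by
  classical
  have h : μ.space = ({a | μ a ≠ 0} : Finset (BitVec w)).card := by
    rw [RamMemory.space, Nat.card_eq_fintype_card, Fintype.card_subtype]
  rw [h]
  refine (space_le_card (F := Insert.insert a ({a | μ a ≠ 0} : Finset (BitVec w))) ?_).trans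
    (Finset.card_insert_le _ _)
  intro c hc
  by_cases hca : c = a
  · simp [hca]
  · simpa [hca] using hc

theorem space_step_le (h : P.step x = some y) : y.mem.space ≤ x.mem.space + 1 := by
  unfold RamProgram.step at h
  split at h
  case h_2 => simp at h
  case h_1 i _ =>
    cases i <;> simp only [Instr.exec, Option.some.injEq, reduceCtorEq] at h <;> subst h <;>
      first | exact Nat.le_succ _ | exact space_update_le _ _ _

theorem Steps.haltsIn {k S : ℕ} (h : Steps P k x y) (hy : P.step y = none)
    (hS : x.mem.space + k ≤ S) : P.HaltsIn S k x y := by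
  induction h with
  | refl => exact .done (by omega) hy
  | head h _ ih => exact .step (by omega) h (ih hy (by have := space_step_le h; omega))

/-- A command that is executed in time `τ` gives a machine program that halts in time `O(τ)`. -/
theorem Wp.haltsIn (hY : Y.Fits w) {μ : RamMemory w} (hμ : MemRel Y μ s) {i j : ℕ}
    (hi : i < 2 ^ w) (hj : j < 2 ^ w) {c : Cmd} {Q : State → Prop} {τ S : ℕ}
    (h : Wp Y c Q (s.call i j)) (hτ : ∀ s', Q s' → s'.t ≤ τ)
    (hS : μ.space + (c.code 0).length * τ ≤ S) :
    ∃ s', Q s' ∧ ∃ k ≤ (c.code 0).length * τ, ∃ y : RamConfig w,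
      RamProgram.HaltsIn (c.code 0) S k (RamConfig.call μ i j) y ∧
        (y.reg 0).toNat = s'.r 0 ∧ MemRel Y y.mem s' := by
  obtain ⟨s', hr, hQ⟩ := h
  have hrel : Rel Y (RamConfig.call μ i j) (s.call i j) := by
    refine ⟨fun d _ => ?_, hμ.1, hμ.2⟩
    simp only [RamConfig.call, State.call, update_apply, Pi.zero_apply]
    split_ifs <;> simp_all [Nat.mod_eq_of_lt]
  obtain ⟨k, hk, y, h1, h2, h3⟩ := hr.steps hY (x := RamConfig.call μ i j) le_rfl
    (seg_self _) hrel
  have hpc : (RamConfig.call μ i j).pc = 0 := rfl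
  rw [hpc] at hk h2
  have ht : (s.call i j).t = 0 := rfl
  have hkτ : k ≤ (c.code 0).length * τ := by
    have := Nat.mul_le_mul_left (c.code 0).length (hτ s' hQ)
    rw [ht, mul_zero] at hk; omega
  refine ⟨s', hQ, k, hkτ, y, h1.haltsIn ?_ ?_, h3.reg 0 (by omega), h3.mem, h3.stored⟩
  · rw [RamProgram.step, h2, hpc, List.getElem?_eq_none (by omega)]
  · exact (Nat.add_le_add_left hkτ _).trans hS

/-- The space is at most the number of cells in use of the state. -/
theorem MemRel.space_le {μ : RamMemory w} (h : MemRel Y μ s) {F : Finset ℕ}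
    (hF : ∀ a, flat Y s a ≠ 0 → a ∈ F) : μ.space ≤ F.card := by
  classical
  refine (space_le_card (F := Finset.univ.filter fun a : BitVec w => a.toNat ∈ F) ?_).trans ?_
  · intro a ha
    simp only [Finset.mem_filter, Finset.mem_univ, true_and]
    refine hF _ ?_
    rw [← h.1 a]
    exact fun h0 => ha (by simpa [toNat_eq_iff] using h0)
  · exact Finset.card_le_card_of_injOn BitVec.toNat (fun a ha => by simpa using ha)
      (fun a _ b _ => toNat_eq_iff.2)

end

end Ram

namespace Veb

open Ram

variable {Y : Layout} {s : State} {Q : State → Prop} {x U j e a b p q y : ℕ} {c : NodeCells}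

/-! ### Programs for insertion -/

/-! The registers of the programs for van Emde Boas structures: `rV` is the number of the node, `rE`
and `rL` are the start and the length of the window, `rX` is a digit, `rP` and `rS` are its
neighbors plus one, and `rH` is half the length of the window. The others hold intermediate
results. -/

notation "rV" => Exp.reg 20
notation "rE" => Exp.reg 21
notation "rL" => Exp.reg 22
notation "rX" => Exp.reg 23
notation "rP" => Exp.reg 24
notation "rS" => Exp.reg 25
notation "rM" => Exp.reg 26
notation "rH" => Exp.reg 27
notation "rA" => Exp.reg 28
notation "rB" => Exp.reg 29
notation "rG" => Exp.reg 30
notation "rC" => Exp.reg 31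
notation "rF" => Exp.reg 32

/-- Compute `restMin` into register `26`. -/
def restMinCmd : Cmd :=
  .set 28 (.cell 0 rV (rE + rH) rH (rX >>> (rE + rL))) ;;
  .ite (.eq rA 0) (.set 26 0)
    (.set 26 (.cell 0 rV rE rH ((rA - 1) >>> (rE + rH))) ;;
     .ite (.eq rM 0) (.set 26 rA) .skip)

/-- Store the set of the two digits in the registers `28` and `29`. -/
def pairCmd : Cmd :=
  .putCell 0 rV rE rH (rA >>> (rE + rH)) (rA + 1) ;;
  .putCell 1 rV rE rH (rA >>> (rE + rH)) (rB + 1) ;;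
  .ite (.lt 1 rH)
    (.set 30 (rH / 2) ;;
     .putCell 0 rV (rE + rG) rG (rA >>> (rE + rH)) (rB + 1) ;;
     .putCell 1 rV (rE + rG) rG (rA >>> (rE + rH)) (rB + 1)) .skip

/-- Prepare the insertion into a nonempty set for the insertion into its rest. -/
def insertTopCmd : Cmd :=
  .ite (.lt (rX + 1) rC)
    (restMinCmd ;;
     .putCell 0 rV rE rL (rX >>> (rE + rL)) (rX + 1) ;;
     .set 23 (rC - 1) ;; .set 24 0 ;; .set 25 rM)
    (.ite (.ne rP 0) (.ite (.eq ((rP - 1) >>> rE) ((rC - 1) >>> rE)) (.set 24 0) .skip) .skip ;;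
     .ite (.lt (.cell 1 rV rE rL (rX >>> (rE + rL))) (rX + 1))
       (.putCell 1 rV rE rL (rX >>> (rE + rL)) (rX + 1)) .skip)

/-- Find out whether a neighbor is in the group of the digit to be inserted. -/
def groupCmd : Cmd :=
  .set 32 0 ;;
  .ite (.ne rS 0)
    (.ite (.eq ((rS - 1) >>> (rE + rH)) (rX >>> (rE + rH))) (.set 32 2) .skip) .skip ;;
  .ite (.ne rP 0)
    (.ite (.eq ((rP - 1) >>> (rE + rH)) (rX >>> (rE + rH))) (.set 32 1) .skip) .skip

/-- One level of the insertion; register `22` becomes `0` when the insertion is finished. -/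
def insertStep : Cmd :=
  .set 27 (rL / 2) ;;
  .set 31 (.cell 0 rV rE rL (rX >>> (rE + rL))) ;;
  .ite (.eq rC 0)
    (.putCell 0 rV rE rL (rX >>> (rE + rL)) (rX + 1) ;;
     .putCell 1 rV rE rL (rX >>> (rE + rL)) (rX + 1) ;; .set 22 0)
    (insertTopCmd ;; groupCmd ;;
     .ite (.ne (.cell 0 rV rE rH (rX >>> (rE + rH))) 0) (.set 22 rH)
       (.ite (.eq rF 0) (.set 21 (rE + rH) ;; .set 22 rH)
         (.ite (.eq rF 1) (.set 28 (rP - 1) ;; .set 29 rX) (.set 28 rX ;; .set 29 (rS - 1)) ;;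
          pairCmd ;; .set 22 0)))

/-- Insertion of a digit. -/
def insertCmd : Cmd :=
  .whl (.lt 1 rL) insertStep ;;
  .ite (.eq rL 1)
    (.set 31 (.cell 0 rV rE rL (rX >>> (rE + rL))) ;;
     .ite (.eq rC 0)
      (.putCell 0 rV rE rL (rX >>> (rE + rL)) (rX + 1) ;;
       .putCell 1 rV rE rL (rX >>> (rE + rL)) (rX + 1))
      (.ite (.lt (rX + 1) rC) (.putCell 0 rV rE rL (rX >>> (rE + rL)) (rX + 1))
        (.putCell 1 rV rE rL (rX >>> (rE + rL)) (rX + 1)))) .skip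

/-- The registers other than `21, …, 39` are unchanged, and so are the arrays. -/
def Frame (s s' : State) : Prop := s'.m = s.m ∧ ∀ i, i < 21 ∨ 40 ≤ i → s'.r i = s.r i

/-- The bounds under which the programs run: digits are below `U`, digits plus one fit into words,
and the window lies within the digits. -/
structure Bounds (Y : Layout) (s : State) (j e x : ℕ) : Prop where
  node : s.r 20 < Y.I
  x_lt : x < Y.U
  cells : ∀ k, s.nd (s.r 20) k ≤ Y.U
  window : e + 2 ^ j < Y.T
  t_le : Y.T ≤ Y.W
  u_lt : Y.U + 1 < Y.W

theorem div_lt {k : ℕ} (h : x < U) : x / k < U := (Nat.div_le_self _ _).trans_lt h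

theorem wp_restMin
    (hB : Bounds Y s (j + 1) e x) (he : s.r 21 = e) (hl : s.r 22 = 2 ^ (j + 1)) (hx : s.r 23 = x)
    (hh : s.r 27 = 2 ^ j)
    (hQ : ∀ s', s'.m = s.m → s'.nd = s.nd → (∀ i, i ≠ 26 → i ≠ 28 → s'.r i = s.r i) →
      s'.r 26 = restMin j e x (s.nd (s.r 20)) → s'.t ≤ s.t + 5 → Q s') : Wp Y restMinCmd Q s := by
  obtain ⟨h1, h2, h3, h4, h5, h6⟩ := hB
  have hp : 2 ^ (j + 1) = 2 ^ j + 2 ^ j := by rw [pow_succ]; ring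
  have hp0 := Nat.one_le_two_pow (n := j)
  have hc : ∀ k, s.nd (s.r 20) k - 1 < Y.U := fun k => by have := h3 k; omega
  have hkey : key 0 (e + 2 ^ j) j x = (0, e + 2 ^ j, 2 ^ j, x / 2 ^ (e + 2 ^ (j + 1))) := by
    rw [key, hp, add_assoc]
  simp only [restMin, hkey] at hQ
  simp [restMinCmd, he, hl, hx, hh, Layout.HasCell, div_lt h2, div_lt (hc _), h1]
  generalize s.nd (s.r 20) (0, e + 2 ^ j, 2 ^ j, x / 2 ^ (e + 2 ^ (j + 1))) = v at *
  repeat' first | apply And.intro | intro _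
  all_goals try omega
  all_goals refine hQ _ rfl rfl ?_ ?_ ?_
  all_goals simp +contextual [*, key]

theorem wp_pair (hB : Bounds Y s (j + 1) e a) (he : s.r 21 = e) (hb : b < Y.U)
    (hh : s.r 27 = 2 ^ j) (ha : s.r 28 = a) (hb' : s.r 29 = b)
    (hQ : ∀ s', s'.m = s.m → s'.nd = update s.nd (s.r 20) (pair j e a b (s.nd (s.r 20))) →
      (∀ i, i ≠ 30 → s'.r i = s.r i) → s'.t ≤ s.t + 6 → Q s') : Wp Y pairCmd Q s := by
  obtain ⟨h1, h2, h3, h4, h5, h6⟩ := hB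
  have hp : 2 ^ (j + 1) = 2 ^ j + 2 ^ j := by rw [pow_succ]; ring
  have hp0 := Nat.one_le_two_pow (n := j)
  simp [pairCmd, he, hh, ha, hb', Layout.HasCell, div_lt h2, h1]
  cases j with
  | zero => 
    simp [pair, key] at hQ ⊢
    repeat' first | apply And.intro | intro _
    all_goals try omega
    refine hQ _ ?_ ?_ ?_ ?_ <;> simp
  | succ j =>
    have hp' : 2 ^ (j + 1) = 2 ^ j + 2 ^ j := by rw [pow_succ]; ring
    have hp0' := Nat.one_le_two_pow (n := j)
    have hd : 2 ^ (j + 1) / 2 = 2 ^ j := by omega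
    have hkey : ∀ s, key s (e + 2 ^ j) j a = (s, e + 2 ^ j, 2 ^ j, a / 2 ^ (e + 2 ^ (j + 1))) := by
      intro s; rw [key, hp', add_assoc]
    simp only [pair, hkey] at hQ
    simp [key, hd] at hQ ⊢
    repeat' first | apply And.intro | intro _
    all_goals try omega
    refine hQ _ ?_ ?_ ?_ ?_ <;> simp +contextual

theorem wp_group {l : ℕ} (he : s.r 21 = e)
    (hx : s.r 23 = x) (hp : s.r 24 = p) (hq : s.r 25 = q) (hh : s.r 27 = l) (hW : e + l < Y.W)
    (hQ : ∀ s', s'.m = s.m → s'.nd = s.nd → (∀ i, i ≠ 32 → s'.r i = s.r i) →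
      s'.r 32 = (if p ≠ 0 ∧ (p - 1) / 2 ^ (e + l) = x / 2 ^ (e + l) then 1
        else if q ≠ 0 ∧ (q - 1) / 2 ^ (e + l) = x / 2 ^ (e + l) then 2 else 0) →
      s'.t ≤ s.t + 7 → Q s') : Wp Y groupCmd Q s := by
  simp [groupCmd, he, hx, hp, hq, hh, hW]
  repeat' first | apply And.intro | intro _
  all_goals refine hQ _ rfl rfl ?_ ?_ ?_
  all_goals simp +contextual [*]

/-- The top level of `insert`, in the case of a nonempty set. -/
theorem insert_succ_of_ne {m : ℕ}
    (hm : c (key 0 e (j + 1) x) = m) (h0 : m ≠ 0) : insert (j + 1) e x p q c = if x + 1 < m then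
        insertRest (insert j) j e (m - 1) 0 (restMin j e x c)
          (update c (key 0 e (j + 1) x) (x + 1)) else
        insertRest (insert j) j e x (if p ≠ 0 ∧ (p - 1) / 2 ^ e = (m - 1) / 2 ^ e then 0 else p) q
          (if c (key 1 e (j + 1) x) < x + 1 then update c (key 1 e (j + 1) x) (x + 1)
            else c) := by
  simp [insert, hm, h0]

theorem wp_insertTop
    (hB : Bounds Y s (j + 1) e x) (he : s.r 21 = e) (hl : s.r 22 = 2 ^ (j + 1)) (hx : s.r 23 = x)
    (hp : s.r 24 = p) (hq : s.r 25 = q) (hh : s.r 27 = 2 ^ j) (hc : s.nd (s.r 20) = c)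
    (hm : s.r 31 = c (key 0 e (j + 1) x)) (h0 : s.r 31 ≠ 0) (hpU : p ≤ Y.U) (hqU : q ≤ Y.U)
    (hQ : ∀ s' x' p' q' c', s'.m = s.m → s'.nd = update s.nd (s.r 20) c' →
      (∀ i, i < 23 ∨ i = 27 ∨ 40 ≤ i → s'.r i = s.r i) → s'.r 23 = x' → s'.r 24 = p' → s'.r 25 = q' →
      x' < Y.U → p' ≤ Y.U → q' ≤ Y.U → (∀ k, c' k ≤ Y.U) →
      insert (j + 1) e x p q c = insertRest (insert j) j e x' p' q' c' → s'.t ≤ s.t + 12 → Q s') :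
    Wp Y insertTopCmd Q s := by
  obtain ⟨h1, h2, h3, h4, h5, h6⟩ := id hB
  rw [hc] at h3
  have hp0 := Nat.one_le_two_pow (n := j + 1)
  have hup : ∀ k v (c : NodeCells), (∀ k, c k ≤ Y.U) → v ≤ Y.U →
      ∀ k', update c k v k' ≤ Y.U := by
    intro k v c h3 hv k'
    rw [update_apply]; split_ifs
    · exact hv
    · exact h3 k'
  have hmU : s.r 31 ≤ Y.U := hm ▸ h3 _
  have hk := insert_succ_of_ne (p := p) (q := q) hm.symm h0
  rw [insertTopCmd, wp_ite]
  refine ⟨by simp [hx]; omega, fun h => ?_, fun h => ?_⟩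
  · simp only [holds_lt, val_add, val_reg, val_ofNat, hx] at h
    rw [wp_seq]
    refine wp_restMin (j := j) (e := e) (x := x) ⟨h1, h2, by simpa [hc] using h3, h4, h5, h6⟩ he hl
      hx hh fun s' g1 g2 g3 g4 g5 => ?_
    have hr : restMin j e x c ≤ Y.U := by
      simp only [restMin]; split_ifs <;> first | exact h3 _ | omega
    simp [g3, he, hl, hx, div_lt h2, h1, Layout.HasCell]
    repeat' first | apply And.intro | intro _
    all_goals try omega
    refine hQ _ (s.r 31 - 1) 0 (restMin j e x c)
      (update c (key 0 e (j + 1) x) (x + 1)) ?_ ?_ ?_ ?_ ?_ ?_ ?_ ?_ ?_ ?_ ?_ ?_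
    · simp [g1]
    · simp [g2, hc, key]
    · intro i hi
      simp [g3 i (by omega) (by omega), show i ≠ 23 by omega, show i ≠ 24 by omega,
        show i ≠ 25 by omega]
    · simp
    · simp
    · simp [g4, hc]
    · omega
    · omega
    · omega
    · exact hup _ _ _ h3 (by omega)
    · rw [hk, if_pos h]
    · simp at g5 ⊢; omega
  · simp only [holds_lt, val_add, val_reg, val_ofNat, hx] at h
    rw [if_neg h] at hk
    rw [wp_seq]
    refine Wp.mono (Q := fun s' => s'.m = s.m ∧ s'.nd = s.nd ∧ (∀ i, i ≠ 24 → s'.r i = s.r i) ∧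
      s'.r 24 = (if p ≠ 0 ∧ (p - 1) / 2 ^ e = (s.r 31 - 1) / 2 ^ e then 0 else p) ∧
      s'.t ≤ s.t + 4) ?_ ?_
    · simp [he, hp]
      repeat' first | apply And.intro | intro _
      all_goals simp [*] at *
    rintro s' ⟨g1, g2, g3, g4, g5⟩
    have hQ' := hQ
    simp [g3, g2, he, hl, hx, div_lt h2, h1, hc, Layout.HasCell]
    repeat' first | apply And.intro | intro _
    all_goals try omega
    all_goals rename_i hcc
    all_goals
      refine hQ _ x (if p ≠ 0 ∧ (p - 1) / 2 ^ e = (s.r 31 - 1) / 2 ^ e then 0 else p) q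
        (if c (key 1 e (j + 1) x) < x + 1 then update c (key 1 e (j + 1) x) (x + 1)
          else c) g1 ?_ (fun i hi => g3 i (by omega)) ((g3 _ (by omega)).trans hx) g4
          ((g3 _ (by omega)).trans hq) h2 ?_ hqU ?_ hk ?_
      · simp [key, hcc, g2, hc]
      · split_ifs <;> omega
      · split_ifs
        · exact hup _ _ _ h3 (by omega)
        · exact h3
      · simp at g5 ⊢; omega

theorem update_le {v : ℕ} (h : ∀ k, c k ≤ U) (hv : v ≤ U) (k : ℕ × ℕ × ℕ × ℕ) :
    ∀ k', update c k v k' ≤ U := by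
  intro k'
  rw [update_apply]; split_ifs
  · exact hv
  · exact h k'

theorem pair_le (h : ∀ k, c k ≤ U) (ha : a < U) (hb : b < U) : ∀ k, pair j e a b c k ≤ U := by
  cases j with
  | zero => exact update_le (update_le h ha _) hb _
  | succ j => exact update_le (update_le (update_le (update_le h ha _) hb _) hb _) hb _

theorem wp_insert_done (h : s.r 22 = 0) (hQ : Q s.tick.tick) : Wp Y insertCmd Q s := by
  rw [insertCmd, wp_seq, wp_whl]
  simpa [h] using hQ

/-- The time is proportional to the number of levels. -/
theorem wp_insert (hB : Bounds Y s j e x) (he : s.r 21 = e) (hl : s.r 22 = 2 ^ j) (hx : s.r 23 = x)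
    (hp : s.r 24 = p) (hq : s.r 25 = q) (hc : s.nd (s.r 20) = c) (hpU : p ≤ Y.U) (hqU : q ≤ Y.U)
    (hQ : ∀ s', s'.nd = update s.nd (s.r 20) (insert j e x p q c) →
      (∀ k, insert j e x p q c k ≤ Y.U) → Frame s s' → s'.t ≤ s.t + 50 * (j + 1) → Q s') :
    Wp Y insertCmd Q s := by
  induction j generalizing s e x p q c with
  | zero =>
    obtain ⟨h1, h2, h3, h4, h5, h6⟩ := hB
    rw [hc] at h3
    rw [insertCmd, wp_seq, wp_whl]
    simp only [pow_zero] at h4 hl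
    refine ⟨by simp, fun h => by simp [hl] at h, fun _ => ?_⟩
    simp [he, hl, hx, hc, h1, div_lt h2, Layout.HasCell]
    have hk : ∀ s, key s e 0 x = (s, e, 1, x / 2 ^ (e + 1)) := fun s => rfl
    repeat' first | apply And.intro | intro _
    all_goals try omega
    all_goals refine hQ _ ?_ ?_ ⟨rfl, fun i hi => by simp; omega⟩ (by simp)
    · simp [insert, *]
    · rw [insert, if_pos (by assumption)]; exact update_le (update_le h3 h2 _) h2 _
    · simp [insert, *]
    · rw [insert, if_neg (by assumption), if_pos (by assumption)]; exact update_le h3 h2 _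
    · rename_i g1 g2
      simp [insert, hk, g1, if_neg (not_lt.2 g2), hc]
    · rename_i g1 g2
      rw [insert, hk, if_neg g1, if_neg (not_lt.2 g2)]; exact update_le h3 h2 _
  | succ j ih =>
    obtain ⟨h1, h2, h3, h4, h5, h6⟩ := id hB
    have hpow : 2 ^ (j + 1) = 2 ^ j + 2 ^ j := by rw [pow_succ]; ring
    have hp0 := Nat.one_le_two_pow (n := j)
    rw [insertCmd, wp_seq, wp_whl]
    refine ⟨by simp, fun _ => ?_, fun h => by simp [hl] at h⟩
    suffices h : Wp Y insertStep (Wp Y insertCmd Q) s.tick by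
      exact h.mono fun s' hs' => by rwa [insertCmd, wp_seq] at hs'
    have hd : 2 ^ (j + 1) / 2 = 2 ^ j := by omega
    rw [insertStep]
    simp only [wp_seq, wp_set, wp_ite, wp_putCell]
    simp [-wp_seq, -wp_ite, -wp_set, -wp_putCell, he, hl, hx, hc, h1, div_lt h2, Layout.HasCell, hd]
    rw [hc] at h3
    set c0 := c (0, e, 2 ^ (j + 1), x / 2 ^ (e + 2 ^ (j + 1))) with hc0
    refine ⟨by omega, fun h => ⟨by omega, by omega, by omega, by omega, by omega, by omega,
      wp_insert_done (by simp) ?_⟩, fun h => ?_⟩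
    · have hi : insert (j + 1) e x p q c = update (update c
          (key 0 e (j + 1) x) (x + 1)) (key 1 e (j + 1) x) (x + 1) := by
        rw [insert, key]; simp only [← hc0, h, if_true]
      rw [hi] at hQ
      refine hQ _ (by simp [key, hc]) (update_le (update_le h3 h2 _) h2 _) 
        ⟨rfl, fun i hi => ?_⟩ (by simp; omega)
      simp [show i ≠ 22 by omega, show i ≠ 27 by omega, show i ≠ 31 by omega]
    · refine wp_insertTop (j := j) (e := e) (x := x) (p := p) (q := q) (c := c)
        ⟨h1, h2, by simpa [hc] using h3, h4, h5, h6⟩ (by simp [he])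
        (by simp [hl]) (by simp [hx]) (by simp [hp]) (by simp [hq]) (by simp) (by simpa using hc)
        (by simp [hc0, key]) (by simpa using h) hpU hqU ?_
      intro s1 x1 p1 q1 c1 g1 g2 g3 g4 g5 g6 g7 g8 g9 g10 g11 g12
      have r20 : s1.r 20 = s.r 20 := by rw [g3 _ (by omega)]; simp
      have r21 : s1.r 21 = e := by rw [g3 _ (by omega)]; simp [he]
      have r27 : s1.r 27 = 2 ^ j := by rw [g3 _ (by omega)]; simp
      have n1 : s1.nd (s.r 20) = c1 := by
        rw [g2, show ((s.tick.set 27 (2 ^ j)).set 31 c0).tick.r 20 = s.r 20 by simp]; simp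
      have m1 : s1.m = s.m := by rw [g1]; rfl
      have n2 : ∀ c2, update s1.nd (s.r 20) c2 = update s.nd (s.r 20) c2 := by
        intro c2; rw [g2]; simp
      have f1 : ∀ i, i < 21 ∨ 40 ≤ i → s1.r i = s.r i := by
        intro i hi
        rw [g3 i (by omega)]; simp [show i ≠ 27 by omega, show i ≠ 31 by omega]
      have t1 : s1.t ≤ s.t + 16 := by simp at g12; omega
      clear g1 g2 g3 g12
      rw [wp_seq]
      refine wp_group (e := e) (l := 2 ^ j) r21 g4 g5 g6 r27 (by omega) ?_
      intro s2 k1 k2 k3 k4 k5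
      simp only [wp_seq, wp_set, wp_ite]
      simp [-wp_seq, -wp_ite, -wp_set, -wp_putCell, k2, n1, k3, r20, r21, r27, g4, g5, g6, h1,
        div_lt g7, Layout.HasCell]
      rw [g11] at hQ
      rw [insertRest, show key 0 e j x1 = (0, e, 2 ^ j, x1 / 2 ^ (e + 2 ^ j)) from rfl] at hQ
      refine ⟨by omega, fun hh => ?_, fun hh => ⟨fun h0 => ⟨by omega, ?_⟩, fun h0 => ?_⟩⟩
      · rw [if_pos hh] at hQ
        refine ih (e := e) (x := x1) (p := p1) (q := q1) (c := c1)
          ⟨by simp [k3, r20, h1], g7, by simp [k3, k2, r20, n1, g10], by omega, h5, h6⟩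
          (by simp [k3, r21]) (by simp) (by simp [k3, g4]) (by simp [k3, g5]) (by simp [k3, g6])
          (by simp [k2, k3, r20, n1]) g8 g9 ?_
        intro s' q1 q2 q3 q4
        refine hQ s' ?_ q2 ⟨?_, fun i hi => ?_⟩ ?_
        · rw [q1]; simp [k2, k3, r20, n2]
        · rw [q3.1]; simp [k1, m1]
        · rw [q3.2 i hi]; simp [k3 i (by omega), f1 i hi, show i ≠ 22 by omega]
        · simp at q4; linarith
      · rw [if_neg (by simpa using hh)] at hQ
        rw [h0] at k4
        have hA : ¬ (p1 ≠ 0 ∧ (p1 - 1) / 2 ^ (e + 2 ^ j) = x1 / 2 ^ (e + 2 ^ j)) := by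
          intro hA; rw [if_pos hA] at k4; omega
        rw [if_neg hA] at k4
        have hA' : ¬ (q1 ≠ 0 ∧ (q1 - 1) / 2 ^ (e + 2 ^ j) = x1 / 2 ^ (e + 2 ^ j)) := by
          intro hA'; rw [if_pos hA'] at k4; omega
        rw [if_neg hA, if_neg hA'] at hQ
        refine ih (e := e + 2 ^ j) (x := x1) (p := p1) (q := q1) (c := c1)
          ⟨by simp [k3, r20, h1], g7, by simp [k3, k2, r20, n1, g10], by omega, h5, h6⟩
          (by simp) (by simp) (by simp [k3, g4]) (by simp [k3, g5]) (by simp [k3, g6])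
          (by simp [k2, k3, r20, n1]) g8 g9 ?_
        intro s' q1 q2 q3 q4
        refine hQ s' ?_ q2 ⟨?_, fun i hi => ?_⟩ ?_
        · rw [q1]; simp [k2, k3, r20, n2]
        · rw [q3.1]; simp [k1, m1]
        · rw [q3.2 i hi]; simp [k3 i (by omega), f1 i hi, show i ≠ 21 by omega, show i ≠ 22 by omega]
        · simp at q4; linarith
      · rw [if_neg (by simpa using hh)] at hQ
        -- the common end of both cases
        have hfin : ∀ (s3 : State) (a b : ℕ), a < Y.U → b < Y.U → s3.m = s.m → s3.nd = s2.nd →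
            (∀ i, i ≠ 28 → i ≠ 29 → s3.r i = s2.r i) → s3.r 28 = a → s3.r 29 = b →
            s3.t ≤ s2.t + 8 →
            (∀ s', s'.nd = update s.nd (s.r 20) (pair j e a b c1) →
              (∀ k, pair j e a b c1 k ≤ Y.U) → Frame s s' → s'.t ≤ s.t + 50 * (j + 1 + 1) →
              Q s') →
            Wp Y (pairCmd ;; .set 22 0) (Wp Y insertCmd Q) s3 := by
          intro s3 a b ha hb hm hn hr h28 h29 ht hQ'
          rw [wp_seq]
          have e20 : s3.r 20 = s.r 20 := by rw [hr _ (by omega) (by omega), k3 _ (by omega), r20]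
          have en : s3.nd (s.r 20) = c1 := by rw [hn, k2, n1]
          refine wp_pair (j := j) (e := e) (a := a) (b := b)
            ⟨by rw [e20]; exact h1, ha, by rw [e20, en]; exact g10, by omega, h5, h6⟩
            (by rw [hr _ (by omega) (by omega), k3 _ (by omega), r21]) hb
            (by rw [hr _ (by omega) (by omega), k3 _ (by omega), r27]) h28 h29 ?_
          intro s4 l1 l2 l3 l4
          simp
          refine wp_insert_done (by simp) (hQ' _ ?_ (pair_le g10 ha hb) ⟨?_, fun i hi => ?_⟩ ?_)
          · simp [l2, e20, en, hn, k2, n2]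
          · simp [l1, hm]
          · simp [l3 i (by omega), hr i (by omega) (by omega), k3 i (by omega), f1 i hi,
              show i ≠ 22 by omega]
          · simp; omega
        simp only [wp_seq] at hfin
        by_cases hA : p1 ≠ 0 ∧ (p1 - 1) / 2 ^ (e + 2 ^ j) = x1 / 2 ^ (e + 2 ^ j)
        · rw [if_pos hA] at k4 hQ
          refine ⟨fun _ => ?_, fun h => absurd k4 h⟩
          refine hfin _ (p1 - 1) x1 (by omega) g7 (by simp [k1, m1]) (by simp) (fun i hi hi' => by simp [hi, hi'])
            (by simp) (by simp) (by simp) hQ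
        · rw [if_neg hA] at k4 hQ
          by_cases hA' : q1 ≠ 0 ∧ (q1 - 1) / 2 ^ (e + 2 ^ j) = x1 / 2 ^ (e + 2 ^ j)
          · rw [if_pos hA'] at k4 hQ
            refine ⟨fun h => by omega, fun _ => ?_⟩
            refine hfin _ x1 (q1 - 1) g7 (by omega) (by simp [k1, m1]) (by simp)
              (fun i hi hi' => by simp [hi, hi']) (by simp) (by simp) (by simp) hQ
          · rw [if_neg hA'] at k4; exact absurd k4 h0

/-! ### Programs for deletion -/

/-- The program for `relabelCells`. -/
def relabelCellsCmd : Cmd :=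
  .set 31 (.cell 0 rV rE rL (rX >>> (rE + rL))) ;;
  .ite (.eq ((Exp.cell 1 rV rE rL (rX >>> (rE + rL)) - 1) >>> rE) (rX >>> rE))
    (.putCell 1 rV rE rL (rX >>> (rE + rL)) (rX + 1)) .skip ;;
  .ite (.eq ((rC - 1) >>> rE) (rX >>> rE))
    (.putCell 0 rV rE rL (rX >>> (rE + rL)) (rX + 1)) .skip

/-- The program for `relabel`. -/
def relabelCmd : Cmd :=
  .whl (.lt 1 rL)
    (relabelCellsCmd ;;
     .set 27 (rL / 2) ;;
     .ite (.eq ((rC - 1) >>> rE) (rX >>> rE)) (.set 22 0)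
       (.ite (.eq (.cell 0 rV rE rH (rX >>> (rE + rH))) 0) (.set 21 (rE + rH)) .skip ;;
        .set 22 rH)) ;;
  .ite (.eq rL 1) relabelCellsCmd .skip

/-- Find out whether a set with at least two elements has exactly two elements. -/
def isPairCmd : Cmd :=
  .set 32 1 ;;
  .ite (.lt 1 rL)
    (.set 27 (rL / 2) ;; restMinCmd ;;
     .ite (.eq ((rM - 1) >>> rE) ((Exp.cell 1 rV rE rL (rX >>> (rE + rL)) - 1) >>> rE)) .skip
       (.set 32 0)) .skip

/-- The program for `clear`. -/
def clearCmd : Cmd :=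
  .putCell 0 rV rE rL (rX >>> (rE + rL)) 0 ;;
  .putCell 1 rV rE rL (rX >>> (rE + rL)) 0 ;;
  .ite (.lt 1 rL)
    (.set 27 (rL / 2) ;;
     .putCell 0 rV (rE + rH) rH (rX >>> (rE + rL)) 0 ;;
     .putCell 1 rV (rE + rH) rH (rX >>> (rE + rL)) 0) .skip

/-- Prepare the deletion from a set of at least two elements for the deletion from its rest. -/
def eraseTopCmd : Cmd :=
  .ite (.eq (rX >>> rE) ((rC - 1) >>> rE))
    (restMinCmd ;; .putCell 0 rV rE rL (rX >>> (rE + rL)) rM ;; .set 23 (rM - 1))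
    (.ite (.eq (rX >>> rE) ((rG - 1) >>> rE)) (.putCell 1 rV rE rL (rX >>> (rE + rL)) rP) .skip)

/-- One level of the deletion; register `22` becomes `0` when the deletion is finished. -/
def eraseStep : Cmd :=
  .set 27 (rL / 2) ;;
  .set 31 (.cell 0 rV rE rL (rX >>> (rE + rL))) ;;
  .set 30 (.cell 1 rV rE rL (rX >>> (rE + rL))) ;;
  .ite (.eq ((rC - 1) >>> rE) ((rG - 1) >>> rE))
    (.putCell 0 rV rE rL (rX >>> (rE + rL)) 0 ;;
     .putCell 1 rV rE rL (rX >>> (rE + rL)) 0 ;; .set 22 0)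
    (eraseTopCmd ;;
     .set 22 rH ;;
     .set 31 (.cell 0 rV rE rL (rX >>> (rE + rL))) ;;
     .ite (.eq rC 0) (.set 21 (rE + rL))
       (isPairCmd ;;
        .ite (.eq rF 1)
          (.ite (.eq (rX >>> rE) ((rC - 1) >>> rE))
             (.set 31 (.cell 1 rV rE rL (rX >>> (rE + rL)))) .skip ;;
           clearCmd ;; .set 21 (rE + rL) ;; .set 23 (rC - 1) ;; relabelCmd ;; .set 22 0) .skip))

/-- Deletion of a digit. -/
def eraseCmd : Cmd :=
  .whl (.lt 1 rL) eraseStep ;;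
  .ite (.eq rL 1)
    (.set 31 (.cell 0 rV rE rL (rX >>> (rE + rL))) ;;
     .set 30 (.cell 1 rV rE rL (rX >>> (rE + rL))) ;;
     .ite (.eq ((rC - 1) >>> rE) ((rG - 1) >>> rE))
      (.putCell 0 rV rE rL (rX >>> (rE + rL)) 0 ;;
       .putCell 1 rV rE rL (rX >>> (rE + rL)) 0)
      (.ite (.eq (rX >>> rE) ((rC - 1) >>> rE)) (.putCell 0 rV rE rL (rX >>> (rE + rL)) rG)
        (.putCell 1 rV rE rL (rX >>> (rE + rL)) rC))) .skip

theorem Bounds.tick (h : Bounds Y s j e x) :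
    Bounds Y s.tick j e x := ⟨h.node, h.x_lt, h.cells, h.window, h.t_le, h.u_lt⟩

theorem relabelCells_le {o : ℕ} (h : ∀ k, c k ≤ U) (ho : o < U) :
    ∀ k, relabelCells j e o c k ≤ U := by
  unfold relabelCells
  split_ifs
  · exact update_le (update_le h ho _) ho _
  · exact update_le h ho _
  · exact update_le h ho _
  · exact h

theorem wp_relabelCells
    (hB : Bounds Y s j e x) (he : s.r 21 = e) (hl : s.r 22 = 2 ^ j) (hx : s.r 23 = x)
    (hc : s.nd (s.r 20) = c)
    (hQ : ∀ s', s'.m = s.m → s'.nd = update s.nd (s.r 20) (relabelCells j e x c) →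
      (∀ i, i ≠ 31 → s'.r i = s.r i) → s'.r 31 = c (key 0 e j x) → s'.t ≤ s.t + 5 → Q s') :
    Wp Y relabelCellsCmd Q s := by
  obtain ⟨h1, h2, h3, h4, h5, h6⟩ := hB
  have hne : key 0 e j x ≠ key 1 e j x := by simp [key]
  have hk : ∀ s, key s e j x = (s, e, 2 ^ j, x / 2 ^ (e + 2 ^ j)) := fun s => rfl
  unfold relabelCells at hQ
  simp only [hk] at hQ
  simp [relabelCellsCmd, he, hl, hx, hc, h1, div_lt h2, Layout.HasCell]
  repeat' first | apply And.intro | intro _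
  all_goals try omega
  all_goals refine hQ _ rfl ?_ (fun i hi => by simp [hi]) (by simp) (by simp)
  all_goals simp [*]

theorem wp_relabel (hB : Bounds Y s j e x) (he : s.r 21 = e) (hl : s.r 22 = 2 ^ j) (hx : s.r 23 = x)
    (hc : s.nd (s.r 20) = c) (hQ : ∀ s', s'.nd = update s.nd (s.r 20) (relabel j e x c) →
      (∀ k, relabel j e x c k ≤ Y.U) → Frame s s' → s'.t ≤ s.t + 20 * (j + 1) → Q s') :
    Wp Y relabelCmd Q s := by
  induction j generalizing s e c with
  | zero =>
    rw [relabelCmd, wp_seq, wp_whl]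
    refine ⟨by simp, fun h => by simp [hl] at h, fun _ => ?_⟩
    simp [hl]
    refine wp_relabelCells (j := 0) (e := e) (x := x) (c := c) hB.tick.tick he hl hx hc ?_
    intro s' g1 g2 g3 g4 g5
    refine hQ s' g2 (relabelCells_le (fun k => hc ▸ hB.cells k) hB.x_lt)
      ⟨g1, fun i hi => by rw [g3 i (by omega)]; rfl⟩ (by simp at g5; omega)
  | succ j ih =>
    obtain ⟨h1, h2, h3, h4, h5, h6⟩ := id hB
    have hpow : 2 ^ (j + 1) = 2 ^ j + 2 ^ j := by rw [pow_succ]; ring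
    have hp0 := Nat.one_le_two_pow (n := j)
    have hd : 2 ^ (j + 1) / 2 = 2 ^ j := by omega
    rw [relabelCmd, wp_seq, wp_whl]
    refine ⟨by simp, fun _ => ?_, fun h => by simp [hl] at h⟩
    rw [wp_seq]
    refine wp_relabelCells (j := j + 1) (e := e) (x := x) (c := c) hB.tick he hl hx hc ?_
    intro s1 g1 g2 g3 g4 g5
    set c1 := relabelCells (j + 1) e x c with hc1
    have hc1U : ∀ k, c1 k ≤ Y.U := relabelCells_le (fun k => hc ▸ hB.cells k) hB.x_lt
    have n1 : s1.nd (s.r 20) = c1 := by rw [g2]; simp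
    have m1 : s1.m = s.m := by rw [g1]; rfl
    have n2 : ∀ c2, update s1.nd (s.r 20) c2 = update s.nd (s.r 20) c2 := by
      intro c2; rw [g2]; simp
    have r1 : ∀ i, i ≠ 31 → s1.r i = s.r i := g3
    have t1 : s1.t ≤ s.t + 6 := by simp at g5; omega
    clear g1 g2 g3 g5
    rw [relabel, ← hc1] at hQ
    rw [show key 0 e j x = (0, e, 2 ^ j, x / 2 ^ (e + 2 ^ j)) from rfl] at hQ
    have fin : ∀ s' : State, s'.r 22 = 0 → Q s'.tick.tick →
        Wp Y (.whl (.lt 1 rL) (relabelCellsCmd ;; .set 27 (rL / 2) ;;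
          .ite (.eq ((rC - 1) >>> rE) (rX >>> rE)) (.set 22 0)
          (.ite (.eq (.cell 0 rV rE rH (rX >>> (rE + rH))) 0) (.set 21 (rE + rH)) .skip ;;
          .set 22 rH))) (Wp Y (.ite (.eq rL 1) relabelCellsCmd .skip) Q) s' := by
      intro s' h hQ
      rw [wp_whl]
      simpa [h] using hQ
    simp only [relabelCmd, wp_seq] at ih
    simp only [wp_seq, wp_set, wp_ite, wp_skip]
    simp [-wp_seq, -wp_ite, -wp_set, n1, r1, he, hl, hx, h1, div_lt h2, Layout.HasCell, hd, g4]
    have hfr : ∀ i, i < 21 ∨ 40 ≤ i → i ≠ 21 ∧ i ≠ 22 ∧ i ≠ 27 ∧ i ≠ 31 := fun i hi => by omega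
    refine ⟨fun h => fin _ (by simp) ?_, fun h => ⟨by omega, fun h0 => ⟨by omega, ?_⟩, fun h0 => ?_⟩⟩
    · rw [if_pos h] at hQ
      refine hQ _ ?_ hc1U ⟨?_, fun i hi => ?_⟩ ?_
      · simp [← n2, ← n1]
      · simp [m1]
      · simp [hfr i hi, r1]
      · simp; omega
    · rw [if_neg h, if_neg (by simpa using h0)] at hQ
      refine ih (e := e + 2 ^ j) (c := c1)
        ⟨by simp [r1, h1], h2, by simpa [n1, r1] using hc1U, by omega, h5, h6⟩
        (by simp) (by simp) (by simp [r1, hx]) (by simp [r1, n1]) ?_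
      intro s' q1 q2 q3 q4
      refine hQ s' ?_ q2 ⟨?_, fun i hi => ?_⟩ ?_
      · rw [q1]; simp [r1, n2]
      · rw [q3.1]; simp [m1]
      · rw [q3.2 i hi]; simp [r1, hfr i hi]
      · simp at q4; linarith
    · rw [if_neg h, if_pos h0] at hQ
      refine ih (e := e) (c := c1)
        ⟨by simp [r1, h1], h2, by simpa [n1, r1] using hc1U, by omega, h5, h6⟩
        (by simp [r1, he]) (by simp) (by simp [r1, hx]) (by simp [r1, n1]) ?_
      intro s' q1 q2 q3 q4
      refine hQ s' ?_ q2 ⟨?_, fun i hi => ?_⟩ ?_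
      · rw [q1]; simp [r1, n2]
      · rw [q3.1]; simp [m1]
      · rw [q3.2 i hi]; simp [r1, hfr i hi]
      · simp at q4; linarith

theorem restMin_le (h : ∀ k, c k ≤ U) : restMin j e x c ≤ U := by
  simp only [restMin]; split_ifs <;> first | exact h _ | omega

theorem clear_le (h : ∀ k, c k ≤ U) : ∀ k, clear j e x c k ≤ U := by
  have hu := fun {c : NodeCells} (h : ∀ k, c k ≤ U) => update_le h U.zero_le
  cases j with
  | zero => exact hu (hu h _) _
  | succ j => exact hu (hu (hu (hu h _) _) _) _

theorem wp_isPair (hB : Bounds Y s j e x) (he : s.r 21 = e) (hl : s.r 22 = 2 ^ j) (hx : s.r 23 = x)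
    (hc : s.nd (s.r 20) = c) (hQ : ∀ s', s'.m = s.m → s'.nd = s.nd →
      (∀ i, i ≠ 26 → i ≠ 27 → i ≠ 28 → i ≠ 32 → s'.r i = s.r i) →
      s'.r 32 = (if IsPair j e x c then 1 else 0) → s'.t ≤ s.t + 12 → Q s') :
    Wp Y isPairCmd Q s := by
  obtain ⟨h1, h2, h3, h4, h5, h6⟩ := id hB
  cases j with
  | zero =>
    simp only [IsPair] at hQ
    simp [isPairCmd, hl]
    exact hQ _ rfl rfl (fun i h1 h2 h3 h4 => by simp [h4]) (by simp) (by simp)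
  | succ j =>
    have hpow : 2 ^ (j + 1) = 2 ^ j + 2 ^ j := by rw [pow_succ]; ring
    have hp0 := Nat.one_le_two_pow (n := j)
    have hd : 2 ^ (j + 1) / 2 = 2 ^ j := by omega
    simp only [IsPair] at hQ
    simp [isPairCmd, hl, hd]
    refine wp_restMin (j := j) (e := e) (x := x) ⟨h1, h2, h3, h4, h5, h6⟩ (by simp [he])
      (by simp [hl]) (by simp [hx]) (by simp) ?_
    intro s1 g1 g2 g3 g4 g5
    have r1 : ∀ i, i ≠ 26 → i ≠ 27 → i ≠ 28 → i ≠ 32 → s1.r i = s.r i := by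
      intro i a b c d
      rw [g3 i a c]; simp [b, d]
    have r32 : s1.r 32 = 1 := by rw [g3 _ (by omega) (by omega)]; simp
    have n1 : s1.nd (s.r 20) = c := by rw [g2]; simpa using hc
    have g4 : s1.r 26 = restMin j e x c := by rw [g4]; simp [hc]
    simp at g5
    simp [r1, he, hl, hx, n1, g4, h1, div_lt h2, Layout.HasCell]
    refine ⟨by omega, fun h => hQ _ g1 g2 r1 ?_ (by simp; omega), fun h => hQ _ g1 g2 ?_ ?_
      (by simp; omega)⟩
    · simp only [key, h, if_true]; simpa using r32
    · intro i a b c d; simp [d, r1 i a b c d]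
    · simp [key, h]

theorem wp_clear (hB : Bounds Y s j e x) (he : s.r 21 = e) (hl : s.r 22 = 2 ^ j) (hx : s.r 23 = x)
    (hc : s.nd (s.r 20) = c)
    (hQ : ∀ s', s'.m = s.m → s'.nd = update s.nd (s.r 20) (clear j e x c) →
      (∀ i, i ≠ 27 → s'.r i = s.r i) → s'.t ≤ s.t + 6 → Q s') : Wp Y clearCmd Q s := by
  obtain ⟨h1, h2, h3, h4, h5, h6⟩ := id hB
  cases j with
  | zero =>
    simp only [pow_zero] at *
    simp [clearCmd, he, hl, hx, h1, div_lt h2, Layout.HasCell]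
    repeat' first | apply And.intro | intro _
    all_goals try omega
    exact hQ _ (by simp) (by simp [clear, hc, key]) (fun i hi => by simp) (by simp)
  | succ j =>
    have hpow : 2 ^ (j + 1) = 2 ^ j + 2 ^ j := by rw [pow_succ]; ring
    have hp0 := Nat.one_le_two_pow (n := j)
    have hd : 2 ^ (j + 1) / 2 = 2 ^ j := by omega
    have hkey : ∀ s, key s (e + 2 ^ j) j x = (s, e + 2 ^ j, 2 ^ j, x / 2 ^ (e + 2 ^ (j + 1))) := by
      intro s; rw [key, hpow, add_assoc]
    simp [clearCmd, he, hl, hx, h1, hd, div_lt h2, Layout.HasCell]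
    repeat' first | apply And.intro | intro _
    all_goals try omega
    exact hQ _ (by simp) (by simp only [clear, hkey]; simp [hc, key]) (fun i hi => by simp [hi]) (by simp)

theorem wp_eraseTop
    (hB : Bounds Y s (j + 1) e x) (he : s.r 21 = e) (hl : s.r 22 = 2 ^ (j + 1)) (hx : s.r 23 = x)
    (hp : s.r 24 = p) (hh : s.r 27 = 2 ^ j) (hc : s.nd (s.r 20) = c)
    (hm : s.r 31 = c (key 0 e (j + 1) x)) (hM : s.r 30 = c (key 1 e (j + 1) x))
    (h0 : (c (key 0 e (j + 1) x) - 1) / 2 ^ e ≠ (c (key 1 e (j + 1) x) - 1) / 2 ^ e) (hpU : p ≤ Y.U)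
    (hQ : ∀ s' x' c', s'.m = s.m → s'.nd = update s.nd (s.r 20) c' →
      (∀ i, i ≠ 23 → i ≠ 26 → i ≠ 28 → s'.r i = s.r i) → s'.r 23 = x' → x' < Y.U →
      (∀ k, c' k ≤ Y.U) →
      erase (j + 1) e x p c = eraseRest (erase j) j e x' p c' → s'.t ≤ s.t + 10 → Q s') :
    Wp Y eraseTopCmd Q s := by
  obtain ⟨h1, h2, h3, h4, h5, h6⟩ := id hB
  rw [hc] at h3
  have hrU : restMin j e x c ≤ Y.U := restMin_le h3
  have hk : ∀ s, key s e (j + 1) x = (s, e, 2 ^ (j + 1), x / 2 ^ (e + 2 ^ (j + 1))) := fun s => rfl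
  rw [erase] at hQ
  rw [if_neg h0, ← hm, ← hM] at hQ
  rw [eraseTopCmd, wp_ite]
  refine ⟨by simp, fun h => ?_, fun h => ?_⟩
  · simp only [holds_eq, val_shr, val_sub, val_reg, val_ofNat, hx, he] at h
    rw [if_pos h] at hQ
    rw [wp_seq]
    refine wp_restMin (j := j) (e := e) (x := x) hB.tick he hl hx hh ?_
    intro s1 g1 g2 g3 g4 g5
    simp [hc] at g4 g5
    simp [g3, he, hl, hx, h1, g4, div_lt h2, Layout.HasCell]
    refine ⟨by omega, by omega, hQ _ (restMin j e x c - 1) _ ?_ ?_ ?_ (by simp) (by omega) ?_ rfl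
      (by simp; omega)⟩
    · simp [g1]
    · simp [g2, hk, hc]
    · intro i a b c; simp [a, b, c, g3]
    · exact update_le h3 hrU _
  · simp only [holds_eq, val_shr, val_sub, val_reg, val_ofNat, hx, he] at h
    rw [if_neg h] at hQ
    simp [he, hl, hx, h1, hp, div_lt h2, Layout.HasCell]
    refine ⟨fun h' => ⟨by omega, by omega, hQ _ x _ rfl ?_ (fun i a b c => by simp) (by simp [hx])
      h2 ?_ rfl (by simp)⟩, fun h' => hQ _ x _ rfl ?_ (fun i a b c => by simp) (by simp [hx])
      h2 ?_ rfl (by simp)⟩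
    · simp [h', hk, hc]
    · rw [if_pos h']; exact update_le h3 hpU _
    · simp [h', ← hc]
    · rwa [if_neg h']

theorem wp_erase_done (h : s.r 22 = 0) (hQ : Q s.tick.tick) : Wp Y eraseCmd Q s := by
  rw [eraseCmd, wp_seq, wp_whl]
  simpa [h] using hQ

theorem wp_erase (hB : Bounds Y s j e x) (he : s.r 21 = e) (hl : s.r 22 = 2 ^ j) (hx : s.r 23 = x)
    (hp : s.r 24 = p) (hc : s.nd (s.r 20) = c) (hpU : p ≤ Y.U)
    (hQ : ∀ s', s'.nd = update s.nd (s.r 20) (erase j e x p c) →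
      (∀ k, erase j e x p c k ≤ Y.U) → Frame s s' → s'.t ≤ s.t + 80 * (j + 1) → Q s') :
    Wp Y eraseCmd Q s := by
  induction j generalizing s e x p c with
  | zero =>
    obtain ⟨h1, h2, h3, h4, h5, h6⟩ := hB
    rw [hc] at h3
    rw [eraseCmd, wp_seq, wp_whl]
    simp only [pow_zero] at h4 hl
    refine ⟨by simp, fun h => by simp [hl] at h, fun _ => ?_⟩
    have hk : ∀ s, key s e 0 x = (s, e, 1, x / 2 ^ (e + 1)) := fun s => rfl
    rw [erase] at hQ
    simp only [hk] at hQ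
    simp [he, hl, hx, hc, h1, div_lt h2, Layout.HasCell]
    have hfr : ∀ i, i < 21 ∨ 40 ≤ i → i ≠ 30 ∧ i ≠ 31 := fun i hi => by omega
    repeat' first | apply And.intro | intro _
    all_goals try omega
    all_goals refine hQ _ ?_ ?_ ⟨rfl, fun i hi => by simp [hfr i hi]⟩ (by simp)
    · simp [*]
    · rw [if_pos (by assumption)]
      exact update_le (update_le h3 Y.U.zero_le _) Y.U.zero_le _
    · simp [*]
    · rw [if_neg (by assumption), if_pos (by assumption)]; exact update_le h3 (h3 _) _
    · simp [*]
    · rw [if_neg (by assumption), if_neg (by assumption)]; exact update_le h3 (h3 _) _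
  | succ j ih =>
    obtain ⟨h1, h2, h3, h4, h5, h6⟩ := id hB
    have hpow : 2 ^ (j + 1) = 2 ^ j + 2 ^ j := by rw [pow_succ]; ring
    have hp0 := Nat.one_le_two_pow (n := j)
    rw [eraseCmd, wp_seq, wp_whl]
    refine ⟨by simp, fun _ => ?_, fun h => by simp [hl] at h⟩
    suffices h : Wp Y eraseStep (Wp Y eraseCmd Q) s.tick by
      exact h.mono fun s' hs' => by rwa [eraseCmd, wp_seq] at hs'
    have hd : 2 ^ (j + 1) / 2 = 2 ^ j := by omega
    have hk : ∀ s, key s e (j + 1) x = (s, e, 2 ^ (j + 1), x / 2 ^ (e + 2 ^ (j + 1))) :=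
      fun s => rfl
    rw [eraseStep]
    simp only [wp_seq, wp_set, wp_ite, wp_putCell]
    simp [-wp_seq, -wp_ite, -wp_set, -wp_putCell, he, hl, hx, hc, h1, div_lt h2, Layout.HasCell, hd]
    rw [hc] at h3
    have hfr : ∀ i, i < 21 ∨ 40 ≤ i → i ≠ 21 ∧ i ≠ 22 ∧ i ≠ 23 ∧ i ≠ 26 ∧ i ≠ 27 ∧ i ≠ 28 ∧
        i ≠ 30 ∧ i ≠ 31 ∧ i ≠ 32 := fun i hi => by omega
    refine ⟨by omega, fun h => ⟨by omega, by omega, by omega, by omega,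
      wp_erase_done (by simp) ?_⟩, fun h => ?_⟩
    · have hi : erase (j + 1) e x p c = update (update c
          (key 0 e (j + 1) x) 0) (key 1 e (j + 1) x) 0 := by
        rw [erase]; rw [hk, hk, if_pos h]
      rw [hi] at hQ
      refine hQ _ (by simp [hk, hc]) (update_le (update_le h3 Y.U.zero_le _) Y.U.zero_le _)
        ⟨rfl, fun i hi => ?_⟩ (by simp; omega)
      simp [hfr i hi]
    · refine wp_eraseTop (j := j) (e := e) (x := x) (p := p) (c := c)
        ⟨h1, h2, by simpa [hc] using h3, h4, h5, h6⟩ (by simp [he])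
        (by simp [hl]) (by simp [hx]) (by simp [hp]) (by simp) (by simpa using hc)
        (by simp [hk]) (by simp [hk]) (by simpa [hk] using h) hpU ?_
      intro s1 x1 c1 g1 g2 g3 g4 g7 g10 g11 g12
      have r20 : s1.r 20 = s.r 20 := by rw [g3 _ (by omega) (by omega) (by omega)]; simp
      have r21 : s1.r 21 = e := by rw [g3 _ (by omega) (by omega) (by omega)]; simp [he]
      have r24 : s1.r 24 = p := by rw [g3 _ (by omega) (by omega) (by omega)]; simp [hp]
      have r27 : s1.r 27 = 2 ^ j := by rw [g3 _ (by omega) (by omega) (by omega)]; simp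
      have n0 : s1.nd = update s.nd (s.r 20) c1 := by simpa using g2
      have n1 : s1.nd (s.r 20) = c1 := by rw [n0]; simp
      have m1 : s1.m = s.m := by rw [g1]; rfl
      have n2 : ∀ c2, update s1.nd (s.r 20) c2 = update s.nd (s.r 20) c2 := by
        intro c2; rw [n0]; simp
      have f1 : ∀ i, i < 21 ∨ 40 ≤ i → s1.r i = s.r i := by
        intro i hi
        rw [g3 i (by omega) (by omega) (by omega)]; simp [hfr i hi]
      have t1 : s1.t ≤ s.t + 15 := by simp at g12; omega
      clear g1 g2 g3 g12 n0
      rw [g11] at hQ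
      unfold eraseRest at hQ
      dsimp only at hQ
      have hkx : ∀ s, key s e j x1 = (s, e, 2 ^ j, x1 / 2 ^ (e + 2 ^ j)) := fun s => rfl
      simp only [hkx] at hQ
      simp only [wp_seq, wp_set, wp_ite]
      simp [-wp_seq, -wp_ite, -wp_set, -wp_putCell, n1, r20, r21, r27, g4, h1,
        div_lt g7, Layout.HasCell]
      refine ⟨by omega, fun hh => ⟨by omega, ?_⟩, fun hh => ?_⟩
      · rw [if_neg (by simpa using hh)] at hQ
        refine ih (e := e + 2 ^ j) (x := x1) (p := p) (c := c1)
          ⟨by simp [r20, h1], g7, by simp [r20, n1, g10], by omega, h5, h6⟩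
          (by simp) (by simp) (by simp [g4]) (by simp [r24])
          (by simp [r20, n1]) hpU ?_
        intro s' q1 q2 q3 q4
        refine hQ s' ?_ q2 ⟨?_, fun i hi => ?_⟩ ?_
        · rw [q1]; simp [r20, n2]
        · rw [q3.1]; simp [m1]
        · rw [q3.2 i hi]; simp [f1 i hi, hfr i hi]
        · simp at q4; linarith
      · rw [if_pos (by simpa using hh)] at hQ
        refine wp_isPair (j := j) (e := e) (x := x1) (c := c1)
          ⟨by simp [r20, h1], g7, by simp [r20, n1, g10], by omega, h5, h6⟩ (by simp [r21])
          (by simp) (by simp [g4]) (by simp [r20, n1]) ?_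
        intro s2 k1 k2 k3 k4 k5
        have k1' : s2.m = s.m := by rw [k1]; simpa using m1
        have k2' : s2.nd = s1.nd := by simpa using k2
        have r2 : ∀ i, i ≠ 26 → i ≠ 27 → i ≠ 28 → i ≠ 32 → i ≠ 31 → i ≠ 22 → s2.r i = s1.r i := by
          intro i a b c d e f
          rw [k3 i a b c d]; simp [e, f]
        have r22 : s2.r 22 = 2 ^ j := by rw [k3] <;> simp
        have r31 : s2.r 31 = c1 (0, e, 2 ^ j, x1 / 2 ^ (e + 2 ^ j)) := by rw [k3] <;> simp
        have t2 : s2.t ≤ s.t + 30 := by simp at k5; omega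
        clear k1 k2 k3 k5
        by_cases hpair : IsPair j e x1 c1
        · rw [if_pos hpair] at k4 hQ
          -- the common end of both cases
          have hfin : ∀ (s3 : State) (a : ℕ), a - 1 < Y.U → s3.m = s.m → s3.nd = s2.nd →
              (∀ i, i ≠ 31 → s3.r i = s2.r i) → s3.r 31 = a → s3.t ≤ s2.t + 5 →
              (∀ s', s'.nd = update s.nd (s.r 20)
                  (relabel j (e + 2 ^ j) (a - 1) (clear j e x1 c1)) →
                (∀ k, relabel j (e + 2 ^ j) (a - 1) (clear j e x1 c1) k ≤ Y.U) → Frame s s' →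
                s'.t ≤ s.t + 80 * (j + 1 + 1) → Q s') →
              Wp Y (clearCmd ;; .set 21 (rE + rL) ;; .set 23 (rC - 1) ;; relabelCmd ;; .set 22 0)
                (Wp Y eraseCmd Q) s3 := by
            intro s3 a ha hm hn hr h31 ht hQ'
            have e20 : s3.r 20 = s.r 20 := by rw [hr, r2, r20] <;> omega
            have en : s3.nd (s.r 20) = c1 := by rw [hn, k2', n1]
            rw [wp_seq]
            refine wp_clear (j := j) (e := e) (x := x1) (c := c1)
              ⟨by rw [e20]; exact h1, g7, by rw [e20, en]; exact g10, by omega, h5, h6⟩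
              (by rw [hr, r2, r21] <;> omega) (by rw [hr, r22]; omega) (by rw [hr, r2, g4] <;> omega)
              (by rw [e20, en]) ?_
            intro s4 l1 l2 l3 l4
            have e21 : s4.r 21 = e := by rw [l3, hr, r2, r21] <;> omega
            have e22 : s4.r 22 = 2 ^ j := by rw [l3, hr, r22] <;> omega
            have e31 : s4.r 31 = a := by rw [l3, h31]; omega
            simp [e21, e22, e31]
            refine ⟨by omega, ?_⟩
            refine wp_relabel (j := j) (e := e + 2 ^ j) (x := a - 1) (c := clear j e x1 c1)
              ⟨by simp [l3, e20, h1], ha, ?_, by omega, h5, h6⟩ (by simp) (by simp [e22])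
              (by simp) (by simp [l2, l3, e20]) ?_
            · simp [l2, l3, e20, clear_le g10]
            intro s5 z1 z2 z3 z4
            simp
            refine wp_erase_done (by simp) (hQ' _ ?_ z2 ⟨?_, fun i hi => ?_⟩ ?_)
            · simp [z1, l2, l3, hn, k2', n2, e20]
            · simp [z3.1, l1, hm]
            · simp [z3.2 i hi, hfr i hi, l3, hr, r2, f1 i hi]
            · simp at z4 ⊢; omega
          simp [-wp_seq, k4]
          simp only [wp_seq]
          rw [wp_ite]
          simp only [wp_set, wp_skip]
          have hsub : ∀ k, c1 k - 1 < Y.U := fun k => by have := g10 k; omega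
          simp [-wp_seq, -wp_set, r31, r2, r21, g4, r20, k2', n1, h1, r22, div_lt g7,
            Layout.HasCell]
          refine ⟨fun hx1 => ⟨by omega, ?_⟩, fun hx1 => ?_⟩
          · rw [if_pos hx1] at hQ
            refine hfin _ _ (hsub _) ?_ ?_ (fun i hi => ?_) ?_ ?_ hQ <;> simp [*]
          · rw [if_neg hx1] at hQ
            refine hfin _ _ (hsub _) ?_ ?_ (fun i hi => ?_) ?_ ?_ hQ <;> simp [k1', r31]
        · rw [if_neg hpair] at k4 hQ
          simp [-wp_seq, k4]
          refine ih (e := e) (x := x1) (p := p) (c := c1)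
            ⟨by simp [r2, r20, h1], g7, by simp [r2, r20, k2', n1, g10], by omega, h5, h6⟩
            (by simp [r2, r21]) (by simp [r22]) (by simp [r2, g4]) (by simp [r2, r24])
            (by simp [r2, r20, k2', n1]) hpU ?_
          intro s' q1 q2 q3 q4
          refine hQ s' ?_ q2 ⟨?_, fun i hi => ?_⟩ ?_
          · rw [q1]; simp [r2, r20, k2', n2]
          · rw [q3.1]; simp [k1']
          · rw [q3.2 i hi]; simp [r2, f1 i hi, hfr i hi]
          · simp at q4; linarith

/-! ### A program for the search of neighbors -/

/-- The descent of the search. Register `30` keeps track of the path: a digit `1` stands for a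
descent into the summary, a digit `0` for one into a cluster. -/
def descendCmd : Cmd :=
  .whl (.eq rM 0)
    (.set 31 (.cell 0 rV rE rL (rX >>> (rE + rL))) ;;
     .ite (.le (rX >>> rE) ((rC - 1) >>> rE)) (.set 28 (rC - 1) ;; .set 26 1)
      (.set 31 (.cell 1 rV rE rL (rX >>> (rE + rL))) ;;
       .set 32 0 ;;
       .ite (.eq rL 1) (.set 32 1) .skip ;;
       .ite (.le ((rC - 1) >>> rE) (rX >>> rE)) (.set 32 1) .skip ;;
       .ite (.eq rF 1) (.set 28 (rC - 1) ;; .set 26 1)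
        (.set 22 (rL / 2) ;;
         .ite (.eq (.cell 0 rV rE rL (rX >>> (rE + rL))) 0)
           (.set 21 (rE + rL) ;; .set 30 (rG * 2 + 1)) (.set 30 (rG * 2)))))

/-- The way back: `liftNeighbor` is applied at each descent into a summary. -/
def ascendCmd : Cmd :=
  .whl (.lt 1 rG)
    (.ite (.eq (rG % 2) 1)
      (.set 21 (rE - rL) ;;
       .set 31 (.cell 0 rV rE rL (rA >>> (rE + rL))) ;;
       .ite (.eq rC 0) .skip
        (.ite (.lt (rA >>> (rE + rL)) (rX >>> (rE + rL)))
          (.set 28 (.cell 1 rV rE rL (rA >>> (rE + rL)) - 1)) (.set 28 (rC - 1)))) .skip ;;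
     .set 30 (rG / 2) ;; .set 22 (rL * 2))

/-- The program for `neighbor`; its result is in register `28`. -/
def neighborCmd : Cmd := .set 26 0 ;; .set 30 1 ;; descendCmd ;; ascendCmd

theorem neighbor_lt (hU : 0 < U) (h : ∀ k, c k ≤ U) : neighbor j e y c < U := by
  have hc : ∀ k, c k - 1 < U := fun k => by have := h k; omega
  induction j generalizing e with
  | zero => simp only [neighbor]; split_ifs <;> exact hc _
  | succ j ih =>
    simp only [neighbor, liftNeighbor]
    split_ifs
    all_goals first | exact hc _ | exact ih

theorem wp_descend {π : ℕ}
    (hB : Bounds Y s j e y) (he : s.r 21 = e) (hl : s.r 22 = 2 ^ j) (hy : s.r 23 = y)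
    (hπ : s.r 30 = π) (hπ0 : 0 < π) (hπW : (π + 1) * 2 ^ j ≤ Y.W) (h0 : s.r 26 = 0)
    (hW : e + 2 * 2 ^ j < Y.W)
    (hQ : ∀ s', s'.nd = s.nd → Frame s s' → s'.r 28 = neighbor j e y (s.nd (s.r 20)) →
      s'.r 21 = e → s'.r 22 = 2 ^ j → s'.r 23 = y → s'.r 30 = π → s'.t ≤ s.t + 30 * (j + 1) →
      Wp Y ascendCmd Q s') : Wp Y descendCmd (Wp Y ascendCmd Q) s := by
  induction j generalizing s e π with
  | zero =>
    obtain ⟨h1, h2, h3, h4, h5, h6⟩ := id hB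
    have hfr : ∀ i, i < 21 ∨ 40 ≤ i → i ≠ 26 ∧ i ≠ 28 ∧ i ≠ 31 ∧ i ≠ 32 := fun i hi => by omega
    simp only [pow_zero] at h4 hl
    have hk : ∀ s, key s e 0 y = (s, e, 1, y / 2 ^ (e + 1)) := fun s => rfl
    simp only [neighbor, hk] at hQ
    have hfin : ∀ s' Q', s'.r 26 = 1 → Q' s'.tick → Wp Y descendCmd Q' s' := by
      intro s' Q' h hQ'
      rw [descendCmd, wp_whl]; simpa [h] using hQ'
    rw [descendCmd, wp_whl]
    refine ⟨by simp, fun _ => ?_, fun h => by simp [h0] at h⟩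
    rw [← descendCmd]
    simp [he, hl, hy, h1, div_lt h2, Layout.HasCell]
    repeat' first | apply And.intro | intro _
    all_goals try omega
    all_goals
      refine hfin _ _ (by simp) (hQ _ (by simp) ⟨rfl, fun i hi => by simp [hfr i hi]⟩ ?_ ?_ ?_ ?_ ?_ ?_)
    all_goals try simp [*]
  | succ j ih =>
    obtain ⟨h1, h2, h3, h4, h5, h6⟩ := id hB
    have hfr : ∀ i, i < 21 ∨ 40 ≤ i → i ≠ 21 ∧ i ≠ 22 ∧ i ≠ 26 ∧ i ≠ 28 ∧ i ≠ 30 ∧ i ≠ 31 ∧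
      i ≠ 32 := fun i hi => by omega
    have hpow : 2 ^ (j + 1) = 2 ^ j + 2 ^ j := by rw [pow_succ]; ring
    have hp0 := Nat.one_le_two_pow (n := j)
    have hd : 2 ^ (j + 1) / 2 = 2 ^ j := by omega
    have hL1 : 2 ^ (j + 1) ≠ 1 := by omega
    have hk : ∀ s, key s e (j + 1) y = (s, e, 2 ^ (j + 1), y / 2 ^ (e + 2 ^ (j + 1))) :=
      fun s => rfl
    have hkj : key 0 e j y = (0, e, 2 ^ j, y / 2 ^ (e + 2 ^ j)) := rfl
    simp only [neighbor, hk, hkj] at hQ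
    have hfin : ∀ s' Q', s'.r 26 = 1 → Q' s'.tick → Wp Y descendCmd Q' s' := by
      intro s' Q' h hQ'
      rw [descendCmd, wp_whl]; simpa [h] using hQ'
    rw [descendCmd, wp_whl]
    refine ⟨by simp, fun _ => ?_, fun h => by simp [h0] at h⟩
    rw [← descendCmd]
    simp only [wp_seq, wp_set, wp_ite, wp_skip]
    set c := s.nd (s.r 20) with hc
    have hc' : s.nd (s.r 20) = c := rfl
    by_cases hA : y / 2 ^ e ≤ (c (0, e, 2 ^ (j + 1), y / 2 ^ (e + 2 ^ (j + 1))) - 1) / 2 ^ e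
    · rw [if_pos hA] at hQ
      simp [he, hl, hy, h1, div_lt h2, Layout.HasCell, hc', hA]
      repeat' apply And.intro
      all_goals try omega
      refine hfin _ _ (by simp) (hQ _ (by simp)
        ⟨rfl, fun i hi => by simp [hfr i hi]⟩ ?_ ?_ ?_ ?_ ?_ ?_)
      all_goals simp [he, hl, hy, hπ]
      omega
    have hA' := not_le.1 hA
    rw [if_neg hA] at hQ
    by_cases hBc : (c (1, e, 2 ^ (j + 1), y / 2 ^ (e + 2 ^ (j + 1))) - 1) / 2 ^ e ≤ y / 2 ^ e
    · rw [if_pos hBc] at hQ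
      simp [-wp_set, he, hl, hy, h1, div_lt h2, Layout.HasCell, hc', hA, hBc]
      repeat' apply And.intro
      all_goals try omega
      refine hfin _ _ (by simp) (hQ _ (by simp)
        ⟨rfl, fun i hi => by simp [hfr i hi]⟩ ?_ ?_ ?_ ?_ ?_ ?_)
      all_goals simp [he, hl, hy, hπ]
      omega
    have hB' := not_le.1 hBc
    rw [if_neg hBc] at hQ
    by_cases hC : c (0, e, 2 ^ j, y / 2 ^ (e + 2 ^ j)) = 0
    · rw [if_neg (by simpa using hC)] at hQ
      have e1 : (π * 2 + 1 + 1) * 2 ^ j ≤ Y.W := by rw [hpow] at hπW; linarith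
      have e2 : π * 2 + 1 < Y.W := by
        have := Nat.le_mul_of_pos_right (π * 2 + 1 + 1) hp0; omega
      simp [he, hl, hy, h1, hπ, div_lt h2, Layout.HasCell, hc', hA, hBc, hd, hC]
      repeat' apply And.intro
      all_goals try omega
      refine ih (e := e + 2 ^ j) (π := π * 2 + 1)
        ⟨by simpa using h1, h2, by simpa using h3, by omega, h5, h6⟩ (by simp) (by simp)
        (by simp [hy]) (by simp) (by omega) e1 (by simp [h0]) (by omega) ?_
      intro s1 g1 g2 g3 g4 g5 g6 g7 g8
      have r20 : s1.r 20 = s.r 20 := by rw [g2.2 _ (by omega)]; simp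
      have g1' : s1.nd = s.nd := by rw [g1]; simp
      set z := neighbor j (e + 2 ^ j) y c with hz
      have hzU : z < Y.U := neighbor_lt (by omega) h3
      have g3' : s1.r 28 = z := by rw [g3]; simp [hz, ← hc']
      have hodd : (π * 2 + 1) % 2 = 1 := by omega
      have hhalf : (π * 2 + 1) / 2 = π := by omega
      have hL2 : 2 ^ j * 2 = 2 ^ (j + 1) := by omega
      have hgt : 1 < π * 2 + 1 := by omega
      have hkz : ∀ s, key s e j z = (s, e, 2 ^ j, z / 2 ^ (e + 2 ^ j)) := fun s => rfl
      simp only [liftNeighbor, hkz] at hQ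
      rw [ascendCmd, wp_whl]
      refine ⟨by simp, fun _ => ?_, fun h => absurd hgt (by simpa [g7] using h)⟩
      rw [← ascendCmd]
      have hframe : ∀ i, i < 21 ∨ 40 ≤ i → s1.r i = s.r i := by
        intro i hi
        rw [g2.2 i hi]; simp [hfr i hi]
      have hm1 : s1.m = s.m := by rw [g2.1]; simp
      have ht1 : s1.t ≤ s.t + 12 + 30 * (j + 1) := by simp at g8; omega
      by_cases hD : c (0, e, 2 ^ j, z / 2 ^ (e + 2 ^ j)) = 0
      · rw [if_pos hD] at hQ
        simp [g3', g4, g5, g6, g7, r20, h1, hodd, hhalf, hL2, div_lt hzU, Layout.HasCell, g1', hc',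
          hD]
        repeat' apply And.intro
        all_goals try omega
        refine hQ _ (by simp [g1']) ⟨by simp [hm1], fun i hi => ?_⟩ ?_ ?_ ?_ ?_ ?_ ?_
        · simp [hfr i hi, hframe i hi]
        all_goals simp [g3', g6]
        omega
      rw [if_neg hD] at hQ
      by_cases hE : z / 2 ^ (e + 2 ^ j) < y / 2 ^ (e + 2 ^ j)
      · rw [if_pos hE] at hQ
        simp [g3', g4, g5, g6, g7, r20, h1, hodd, hhalf, hL2, div_lt hzU, Layout.HasCell, g1', hc',
          hD, hE]
        repeat' apply And.intro
        all_goals try omega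
        refine hQ _ (by simp [g1']) ⟨by simp [hm1], fun i hi => ?_⟩ ?_ ?_ ?_ ?_ ?_ ?_
        · simp [hfr i hi, hframe i hi]
        all_goals simp [g6]
        omega
      · rw [if_neg hE] at hQ
        simp [g3', g4, g5, g6, g7, r20, h1, hodd, hhalf, hL2, div_lt hzU, Layout.HasCell, g1', hc',
          hD, hE]
        repeat' apply And.intro
        all_goals try omega
        refine hQ _ (by simp [g1']) ⟨by simp [hm1], fun i hi => ?_⟩ ?_ ?_ ?_ ?_ ?_ ?_
        · simp [hfr i hi, hframe i hi]
        all_goals simp [g6]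
        omega
    · rw [if_pos (by simpa using hC)] at hQ
      have e1 : (π * 2 + 1) * 2 ^ j ≤ Y.W := by rw [hpow] at hπW; linarith
      have e2 : π * 2 < Y.W := by
        have := Nat.le_mul_of_pos_right (π * 2 + 1) hp0; omega
      simp [he, hl, hy, h1, hπ, div_lt h2, Layout.HasCell, hc', hA, hBc, hd, hC]
      repeat' apply And.intro
      all_goals try omega
      refine ih (e := e) (π := π * 2)
        ⟨by simpa using h1, h2, by simpa using h3, by omega, h5, h6⟩ (by simp [he]) (by simp)
        (by simp [hy]) (by simp) (by omega) e1 (by simp [h0]) (by omega) ?_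
      intro s1 g1 g2 g3 g4 g5 g6 g7 g8
      have g1' : s1.nd = s.nd := by rw [g1]; simp
      have g3' : s1.r 28 = neighbor j e y c := by rw [g3]; simp [← hc']
      have hgt : 1 < π * 2 := by omega
      have hL2 : 2 ^ j * 2 = 2 ^ (j + 1) := by omega
      rw [ascendCmd, wp_whl]
      refine ⟨by simp, fun _ => ?_, fun h => absurd hgt (by simpa [g7] using h)⟩
      rw [← ascendCmd]
      simp [g5, g7, hL2]
      repeat' apply And.intro
      all_goals try omega
      refine hQ _ (by simp [g1']) ⟨by simp [g2.1], fun i hi => ?_⟩ ?_ ?_ ?_ ?_ ?_ ?_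
      · simp [hfr i hi, g2.2 i hi]
      all_goals simp [g3', g4, g6]
      simp at g8; omega

theorem wp_neighbor
    (hB : Bounds Y s j e y) (he : s.r 21 = e) (hl : s.r 22 = 2 ^ j) (hy : s.r 23 = y)
    (hW : e + 2 * 2 ^ j < Y.W)
    (hQ : ∀ s', s'.nd = s.nd → Frame s s' → s'.r 28 = neighbor j e y (s.nd (s.r 20)) →
      s'.t ≤ s.t + 40 * (j + 1) → Q s') : Wp Y neighborCmd Q s := by
  simp [neighborCmd]
  refine wp_descend (j := j) (e := e) (y := y) (π := 1)
    ⟨by simpa using hB.node, hB.x_lt, by simpa using hB.cells, hB.window, hB.t_le, hB.u_lt⟩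
    (by simp [he]) (by simp [hl]) (by simp [hy]) (by simp) (by omega) (by omega) (by simp) hW ?_
  intro s1 g1 g2 g3 g4 g5 g6 g7 g8
  rw [ascendCmd, wp_whl]
  simp [g7]
  refine hQ _ (by simp [g1]) ⟨by simp [g2.1], fun i hi => ?_⟩ ?_ ?_
  · rw [State.tick_r, g2.2 i hi]
    simp [show i ≠ 26 by omega, show i ≠ 30 by omega]
  · simp [g3]
  · simp at g8 ⊢; omega

end Veb

/-! ### Tries -/

namespace Trie

open Veb

/-- The node `(γ, h, q)` of the trie of the color `γ` stands for the positions `p` with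
`p / U ^ h = q`. -/
abbrev Node := ℕ × ℕ × ℕ

/-- The pointer to a node: its number, or the position plus one if the node is a leaf. -/
def ptr (nid : Node → ℕ) (x : Node) : ℕ := if x.2.1 = 0 then x.2.2 + 1 else nid x

/-- The digits of the linked children of the node at height `h + 1`. -/
def digits (J : ℕ) (L : Set Node) (γ h q : ℕ) : Set ℕ :=
  {d | d < 2 ^ 2 ^ J ∧ (γ, h, q * 2 ^ 2 ^ J + d) ∈ L}

/-- The tries of the colors below `n`, of height `D` and with digits of `2 ^ J` bits. `A` is the set
of allocated inner nodes, `L` is the set of nodes that are linked to their parents. The node `x` has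
the number `nid x`. The array `ch`, which is array `15`, holds the pointers to the
children. The stack `fr` of unused numbers, which is array `4`, has its size at index `0`. -/
structure Inv (n D J : ℕ) (A L : Set Node) (nid : Node → ℕ) (ch fr : ℕ → ℕ)
    (nd : ℕ → NodeCells) : Prop where
  root : ∀ γ < n, (γ, D, 0) ∈ A
  nid_root : ∀ γ < n, nid (γ, D, 0) = γ
  height : ∀ x ∈ A, x.1 < n ∧ 1 ≤ x.2.1 ∧ x.2.1 ≤ D ∧ (x.2.1 = D → x.2.2 = 0)
  nid_mem : ∀ x ∈ A, x.2.1 < D → n ≤ nid x ∧ nid x < n + n * D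
  inj : Set.InjOn nid A
  linked : ∀ x ∈ L, 1 ≤ x.2.1 → x ∈ A
  child : ∀ γ h q, (γ, h + 1, q) ∈ A → ∀ d < 2 ^ 2 ^ J,
    ((γ, h, q * 2 ^ 2 ^ J + d) ∈ L →
      ch (nid (γ, h + 1, q) * 2 ^ 2 ^ J + d) = ptr nid (γ, h, q * 2 ^ 2 ^ J + d)) ∧
    ((γ, h, q * 2 ^ 2 ^ J + d) ∉ L → ch (nid (γ, h + 1, q) * 2 ^ 2 ^ J + d) = 0)
  veb : ∀ γ h q, (γ, h + 1, q) ∈ A →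
    VebRep J 0 0 (digits J L γ h q) (· < 2 ^ 2 ^ J) (nd (nid (γ, h + 1, q)))
  bound : ∀ v k, nd v k ≤ 2 ^ 2 ^ J
  supp : ∀ v k, ¬ InSub J 0 0 k → nd v k = 0
  unused : ∀ v, v ∉ nid '' A → (∀ k, nd v k = 0) ∧ ∀ d < 2 ^ 2 ^ J, ch (v * 2 ^ 2 ^ J + d) = 0
  free : ∃ F : List ℕ, F.Nodup ∧ F.length = fr 0 ∧ (∀ i (hi : i < F.length), fr (i + 1) = F[i]) ∧
    ∀ v, v ∈ F ↔ (n ≤ v ∧ v < n + n * D) ∧ v ∉ nid '' A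
  free_supp : ∀ i, n * D < i → fr i = 0

section

variable {n D J : ℕ} {A L : Set Node} {nid : Node → ℕ} {ch fr : ℕ → ℕ} {nd : ℕ → NodeCells}

theorem slot_inj {U v v' d d' : ℕ} (hd : d < U) (hd' : d' < U) (h : v * U + d = v' * U + d') :
    v = v' ∧ d = d' := by
  have h1 : (v * U + d) / U = v := by
    rw [mul_comm, Nat.mul_add_div (by omega), Nat.div_eq_of_lt hd, add_zero]
  have h2 : (v' * U + d') / U = v' := by
    rw [mul_comm, Nat.mul_add_div (by omega), Nat.div_eq_of_lt hd', add_zero]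
  have : v = v' := by rw [← h1, ← h2, h]
  subst this; exact ⟨rfl, by omega⟩

theorem Inv.nid_lt (I : Inv n D J A L nid ch fr nd) {x : Node} (hx : x ∈ A) :
    nid x < n + n * D := by
  obtain ⟨γ, h, q⟩ := x
  obtain ⟨h1, h2, h3, h4⟩ := I.height _ hx
  simp only at h1 h2 h3 h4
  rcases h3.lt_or_eq with h5 | rfl
  · exact (I.nid_mem _ hx h5).2
  · rw [h4 rfl, I.nid_root γ h1]; omega

/-- Allocate a node. -/
theorem Inv.alloc (I : Inv n D J A L nid ch fr nd) {γ h q : ℕ} (hγ : γ < n) (h1 : 1 ≤ h)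
    (hD : h < D) (hA : (γ, h, q) ∉ A) (hL : ∀ d, (γ, h - 1, d) ∈ L → d / 2 ^ 2 ^ J ≠ q)
    (hfr : fr 0 ≠ 0) :
    Inv n D J (Insert.insert (γ, h, q) A) L (update nid (γ, h, q) (fr (fr 0))) ch
      (update fr 0 (fr 0 - 1)) nd ∧ fr (fr 0) < n + n * D ∧ 0 < fr (fr 0) := by
  obtain ⟨F, f1, f2, f3, f4⟩ := I.free
  have hlast : fr (fr 0) = F[fr 0 - 1]'(by omega) := by
    rw [← f3 (fr 0 - 1) (by omega)]; congr 1; omega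
  set v := fr (fr 0) with hv
  have hvF : v ∈ F := hlast ▸ List.getElem_mem _
  obtain ⟨⟨v1, v2⟩, v3⟩ := (f4 v).1 hvF
  have hLx : (γ, h, q) ∉ L := fun hx => hA (I.linked _ hx h1)
  have hne : ∀ x ∈ A, x ≠ (γ, h, q) := fun x hx he => hA (he ▸ hx)
  have hnid : ∀ x ∈ A, update nid (γ, h, q) v x = nid x := fun x hx =>
    update_of_ne (hne x hx) _ _
  have hptr : ∀ x ∈ L, ptr (update nid (γ, h, q) v) x = ptr nid x := by
    intro x hx
    unfold ptr
    rw [update_of_ne (by rintro rfl; exact hLx hx)]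
  have himg : update nid (γ, h, q) v '' Insert.insert (γ, h, q) A =
      Insert.insert v (nid '' A) := by
    rw [Set.image_insert_eq, update_self, Set.image_congr hnid]
  have hnoch : ∀ d < 2 ^ 2 ^ J, (γ, h - 1, q * 2 ^ 2 ^ J + d) ∉ L := by
    intro d hd hmem
    refine hL _ hmem ?_
    rw [mul_comm, Nat.mul_add_div (by positivity), Nat.div_eq_of_lt hd, add_zero]
  obtain ⟨u1, u2⟩ := I.unused v v3
  refine ⟨⟨fun γ hγ => .inr (I.root γ hγ), fun γ' hγ' => ?_, ?_, ?_, ?_,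
    fun x hx h1 => .inr (I.linked x hx h1), ?_, ?_, I.bound, I.supp, ?_, ?_, fun i hi => ?_⟩, v2,
    by omega⟩
  · rw [hnid _ (I.root γ' hγ')]; exact I.nid_root γ' hγ'
  · rintro x (rfl | hx)
    · exact ⟨hγ, h1, by simp; omega, by simp; omega⟩
    · exact I.height x hx
  · rintro x (rfl | hx) hxD
    · rw [update_self]; exact ⟨v1, v2⟩
    · rw [hnid x hx]; exact I.nid_mem x hx hxD
  · rintro x (rfl | hx) y (rfl | hy) hxy
    · rfl
    · rw [update_self, hnid y hy] at hxy; exact absurd ⟨y, hy, hxy.symm⟩ v3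
    · rw [update_self, hnid x hx] at hxy; exact absurd ⟨x, hx, hxy⟩ v3
    · rw [hnid x hx, hnid y hy] at hxy; exact I.inj hx hy hxy
  · rintro γ' h' q' (he | hx) d hd
    · simp only [Prod.mk.injEq] at he
      obtain ⟨rfl, rfl, rfl⟩ := he
      rw [update_self]
      exact ⟨fun hmem => absurd hmem (hnoch d hd), fun _ => u2 d hd⟩
    · rw [hnid _ hx]
      refine ⟨fun hmem => ?_, (I.child γ' h' q' hx d hd).2⟩
      rw [hptr _ hmem]; exact (I.child γ' h' q' hx d hd).1 hmem
  · rintro γ' h' q' (he | hx)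
    · simp only [Prod.mk.injEq] at he
      obtain ⟨rfl, rfl, rfl⟩ := he
      have : digits J L γ' h' q' = ∅ := by
        ext d
        simp only [digits, Set.mem_ofPred_eq, Set.mem_empty_iff_false, iff_false]
        exact fun hd => hnoch d hd.1 hd.2
      rw [update_self, this]; exact VebRep.of_zero fun k _ => u1 k
    · rw [hnid _ hx]; exact I.veb γ' h' q' hx
  · intro u hu
    rw [himg] at hu; exact I.unused u fun h => hu (.inr h)
  · refine ⟨F.dropLast, f1.sublist (List.dropLast_sublist F), by simp [f2], ?_, ?_⟩
    · intro i hi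
      rw [List.length_dropLast] at hi
      rw [List.getElem_dropLast, update_of_ne (by omega)]; exact f3 i (by omega)
    · intro u
      have hFne : F ≠ [] := by rintro rfl; simp at hvF
      have hgl : F.getLast hFne = v := by rw [List.getLast_eq_getElem, hlast]; simp [f2]
      have hsplit := List.dropLast_append_getLast hFne
      rw [hgl] at hsplit
      have hnd : v ∉ F.dropLast := by
        intro hm
        rw [← hsplit] at f1
        exact (List.nodup_append.1 f1).2.2 v hm v (by simp) rfl
      have hmemF : u ∈ F ↔ u ∈ F.dropLast ∨ u = v := by
        conv_lhs => rw [← hsplit]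
        simp
      rw [himg, Set.mem_insert_iff]
      have := f4 u
      constructor
      · intro hu
        have h2 := this.1 (hmemF.2 (.inl hu))
        refine ⟨h2.1, ?_⟩
        rintro (rfl | h3)
        · exact hnd hu
        · exact h2.2 h3
      · rintro ⟨h2, h3⟩
        have := hmemF.1 (this.2 ⟨h2, fun h => h3 (.inr h)⟩)
        exact this.resolve_right fun h => h3 (.inl h)
  · rw [update_of_ne (by omega)]; exact I.free_supp i hi

/-- Free a node. -/
theorem Inv.dealloc (I : Inv n D J A L nid ch fr nd) {γ h q : ℕ} (h1 : 1 ≤ h)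
    (hD : h < D) (hA : (γ, h, q) ∈ A) (hLx : (γ, h, q) ∉ L)
    (hL : ∀ d, (γ, h - 1, d) ∈ L → d / 2 ^ 2 ^ J ≠ q) : Inv n D J (A \ {(γ, h, q)}) L nid ch
      (update (update fr (fr 0 + 1) (nid (γ, h, q))) 0 (fr 0 + 1)) nd ∧
      fr 0 < n * D := by
  obtain ⟨F, f1, f2, f3, f4⟩ := I.free
  have hnoch : ∀ d < 2 ^ 2 ^ J, (γ, h - 1, q * 2 ^ 2 ^ J + d) ∉ L := by
    intro d hd hmem
    refine hL _ hmem ?_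
    rw [mul_comm, Nat.mul_add_div (by positivity), Nat.div_eq_of_lt hd, add_zero]
  obtain ⟨h, rfl⟩ : ∃ h', h = h' + 1 := ⟨h - 1, by omega⟩
  have himg : ∀ v, v ∈ nid '' (A \ {(γ, h + 1, q)}) ↔ v ∈ nid '' A ∧ v ≠ nid (γ, h + 1, q) := by
    intro v
    constructor
    · rintro ⟨x, ⟨hx, hne⟩, rfl⟩
      exact ⟨⟨x, hx, rfl⟩, fun h => hne (I.inj hx hA h)⟩
    · rintro ⟨⟨x, hx, rfl⟩, hne⟩
      exact ⟨x, ⟨hx, fun h => hne (by rw [Set.mem_singleton_iff.1 h])⟩, rfl⟩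
  have hnm := I.nid_mem _ hA hD
  have hnF : nid (γ, h + 1, q) ∉ F := fun hm => ((f4 _).1 hm).2 ⟨_, hA, rfl⟩
  have hsub : Insert.insert (nid (γ, h + 1, q)) F.toFinset ⊆ Finset.Ico n (n + n * D) := by
    intro v hv
    rw [Finset.mem_insert, List.mem_toFinset] at hv
    rw [Finset.mem_Ico]
    rcases hv with rfl | hv
    · exact hnm
    · exact ((f4 v).1 hv).1
  have hcard := Finset.card_le_card hsub
  rw [Finset.card_insert_of_notMem (by simpa using hnF), List.toFinset_card_of_nodup f1,
    Nat.card_Ico, f2] at hcard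
  refine ⟨⟨fun γ' hγ' => ⟨I.root γ' hγ', ?_⟩, I.nid_root, fun x hx => I.height x hx.1,
    fun x hx => I.nid_mem x hx.1, I.inj.mono Set.sdiff_subset,
    fun x hx h1 => ⟨I.linked x hx h1, fun h => hLx ?_⟩,
    fun γ' h' q' hx => I.child γ' h' q' hx.1, fun γ' h' q' hx => I.veb γ' h' q' hx.1, I.bound,
    I.supp, ?_, ?_, fun i hi => ?_⟩, by omega⟩
  · simp only [Set.mem_singleton_iff, Prod.mk.injEq]
    rintro ⟨-, h, -⟩; omega
  · rw [← Set.mem_singleton_iff.1 h]; exact hx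
  · intro v hv
    rw [himg, not_and_or, not_not] at hv
    rcases hv with hv | rfl
    · exact I.unused v hv
    · have hv := I.veb γ h q hA
      have : digits J L γ h q = ∅ := by
        ext d
        simp only [digits, Set.mem_ofPred_eq, Set.mem_empty_iff_false, iff_false]
        exact fun hd => hnoch d hd.1 hd.2
      rw [this] at hv
      refine ⟨fun k => ?_, fun d hd => (I.child γ h q hA d hd).2 (hnoch d hd)⟩
      by_cases hk : InSub J 0 0 k
      · exact hv.zero_of_empty hk
      · exact I.supp _ k hk
  · refine ⟨F ++ [nid (γ, h + 1, q)], ?_, by simp [f2], ?_, ?_⟩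
    · refine List.nodup_append.2 ⟨f1, by simp, fun a ha b hb => ?_⟩
      rw [List.mem_singleton.1 hb]
      rintro rfl; exact hnF ha
    · intro i hi
      simp only [List.length_append, List.length_singleton] at hi
      rw [update_of_ne (by omega)]
      rcases Nat.lt_or_ge i F.length with h5 | h5
      · rw [update_of_ne (by omega), f3 i h5, List.getElem_append_left h5]
      · have : i = F.length := by omega
        subst this; simp [f2]
    · intro v
      rw [List.mem_append, List.mem_singleton, f4, himg]
      constructor
      · rintro (⟨h5, h6⟩ | rfl)
        · exact ⟨h5, fun h => h6 h.1⟩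
        · exact ⟨hnm, fun h => h.2 rfl⟩
      · rintro ⟨h5, h6⟩
        by_cases hv : v = nid (γ, h + 1, q)
        · exact .inr hv
        · exact .inl ⟨h5, fun h => h6 ⟨h, hv⟩⟩
  · rw [update_of_ne (by omega), update_of_ne (by omega)]; exact I.free_supp i hi

theorem digits_insert {γ h q d : ℕ} (hd : d < 2 ^ 2 ^ J) :
    digits J (Insert.insert (γ, h, q * 2 ^ 2 ^ J + d) L) γ h q =
      Insert.insert d (digits J L γ h q) := by
  ext d'
  simp only [digits, Set.mem_ofPred_eq, Set.mem_insert_iff, Prod.mk.injEq, true_and]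
  grind

theorem digits_diff {γ h q d : ℕ} :
    digits J (L \ {(γ, h, q * 2 ^ 2 ^ J + d)}) γ h q = digits J L γ h q \ {d} := by
  ext d'
  simp only [digits, Set.mem_ofPred_eq, Set.mem_sdiff, Set.mem_singleton_iff, Prod.mk.injEq,
    true_and]
  grind

theorem slot_ne {γ h q d γ' h' q' d' : ℕ} (hd : d < 2 ^ 2 ^ J) (hd' : d' < 2 ^ 2 ^ J)
    (hne : (γ', h' + 1, q') ≠ (γ, h + 1, q)) :
    (γ', h', q' * 2 ^ 2 ^ J + d') ≠ (γ, h, q * 2 ^ 2 ^ J + d) := by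
  intro he
  simp only [Prod.mk.injEq] at he
  obtain ⟨rfl, rfl, h3⟩ := he; exact hne (by rw [(slot_inj hd' hd h3).1])

/-- Link or unlink a child: the conditions for the pointers and for the set of digits. -/
theorem Inv.relink (I : Inv n D J A L nid ch fr nd) {γ h q d v : ℕ} {L' : Set Node} {c : NodeCells}
    (hA : (γ, h + 1, q) ∈ A) (hd : d < 2 ^ 2 ^ J)
    (hL' : ∀ x, x ≠ (γ, h, q * 2 ^ 2 ^ J + d) → (x ∈ L' ↔ x ∈ L))
    (hx : (γ, h, q * 2 ^ 2 ^ J + d) ∈ L' → 1 ≤ h → (γ, h, q * 2 ^ 2 ^ J + d) ∈ A)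
    (hv1 : (γ, h, q * 2 ^ 2 ^ J + d) ∈ L' → v = ptr nid (γ, h, q * 2 ^ 2 ^ J + d))
    (hv2 : (γ, h, q * 2 ^ 2 ^ J + d) ∉ L' → v = 0)
    (hc : VebRep J 0 0 (digits J L' γ h q) (· < 2 ^ 2 ^ J) c)
    (hcU : ∀ k, c k ≤ 2 ^ 2 ^ J) (hcs : ∀ k, ¬ InSub J 0 0 k → c k = 0) :
    Inv n D J A L' nid (update ch (nid (γ, h + 1, q) * 2 ^ 2 ^ J + d) v) fr
      (update nd (nid (γ, h + 1, q)) c) := by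
  refine ⟨I.root, I.nid_root, I.height, I.nid_mem, I.inj, ?_, ?_, ?_, ?_, ?_, ?_, I.free,
    I.free_supp⟩
  · intro x hxL h1
    by_cases he : x = (γ, h, q * 2 ^ 2 ^ J + d)
    · subst he; exact hx hxL h1
    · exact I.linked x ((hL' x he).1 hxL) h1
  · intro γ' h' q' hA' d' hd'
    by_cases he : (γ', h' + 1, q') = (γ, h + 1, q) ∧ d' = d
    · obtain ⟨he, rfl⟩ := he
      simp only [Prod.mk.injEq, add_left_inj] at he
      obtain ⟨rfl, rfl, rfl⟩ := he
      simp only [update_self]; exact ⟨hv1, hv2⟩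
    · have hne : (γ', h', q' * 2 ^ 2 ^ J + d') ≠ (γ, h, q * 2 ^ 2 ^ J + d) := by
        intro h3
        simp only [Prod.mk.injEq] at h3
        obtain ⟨rfl, rfl, h3⟩ := h3
        obtain ⟨rfl, rfl⟩ := slot_inj hd' hd h3; exact he ⟨rfl, rfl⟩
      have hne' : nid (γ', h' + 1, q') * 2 ^ 2 ^ J + d' ≠ nid (γ, h + 1, q) * 2 ^ 2 ^ J + d := by
        intro h3
        obtain ⟨h4, h5⟩ := slot_inj hd' hd h3; exact he ⟨I.inj hA' hA h4, h5⟩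
      rw [hL' _ hne, update_of_ne hne']; exact I.child γ' h' q' hA' d' hd'
  · intro γ' h' q' hA'
    by_cases he : (γ', h' + 1, q') = (γ, h + 1, q)
    · simp only [Prod.mk.injEq, add_left_inj] at he
      obtain ⟨rfl, rfl, rfl⟩ := he
      rwa [update_self]
    · rw [update_of_ne fun h3 => he (I.inj hA' hA h3)]
      have : digits J L' γ' h' q' = digits J L γ' h' q' := by
        ext d'
        simp only [digits, Set.mem_ofPred_eq]
        exact and_congr_right fun hd' => hL' _ (slot_ne hd hd' he)
      rw [this]; exact I.veb γ' h' q' hA'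
  · intro u k
    by_cases hu : u = nid (γ, h + 1, q)
    · rw [hu, update_self]; exact hcU k
    · rw [update_of_ne hu]; exact I.bound u k
  · intro u k hk
    by_cases hu : u = nid (γ, h + 1, q)
    · rw [hu, update_self]; exact hcs k hk
    · rw [update_of_ne hu]; exact I.supp u k hk
  · intro u hu
    have hne : u ≠ nid (γ, h + 1, q) := fun he => hu ⟨_, hA, he.symm⟩
    rw [update_of_ne hne]
    refine ⟨(I.unused u hu).1, fun d' hd' => ?_⟩
    rw [update_of_ne fun h3 => hne (slot_inj hd' hd h3).1]; exact (I.unused u hu).2 d' hd'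

end

open Veb Ram

/-- The inner nodes of the tries for the sets `S γ`. -/
def inner (n D J : ℕ) (S : ℕ → Set ℕ) : Set Node :=
  {x | (x.1 < n ∧ x.2.1 = D ∧ x.2.2 = 0) ∨
    (1 ≤ x.2.1 ∧ x.2.1 < D ∧ ∃ p ∈ S x.1, p / (2 ^ 2 ^ J) ^ x.2.1 = x.2.2)}

/-- The nodes of the tries for the sets `S γ`, without the roots. -/
def below (D J : ℕ) (S : ℕ → Set ℕ) : Set Node :=
  {x | x.2.1 < D ∧ ∃ p ∈ S x.1, p / (2 ^ 2 ^ J) ^ x.2.1 = x.2.2}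

/-- The layout has room for the tries. -/
structure Fits (Y : Layout) (n D J : ℕ) : Prop where
  size : Y.U = 2 ^ 2 ^ J
  window : Y.T = 2 ^ J + 1
  nodes : Y.I = n + n * D
  slots : (n + n * D) * 2 ^ 2 ^ J ≤ Y.N
  arr : Y.N < Y.W
  shift : (D + 1) * 2 ^ J < Y.W
  n_le : n ≤ (2 ^ 2 ^ J) ^ D
  n_pos : 1 ≤ n
  D_pos : 1 ≤ D

/-- The parameters stored in the memory. -/
structure Params (D J : ℕ) (s : State) : Prop where
  U : s.m 0 1 = 2 ^ 2 ^ J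
  b : s.m 0 2 = 2 ^ J
  D : s.m 0 3 = D

/-- The state holds the tries for the sets `S γ` of numbers below `n`. -/
structure Holds (n D J : ℕ) (S : ℕ → Set ℕ) (A L : Set Node) (nid : Node → ℕ) (s : State) :
    Prop where
  inv : Inv n D J A L nid (s.m 15) (s.m 4) s.nd
  params : Params D J s
  lt : ∀ γ, ∀ p ∈ S γ, γ < n ∧ p < n

theorem Fits.bounds {Y : Layout} {n D J : ℕ} (F : Fits Y n D J) :
    Y.T ≤ Y.W ∧ Y.U + 1 < Y.W ∧ 2 * 2 ^ J < Y.W ∧ n + n * D + 1 < Y.N ∧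
      2 ^ 2 ^ J < Y.N ∧ ∀ v < n + n * D, ∀ d < 2 ^ 2 ^ J, v * 2 ^ 2 ^ J + d < Y.N := by
  have h1 : 2 ^ J < 2 ^ 2 ^ J := Nat.lt_two_pow_self
  have h2 := F.slots
  have h3 : 2 ≤ n + n * D := by
    have := Nat.le_mul_of_pos_right n F.D_pos
    have := F.n_pos; omega
  have h4 : 2 * 2 ^ 2 ^ J ≤ (n + n * D) * 2 ^ 2 ^ J := Nat.mul_le_mul_right _ h3
  have h5 := F.arr
  have h6 := F.size
  have h7 := F.window
  have h0 := Nat.one_le_two_pow (n := J)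
  have h8 : (n + n * D) * 2 ≤ (n + n * D) * 2 ^ 2 ^ J := Nat.mul_le_mul_left _ (by omega)
  refine ⟨by omega, by omega, by omega, ?_, by omega, fun v hv d hd => ?_⟩
  · rcases Nat.lt_or_ge 2 (n + n * D) with h9 | h9
    · omega
    · rcases Nat.eq_zero_or_pos J with rfl | hJ
      · simp only [pow_zero, pow_one] at *; omega
      · have : 2 ^ 1 ≤ 2 ^ J := Nat.pow_le_pow_right (by omega) hJ
        have : 2 ^ 2 ≤ 2 ^ 2 ^ J := Nat.pow_le_pow_right (by omega) (by omega); omega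
  · calc v * 2 ^ 2 ^ J + d < v * 2 ^ 2 ^ J + 2 ^ 2 ^ J := by omega
      _ = (v + 1) * 2 ^ 2 ^ J := by ring
      _ ≤ (n + n * D) * 2 ^ 2 ^ J := Nat.mul_le_mul_right _ hv
      _ ≤ _ := h2

section

variable {n D J : ℕ} {S : ℕ → Set ℕ} {γ h p q : ℕ}

theorem div_pow_succ (p h U : ℕ) : p / U ^ h / U = p / U ^ (h + 1) := by
  rw [Nat.div_div_eq_div_mul, pow_succ]

theorem prefix_eq (p h U : ℕ) : p / U ^ (h + 1) * U + p / U ^ h % U = p / U ^ h := by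
  rw [← div_pow_succ]; exact Nat.div_add_mod' _ _

theorem shift_eq (p h J : ℕ) : p / 2 ^ (h * 2 ^ J) = p / (2 ^ 2 ^ J) ^ h := by
  rw [← pow_mul, mul_comm]

theorem mem_inner (hlt : ∀ γ, ∀ p ∈ S γ, γ < n ∧ p < n) (hn : n ≤ (2 ^ 2 ^ J) ^ D) (h1 : 1 ≤ h)
    (hD : h ≤ D) (hγ : γ < n) : (∃ p ∈ S γ, p / (2 ^ 2 ^ J) ^ h = q) →
      (γ, h, q) ∈ inner n D J S := by
  rintro ⟨p, hp, rfl⟩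
  rcases hD.lt_or_eq with h2 | rfl
  · exact .inr ⟨h1, h2, p, hp, rfl⟩
  · exact .inl ⟨hγ, rfl, Nat.div_eq_of_lt ((hlt γ p hp).2.trans_le hn)⟩

/-- A node of the trie of `S γ` next to the path to `v`, on the side of smaller positions if `f` is
one and on the other side otherwise: its subtree contains an element that is closest to `v`. -/
def Beside (J : ℕ) (C : Set ℕ) (v f h q : ℕ) : Prop :=
  (∃ x ∈ C, x / (2 ^ 2 ^ J) ^ h = q) ∧
    ((f = 1 ∧ q < v / (2 ^ 2 ^ J) ^ h ∧ ∀ x ∈ C, x ≤ v → x / (2 ^ 2 ^ J) ^ h ≤ q) ∨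
      (f = 0 ∧ v / (2 ^ 2 ^ J) ^ h < q ∧ ∀ x ∈ C, v ≤ x → q ≤ x / (2 ^ 2 ^ J) ^ h))

theorem mem_digits_below (hD : h < D) {d : ℕ} : d ∈ digits J (below D J S) γ h q ↔
    d < 2 ^ 2 ^ J ∧ ∃ x ∈ S γ, x / (2 ^ 2 ^ J) ^ h = q * 2 ^ 2 ^ J + d := by
  simp [digits, below, hD]

theorem exists_digit (hD : h < D) (hq : ∃ x ∈ S γ, x / (2 ^ 2 ^ J) ^ (h + 1) = q) :
    (digits J (below D J S) γ h q).Nonempty := by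
  obtain ⟨x, hx, rfl⟩ := hq
  exact ⟨_, (mem_digits_below hD).2 ⟨Nat.mod_lt _ (by positivity), x, hx, (prefix_eq x h _).symm⟩⟩

theorem Beside.step {v f d : ℕ} (hD : h < D) (hB : Beside J (S γ) v f (h + 1) q)
    (hd : d ∈ digits J (below D J S) γ h q)
    (h1 : f = 1 → ∀ d' ∈ digits J (below D J S) γ h q, d' ≤ d)
    (h0 : f = 0 → ∀ d' ∈ digits J (below D J S) γ h q, d ≤ d') :
    Beside J (S γ) v f h (q * 2 ^ 2 ^ J + d) := by
  obtain ⟨hdU, hd⟩ := (mem_digits_below hD).1 hd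
  obtain ⟨-, hB⟩ := hB
  have hU : 0 < 2 ^ 2 ^ J := by positivity
  have hdig : ∀ x ∈ S γ, x / (2 ^ 2 ^ J) ^ (h + 1) = q →
      x / (2 ^ 2 ^ J) ^ h % 2 ^ 2 ^ J ∈ digits J (below D J S) γ h q := by
    rintro x hx rfl
    exact (mem_digits_below hD).2 ⟨Nat.mod_lt _ hU, x, hx, (prefix_eq x h _).symm⟩
  refine ⟨hd, hB.imp ?_ ?_⟩
  · rintro ⟨rfl, g1, g2⟩
    refine ⟨rfl, ?_, fun x hx hxv => ?_⟩
    · by_contra hn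
      have := Nat.div_le_div_right (c := 2 ^ 2 ^ J) (not_lt.1 hn)
      rw [div_pow_succ, mul_comm, Nat.mul_add_div hU, Nat.div_eq_of_lt hdU] at this; omega
    · have g3 := g2 x hx hxv
      have g4 := prefix_eq x h (2 ^ 2 ^ J)
      have g5 := Nat.mod_lt (x / (2 ^ 2 ^ J) ^ h) hU
      rcases g3.lt_or_eq with g3 | g3
      · have := Nat.mul_le_mul_right (2 ^ 2 ^ J) (Nat.succ_le_of_lt g3)
        rw [Nat.succ_mul] at this; omega
      · have := h1 rfl _ (hdig x hx g3)
        rw [g3] at g4; omega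
  · rintro ⟨rfl, g1, g2⟩
    refine ⟨rfl, ?_, fun x hx hxv => ?_⟩
    · by_contra hn
      have := Nat.div_le_div_right (c := 2 ^ 2 ^ J) (not_lt.1 hn)
      rw [div_pow_succ, mul_comm, Nat.mul_add_div hU, Nat.div_eq_of_lt hdU] at this; omega
    · have g3 := g2 x hx hxv
      have g4 := prefix_eq x h (2 ^ 2 ^ J)
      rcases g3.lt_or_eq with g3 | g3
      · have := Nat.mul_le_mul_right (2 ^ 2 ^ J) (Nat.succ_le_of_lt g3)
        rw [Nat.succ_mul] at this; omega
      · have := h0 rfl _ (hdig x hx g3.symm)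
        rw [← g3] at g4; omega

/-- The first node beside the path to `v`. -/
theorem Beside.start {v d : ℕ} (hD : h < D)
    (hd : IsNeighbor (digits J (below D J S) γ h (v / (2 ^ 2 ^ J) ^ (h + 1)))
      (v / (2 ^ 2 ^ J) ^ h % 2 ^ 2 ^ J) d) (hv : (γ, h, v / (2 ^ 2 ^ J) ^ h) ∉ below D J S) :
    Beside J (S γ) v (if d < v / (2 ^ 2 ^ J) ^ h % 2 ^ 2 ^ J then 1 else 0) h
      (v / (2 ^ 2 ^ J) ^ (h + 1) * 2 ^ 2 ^ J + d) := by
  have hU : 0 < 2 ^ 2 ^ J := by positivity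
  have hnv : ∀ x ∈ S γ, x / (2 ^ 2 ^ J) ^ h ≠ v / (2 ^ 2 ^ J) ^ h := fun x hx he =>
    hv ⟨hD, x, hx, he⟩
  obtain ⟨hd, hdn⟩ := hd
  obtain ⟨hdU, x0, hx0, hd⟩ := (mem_digits_below hD).1 hd
  have hv4 := prefix_eq v h (2 ^ 2 ^ J)
  set y := v / (2 ^ 2 ^ J) ^ h % 2 ^ 2 ^ J with hy
  have hyd : d ≠ y := by
    rintro rfl; exact hnv x0 hx0 (by rw [hd, hv4])
  have hdig : ∀ x ∈ S γ, x / (2 ^ 2 ^ J) ^ (h + 1) = v / (2 ^ 2 ^ J) ^ (h + 1) →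
      x / (2 ^ 2 ^ J) ^ h % 2 ^ 2 ^ J ∈ digits J (below D J S) γ h (v / (2 ^ 2 ^ J) ^ (h + 1)) :=
    fun x hx he => (mem_digits_below hD).2 ⟨Nat.mod_lt _ hU, x, hx, by rw [← he, prefix_eq]⟩
  refine ⟨⟨x0, hx0, hd⟩, ?_⟩
  have hcase : ∀ x ∈ S γ, (x ≤ v → x / (2 ^ 2 ^ J) ^ h < v / (2 ^ 2 ^ J) ^ h) ∧
      (v ≤ x → v / (2 ^ 2 ^ J) ^ h < x / (2 ^ 2 ^ J) ^ h) := fun x hx =>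
    ⟨fun h1 => lt_of_le_of_ne (Nat.div_le_div_right h1) (hnv x hx),
      fun h1 => lt_of_le_of_ne (Nat.div_le_div_right h1) (hnv x hx).symm⟩
  rcases hdn with ⟨h1, h2⟩ | ⟨h1, h2⟩
  · have hlt : d < y := by omega
    rw [if_pos hlt]
    refine .inl ⟨rfl, by omega, fun x hx hxv => ?_⟩
    have g1 := (hcase x hx).1 hxv
    have g4 := prefix_eq x h (2 ^ 2 ^ J)
    have g5 := Nat.mod_lt (x / (2 ^ 2 ^ J) ^ h) hU
    rcases (Nat.div_le_div_right (c := (2 ^ 2 ^ J) ^ (h + 1)) hxv).lt_or_eq with g3 | g3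
    · have := Nat.mul_le_mul_right (2 ^ 2 ^ J) (Nat.succ_le_of_lt g3)
      rw [Nat.succ_mul] at this; omega
    · have := h2 _ (hdig x hx g3) (by rw [g3] at g4; omega)
      rw [g3] at g4; omega
  · rw [if_neg (by omega)]
    refine .inr ⟨rfl, by omega, fun x hx hxv => ?_⟩
    have g1 := (hcase x hx).2 hxv
    have g4 := prefix_eq x h (2 ^ 2 ^ J)
    rcases (Nat.div_le_div_right (c := (2 ^ 2 ^ J) ^ (h + 1)) hxv).lt_or_eq with g3 | g3
    · have := Nat.mul_le_mul_right (2 ^ 2 ^ J) (Nat.succ_le_of_lt g3)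
      rw [Nat.succ_mul] at this; omega
    · have := h2 _ (hdig x hx g3.symm) (by rw [← g3] at g4; omega)
      rw [← g3] at g4; omega

theorem Beside.isNeighbor {C : Set ℕ} {v f q : ℕ} (hB : Beside J C v f 0 q) : IsNeighbor C v q := by
  obtain ⟨⟨x, hx, rfl⟩, hB⟩ := hB
  simp only [pow_zero, Nat.div_one] at *
  refine ⟨hx, hB.imp ?_ ?_⟩
  · rintro ⟨-, h1, h2⟩; exact ⟨h1.le, h2⟩
  · rintro ⟨-, h1, h2⟩; exact ⟨h1.le, h2⟩

end

/-! ### The search in a trie -/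

/-- The state during a walk along the path to the position `v` in the trie of the color `γ`, at the
height `h`. -/
structure Walk (n D J γ v h : ℕ) (s : State) : Prop where
  pos : s.r 40 = v
  color : s.r 41 = γ
  height : s.r 42 = h
  b : s.r 48 = 2 ^ J
  U : s.r 49 = 2 ^ 2 ^ J

/-- The digit of the number `a` that belongs to the next node of the walk. -/
def digitExp (a : Exp) : Exp := (a >>> ((Exp.reg 42 - 1) * Exp.reg 48)) % .reg 49

/-- The index of the pointer for the digit in register `45`. -/
def slotExp : Exp := rV * .reg 49 + .reg 45

/-- Start a walk at the root. -/
def startCmd : Cmd :=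
  .set 49 (.arr 0 1) ;; .set 48 (.arr 0 2) ;; .set 42 (.arr 0 3) ;; .set 20 (.reg 41)

section

variable {Y : Layout} {n D J γ v h : ℕ} {s : State} {S : ℕ → Set ℕ} {A L : Set Node}
  {nid : Node → ℕ}

theorem Fits.shift_ok (F : Fits Y n D J) (hD : h ≤ D) :
    (h + 1) * 2 ^ J < Y.W ∧ h * 2 ^ J < Y.W := by
  have h1 := Nat.mul_le_mul_right (2 ^ J) (Nat.succ_le_succ hD)
  have h2 : h * 2 ^ J ≤ (h + 1) * 2 ^ J := Nat.mul_le_mul_right _ (by omega)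
  exact ⟨h1.trans_lt F.shift, (h2.trans h1).trans_lt F.shift⟩

theorem Fits.slot (F : Fits Y n D J) {d i : ℕ} (hd : d < 2 ^ 2 ^ J) (hi : i < n + n * D) :
    i * 2 ^ 2 ^ J < Y.W ∧ i * 2 ^ 2 ^ J + d < Y.W ∧ i * 2 ^ 2 ^ J + d < Y.N := by
  have h1 := F.bounds.2.2.2.2.2 i hi d hd
  have h2 := F.arr; omega

theorem Fits.start (F : Fits Y n D J) (P : Params D J s) (h40 : s.r 40 = v) (h41 : s.r 41 = γ)
    {Q : State → Prop} (hQ : ∀ s', s'.m = s.m → s'.nd = s.nd → Walk n D J γ v D s' →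
      s'.r 20 = γ → (∀ i, i ≠ 20 → i ≠ 42 → i ≠ 48 → i ≠ 49 → s'.r i = s.r i) →
      s'.t = s.t + 4 → Q s') : Wp Y startCmd Q s := by
  have h1 := F.bounds
  have : 3 < Y.N := by
    have := Nat.lt_two_pow_self (n := 2 ^ J)
    have := Nat.one_le_two_pow (n := J)
    have := Nat.le_mul_of_pos_right n F.D_pos
    have := F.n_pos; omega
  simp [startCmd, P.U, P.b, P.D, h41]
  repeat' apply And.intro
  all_goals try omega
  exact hQ _ rfl rfl ⟨by simp [h40], by simp [h41], by simp, by simp, by simp⟩ (by simp)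
    (fun i a b c d => by simp [a, b, c, d]) (by simp)

/-- The first phase of the search: follow the path to the position in register `40`. -/
def followCmd : Cmd :=
  .set 51 (.reg 42) ;;
  .whl (.ne (.reg 51) 0)
    (.set 45 (digitExp (.reg 40)) ;; .set 46 (.arr 15 slotExp) ;;
     .ite (.eq (.reg 46) 0) (.set 51 0)
      (.set 20 (.reg 46) ;; .set 42 (.reg 42 - 1) ;; .set 51 (.reg 42)))

/-- The second phase of the search: go to the extreme leaf below the node in register `20`. -/
def extremeCmd : Cmd :=
  .whl (.ne (.reg 42) 0)
    (.set 45 (.cell (.reg 47) rV 0 (.reg 48) 0 - 1) ;; .set 20 (.arr 15 slotExp) ;;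
     .set 42 (.reg 42 - 1))

/-- Find an element that is nearest on one side; it is stored, plus one, in register `20`. -/
def searchCmd : Cmd :=
  startCmd ;; followCmd ;;
  .ite (.eq (.reg 42) 0) .skip
    (.set 21 0 ;; .set 22 (.reg 48) ;; .set 23 (.reg 45) ;; neighborCmd ;; .set 47 0 ;;
     .ite (.lt rA (.reg 45)) (.set 47 1) .skip ;;
     .set 45 rA ;; .set 20 (.arr 15 slotExp) ;; .set 42 (.reg 42 - 1) ;; extremeCmd)

theorem ptr_of_pos {x : Node} (h : 1 ≤ x.2.1) : ptr nid x = nid x := by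
  rw [ptr, if_neg (by omega)]

theorem ptr_ne_zero (I : Inv n D J A L nid (s.m 15) (s.m 4) s.nd) {x : Node} (hx : x ∈ L)
    (hD : x.2.1 < D) (hn : 1 ≤ n) : ptr nid x ≠ 0 := by
  by_cases h0 : x.2.1 = 0
  · simp [ptr, h0]
  · rw [ptr_of_pos (by omega)]
    have := (I.nid_mem x (I.linked x hx (by omega)) hD).1; omega

/-- The registers and the memory after a search. -/
def SearchFrame (s s' : State) : Prop :=
  s'.m = s.m ∧ s'.nd = s.nd ∧ ∀ i, i < 20 ∨ i = 40 ∨ i = 41 ∨ 53 ≤ i → s'.r i = s.r i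

theorem wp_extreme (F : Fits Y n D J) (I : Inv n D J (inner n D J S) (below D J S) nid
      (s.m 15) (s.m 4) s.nd) (hlt : ∀ γ, ∀ p ∈ S γ, γ < n ∧ p < n) {f q : ℕ}
    (W : Walk n D J γ v h s) (hD : h < D) (hγ : γ < n) (h47 : s.r 47 = f)
    (h20 : s.r 20 = ptr nid (γ, h, q)) (hB : Beside J (S γ) v f h q) {Q : State → Prop}
    (hQ : ∀ s' e, SearchFrame s s' → s'.t ≤ s.t + 4 * h + 1 → s'.r 20 = e + 1 →
      IsNeighbor (S γ) v e → Q s') : Wp Y extremeCmd Q s := by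
  induction h generalizing s q with
  | zero =>
    rw [extremeCmd, wp_whl]
    simp only [ok_ne, ok_reg, ok_ofNat, holds_ne, val_reg, W.height, val_ofNat]
    refine ⟨by omega, fun h => absurd rfl h, fun _ => hQ _ q ⟨rfl, rfl, fun _ _ => rfl⟩ (by simp)
      (by simpa [ptr] using h20) hB.isNeighbor⟩
  | succ h ih =>
    rw [extremeCmd, wp_whl, ← extremeCmd]
    refine ⟨by simp, fun _ => ?_, fun h => by simp [W.height] at h⟩
    have hA : (γ, h + 1, q) ∈ inner n D J S :=
      mem_inner hlt F.n_le (by omega) hD.le hγ hB.1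
    rw [ptr_of_pos (by simp)] at h20
    have hid := I.nid_lt hA
    rw [← h20] at hid
    obtain ⟨a, b, ha, hb, haU, hbU, hmin, hmax⟩ :=
      (I.veb _ _ _ hA).cell_ne_zero (exists_digit (by omega) hB.1)
    rw [← h20] at ha hb
    simp only [pow_zero, Nat.div_one] at hmin hmax
    obtain ⟨d, hd, hdU, hdig, h1, h0⟩ : ∃ d, s.nd (s.r 20) (f, 0, 2 ^ J, 0) = d + 1 ∧
        d < 2 ^ 2 ^ J ∧ d ∈ digits J (below D J S) γ h q ∧
        (f = 1 → ∀ d' ∈ digits J (below D J S) γ h q, d' ≤ d) ∧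
        (f = 0 → ∀ d' ∈ digits J (below D J S) γ h q, d ≤ d') := by
      rcases hB.2 with ⟨rfl, -⟩ | ⟨rfl, -⟩
      · exact ⟨b, hb, hbU, hmax.1, fun _ d' hd' => hmax.2 hd', by simp⟩
      · exact ⟨a, ha, haU, hmin.1, by simp, fun _ d' hd' => hmin.2 hd'⟩
    have hf : f < 2 := by rcases hB.2 with ⟨rfl, -⟩ | ⟨rfl, -⟩ <;> omega
    have hsl := F.slot hdU hid
    have hp0 := Nat.one_le_two_pow (n := J)
    have hch := (I.child _ _ _ hA d hdU).1 hdig.2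
    rw [← h20] at hch
    have hw := F.window
    have hu := F.size
    have hi := F.nodes
    have hU0 : 0 < 2 ^ 2 ^ J := by omega
    have hB' := hB.step (by omega) hdig h1 h0
    simp [slotExp, W.height, W.b, W.U, h47, hd, hsl, Layout.HasCell]
    repeat' apply And.intro
    all_goals try omega
    refine ih (s := (((s.tick.set 45 d).set 20 _).set 42 h)) (by simpa using I)
      ⟨by simp [W.pos], by simp [W.color], by simp, by simp [W.b], by simp [W.U]⟩ (by omega)
      (by simp [h47]) (by simpa using hch) hB' fun s' e g1 g2 g3 g4 => hQ s' e
        ⟨g1.1, g1.2.1, fun i hi => ?_⟩ (by simp at g2; omega) g3 g4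
    rw [g1.2.2 i hi]
    have : i ≠ 20 ∧ i ≠ 42 ∧ i ≠ 45 := by omega
    simp [this]

theorem wp_follow (F : Fits Y n D J) (I : Inv n D J (inner n D J S) (below D J S) nid
      (s.m 15) (s.m 4) s.nd) (hlt : ∀ γ, ∀ p ∈ S γ, γ < n ∧ p < n)
    (W : Walk n D J γ v h s) (h51 : s.r 51 = h) (hD : h ≤ D) (hγ : γ < n)
    (h20 : s.r 20 = ptr nid (γ, h, v / (2 ^ 2 ^ J) ^ h))
    (hv : ∃ x ∈ S γ, x / (2 ^ 2 ^ J) ^ h = v / (2 ^ 2 ^ J) ^ h) {Q : State → Prop}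
    (hQ : ∀ s' h', SearchFrame s s' → s'.t ≤ s.t + 7 * h + 10 → Walk n D J γ v h' s' → h' ≤ D →
      s'.r 20 = ptr nid (γ, h', v / (2 ^ 2 ^ J) ^ h') →
      (∃ x ∈ S γ, x / (2 ^ 2 ^ J) ^ h' = v / (2 ^ 2 ^ J) ^ h') →
      (∀ h, h' = h + 1 → (γ, h, v / (2 ^ 2 ^ J) ^ h) ∉ below D J S ∧
        s'.r 45 = v / (2 ^ 2 ^ J) ^ h % 2 ^ 2 ^ J) → Q s') : Wp Y (.whl (.ne (.reg 51) 0)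
      (.set 45 (digitExp (.reg 40)) ;; .set 46 (.arr 15 slotExp) ;;
       .ite (.eq (.reg 46) 0) (.set 51 0)
        (.set 20 (.reg 46) ;; .set 42 (.reg 42 - 1) ;; .set 51 (.reg 42)))) Q s := by
  induction h generalizing s with
  | zero =>
    rw [wp_whl]
    simp only [ok_ne, ok_reg, ok_ofNat, holds_ne, val_reg, h51, val_ofNat]
    exact ⟨by omega, fun h => absurd rfl h, fun _ => hQ _ 0 ⟨rfl, rfl, fun _ _ => rfl⟩ (by simp)
      ⟨W.pos, W.color, W.height, W.b, W.U⟩ hD h20 hv (by simp)⟩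
  | succ h ih =>
    rw [wp_whl]
    refine ⟨by simp, fun _ => ?_, fun h => by simp [h51] at h⟩
    have hA : (γ, h + 1, v / (2 ^ 2 ^ J) ^ (h + 1)) ∈ inner n D J S :=
      mem_inner hlt F.n_le (by omega) hD hγ hv
    rw [ptr_of_pos (by simp)] at h20
    have hid := I.nid_lt hA
    rw [← h20] at hid
    have hU0 : 0 < 2 ^ 2 ^ J := by positivity
    set d := v / (2 ^ 2 ^ J) ^ h % 2 ^ 2 ^ J with hd
    have hdU : d < 2 ^ 2 ^ J := Nat.mod_lt _ hU0
    have hsl := F.slot hdU hid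
    have hsh := F.shift_ok (h := h) (by omega)
    have hch := I.child _ _ _ hA d hdU
    rw [← h20, prefix_eq] at hch
    simp [-wp_ite, slotExp, digitExp, W.height, W.b, W.U, W.pos, hsl, hsh, shift_eq, ← hd]
    rw [wp_ite]
    by_cases hL : (γ, h, v / (2 ^ 2 ^ J) ^ h) ∈ below D J S
    · have hne : s.m 15 (s.r 20 * 2 ^ 2 ^ J + d) ≠ 0 := by
        rw [hch.1 hL]; exact ptr_ne_zero I hL (by simp; omega) F.n_pos
      simp [W.height, hne]
      refine ih (s := (((((s.tick.set 45 d).set 46 _).tick).set 20 _).set 42 h).set 51 h)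
        (by simpa using I)
        ⟨by simp [W.pos], by simp [W.color], by simp, by simp [W.b], by simp [W.U]⟩ (by simp)
        (by omega) (by simpa using hch.1 hL) hL.2 fun s' h' g1 g2 g3 g4 g5 g6 g7 => hQ s' h'
          ⟨g1.1, g1.2.1, fun i hi => ?_⟩ (by simp at g2; omega) g3 g4 g5 g6 g7
      rw [g1.2.2 i hi]
      have : i ≠ 20 ∧ i ≠ 42 ∧ i ≠ 45 ∧ i ≠ 46 ∧ i ≠ 51 := by omega
      simp [this]
    · simp [hch.2 hL]
      rw [wp_whl]
      simp
      refine hQ _ (h + 1) ⟨rfl, rfl, fun i hi => ?_⟩ (by simp; omega)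
        ⟨by simp [W.pos], by simp [W.color], by simp [W.height], by simp [W.b], by simp [W.U]⟩
        hD (by rw [ptr_of_pos (by simp)]; simpa using h20) hv ?_
      · have : i ≠ 20 ∧ i ≠ 42 ∧ i ≠ 45 ∧ i ≠ 46 ∧ i ≠ 51 := by omega
        simp [this]
      · intro h' he
        obtain rfl : h = h' := by omega
        exact ⟨hL, by simp [hd]⟩

/-- The path to `v` is followed as long as it exists. The nearest child on one side of it is found in
the structure of the last node, and from there the extreme children lead to the neighbor. -/
theorem wp_search (F : Fits Y n D J) (H : Holds n D J S (inner n D J S) (below D J S) nid s)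
    (hγ : γ < n) (hS : (S γ).Nonempty) (hv : v < n) (h40 : s.r 40 = v) (h41 : s.r 41 = γ)
    {Q : State → Prop}
    (hQ : ∀ s' e, SearchFrame s s' → s'.t ≤ s.t + 12 * D + 40 * J + 100 → s'.r 20 = e + 1 →
      IsNeighbor (S γ) v e → Q s') : Wp Y searchCmd Q s := by
  obtain ⟨I, P, hlt⟩ := H
  have hroot : ∃ x ∈ S γ, x / (2 ^ 2 ^ J) ^ D = v / (2 ^ 2 ^ J) ^ D := by
    obtain ⟨x, hx⟩ := hS
    refine ⟨x, hx, ?_⟩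
    rw [Nat.div_eq_of_lt ((hlt γ x hx).2.trans_le F.n_le), Nat.div_eq_of_lt (hv.trans_le F.n_le)]
  rw [searchCmd, wp_seq]
  refine F.start P h40 h41 fun s1 g1 g2 W g3 g4 g5 => ?_
  rw [wp_seq, followCmd, wp_seq, wp_set]
  refine ⟨by omega, by simp, ?_⟩
  refine wp_follow F (by simpa [g1, g2] using I) hlt
    ⟨by simp [W.pos], by simp [W.color], by simp [W.height], by simp [W.b], by simp [W.U]⟩
    (by simp [W.height]) le_rfl hγ ?_ hroot fun s2 h' f1 f2 W2 f3 f4 f5 f6 => ?_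
  · rw [ptr_of_pos (by simpa using F.D_pos), Nat.div_eq_of_lt (hv.trans_le F.n_le),
      I.nid_root γ hγ]
    simp [g3]
  have hfr2 : SearchFrame s s2 := ⟨by rw [f1.1]; exact g1, by rw [f1.2.1]; exact g2, fun i hi => by
    rw [f1.2.2 i hi]
    have : i ≠ 20 ∧ i ≠ 42 ∧ i ≠ 48 ∧ i ≠ 49 ∧ i ≠ 51 := by omega
    simp [this, g4]⟩
  have ht2 : s2.t ≤ s.t + 7 * D + 20 := by simp at f2; omega
  rw [wp_ite]
  simp only [ok_eq, ok_reg, ok_ofNat, holds_eq, val_reg, val_ofNat, W2.height]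
  refine ⟨by omega, ?_, fun h0 => ?_⟩
  · rintro rfl
    obtain ⟨x, hx, hxv⟩ := f5
    simp only [pow_zero, Nat.div_one] at hxv
    subst hxv
    rw [wp_skip]
    exact hQ _ x hfr2 (by simp; omega) (by simpa [ptr] using f4) ⟨hx, .inl ⟨le_rfl, fun _ _ h => h⟩⟩
  obtain ⟨h, rfl⟩ : ∃ h, h' = h + 1 := ⟨h' - 1, by omega⟩
  obtain ⟨hL, h45⟩ := f6 h rfl
  have hA : (γ, h + 1, v / (2 ^ 2 ^ J) ^ (h + 1)) ∈ inner n D J S :=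
    mem_inner hlt F.n_le (by omega) f3 hγ f5
  rw [ptr_of_pos (by simp)] at f4
  have hid := I.nid_lt hA
  rw [← f4] at hid
  have hU0 : 0 < 2 ^ 2 ^ J := by positivity
  set d := v / (2 ^ 2 ^ J) ^ h % 2 ^ 2 ^ J with hd
  have hdU : d < 2 ^ 2 ^ J := Nat.mod_lt _ hU0
  have hnd : s2.nd = s.nd := hfr2.2.1
  have hu := F.size
  have hw := F.window
  have hni := F.nodes
  have hbd := F.bounds
  simp [W2.b, h45]
  refine wp_neighbor (j := J) (e := 0) (y := d)
    ⟨by simp; omega, by omega, by simp [hnd, hu, I.bound], by omega, hbd.1, hbd.2.1⟩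
    (by simp) (by simp) (by simp) (by omega) fun s3 e1 e2 e3 e4 => ?_
  simp only [State.set_nd, State.tick_nd] at e1
  have hveb := I.veb _ _ _ hA
  rw [← f4] at hveb
  have hdz : d / 2 ^ (0 + 2 ^ J) = 0 := Nat.div_eq_of_lt (by simpa using hdU)
  obtain ⟨hzU, hz⟩ := neighbor_spec hveb (exists_digit (by omega) f5) hdz
  simp only [pow_zero, Nat.div_one] at hz
  have e3' : s3.r 28 = neighbor J 0 d (s.nd (s2.r 20)) := by rw [e3]; simp [hnd]
  set z := neighbor J 0 d (s.nd (s2.r 20)) with hzd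
  have hfr3 : ∀ i, 40 ≤ i → s3.r i = s2.r i := by
    intro i hi
    rw [e2.2 i (by omega)]
    have : i ≠ 21 ∧ i ≠ 22 ∧ i ≠ 23 := by omega
    simp [this]
  have r20 : s3.r 20 = s2.r 20 := by rw [e2.2 20 (by omega)]; simp
  have hfr4 : ∀ i, i < 20 ∨ i = 40 ∨ i = 41 ∨ 53 ≤ i → s3.r i = s.r i := by
    intro i hi
    rw [← hfr2.2.2 i hi, e2.2 i (by omega)]
    have : i ≠ 21 ∧ i ≠ 22 ∧ i ≠ 23 := by omega
    simp [this]
  have hm3 : s3.m = s.m := by rw [e2.1]; exact hfr2.1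
  have ht3 : s3.t ≤ s.t + 7 * D + 40 * J + 70 := by simp at e4; omega
  have hsl := F.slot hzU hid
  have hch := (I.child _ _ _ hA z hzU).1 hz.1.2
  rw [← f4] at hch
  have hB := Beside.start (by omega) hz hL
  rw [← hd] at hB
  have key : ∀ f, f = (if z < d then 1 else 0) →
      ∀ s5 : State, s5.m = s.m → s5.nd = s.nd → s5.t ≤ s3.t + 6 → s5.r 47 = f →
      s5.r 20 = s.m 15 (s2.r 20 * 2 ^ 2 ^ J + z) → s5.r 42 = h →
      (∀ i, i ≠ 20 → i ≠ 42 → i ≠ 45 → i ≠ 47 → s5.r i = s3.r i) → Wp Y extremeCmd Q s5 := by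
    intro f hf s5 c1 c2 c3 c4 c5 c6 c7
    refine wp_extreme F (by rw [c1, c2]; exact I) hlt (q := v / (2 ^ 2 ^ J) ^ (h + 1) * 2 ^ 2 ^ J + z)
      ⟨?_, ?_, c6, ?_, ?_⟩ (by omega) hγ (c4.trans hf) (c5.trans hch) hB
      fun s' e b1 b2 b3 b4 => hQ s' e ⟨b1.1.trans c1, b1.2.1.trans c2, fun i hi => ?_⟩ (by omega)
        b3 b4
    · rw [c7 _ (by omega) (by omega) (by omega) (by omega), hfr3 _ (by omega), W2.pos]
    · rw [c7 _ (by omega) (by omega) (by omega) (by omega), hfr3 _ (by omega), W2.color]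
    · rw [c7 _ (by omega) (by omega) (by omega) (by omega), hfr3 _ (by omega), W2.b]
    · rw [c7 _ (by omega) (by omega) (by omega) (by omega), hfr3 _ (by omega), W2.U]
    · rw [b1.2.2 i hi, c7 _ (by omega) (by omega) (by omega) (by omega), hfr4 i hi]
  simp [slotExp, e3', hfr3, h45, W2.U, W2.height, r20, hsl, hm3]
  repeat' first | apply And.intro | intro _
  all_goals
    refine key _ rfl _ (by simp [hm3]) (by simp [e1, hnd]) (by simp; try omega) ?_ (by simp) (by simp)
      fun i h1 h2 h3 h4 => by simp [h1, h2, h3, h4]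
    simp
    assumption

end

/-! ### Insertion into a trie -/

/-- The nodes on the path to the position `p` in the trie of `γ`, at the heights from `a` to
`b - 1`. -/
def path (J γ p a b : ℕ) : Set Node :=
  {x | x.1 = γ ∧ (a ≤ x.2.1 ∧ x.2.1 < b) ∧ x.2.2 = p / (2 ^ 2 ^ J) ^ x.2.1}

/-- The positions next to `p` in `C`, plus one, or `0` if there is none. -/
structure Nbrs (C : Set ℕ) (p pr su : ℕ) : Prop where
  pred : pr ≠ 0 → pr - 1 ∈ C ∧ pr - 1 < p
  pred_max : ∀ x ∈ C, x < p → x < pr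
  succ : su ≠ 0 → su - 1 ∈ C ∧ p < su - 1
  succ_min : ∀ x ∈ C, p < x → su ≠ 0 ∧ su ≤ x + 1

/-- The digit, plus one, of the neighbor `k` of `p` at height `h`, if it is in the same subtree of
height `h + 1` as `p`. -/
def sideDigit (J p h k : ℕ) : ℕ :=
  if k ≠ 0 ∧ (k - 1) / (2 ^ 2 ^ J) ^ (h + 1) = p / (2 ^ 2 ^ J) ^ (h + 1) then
    (k - 1) / (2 ^ 2 ^ J) ^ h % 2 ^ 2 ^ J + 1 else 0

section

variable {n D J γ p h : ℕ} {S : ℕ → Set ℕ} {L : Set Node}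

theorem below_insert : below D J (update S γ (Insert.insert p (S γ))) =
    below D J S ∪ path J γ p 0 D := by
  ext ⟨γ', h, q⟩
  by_cases hγ : γ' = γ
  · subst hγ
    simp only [below, path, update_self, Set.mem_ofPred_eq, Set.mem_insert_iff,
      Set.mem_union]
    grind
  · simp [below, path, hγ]

theorem inner_insert : inner n D J (update S γ (Insert.insert p (S γ))) =
    inner n D J S ∪ path J γ p 1 D := by
  ext ⟨γ', h, q⟩
  by_cases hγ : γ' = γ
  · subst hγ
    simp only [inner, path, update_self, Set.mem_ofPred_eq, Set.mem_insert_iff,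
      Set.mem_union]
    grind
  · simp [inner, path, hγ]

theorem path_bot {a b : ℕ} (hab : a < b) : path J γ p a b =
    Insert.insert (γ, a, p / (2 ^ 2 ^ J) ^ a) (path J γ p (a + 1) b) := by
  ext ⟨γ', h, q⟩
  simp only [path, Set.mem_ofPred_eq, Set.mem_insert_iff, Prod.mk.injEq]
  grind

theorem path_top {a b : ℕ} (hab : a ≤ b) : path J γ p a (b + 1) =
    Insert.insert (γ, b, p / (2 ^ 2 ^ J) ^ b) (path J γ p a b) := by
  ext ⟨γ', h, q⟩
  simp only [path, Set.mem_ofPred_eq, Set.mem_insert_iff, Prod.mk.injEq]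
  grind

theorem path_self {a : ℕ} : path J γ p a a = ∅ := by
  ext x
  simp only [path, Set.mem_ofPred_eq, Set.mem_empty_iff_false, iff_false]; omega

theorem mem_inner_iff (h1 : 1 ≤ h) (hD : h < D) {q : ℕ} :
    (γ, h, q) ∈ inner n D J S ↔ (γ, h, q) ∈ below D J S := by
  simp only [inner, below, Set.mem_ofPred_eq]
  grind

/-- A node below the path has a parent. -/
theorem below_parent {q : ℕ} (hL : (γ, h, q) ∈ below D J S) (hD : h + 1 < D) :
    (γ, h + 1, q / 2 ^ 2 ^ J) ∈ below D J S := by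
  obtain ⟨-, x, hx, he⟩ := hL
  exact ⟨hD, x, hx, by simp only at he ⊢; rw [← he, div_pow_succ]⟩

theorem Nbrs.shares {C : Set ℕ} {pr su : ℕ} (N : Nbrs C p pr su) (hp : p ∉ C) :
    (∃ x ∈ C, x / (2 ^ 2 ^ J) ^ h = p / (2 ^ 2 ^ J) ^ h) ↔
      (pr ≠ 0 ∧ (pr - 1) / (2 ^ 2 ^ J) ^ h = p / (2 ^ 2 ^ J) ^ h) ∨
        (su ≠ 0 ∧ (su - 1) / (2 ^ 2 ^ J) ^ h = p / (2 ^ 2 ^ J) ^ h) := by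
  constructor
  · rintro ⟨x, hx, he⟩
    have hne : x ≠ p := fun h => hp (h ▸ hx)
    rcases lt_or_gt_of_ne hne with hlt | hgt
    · have h1 := N.pred_max x hx hlt
      have h2 := N.pred (by omega)
      refine .inl ⟨by omega, le_antisymm (Nat.div_le_div_right h2.2.le) ?_⟩
      rw [← he]; exact Nat.div_le_div_right (by omega)
    · have h1 := N.succ_min x hx hgt
      have h2 := N.succ h1.1
      refine .inr ⟨h1.1, le_antisymm ?_ (Nat.div_le_div_right h2.2.le)⟩
      rw [← he]; exact Nat.div_le_div_right (by omega)
  · rintro (⟨h1, h2⟩ | ⟨h1, h2⟩)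
    · exact ⟨_, (N.pred h1).1, h2⟩
    · exact ⟨_, (N.succ h1).1, h2⟩

theorem sideDigit_le {k : ℕ} : sideDigit J p h k ≤ 2 ^ 2 ^ J := by
  unfold sideDigit
  split_ifs
  · exact Nat.mod_lt _ (by positivity)
  · exact Nat.zero_le _

theorem digit_lt {x p U : ℕ} (hq : x / U ^ (h + 1) = p / U ^ (h + 1))
    (hlt : x / U ^ h % U < p / U ^ h % U) : x < p := by
  have h1 := prefix_eq x h U
  have h2 := prefix_eq p h U
  rw [hq] at h1
  by_contra hn
  have := Nat.div_le_div_right (c := U ^ h) (not_lt.1 hn); omega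

theorem digit_le {x p U : ℕ} (hq : x / U ^ (h + 1) = p / U ^ (h + 1)) (hlt : x ≤ p) :
    x / U ^ h % U ≤ p / U ^ h % U := by
  have h1 := prefix_eq x h U
  have h2 := prefix_eq p h U
  rw [hq] at h1
  have := Nat.div_le_div_right (c := U ^ h) hlt; omega

/-- The digit of an element of the subtree around `p`. -/
theorem digit_mem (hD : h < D) {x : ℕ} (hx : x ∈ S γ)
    (hq : x / (2 ^ 2 ^ J) ^ (h + 1) = p / (2 ^ 2 ^ J) ^ (h + 1)) :
    x / (2 ^ 2 ^ J) ^ h % 2 ^ 2 ^ J ∈ digits J (below D J S) γ h (p / (2 ^ 2 ^ J) ^ (h + 1)) :=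
  (mem_digits_below hD).2 ⟨Nat.mod_lt _ (by positivity), x, hx, by rw [← hq, prefix_eq]⟩

theorem of_digit_mem (hD : h < D) {d : ℕ}
    (hd : d ∈ digits J (below D J S) γ h (p / (2 ^ 2 ^ J) ^ (h + 1))) :
    ∃ x ∈ S γ, x / (2 ^ 2 ^ J) ^ (h + 1) = p / (2 ^ 2 ^ J) ^ (h + 1) ∧
      x / (2 ^ 2 ^ J) ^ h % 2 ^ 2 ^ J = d := by
  obtain ⟨h1, x, hx, he⟩ := (mem_digits_below hD).1 hd
  have hU : 0 < 2 ^ 2 ^ J := by positivity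
  refine ⟨x, hx, ?_, ?_⟩
  · rw [← div_pow_succ, he, mul_comm, Nat.mul_add_div hU, Nat.div_eq_of_lt h1, add_zero]
  · rw [he, mul_comm, Nat.mul_add_mod, Nat.mod_eq_of_lt h1]

theorem Nbrs.digit_ok {pr su : ℕ} (N : Nbrs (S γ) p pr su) (hD : h < D) {C : Set ℕ}
    (hC : C = digits J (below D J S) γ h (p / (2 ^ 2 ^ J) ^ (h + 1)))
    (hn : p / (2 ^ 2 ^ J) ^ h % 2 ^ 2 ^ J ∉ C) :
    PredOk J 0 0 C (· < 2 ^ 2 ^ J) (p / (2 ^ 2 ^ J) ^ h % 2 ^ 2 ^ J) (sideDigit J p h pr) ∧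
      SuccOk J 0 0 C (· < 2 ^ 2 ^ J) (p / (2 ^ 2 ^ J) ^ h % 2 ^ 2 ^ J) (sideDigit J p h su) := by
  subst hC
  have hU : 0 < 2 ^ 2 ^ J := by positivity
  simp only [PredOk, SuccOk, pow_zero, Nat.div_one]
  have hside : ∀ k d, sideDigit J p h k = d + 1 → k ≠ 0 ∧
      (k - 1) / (2 ^ 2 ^ J) ^ (h + 1) = p / (2 ^ 2 ^ J) ^ (h + 1) ∧
        (k - 1) / (2 ^ 2 ^ J) ^ h % 2 ^ 2 ^ J = d := by
    intro k d hk
    unfold sideDigit at hk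
    split_ifs at hk with hc; exact ⟨hc.1, hc.2, by omega⟩
  refine ⟨⟨fun κ hκ hlt hmax => ?_, fun d hd _ => ?_⟩, ⟨fun κ hκ hlt hmin => ?_, fun d hd _ => ?_⟩⟩
  · obtain ⟨x, hx, hq, rfl⟩ := of_digit_mem hD hκ
    have h1 := N.pred_max x hx (digit_lt hq hlt)
    have h2 := N.pred (by omega)
    have h3 : (pr - 1) / (2 ^ 2 ^ J) ^ (h + 1) = p / (2 ^ 2 ^ J) ^ (h + 1) :=
      le_antisymm (Nat.div_le_div_right h2.2.le) (hq ▸ Nat.div_le_div_right (by omega))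
    have h4 := digit_mem hD h2.1 h3
    have h5 := digit_le h3 h2.2.le
    have h6 := digit_le (hq.trans h3.symm) (by omega : x ≤ pr - 1)
    have h7 : (pr - 1) / (2 ^ 2 ^ J) ^ h % 2 ^ 2 ^ J ≠ p / (2 ^ 2 ^ J) ^ h % 2 ^ 2 ^ J :=
      fun he => hn (he ▸ h4)
    refine ⟨_, by rw [sideDigit, if_pos ⟨by omega, h3⟩], ?_, Nat.mod_lt _ hU⟩
    exact le_antisymm (hmax _ h4 (by omega)) h6
  · obtain ⟨h1, h2, rfl⟩ := hside _ _ hd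
    have h3 := N.pred h1
    have h4 := digit_mem hD h3.1 h2
    have h5 := digit_le h2 h3.2.le
    exact ⟨h4, lt_of_le_of_ne h5 fun he => hn (he ▸ h4), Nat.mod_lt _ hU⟩
  · obtain ⟨x, hx, hq, rfl⟩ := of_digit_mem hD hκ
    have h1 := N.succ_min x hx (digit_lt hq.symm hlt)
    have h2 := N.succ h1.1
    have h3 : (su - 1) / (2 ^ 2 ^ J) ^ (h + 1) = p / (2 ^ 2 ^ J) ^ (h + 1) :=
      le_antisymm (hq ▸ Nat.div_le_div_right (by omega)) (Nat.div_le_div_right h2.2.le)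
    have h4 := digit_mem hD h2.1 h3
    have h5 := digit_le h3.symm h2.2.le
    have h6 := digit_le (h3.trans hq.symm) (by omega : su - 1 ≤ x)
    have h7 : (su - 1) / (2 ^ 2 ^ J) ^ h % 2 ^ 2 ^ J ≠ p / (2 ^ 2 ^ J) ^ h % 2 ^ 2 ^ J :=
      fun he => hn (he ▸ h4)
    refine ⟨_, by rw [sideDigit, if_pos ⟨h1.1, h3⟩], ?_, Nat.mod_lt _ hU⟩
    exact le_antisymm h6 (hmin _ h4 (by omega))
  · obtain ⟨h1, h2, rfl⟩ := hside _ _ hd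
    have h3 := N.succ h1
    have h4 := digit_mem hD h3.1 h2
    have h5 := digit_le h2.symm h3.2.le
    exact ⟨h4, lt_of_le_of_ne h5 fun he => hn (he ▸ h4), Nat.mod_lt _ hU⟩

end

section

variable {n D J : ℕ} {A L : Set Node} {nid : Node → ℕ} {ch fr : ℕ → ℕ} {nd : ℕ → NodeCells}
  {γ p h x y : ℕ}

/-- Link the next node on the path to `p` to its parent. -/
theorem Inv.link (I : Inv n D J A L nid ch fr nd)
    (hA : (γ, h + 1, p / (2 ^ 2 ^ J) ^ (h + 1)) ∈ A) (hL : (γ, h, p / (2 ^ 2 ^ J) ^ h) ∉ L)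
    (hA' : 1 ≤ h → (γ, h, p / (2 ^ 2 ^ J) ^ h) ∈ A) {C : Set ℕ}
    (hC : C = digits J L γ h (p / (2 ^ 2 ^ J) ^ (h + 1)))
    (hx : PredOk J 0 0 C (· < 2 ^ 2 ^ J) (p / (2 ^ 2 ^ J) ^ h % 2 ^ 2 ^ J) x)
    (hy : SuccOk J 0 0 C (· < 2 ^ 2 ^ J) (p / (2 ^ 2 ^ J) ^ h % 2 ^ 2 ^ J) y) {i v d : ℕ}
    (hi : i = nid (γ, h + 1, p / (2 ^ 2 ^ J) ^ (h + 1))) (hd : d = p / (2 ^ 2 ^ J) ^ h % 2 ^ 2 ^ J)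
    (hv : v = ptr nid (γ, h, p / (2 ^ 2 ^ J) ^ h))
    (hU : ∀ k, insert J 0 d x y (nd i) k ≤ 2 ^ 2 ^ J) :
    Inv n D J A (Insert.insert (γ, h, p / (2 ^ 2 ^ J) ^ h) L) nid
      (update ch (i * 2 ^ 2 ^ J + d) v) fr
      (update nd i (insert J 0 d x y (nd i))) := by
  subst hi hv hC hd
  have hdU : p / (2 ^ 2 ^ J) ^ h % 2 ^ 2 ^ J < 2 ^ 2 ^ J := Nat.mod_lt _ (by positivity)
  obtain ⟨h1, h2⟩ := insert_spec J (I.veb _ _ _ hA) (Nat.div_eq_of_lt (by simpa using hdU))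
    (x := p / (2 ^ 2 ^ J) ^ h % 2 ^ 2 ^ J)
    (by simp only [digits, pow_zero, Nat.div_one, Set.mem_ofPred_eq, prefix_eq]; tauto) hdU hx hy
  rw [pow_zero, Nat.div_one, ← digits_insert hdU] at h1
  have h3 := I.relink (v := ptr nid (γ, h, p / (2 ^ 2 ^ J) ^ h))
    (L' := Insert.insert (γ, h, p / (2 ^ 2 ^ J) ^ (h + 1) * 2 ^ 2 ^ J +
      p / (2 ^ 2 ^ J) ^ h % 2 ^ 2 ^ J) L) hA hdU (fun z hz => by simp [hz])
    (fun _ h1 => by rw [prefix_eq]; exact hA' h1) (fun _ => by rw [prefix_eq])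
    (fun h => absurd (Set.mem_insert _ _) h) h1 hU
    (fun k hk => by rw [h2 k hk]; exact I.supp _ k hk)
  rwa [prefix_eq] at h3

/-- Unlink the next node on the path to `p` from its parent. -/
theorem Inv.unlink (I : Inv n D J A L nid ch fr nd)
    (hA : (γ, h + 1, p / (2 ^ 2 ^ J) ^ (h + 1)) ∈ A) (hL : (γ, h, p / (2 ^ 2 ^ J) ^ h) ∈ L)
    {C : Set ℕ} (hC : C = digits J L γ h (p / (2 ^ 2 ^ J) ^ (h + 1)))
    (hx : EraseOk 0 C (· < 2 ^ 2 ^ J) (p / (2 ^ 2 ^ J) ^ h % 2 ^ 2 ^ J) x) {i d : ℕ}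
    (hi : i = nid (γ, h + 1, p / (2 ^ 2 ^ J) ^ (h + 1))) (hd : d = p / (2 ^ 2 ^ J) ^ h % 2 ^ 2 ^ J)
    (hU : ∀ k, erase J 0 d x (nd i) k ≤ 2 ^ 2 ^ J) :
    Inv n D J A (L \ {(γ, h, p / (2 ^ 2 ^ J) ^ h)}) nid
      (update ch (i * 2 ^ 2 ^ J + d) 0) fr
      (update nd i (erase J 0 d x (nd i))) := by
  subst hi hC hd
  have hdU : p / (2 ^ 2 ^ J) ^ h % 2 ^ 2 ^ J < 2 ^ 2 ^ J := Nat.mod_lt _ (by positivity)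
  obtain ⟨h1, h2⟩ := erase_spec J (I.veb _ _ _ hA) (x := p / (2 ^ 2 ^ J) ^ h % 2 ^ 2 ^ J)
    (by simp only [digits, pow_zero, Nat.div_one, Set.mem_ofPred_eq, prefix_eq]; tauto) hx
  rw [pow_zero, Nat.div_one, ← digits_diff] at h1
  have h3 := I.relink (v := 0) (L' := L \ {(γ, h, p / (2 ^ 2 ^ J) ^ (h + 1) * 2 ^ 2 ^ J +
      p / (2 ^ 2 ^ J) ^ h % 2 ^ 2 ^ J)}) hA hdU (fun z hz => by simp [hz])
    (fun h => absurd rfl h.2) (fun h => absurd rfl h.2) (fun _ => rfl) h1 hU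
    (fun k hk => by rw [h2 k hk]; exact I.supp _ k hk)
  rwa [prefix_eq] at h3

/-- There are unused numbers, since the trie has at most one inner node of each height below `D` for
each position. -/
theorem Inv.free_pos (I : Inv n D J A L nid ch fr nd) (hn : 1 ≤ n) (hD : 1 ≤ D) (col : ℕ → ℕ)
    (hA : ∀ γ h q, (γ, h, q) ∈ A → h < D → ∃ p < n, col p = γ ∧ p / (2 ^ 2 ^ J) ^ h = q) :
    fr 0 ≠ 0 := by
  intro h0
  obtain ⟨F, -, f2, -, f4⟩ := I.free
  obtain rfl : F = [] := List.length_eq_zero_iff.1 (f2.trans h0)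
  have hsub : Finset.Ico n (n + n * D) ⊆ (Finset.range n ×ˢ Finset.Ico 1 D).image
      fun x => nid (col x.1, x.2, x.1 / (2 ^ 2 ^ J) ^ x.2) := by
    intro v hv
    rw [Finset.mem_Ico] at hv
    have hv' : v ∈ nid '' A := by
      by_contra h
      simpa using (f4 v).2 ⟨hv, h⟩
    obtain ⟨⟨γ, h, q⟩, hx, rfl⟩ := hv'
    obtain ⟨h1, h2, h3, h4⟩ := I.height _ hx
    simp only at h1 h2 h3 h4
    have h5 : h < D := by
      refine lt_of_le_of_ne h3 fun he => ?_
      have h6 := h4 he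
      subst he h6
      rw [I.nid_root γ h1] at hv; omega
    obtain ⟨p, hp, rfl, rfl⟩ := hA _ _ _ hx h5
    exact Finset.mem_image.2 ⟨(p, h), by simp [hp]; omega, rfl⟩
  have h1 := (Finset.card_le_card hsub).trans Finset.card_image_le
  rw [Nat.card_Ico, Finset.card_product, Finset.card_range, Nat.card_Ico] at h1
  have h2 : n * (D - 1) < n * D := Nat.mul_lt_mul_of_pos_left (by omega) (by omega); omega

end

/-- Compute `sideDigit` for the neighbor in register `k` into register `r`. -/
def sideCmd (k r : ℕ) : Cmd :=
  .set r 0 ;;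
  .ite (.ne (.reg k) 0)
    (.ite (.eq ((Exp.reg k - 1) >>> (Exp.reg 42 * Exp.reg 48))
        (Exp.reg 40 >>> (Exp.reg 42 * Exp.reg 48)))
      (.set r (digitExp (Exp.reg k - 1) + 1)) .skip) .skip

/-- Make a new node with the pointer in register `46`; a leaf needs no node. -/
def allocCmd : Cmd :=
  .ite (.eq (.reg 42) 1) (.set 46 (.reg 40 + 1))
    (.set 51 (.arr 4 0) ;; .set 46 (.arr 4 (.reg 51)) ;; .put 4 0 (.reg 51 - 1))

/-- Link the node in register `46` to its parent. -/
def linkCmd : Cmd :=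
  .put 15 slotExp (.reg 46) ;; sideCmd 43 24 ;; sideCmd 44 25 ;;
  .set 21 0 ;; .set 22 (.reg 48) ;; .set 23 (.reg 45) ;; insertCmd

/-- Walk down to the leaf and make what is missing on the path. -/
def insertLoop : Cmd :=
  .whl (.ne (.reg 42) 0)
    (.set 45 (digitExp (.reg 40)) ;; .set 46 (.arr 15 slotExp) ;;
     .ite (.eq (.reg 46) 0) (allocCmd ;; linkCmd) .skip ;;
     .set 20 (.reg 46) ;; .set 42 (.reg 42 - 1))

/-- Insert the position in register `40` into the trie of the color in register `41`. The registers
`43` and `44` hold its neighbors. -/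
def insertTrieCmd : Cmd := startCmd ;; insertLoop

theorem put_m_self (s : State) (k i v : ℕ) :
    (s.put k i v).m k = update (s.m k) i v := by simp [State.put]

theorem put_m_of_ne (s : State) {k k' : ℕ} (i v : ℕ) (h : k' ≠ k) :
    (s.put k i v).m k' = s.m k' := by simp [State.put, h]

section

variable {Y : Layout} {n D J γ p h pr su : ℕ} {s : State} {S : ℕ → Set ℕ} {A L : Set Node}
  {nid : Node → ℕ} {Q : State → Prop}

/-- What an update of a trie leaves unchanged. -/
def UpdFrame (s s' : State) : Prop :=
  (∀ k, k ≠ 4 → k ≠ 15 → s'.m k = s.m k) ∧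
    ∀ i, i < 20 ∨ i = 40 ∨ i = 41 ∨ i = 43 ∨ i = 44 ∨ 53 ≤ i → s'.r i = s.r i

theorem wp_side (W : Walk n D J γ p (h + 1) s) (F : Fits Y n D J) (hD : h < D) {k r : ℕ}
    (hk : k < 100) (hr : r < 40) (hkr : k ≠ r)
    (hQ : ∀ s', s'.m = s.m → s'.nd = s.nd → (∀ i, i ≠ r → s'.r i = s.r i) →
      s'.r r = sideDigit J p h (s.r k) → s'.t ≤ s.t + 4 → Q s') : Wp Y (sideCmd k r) Q s := by
  have hsh := F.shift_ok (h := h) hD.le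
  have hU := F.bounds.2.1
  rw [F.size] at hU
  have hmod : ∀ a, a % 2 ^ 2 ^ J + 1 < Y.W := fun a => by
    have := Nat.mod_lt a (by positivity : 0 < 2 ^ 2 ^ J); omega
  have h1 : 40 ≠ r ∧ 42 ≠ r ∧ 48 ≠ r ∧ 49 ≠ r := by omega
  have hmul : (h + 1) * 2 ^ J = 2 ^ J * (h + 1) := mul_comm _ _
  simp [sideCmd, digitExp, hkr, h1, W.pos, W.height, W.b, W.U, hsh, hmod, shift_eq]
  have hr' : r < 100 := by omega
  refine ⟨hr', hk, fun h2 => ⟨hk, fun h3 => ⟨hr', hk, hQ _ rfl rfl ?_ ?_ ?_⟩,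
    fun h3 => hQ _ rfl rfl ?_ ?_ ?_⟩, fun h2 => hQ _ rfl rfl ?_ ?_ ?_⟩
  all_goals first | (intro i hi; simp [hi]) | simp [sideDigit, *]

/-- The nodes on the path to `p` are among those kept while the path is being built or removed. -/
theorem mem_partial (hn : n ≤ (2 ^ 2 ^ J) ^ D) (hγ : γ < n) (hp : p < n) (hD : h ≤ D) :
    (γ, h, p / (2 ^ 2 ^ J) ^ h) ∈ inner n D J S ∪ path J γ p h D := by
  rcases hD.lt_or_eq with h2 | rfl
  · exact .inr ⟨rfl, ⟨le_rfl, h2⟩, rfl⟩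
  · exact .inl (.inl ⟨hγ, rfl, Nat.div_eq_of_lt (hp.trans_le hn)⟩)

theorem wp_alloc (F : Fits Y n D J) (W : Walk n D J γ p (h + 1) s) (hD : h < D) (hγ : γ < n)
    (hp : p < n) (I : Inv n D J A L nid (s.m 15) (s.m 4) s.nd)
    (hA : 1 ≤ h → (γ, h, p / (2 ^ 2 ^ J) ^ h) ∉ A)
    (hL : 1 ≤ h → ∀ d, (γ, h - 1, d) ∈ L → d / 2 ^ 2 ^ J ≠ p / (2 ^ 2 ^ J) ^ h)
    (hfr : 1 ≤ h → s.m 4 0 ≠ 0) {A' : Set Node}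
    (hA' : A' = if h = 0 then A else Insert.insert (γ, h, p / (2 ^ 2 ^ J) ^ h) A)
    (hQ : ∀ s' nid', Inv n D J A' L nid' (s'.m 15) (s'.m 4) s'.nd →
      (∀ x ∈ A, nid' x = nid x) → s'.r 46 = ptr nid' (γ, h, p / (2 ^ 2 ^ J) ^ h) →
      s'.nd = s.nd → (∀ k, k ≠ 4 → s'.m k = s.m k) →
      (∀ i, i ≠ 46 → i ≠ 51 → s'.r i = s.r i) → s'.t ≤ s.t + 4 → Q s') : Wp Y allocCmd Q s := by
  have hbd := F.bounds
  have hNW := F.arr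
  have hn : p + 1 < Y.W := by omega
  subst hA'
  rcases Nat.eq_zero_or_pos h with rfl | h1
  · simp [allocCmd, W.height, W.pos, hn]
    exact hQ _ nid (by simpa using I) (fun _ _ => rfl) (by simp [ptr]) rfl (fun _ _ => rfl)
      (fun i hi _ => by simp [hi]) (by simp)
  · obtain ⟨I', g1, g2⟩ := I.alloc hγ h1 hD (hA h1) (hL h1) (hfr h1)
    have hF : s.m 4 0 ≤ n * D := by
      obtain ⟨F, f1, f2, -, f4⟩ := I.free
      rw [← f2, ← List.toFinset_card_of_nodup f1]
      refine (Finset.card_le_card (t := Finset.Ico n (n + n * D)) fun v hv => ?_).trans (by simp)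
      rw [Finset.mem_Ico]; exact ((f4 v).1 (by simpa using hv)).1
    have h0 : h ≠ 0 := by omega
    have hlt : s.m 4 0 < Y.N := by omega
    have hpos : 0 < Y.N := by omega
    simp [allocCmd, W.height, h0, hlt, hpos]
    refine hQ _ (update nid (γ, h, p / (2 ^ 2 ^ J) ^ h) (s.m 4 (s.m 4 0))) ?_ ?_ ?_ rfl
      ?_ (fun i hi hi' => by simp [hi, hi']) (by simp)
    · rw [if_neg h0]
      rw [put_m_self, put_m_of_ne _ _ _ (by omega)]; exact I'
    · intro x hx
      exact update_of_ne (by rintro rfl; exact hA h1 hx) _ _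
    · rw [ptr_of_pos (show 1 ≤ h from h1)]; simp
    · intro k hk
      rw [put_m_of_ne _ _ _ hk]; rfl

theorem wp_link (F : Fits Y n D J) (W : Walk n D J γ p (h + 1) s) (hD : h < D)
    (I : Inv n D J A L nid (s.m 15) (s.m 4) s.nd)
    (hA : (γ, h + 1, p / (2 ^ 2 ^ J) ^ (h + 1)) ∈ A) (hL : (γ, h, p / (2 ^ 2 ^ J) ^ h) ∉ L)
    (hA' : 1 ≤ h → (γ, h, p / (2 ^ 2 ^ J) ^ h) ∈ A)
    (hdig : digits J L γ h (p / (2 ^ 2 ^ J) ^ (h + 1)) =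
      digits J (below D J S) γ h (p / (2 ^ 2 ^ J) ^ (h + 1)))
    (hN : Nbrs (S γ) p pr su) (h43 : s.r 43 = pr) (h44 : s.r 44 = su)
    (h20 : s.r 20 = nid (γ, h + 1, p / (2 ^ 2 ^ J) ^ (h + 1)))
    (h45 : s.r 45 = p / (2 ^ 2 ^ J) ^ h % 2 ^ 2 ^ J)
    (h46 : s.r 46 = ptr nid (γ, h, p / (2 ^ 2 ^ J) ^ h))
    (hQ : ∀ s', Inv n D J A (Insert.insert (γ, h, p / (2 ^ 2 ^ J) ^ h) L) nid (s'.m 15) (s'.m 4)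
        s'.nd → (∀ k, k ≠ 15 → s'.m k = s.m k) → (∀ i, i < 20 ∨ 40 ≤ i → s'.r i = s.r i) →
      s'.t ≤ s.t + 50 * J + 70 → Q s') : Wp Y linkCmd Q s := by
  have hU0 : 0 < 2 ^ 2 ^ J := by positivity
  have hdU : p / (2 ^ 2 ^ J) ^ h % 2 ^ 2 ^ J < 2 ^ 2 ^ J := Nat.mod_lt _ hU0
  have hid := I.nid_lt hA
  rw [← h20] at hid
  have hsl := F.slot hdU hid
  have hbd := F.bounds
  have hsz := F.size
  have hw := F.window
  have hni := F.nodes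
  have hnd : p / (2 ^ 2 ^ J) ^ h % 2 ^ 2 ^ J ∉ digits J L γ h (p / (2 ^ 2 ^ J) ^ (h + 1)) := by
    simp only [digits, Set.mem_ofPred_eq, prefix_eq]
    tauto
  obtain ⟨hP, hS⟩ := hN.digit_ok hD hdig hnd
  set d := p / (2 ^ 2 ^ J) ^ h % 2 ^ 2 ^ J with hd
  rw [linkCmd, wp_seq, wp_put]
  have hv : slotExp.val s = s.r 20 * 2 ^ 2 ^ J + d := by simp [slotExp, W.U, h45]
  rw [hv]
  refine ⟨by omega, by simp [slotExp, W.U, h45, hsl], by simp, hsl.2.2, ?_⟩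
  rw [wp_seq]
  refine wp_side (s := s.put 15 _ _) (k := 43) (r := 24) (h := h) ⟨W.pos, W.color, W.height, W.b, W.U⟩ F hD (by omega) (by omega)
    (by omega) fun s1 a1 a2 a3 a4 a5 => ?_
  simp only [State.put_nd, State.put_r, State.put_t, h43] at a2 a3 a4 a5
  rw [wp_seq]
  refine wp_side (γ := γ) (p := p) (k := 44) (r := 25) (h := h) ⟨by simp [a3, W.pos], by simp [a3, W.color], by simp [a3, W.height],
    by simp [a3, W.b], by simp [a3, W.U]⟩ F hD (by omega) (by omega)
    (by omega) fun s2 b1 b2 b3 b4 b5 => ?_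
  rw [a3 44 (by omega), h44] at b4
  have hr : ∀ i, i ≠ 24 → i ≠ 25 → s2.r i = s.r i := fun i h1 h2 => by rw [b3 i h2, a3 i h1]
  simp [hr, W.b, h45]
  refine wp_insert (j := J) (e := 0) (x := d) (p := sideDigit J p h pr) (q := sideDigit J p h su)
    ⟨by simp [hr]; omega, by omega, by simp [b2, a2, hsz, I.bound], by omega, hbd.1, hbd.2.1⟩
    (by simp) (by simp) (by simp) (by simp [b3, a4]) (by simp [b4]) rfl
    (by rw [hsz]; exact sideDigit_le) (by rw [hsz]; exact sideDigit_le) fun s3 c1 c2 c3 c4 => ?_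
  simp [hr, a2, b2] at c1 c2 c4
  have hm : s3.m = (s.put 15 (s.r 20 * 2 ^ 2 ^ J + d) (s.r 46)).m := by
    rw [c3.1]; simp [b1, a1]
  refine hQ s3 ?_ (fun k hk => by rw [hm, put_m_of_ne _ _ _ hk]) (fun i hi => ?_) (by linarith)
  · rw [c1, hm, put_m_self, put_m_of_ne _ _ _ (by omega)]
    exact I.link hA hL hA' rfl hP hS h20 hd h46 (by rw [← hsz]; exact fun k => c2 _ _ _ _)
  · rw [c3.2 i (by omega)]
    have : i ≠ 21 ∧ i ≠ 22 ∧ i ≠ 23 ∧ i ≠ 24 ∧ i ≠ 25 := by omega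
    simp [this, hr]

theorem digits_partial {a b q : ℕ} (hh : h < a ∨ b ≤ h) :
    digits J (below D J S ∪ path J γ p a b) γ h q = digits J (below D J S) γ h q := by
  ext d
  simp only [digits, path, Set.mem_union, Set.mem_ofPred_eq]
  constructor
  · rintro ⟨h1, h2 | h2⟩
    · exact ⟨h1, h2⟩
    · omega
  · exact fun h => ⟨h.1, .inl h.2⟩

theorem wp_insertTrie_loop (F : Fits Y n D J) (hlt : ∀ γ, ∀ p ∈ S γ, γ < n ∧ p < n)
    (hγ : γ < n) (hp : p < n) {col : ℕ → ℕ} (hcol : ∀ γ, ∀ p ∈ S γ, col p = γ) (hcp : col p = γ)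
    (hN : Nbrs (S γ) p pr su) (h43 : s.r 43 = pr) (h44 : s.r 44 = su)
    (W : Walk n D J γ p h s) (hD : h ≤ D)
    (I : Inv n D J (inner n D J S ∪ path J γ p (max h 1) D) (below D J S ∪ path J γ p h D) nid
      (s.m 15) (s.m 4) s.nd) (h20 : s.r 20 = ptr nid (γ, h, p / (2 ^ 2 ^ J) ^ h))
    (hQ : ∀ s' nid', Inv n D J (inner n D J S ∪ path J γ p 1 D) (below D J S ∪ path J γ p 0 D) nid'
      (s'.m 15) (s'.m 4) s'.nd → UpdFrame s s' → s'.t ≤ s.t + h * (50 * J + 90) + 1 → Q s') :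
    Wp Y insertLoop Q s := by
  induction h generalizing s nid with
  | zero =>
    rw [insertLoop, wp_whl]
    simp only [ok_ne, ok_reg, ok_ofNat, holds_ne, val_reg, W.height, val_ofNat]
    exact ⟨by omega, fun h => absurd rfl h, fun _ => hQ _ nid (by simpa using I)
      ⟨fun _ _ _ => rfl, fun _ _ => rfl⟩ (by simp)⟩
  | succ h ih =>
    rw [insertLoop, wp_whl, ← insertLoop]
    refine ⟨by simp, fun _ => ?_, fun h => by simp [W.height] at h⟩
    rw [max_eq_left (by omega)] at I
    have hA := mem_partial (S := S) F.n_le hγ hp hD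
    rw [ptr_of_pos (by simp)] at h20
    have hid := I.nid_lt hA
    rw [← h20] at hid
    have hU0 : 0 < 2 ^ 2 ^ J := by positivity
    set d := p / (2 ^ 2 ^ J) ^ h % 2 ^ 2 ^ J with hd
    have hdU : d < 2 ^ 2 ^ J := Nat.mod_lt _ hU0
    have hsl := F.slot hdU hid
    have hsh := F.shift_ok (h := h) (by omega)
    have hch := I.child _ _ _ hA d hdU
    rw [← h20, prefix_eq] at hch
    have hmem : (γ, h, p / (2 ^ 2 ^ J) ^ h) ∈ below D J S ∪ path J γ p (h + 1) D ↔
        (γ, h, p / (2 ^ 2 ^ J) ^ h) ∈ below D J S := by simp [path]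
    have hLb := path_bot (J := J) (γ := γ) (p := p) (show h < D by omega)
    simp [-wp_ite, slotExp, digitExp, W.height, W.b, W.U, W.pos, hsl, hsh, shift_eq, ← hd]
    rw [wp_ite]
    -- the end of the round, for the node that exists now
    have hend : ∀ (s1 : State) (nid' : Node → ℕ),
        Inv n D J (inner n D J S ∪ path J γ p (max h 1) D) (below D J S ∪ path J γ p h D) nid'
          (s1.m 15) (s1.m 4) s1.nd → s1.r 46 = ptr nid' (γ, h, p / (2 ^ 2 ^ J) ^ h) →
        UpdFrame s s1 → s1.r 42 = h + 1 → s1.r 48 = 2 ^ J → s1.r 49 = 2 ^ 2 ^ J →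
        s1.t ≤ s.t + 50 * J + 80 → Wp Y (.set 20 (.reg 46) ;; .set 42 (.reg 42 - 1))
          (Wp Y insertLoop Q) s1 := by
      intro s1 nid' I1 e46 hfr e42 e48 e49 ht
      simp [e42]
      refine ih (s := (s1.set 20 (s1.r 46)).set 42 h) (nid := nid') ?_ ?_ ?_ (by omega)
        (by simpa using I1) (by simp [e46]) fun s' nid' g1 g2 g3 => hQ s' nid' g1
          ⟨fun k h1 h2 => (g2.1 k h1 h2).trans (hfr.1 k h1 h2), fun i hi => ?_⟩ ?_
      · simp [hfr.2, h43]
      · simp [hfr.2, h44]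
      · exact ⟨by simp [hfr.2, W.pos], by simp [hfr.2, W.color], by simp, by simp [e48],
          by simp [e49]⟩
      · rw [g2.2 i hi, ← hfr.2 i hi]
        have : i ≠ 20 ∧ i ≠ 42 := by omega
        simp [this]
      · simp at g3; rw [Nat.succ_mul]; omega
    by_cases hL : (γ, h, p / (2 ^ 2 ^ J) ^ h) ∈ below D J S
    · have hne : s.m 15 (s.r 20 * 2 ^ 2 ^ J + d) ≠ 0 := by
        rw [hch.1 (.inl hL)]; exact ptr_ne_zero I (.inl hL) (by simp; omega) F.n_pos
      refine ⟨by simp, fun h => by simp [hne] at h, fun _ => ?_⟩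
      rw [wp_skip]
      refine hend _ nid ?_ (by simpa using hch.1 (.inl hL))
        ⟨fun k _ _ => rfl, fun i hi => ?_⟩
        (by simp [W.height]) (by simp [W.b]) (by simp [W.U]) (by simp; omega)
      · have e1 : below D J S ∪ path J γ p h D = below D J S ∪ path J γ p (h + 1) D := by
          rw [hLb, Set.union_insert, Set.insert_eq_of_mem (.inl hL)]
        have e2 : inner n D J S ∪ path J γ p (max h 1) D =
            inner n D J S ∪ path J γ p (h + 1) D := by
          rcases Nat.eq_zero_or_pos h with rfl | h1
          · rfl
          · rw [max_eq_left (by omega), hLb, Set.union_insert,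
              Set.insert_eq_of_mem (.inl ((mem_inner_iff h1 (by omega)).2 hL))]
        rw [e1, e2]; exact I
      · have : i ≠ 45 ∧ i ≠ 46 := by omega
        simp [this]
    · have hz := hch.2 (by rwa [hmem])
      refine ⟨by simp, fun _ => ?_, fun h => by simp [hz] at h⟩
      rw [wp_seq]
      refine wp_alloc (A := inner n D J S ∪ path J γ p (h + 1) D)
        (A' := inner n D J S ∪ path J γ p (max h 1) D)
        (L := below D J S ∪ path J γ p (h + 1) D) (nid := nid) (h := h) F
        ⟨by simp [W.pos], by simp [W.color], by simp [W.height], by simp [W.b], by simp [W.U]⟩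
        (by omega) hγ hp (by simpa using I) ?_ ?_ ?_ ?_ fun s1 nid' a1 a2 a3 a4 a5 a6 a7 => ?_
      · rintro h1 (h2 | h2)
        · exact hL ((mem_inner_iff h1 (by omega)).1 h2)
        · have := h2.2.1.1; simp at this
      · rintro h1 d' (⟨h2, x, hx, h3⟩ | h2) he
        · refine hL ⟨by simp; omega, x, hx, ?_⟩
          simp only at h3 ⊢
          rw [← he, ← h3, div_pow_succ, Nat.sub_add_cancel h1]
        · have := h2.2.1.1
          simp only at this; omega
      · intro _
        simp only [State.tick_m, State.set_m]
        refine I.free_pos F.n_pos F.D_pos col ?_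
        rintro γ' h' q (h2 | ⟨h2, -, h3⟩) hh
        · rcases h2 with h2 | ⟨-, -, x, hx, h3⟩
          · exact absurd h2.2.1 (by simp; omega)
          · exact ⟨x, (hlt _ _ hx).2, hcol _ _ hx, h3⟩
        · exact ⟨p, hp, hcp.trans h2.symm, h3.symm⟩
      · rcases Nat.eq_zero_or_pos h with rfl | h1
        · simp
        · rw [if_neg (by omega), max_eq_left (by omega), hLb, Set.union_insert]
      · simp at a4 a5 a6 a7
        have hin : inner n D J S ∪ path J γ p (h + 1) D ⊆
            inner n D J S ∪ path J γ p (max h 1) D :=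
          Set.union_subset_union_right _ fun x hx => ⟨hx.1, ⟨by have := hx.2.1.1; omega,
            hx.2.1.2⟩, hx.2.2⟩
        refine wp_link (pr := pr) (su := su) (S := S) (s := s1) F
          ⟨by simp [a6, W.pos], by simp [a6, W.color], by simp [a6, W.height], by simp [a6, W.b],
            by simp [a6, W.U]⟩ (by omega) a1 (hin hA) (by rwa [hmem])
          (fun h1 => .inr ⟨rfl, ⟨by simp; omega, by simp; omega⟩, rfl⟩)
          (digits_partial (.inl (by omega))) hN (by simp [a6, h43]) (by simp [a6, h44])
          (by simp [a6, a2 _ hA, h20]) (by simp [a6, hd]) a3 fun s2 b1 b2 b3 b4 => ?_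
        refine hend s2 nid' (by rw [hLb, Set.union_insert]; exact b1) ?_
          ⟨fun k h1 h2 => ?_, fun i hi => ?_⟩ ?_ ?_ ?_ (by omega)
        · rw [b3 _ (by omega), a3]
        · rw [b2 k h2, a5 k h1]
        · rw [b3 i (by omega), a6 i (by omega) (by omega)]
          have : i ≠ 45 ∧ i ≠ 46 := by omega
          simp [this]
        · rw [b3 _ (by omega), a6 _ (by omega) (by omega)]; simp [W.height]
        · rw [b3 _ (by omega), a6 _ (by omega) (by omega)]; simp [W.b]
        · rw [b3 _ (by omega), a6 _ (by omega) (by omega)]; simp [W.U]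

/-- The time is `O(D * J)`: on each level of the trie there is at most one insertion of a digit. -/
theorem wp_insertTrie (F : Fits Y n D J) (H : Holds n D J S (inner n D J S) (below D J S) nid s)
    (hγ : γ < n) (hp : p < n) {col : ℕ → ℕ} (hcol : ∀ γ, ∀ p ∈ S γ, col p = γ) (hcp : col p = γ)
    (hN : Nbrs (S γ) p pr su) (h40 : s.r 40 = p) (h41 : s.r 41 = γ) (h43 : s.r 43 = pr)
    (h44 : s.r 44 = su) {S' : ℕ → Set ℕ} (hS' : S' = update S γ (Insert.insert p (S γ)))
    (hQ : ∀ s' nid', Holds n D J S' (inner n D J S') (below D J S') nid' s' → UpdFrame s s' →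
      s'.t ≤ s.t + D * (50 * J + 90) + 5 → Q s') : Wp Y insertTrieCmd Q s := by
  obtain ⟨I, P, hlt⟩ := H
  subst hS'
  rw [insertTrieCmd, wp_seq]
  refine F.start P h40 h41 fun s1 g1 g2 W g3 g4 g5 => ?_
  refine wp_insertTrie_loop (nid := nid) F hlt hγ hp hcol hcp hN (by simp [g4, h43])
    (by simp [g4, h44]) W le_rfl ?_ ?_ fun s2 nid' f1 f2 f3 => ?_
  · rw [max_eq_left F.D_pos, path_self, Set.union_empty, Set.union_empty, g1, g2]; exact I
  · rw [ptr_of_pos (by simpa using F.D_pos), Nat.div_eq_of_lt (hp.trans_le F.n_le),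
      I.nid_root γ hγ, g3]
  · have hfr : UpdFrame s s2 := ⟨fun k h1 h2 => by rw [f2.1 k h1 h2, g1], fun i hi => by
      rw [f2.2 i hi, g4 i (by omega) (by omega) (by omega) (by omega)]⟩
    refine hQ s2 nid' ⟨by rw [below_insert, inner_insert]; exact f1, ?_, ?_⟩ hfr (by omega)
    · have := hfr.1 0 (by omega) (by omega)
      exact ⟨by rw [this, P.U], by rw [this, P.b], by rw [this, P.D]⟩
    · intro γ' p' hp'
      by_cases hg : γ' = γ
      · subst hg
        rw [update_self] at hp'
        rcases hp' with rfl | hp'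
        · exact ⟨hγ, hp⟩
        · exact hlt _ _ hp'
      · rw [update_of_ne hg] at hp'; exact hlt _ _ hp'

end

/-! ### Deletion from a trie -/

/-- Set register `50` to `1` if the subtree of the next node contains the neighbor in register
`k`. -/
def keepCmd (k : ℕ) : Cmd :=
  .ite (.ne (.reg k) 0)
    (.ite (.eq ((Exp.reg k - 1) >>> ((Exp.reg 42 - 1) * Exp.reg 48))
        (Exp.reg 40 >>> ((Exp.reg 42 - 1) * Exp.reg 48))) (.set 50 1) .skip) .skip

/-- Unlink the next node from its parent. The parent is freed if register `47` is `1`. -/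
def unlinkCmd : Cmd :=
  sideCmd 43 24 ;; .set 21 0 ;; .set 22 (.reg 48) ;; .set 23 (.reg 45) ;; eraseCmd ;;
  .put 15 slotExp 0 ;;
  .ite (.eq (.reg 47) 1)
    (.set 51 (Exp.arr 4 0 + 1) ;; .put 4 (.reg 51) rV ;; .put 4 0 (.reg 51)) .skip ;;
  .set 47 1

/-- Walk down to the leaf and remove what is not needed on the path. -/
def deleteLoop : Cmd :=
  .whl (.ne (.reg 42) 0)
    (.set 45 (digitExp (.reg 40)) ;; .set 46 (.arr 15 slotExp) ;; .set 50 0 ;;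
     keepCmd 43 ;; keepCmd 44 ;;
     .ite (.eq (.reg 50) 0) unlinkCmd .skip ;;
     .set 20 (.reg 46) ;; .set 42 (.reg 42 - 1))

/-- Delete the position in register `40` from the trie of the color in register `41`. The registers
`43` and `44` hold its neighbors. -/
def deleteTrieCmd : Cmd := startCmd ;; .set 47 0 ;; deleteLoop

section

variable {Y : Layout} {n D J γ p h pr su : ℕ} {s : State} {S : ℕ → Set ℕ} {A L : Set Node}
  {nid : Node → ℕ} {Q : State → Prop}

theorem wp_keep (W : Walk n D J γ p (h + 1) s) (F : Fits Y n D J) (hD : h < D) {k : ℕ}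
    (hk : k < 100) (hQ : ∀ s', s'.m = s.m → s'.nd = s.nd → (∀ i, i ≠ 50 → s'.r i = s.r i) →
      s'.r 50 = (if s.r k ≠ 0 ∧ (s.r k - 1) / (2 ^ 2 ^ J) ^ h = p / (2 ^ 2 ^ J) ^ h then 1
        else s.r 50) → s'.t ≤ s.t + 3 → Q s') : Wp Y (keepCmd k) Q s := by
  have hsh := F.shift_ok (h := h) hD.le
  simp [keepCmd, W.pos, W.height, W.b, hsh, shift_eq]
  refine ⟨hk, fun h2 => ⟨hk, fun h3 => hQ _ rfl rfl ?_ ?_ ?_, fun h3 => hQ _ rfl rfl ?_ ?_ ?_⟩,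
    fun h2 => hQ _ rfl rfl ?_ ?_ ?_⟩
  all_goals first | (intro i hi; simp [hi]) | simp [*]

theorem wp_unlink (F : Fits Y n D J) (W : Walk n D J γ p (h + 1) s) (hD : h < D)
    (I : Inv n D J A L nid (s.m 15) (s.m 4) s.nd)
    (hA : (γ, h + 1, p / (2 ^ 2 ^ J) ^ (h + 1)) ∈ A) (hL : (γ, h, p / (2 ^ 2 ^ J) ^ h) ∈ L)
    (hS : (γ, h, p / (2 ^ 2 ^ J) ^ h) ∉ below D J S) (hdig : L = below D J S ∪ path J γ p 0 (h + 1))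
    (hN : Nbrs (S γ) p pr su) (h43 : s.r 43 = pr)
    (h20 : s.r 20 = nid (γ, h + 1, p / (2 ^ 2 ^ J) ^ (h + 1)))
    (h45 : s.r 45 = p / (2 ^ 2 ^ J) ^ h % 2 ^ 2 ^ J) {f : ℕ} (h47 : s.r 47 = f)
    (hf : f = 1 → h + 1 < D ∧ (γ, h + 1, p / (2 ^ 2 ^ J) ^ (h + 1)) ∉ below D J S)
    (hQ : ∀ s', Inv n D J (if f = 1 then A \ {(γ, h + 1, p / (2 ^ 2 ^ J) ^ (h + 1))} else A)
        (below D J S ∪ path J γ p 0 h) nid (s'.m 15) (s'.m 4) s'.nd →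
      (∀ k, k ≠ 4 → k ≠ 15 → s'.m k = s.m k) →
      (∀ i, i < 20 ∨ 40 ≤ i → i ≠ 47 → i ≠ 51 → s'.r i = s.r i) → s'.r 47 = 1 →
      s'.t ≤ s.t + 80 * J + 100 → Q s') : Wp Y unlinkCmd Q s := by
  have hU0 : 0 < 2 ^ 2 ^ J := by positivity
  have hdU : p / (2 ^ 2 ^ J) ^ h % 2 ^ 2 ^ J < 2 ^ 2 ^ J := Nat.mod_lt _ hU0
  have hid := I.nid_lt hA
  rw [← h20] at hid
  have hsl := F.slot hdU hid
  have hbd := F.bounds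
  have hsz := F.size
  have hw := F.window
  have hni := F.nodes
  have hNW := F.arr
  have hLb := path_top (J := J) (γ := γ) (p := p) (Nat.zero_le h)
  have hnp : (γ, h, p / (2 ^ 2 ^ J) ^ h) ∉ path J γ p 0 h := fun h => by
    have := h.2.1.2; simp at this
  have hL' : below D J S ∪ path J γ p 0 h = L \ {(γ, h, p / (2 ^ 2 ^ J) ^ h)} := by
    rw [hdig, hLb]
    ext x
    by_cases hx : x = (γ, h, p / (2 ^ 2 ^ J) ^ h)
    · subst hx; simp [hS, hnp]
    · simp [hx]
  have hnd : p / (2 ^ 2 ^ J) ^ h % 2 ^ 2 ^ J ∉ digits J (below D J S) γ h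
      (p / (2 ^ 2 ^ J) ^ (h + 1)) := by
    simp only [digits, Set.mem_ofPred_eq, prefix_eq]
    tauto
  have hP := (hN.digit_ok hD rfl hnd).1.1
  simp only [pow_zero, Nat.div_one] at hP
  have hE : EraseOk 0 (digits J L γ h (p / (2 ^ 2 ^ J) ^ (h + 1))) (· < 2 ^ 2 ^ J)
      (p / (2 ^ 2 ^ J) ^ h % 2 ^ 2 ^ J) (sideDigit J p h pr) := by
    have hmem : ∀ κ < p / (2 ^ 2 ^ J) ^ h % 2 ^ 2 ^ J,
        (κ ∈ digits J L γ h (p / (2 ^ 2 ^ J) ^ (h + 1)) ↔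
          κ ∈ digits J (below D J S) γ h (p / (2 ^ 2 ^ J) ^ (h + 1))) := by
      intro κ hκ
      rw [hdig, hLb]
      simp only [digits, Set.mem_ofPred_eq, Set.mem_union, Set.mem_insert_iff, Prod.mk.injEq,
        true_and, path]
      have := prefix_eq p h (2 ^ 2 ^ J)
      constructor
      · rintro ⟨h1, h2 | h2 | h2⟩
        · exact ⟨h1, h2⟩
        · omega
        · omega
      · exact fun h => ⟨h.1, .inl h.2⟩
    intro κ hκ hlt hmax
    simp only [pow_zero, Nat.div_one] at hlt hmax ⊢
    exact hP κ ((hmem κ hlt).1 hκ) hlt fun κ' h1 h2 => hmax κ' ((hmem κ' h2).2 h1) h2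
  set d := p / (2 ^ 2 ^ J) ^ h % 2 ^ 2 ^ J with hd
  rw [unlinkCmd, wp_seq]
  refine wp_side (k := 43) (r := 24) W F hD (by omega) (by omega)
    (by omega) fun s1 a1 a2 a3 a4 a5 => ?_
  rw [h43] at a4
  simp [-wp_ite, a3, W.b, h45]
  refine wp_erase (j := J) (e := 0) (x := d) (p := sideDigit J p h pr)
    ⟨by simp [a3]; omega, by omega, by simp [a2, hsz, I.bound], by omega, hbd.1, hbd.2.1⟩
    (by simp) (by simp) (by simp) (by simp [a4]) rfl
    (by rw [hsz]; exact sideDigit_le) fun s3 c1 c2 c3 c4 => ?_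
  simp [a3, a2] at c1 c2 c4
  have c5 : s3.m = s.m := by rw [c3.1]; simp [a1]
  have hr : ∀ i, i < 21 ∨ 40 ≤ i → s3.r i = s.r i := by
    intro i hi
    rw [c3.2 i hi]
    have : i ≠ 21 ∧ i ≠ 22 ∧ i ≠ 23 ∧ i ≠ 24 := by omega
    simp [this, a3]
  have I1 := I.unlink hA hL rfl hE h20 hd (by rw [← hsz]; exact fun k => c2 _ _ _ _)
  rw [← hL'] at I1
  simp [-wp_ite, slotExp, hr, W.U, h45, hsl]
  by_cases h1 : f = 1
  · rw [if_pos h1] at hQ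
    obtain ⟨g1, g2⟩ := hf h1
    obtain ⟨I2, g3⟩ := I1.dealloc (by omega) g1 hA
      (fun h => h.elim g2 fun h => by have := h.2.1.2; simp at this) (by
        rintro d' (⟨-, x, hx, h3⟩ | h3) he
        · simp only [Nat.add_sub_cancel] at h3
          refine g2 ⟨g1, x, hx, ?_⟩
          simp only
          rw [← he, ← h3, div_pow_succ]
        · have := h3.2.1.2; simp at this)
    have e4 : (s3.put 15 (s.r 20 * 2 ^ 2 ^ J + d) 0).m 4 = s.m 4 := by
      rw [put_m_of_ne _ _ _ (by omega), c5]
    have hlt : s.m 4 0 + 1 < Y.N := by omega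
    have hltW : s.m 4 0 + 1 < Y.W := by omega
    have hpos : 0 < Y.N := by omega
    simp [hr, h47, h1, c5, hlt, hltW, hpos]
    refine hQ _ ?_ ?_ ?_ (by simp) (by simp; linarith)
    · simp only [State.set_m, State.set_nd, State.put_nd, State.tick_nd, c1]
      rw [put_m_self, put_m_self, put_m_of_ne _ _ _ (by omega), put_m_of_ne _ _ _ (by omega)]
      simp only [State.set_m, State.tick_m]
      rw [e4, put_m_self, c5, h20]
      rw [← h20] at I2 ⊢; exact I2
    · intro k h1 h2
      simp only [State.set_m]
      rw [put_m_of_ne _ _ _ h1, put_m_of_ne _ _ _ h1]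
      simp only [State.set_m, State.tick_m]
      rw [put_m_of_ne _ _ _ h2, c5]
    · intro i hi h1 h2; simp [h1, h2, hr i (by omega)]
  · rw [if_neg h1] at hQ
    simp [hr, h47, h1]
    refine hQ _ ?_ (fun k _ h2 => ?_) (fun i hi h1 h2 => by simp [h1, hr i (by omega)]) (by simp)
      (by simp; linarith)
    · simp only [State.set_m, State.set_nd, State.put_nd, State.tick_nd, State.tick_m, c1]
      rw [put_m_self, put_m_of_ne _ _ _ (by omega), c5]; exact I1
    · simp only [State.set_m, State.tick_m]
      rw [put_m_of_ne _ _ _ h2, c5]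

theorem wp_delete_loop (F : Fits Y n D J) (hγ : γ < n) (hp : p < n) (hpS : p ∉ S γ)
    (hN : Nbrs (S γ) p pr su) (h43 : s.r 43 = pr) (h44 : s.r 44 = su)
    (W : Walk n D J γ p h s) (hD : h ≤ D)
    (I : Inv n D J (inner n D J S ∪ path J γ p 1 (min (h + 1) D)) (below D J S ∪ path J γ p 0 h) nid
      (s.m 15) (s.m 4) s.nd) (h20 : s.r 20 = ptr nid (γ, h, p / (2 ^ 2 ^ J) ^ h))
    (h47 : s.r 47 = 1 ↔ h < D ∧ (γ, h, p / (2 ^ 2 ^ J) ^ h) ∉ below D J S)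
    (hQ : ∀ s', Inv n D J (inner n D J S) (below D J S) nid
      (s'.m 15) (s'.m 4) s'.nd → UpdFrame s s' → s'.t ≤ s.t + h * (80 * J + 130) + 1 → Q s') :
    Wp Y deleteLoop Q s := by
  induction h generalizing s with
  | zero =>
    rw [deleteLoop, wp_whl]
    simp only [ok_ne, ok_reg, ok_ofNat, holds_ne, val_reg, W.height, val_ofNat]
    refine ⟨by omega, fun h => absurd rfl h, fun _ => hQ _ ?_
      ⟨fun _ _ _ => rfl, fun _ _ => rfl⟩ (by simp)⟩
    have : min (0 + 1) D = 1 := by have := F.D_pos; omega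
    simpa [this, path_self] using I
  | succ h ih =>
    rw [deleteLoop, wp_whl, ← deleteLoop]
    refine ⟨by simp, fun _ => ?_, fun h => by simp [W.height] at h⟩
    have hA : (γ, h + 1, p / (2 ^ 2 ^ J) ^ (h + 1)) ∈
        inner n D J S ∪ path J γ p 1 (min (h + 1 + 1) D) := by
      rcases mem_partial (S := S) F.n_le hγ hp hD with h1 | h1
      · exact .inl h1
      · exact .inr ⟨rfl, ⟨by simp, by have := h1.2.1.2; simp at this ⊢; omega⟩, rfl⟩
    rw [ptr_of_pos (by simp)] at h20
    have hid := I.nid_lt hA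
    rw [← h20] at hid
    have hU0 : 0 < 2 ^ 2 ^ J := by positivity
    set d := p / (2 ^ 2 ^ J) ^ h % 2 ^ 2 ^ J with hd
    have hdU : d < 2 ^ 2 ^ J := Nat.mod_lt _ hU0
    have hsl := F.slot hdU hid
    have hsh := F.shift_ok (h := h) (by omega)
    have hmem : (γ, h, p / (2 ^ 2 ^ J) ^ h) ∈ below D J S ∪ path J γ p 0 (h + 1) :=
      .inr ⟨rfl, ⟨by simp, by simp⟩, rfl⟩
    have hch := (I.child _ _ _ hA d hdU).1 (by rwa [prefix_eq])
    rw [← h20, prefix_eq] at hch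
    simp [-wp_ite, slotExp, digitExp, W.height, W.b, W.U, W.pos, hsl, hsh, shift_eq, ← hd]
    refine wp_keep (γ := γ) (p := p) (h := h) ⟨by simp [W.pos], by simp [W.color],
      by simp [W.height], by simp [W.b], by simp [W.U]⟩ F (by omega) (by omega)
      fun s1 a1 a2 a3 a4 a5 => ?_
    rw [wp_seq]
    refine wp_keep (γ := γ) (p := p) (h := h) ⟨by simp [a3, W.pos], by simp [a3, W.color],
      by simp [a3, W.height], by simp [a3, W.b], by simp [a3, W.U]⟩ F (by omega) (by omega)
      fun s2 b1 b2 b3 b4 b5 => ?_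
    simp [h43] at a1 a2 a4 a5
    simp [a3, h44, a4] at b4
    have hr : ∀ i, i ≠ 50 → i ≠ 45 → i ≠ 46 → s2.r i = s.r i := by
      intro i h1 h2 h3; simp [b3 i h1, a3 i h1, h1, h2, h3]
    have r46 : s2.r 46 = ptr nid (γ, h, p / (2 ^ 2 ^ J) ^ h) := by
      simp [b3, a3, hch]
    have r45 : s2.r 45 = d := by simp [b3, a3]
    have hshare := hN.shares (h := h) (J := J) hpS
    have hbel : (γ, h, p / (2 ^ 2 ^ J) ^ h) ∈ below D J S ↔
        ∃ x ∈ S γ, x / (2 ^ 2 ^ J) ^ h = p / (2 ^ 2 ^ J) ^ h :=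
      ⟨fun h => h.2, fun h => ⟨by simp; omega, h⟩⟩
    have h50 : s2.r 50 = 0 ↔ (γ, h, p / (2 ^ 2 ^ J) ^ h) ∉ below D J S := by
      rw [hbel, hshare, b4]
      split_ifs <;> simp_all
    have hm2 : s2.m = s.m := by rw [b1, a1]
    have hnd2 : s2.nd = s.nd := by rw [b2, a2]
    have hLb := path_top (J := J) (γ := γ) (p := p) (Nat.zero_le h)
    -- the end of the round
    have hend : ∀ (s3 : State),
        Inv n D J (inner n D J S ∪ path J γ p 1 (min (h + 1) D)) (below D J S ∪ path J γ p 0 h) nid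
          (s3.m 15) (s3.m 4) s3.nd → s3.r 46 = s2.r 46 → UpdFrame s s3 →
        s3.r 42 = h + 1 → s3.r 48 = 2 ^ J → s3.r 49 = 2 ^ 2 ^ J →
        (s3.r 47 = 1 ↔ h < D ∧ (γ, h, p / (2 ^ 2 ^ J) ^ h) ∉ below D J S) →
        s3.t ≤ s.t + 80 * J + 120 → Wp Y (.set 20 (.reg 46) ;; .set 42 (.reg 42 - 1))
          (Wp Y deleteLoop Q) s3 := by
      intro s3 I1 e46 hfr e42 e48 e49 e47 ht
      simp [e42]
      refine ih (s := (s3.set 20 (s3.r 46)).set 42 h) ?_ ?_ ?_ (by omega)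
        (by simpa using I1) (by simp [e46, r46]) (by simp [e47]) fun s' g1 g2 g3 => hQ s' g1
          ⟨fun k h1 h2 => (g2.1 k h1 h2).trans (hfr.1 k h1 h2), fun i hi => ?_⟩ ?_
      · simp [hfr.2, h43]
      · simp [hfr.2, h44]
      · exact ⟨by simp [hfr.2, W.pos], by simp [hfr.2, W.color], by simp, by simp [e48],
          by simp [e49]⟩
      · rw [g2.2 i hi, ← hfr.2 i hi]
        have : i ≠ 20 ∧ i ≠ 42 := by omega
        simp [this]
      · simp at g3; rw [Nat.succ_mul]; omega
    have ht2 : s2.t ≤ s.t + 10 := by omega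
    -- the set of inner nodes after the round
    have hAnew : inner n D J S ∪ path J γ p 1 (min (h + 1) D) =
        if s.r 47 = 1 then (inner n D J S ∪ path J γ p 1 (min (h + 1 + 1) D)) \
          {(γ, h + 1, p / (2 ^ 2 ^ J) ^ (h + 1))}
        else inner n D J S ∪ path J γ p 1 (min (h + 1 + 1) D) := by
      have hcase : h + 1 = D ∨ h + 1 < D := by omega
      rcases hcase with rfl | hhD
      · rw [if_neg (by rw [h47]; omega), min_self, min_eq_right (by omega)]
      · have hp2 := path_top (J := J) (γ := γ) (p := p) (show 1 ≤ h + 1 by omega)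
        rw [min_eq_left hD, min_eq_left (by omega), hp2]
        have hnp : (γ, h + 1, p / (2 ^ 2 ^ J) ^ (h + 1)) ∉ path J γ p 1 (h + 1) := fun h => by
          have := h.2.1.2; simp at this
        split_ifs with h1
        · have hni : (γ, h + 1, p / (2 ^ 2 ^ J) ^ (h + 1)) ∉ inner n D J S := by
            rw [mem_inner_iff (by omega) hhD]; exact (h47.1 h1).2
          ext x
          by_cases hx : x = (γ, h + 1, p / (2 ^ 2 ^ J) ^ (h + 1))
          · subst hx; simp [hni, hnp]
          · simp [hx]
        · have : (γ, h + 1, p / (2 ^ 2 ^ J) ^ (h + 1)) ∈ inner n D J S := by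
            rw [mem_inner_iff (by omega) hhD]
            by_contra h2; exact h1 (h47.2 ⟨hhD, h2⟩)
          rw [Set.union_insert, Set.insert_eq_of_mem (.inl this)]
    rw [wp_seq, wp_ite]
    by_cases hL : (γ, h, p / (2 ^ 2 ^ J) ^ h) ∈ below D J S
    · have h50' : s2.r 50 ≠ 0 := fun h => h50.1 h hL
      refine ⟨by simp, fun h => by simp [h50'] at h, fun _ => ?_⟩
      rw [wp_skip]
      have h47' : s.r 47 ≠ 1 := fun h1 => (h47.1 h1).2
        (below_parent hL (h47.1 h1).1 |> fun h => by rwa [div_pow_succ] at h)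
      rw [if_neg h47'] at hAnew
      refine hend _ ?_ rfl ⟨fun k _ _ => by simp [hm2], fun i hi => ?_⟩ ?_ ?_ ?_ ?_ (by simp; omega)
      · have e1 : below D J S ∪ path J γ p 0 h = below D J S ∪ path J γ p 0 (h + 1) := by
          rw [hLb, Set.union_insert, Set.insert_eq_of_mem (.inl hL)]
        rw [e1, hAnew]
        simpa [hm2, hnd2] using I
      · simp [hr i (by omega) (by omega) (by omega)]
      · simp [hr, W.height]
      · simp [hr, W.b]
      · simp [hr, W.U]
      · simp [hr, h47', hL]
    · refine ⟨by simp, fun _ => ?_, fun h => by simp [h50.2 hL] at h⟩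
      refine wp_unlink (γ := γ) (p := p) (h := h) (pr := pr) (su := su) (nid := nid) (S := S)
        (A := inner n D J S ∪ path J γ p 1 (min (h + 1 + 1) D)) F
        ⟨by simp [hr, W.pos], by simp [hr, W.color], by simp [hr, W.height], by simp [hr, W.b],
          by simp [hr, W.U]⟩ (by omega) (by simpa [hm2, hnd2] using I) hA hmem hL rfl hN
        (by simp [hr, h43]) (by simp [hr, h20]) (by simp [r45, hd])
        (f := s.r 47) (by simp [hr]) h47.1 fun s3 c1 c2 c3 c4 c5 => ?_
      rw [← hAnew] at c1
      simp [hm2] at c2 c3 c5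
      have c6 : ∀ i, i < 20 ∨ 40 ≤ i → i ≠ 47 → i ≠ 51 → i ≠ 50 → i ≠ 45 → i ≠ 46 →
          s3.r i = s.r i := fun i h1 h2 h3 h4 h5 h6 => by rw [c3 i h1 h2 h3, hr i h4 h5 h6]
      refine hend s3 c1 (c3 46 (by omega) (by omega) (by omega)) ⟨c2, fun i hi => ?_⟩ ?_ ?_ ?_ ?_
        (by omega)
      · exact c6 i (by omega) (by omega) (by omega) (by omega) (by omega) (by omega)
      · rw [c6 42 (by omega) (by omega) (by omega) (by omega) (by omega) (by omega), W.height]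
      · rw [c6 48 (by omega) (by omega) (by omega) (by omega) (by omega) (by omega), W.b]
      · rw [c6 49 (by omega) (by omega) (by omega) (by omega) (by omega) (by omega), W.U]
      · exact ⟨fun _ => ⟨by omega, hL⟩, fun _ => c4⟩

/-- The neighbors tell which nodes on the path are still needed without `p`. -/
theorem wp_deleteTrie (F : Fits Y n D J) (hγ : γ < n) (hp : p < n) (hpS : p ∉ S γ) {S' : ℕ → Set ℕ}
    (hS' : S' = update S γ (Insert.insert p (S γ)))
    (H : Holds n D J S' (inner n D J S') (below D J S') nid s)
    (hN : Nbrs (S γ) p pr su) (h40 : s.r 40 = p) (h41 : s.r 41 = γ) (h43 : s.r 43 = pr)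
    (h44 : s.r 44 = su)
    (hQ : ∀ s', Holds n D J S (inner n D J S) (below D J S) nid s' → UpdFrame s s' →
      s'.t ≤ s.t + D * (80 * J + 130) + 6 → Q s') : Wp Y deleteTrieCmd Q s := by
  obtain ⟨I, P, hlt'⟩ := H
  subst hS'
  have hlt : ∀ γ, ∀ p ∈ S γ, γ < n ∧ p < n := by
    intro γ' p' hp'
    refine hlt' γ' p' ?_
    by_cases hg : γ' = γ
    · subst hg; rw [update_self]; exact .inr hp'
    · rwa [update_of_ne hg]
  rw [deleteTrieCmd, wp_seq]
  refine F.start P h40 h41 fun s1 g1 g2 W g3 g4 g5 => ?_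
  rw [wp_seq, wp_set]
  refine ⟨by omega, by simp, ?_⟩
  rw [below_insert, inner_insert] at I
  refine wp_delete_loop (nid := nid) (γ := γ) (p := p) (h := D) F hγ hp hpS hN
    (by simp [g4, h43]) (by simp [g4, h44])
    ⟨by simp [W.pos], by simp [W.color], by simp [W.height], by simp [W.b], by simp [W.U]⟩ le_rfl
    ?_ ?_ (by simp) fun s2 f1 f2 f3 => ?_
  · rw [min_eq_right (by omega)]
    simpa [g1, g2] using I
  · rw [ptr_of_pos (by simpa using F.D_pos), Nat.div_eq_of_lt (hp.trans_le F.n_le),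
      I.nid_root γ hγ]
    simp [g3]
  · have hfr : UpdFrame s s2 := ⟨fun k h1 h2 => by rw [f2.1 k h1 h2]; simp [g1], fun i hi => by
      rw [f2.2 i hi, State.set_r, if_neg (by omega),
        g4 i (by omega) (by omega) (by omega) (by omega)]⟩
    refine hQ s2 ⟨f1, ?_, hlt⟩ hfr (by simp at f3; omega)
    have := hfr.1 0 (by omega) (by omega)
    exact ⟨by rw [this, P.U], by rw [this, P.b], by rw [this, P.D]⟩

end

end Trie

namespace Nca

/-! ### Range minima -/

/-- The minimum of `A` on the interval from `a` to `b - 1`, or `n` if it is empty. -/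
def minOn (n : ℕ) (A : ℕ → ℕ) (a b : ℕ) : ℕ := (Finset.Ico a b).fold min n A

/-- The stack of the strict suffix minima of the interval from `a` to `a + k`, as a bit mask. -/
def enc (n : ℕ) (A : ℕ → ℕ) : ℕ → ℕ → ℕ
  | _, 0 => 1
  | a, k + 1 => 2 * enc n A (a + 1) k + if A a < minOn n A (a + 1) (a + k + 2) then 1 else 0

section

variable {n : ℕ} {A : ℕ → ℕ} {a b c k : ℕ}

theorem le_minOn : c ≤ minOn n A a b ↔ c ≤ n ∧ ∀ i, a ≤ i → i < b → c ≤ A i := by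
  simp [minOn, Finset.le_fold_min]

theorem minOn_le : minOn n A a b ≤ n := (le_minOn.1 le_rfl).1

theorem enc_pos : 0 < enc n A a k := by
  induction k generalizing a with
  | zero => simp [enc]
  | succ k ih => have := ih (a := a + 1); simp only [enc]; omega

theorem enc_lt : enc n A a k < 2 ^ (k + 1) := by
  induction k generalizing a with
  | zero => simp [enc]
  | succ k ih =>
    have := ih (a := a + 1)
    rw [enc, pow_succ]
    split_ifs <;> omega

theorem enc_div {i : ℕ} (hi : i ≤ k) : enc n A a k / 2 ^ i = enc n A (a + i) (k - i) := by
  induction i generalizing a k with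
  | zero => simp
  | succ i ih =>
    obtain ⟨k, rfl⟩ : ∃ k', k = k' + 1 := ⟨k - 1, by omega⟩
    have h2 : enc n A a (k + 1) / 2 = enc n A (a + 1) k := by rw [enc]; split_ifs <;> omega
    rw [pow_succ', ← Nat.div_div_eq_div_mul, h2, ih (by omega), Nat.succ_sub_succ]
    congr 1; omega

/-- The lowest bit of the mask shows where the minimum is. -/
theorem apply_enc (hA : ∀ i, A i ≤ n) : padicValNat 2 (enc n A a k) ≤ k ∧
      A (a + padicValNat 2 (enc n A a k)) = minOn n A a (a + k + 1) := by
  induction k generalizing a with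
  | zero =>
    simp only [enc, padicValNat_one_right, add_zero]
    refine ⟨le_rfl, eq_of_forall_le_iff fun c => ?_⟩
    rw [le_minOn]
    exact ⟨fun h => ⟨h.trans (hA a), fun i h1 h2 => by rwa [show i = a by omega]⟩,
      fun h => h.2 a le_rfl (by omega)⟩
  | succ k ih =>
    obtain ⟨h1, h2⟩ := ih (a := a + 1)
    rw [show a + 1 + k + 1 = a + k + 2 by omega] at h2
    have h4 : minOn n A a (a + (k + 1) + 1) = min (A a) (minOn n A (a + 1) (a + k + 2)) := by
      refine eq_of_forall_le_iff fun c => ?_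
      rw [le_min_iff, le_minOn, le_minOn]
      refine ⟨fun h => ⟨h.2 a le_rfl (by omega), h.1, fun i h5 h6 => h.2 i (by omega) (by omega)⟩,
        fun h => ⟨h.2.1, fun i h5 h6 => ?_⟩⟩
      rcases h5.eq_or_lt with rfl | h5
      · exact h.1
      · exact h.2.2 i h5 (by omega)
    rw [h4, enc]
    split_ifs with h3
    · rw [padicValNat.eq_zero_of_not_dvd (by omega), add_zero, min_eq_left h3.le]
      exact ⟨Nat.zero_le _, rfl⟩
    · rw [add_zero, padicValNat.mul (by omega) enc_pos.ne', padicValNat.self (by omega),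
        min_eq_right (not_lt.1 h3), ← h2]
      exact ⟨by omega, by rw [add_assoc]⟩

/-- The minimum of an interval that is not contained in a block of length `β`. -/
theorem minOn_blocks {β l r k : ℕ} (hβ : 0 < β) (h1 : 2 ^ k ≤ r / β - l / β)
    (h2 : r / β - l / β < 2 * 2 ^ k) :
    min (min (min (minOn n A l ((l / β + 1) * β)) (minOn n A (r / β * β) (r + 1)))
      (minOn n A ((l / β + 1) * β) ((l / β + 2 ^ k) * β)))
      (minOn n A ((r / β - 2 ^ k + 1) * β) ((r / β - 2 ^ k + 2 ^ k) * β)) =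
        minOn n A l (r + 1) := by
  have hp := Nat.one_le_two_pow (n := k)
  have e1 := Nat.div_add_mod' l β
  have e2 := Nat.div_add_mod' r β
  have e3 := Nat.mod_lt l hβ
  generalize l / β = x at *
  generalize r / β = y at *
  have g : ∀ u v, u ≤ v → u * β ≤ v * β := fun u v h => Nat.mul_le_mul_right _ h
  have g1 := g (x + 1) (x + 2 ^ k) (by omega)
  have g2 := g (x + 2 ^ k) y (by omega)
  have g3 := g (x + 1) (y - 2 ^ k + 1) (by omega)
  have g4 := g (y - 2 ^ k + 1) (x + 2 ^ k) (by omega)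
  have g6 := g (x + 1) y (by omega)
  have g5 : (x + 1) * β = x * β + β := Nat.succ_mul _ _
  rw [Nat.sub_add_cancel (by omega)]
  refine eq_of_forall_le_iff fun c => ?_
  simp only [le_min_iff, le_minOn]
  constructor
  · rintro ⟨⟨⟨⟨h, i1⟩, -, i2⟩, -, i3⟩, -, i4⟩
    refine ⟨h, fun i h5 h6 => ?_⟩
    by_cases j1 : i < (x + 1) * β
    · exact i1 i h5 j1
    by_cases j2 : i < (x + 2 ^ k) * β
    · exact i3 i (by omega) j2
    by_cases j3 : i < y * β
    · exact i4 i (by omega) j3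
    · exact i2 i (by omega) h6
  · rintro ⟨h, i1⟩
    exact ⟨⟨⟨⟨h, fun i _ _ => i1 i (by omega) (by omega)⟩, h, fun i _ _ => i1 i (by omega)
      (by omega)⟩, h, fun i _ _ => i1 i (by omega) (by omega)⟩, h, fun i _ _ => i1 i (by omega)
      (by omega)⟩

end

/-! ### Nearest common ancestors -/

/-- The ancestor relation of a tree whose vertices are numbered in preorder. -/
structure IsPreorder (n : ℕ) (Anc : ℕ → ℕ → Prop) : Prop where
  lt : ∀ {a v}, Anc a v → v < n
  refl : ∀ {v}, v < n → Anc v v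
  le : ∀ {a v}, Anc a v → a ≤ v
  mid : ∀ {a i v}, Anc a v → a ≤ i → i ≤ v → Anc a i
  trans : ∀ {a b v}, Anc a b → Anc b v → Anc a v
  root : ∀ {v}, v < n → Anc 0 v

open Classical in
/-- The parent of a vertex: the greatest proper ancestor. -/
noncomputable def par (Anc : ℕ → ℕ → Prop) (i : ℕ) : ℕ := Nat.findGreatest (Anc · i) (i - 1)

section

variable {n : ℕ} {Anc : ℕ → ℕ → Prop} {c i p v : ℕ}

theorem par_le : par Anc i ≤ i - 1 := by
  classical
  exact Nat.findGreatest_le _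

theorem IsPreorder.anc_par (h : IsPreorder n Anc) (hi : i < n) : Anc (par Anc i) i := by
  classical
  exact Nat.findGreatest_spec (P := (Anc · i)) (Nat.zero_le _) (h.root hi)

theorem le_par (hc : Anc c i) (hci : c < i) : c ≤ par Anc i := by
  classical
  exact Nat.le_findGreatest (by omega) hc

/-- The nearest common ancestor of two vertices is the least parent of a vertex after the first one
and up to the second one. -/
theorem IsPreorder.nca (h : IsPreorder n Anc) (hpv : p < v) (hv : v < n) {m : ℕ}
    (hm : m = minOn n (par Anc) (p + 1) (v + 1)) :
    Anc m p ∧ Anc m v ∧ ∀ c, Anc c p → Anc c v → c ≤ m := by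
  subst hm
  have key : ∀ c, Anc c p → Anc c v → c ≤ minOn n (par Anc) (p + 1) (v + 1) := by
    intro c h1 h2
    have := h.le h1
    exact le_minOn.2 ⟨by omega, fun i h3 h4 =>
      le_par (h.mid h2 (by omega) (by omega)) (by omega)⟩
  -- the first vertex on the way from `v` to the root whose parent is at most `p`
  have walk : ∀ i, p < i → Anc i v → ∃ i, p < i ∧ Anc i v ∧ par Anc i ≤ p := by
    intro i
    induction i using Nat.strong_induction_on with
    | _ i ih =>
      intro h1 h2
      by_cases h3 : par Anc i ≤ p
      · exact ⟨i, h1, h2, h3⟩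
      · have := par_le (Anc := Anc) (i := i)
        exact ih _ (by omega) (by omega) (h.trans (h.anc_par ((h.le h2).trans_lt hv)) h2)
  obtain ⟨i, h1, h2, h3⟩ := walk v hpv (h.refl hv)
  have hiv := h.le h2
  have h4 := h.anc_par (hiv.trans_lt hv)
  have h5 := h.mid h4 h3 h1.le
  have h6 := key _ h5 (h.trans h4 h2)
  have h7 := (le_minOn.1 (le_refl (minOn n (par Anc) (p + 1) (v + 1)))).2 i (by omega) (by omega)
  rw [le_antisymm h7 h6]
  exact ⟨h5, h.trans h4 h2, fun c h8 h9 => (key c h8 h9).trans h7⟩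

end

/-! ### The preorder of a tree -/

section

variable {n : ℕ} {T : SimpleGraph (Fin n)} {r : Fin n}

theorem prefix_of_le {α : Type*} [LinearOrder α] {a i v : List α} (h : a <+: v) (h1 : a ≤ i)
    (h2 : i ≤ v) : a <+: i := by
  induction a generalizing i v with
  | nil => exact List.nil_prefix
  | cons x a ih =>
    obtain ⟨t, rfl⟩ := h
    cases i with
    | nil => exact absurd (List.nil_lt_cons x a) (not_lt.2 h1)
    | cons y i =>
      rw [List.cons_append, ← not_lt, List.cons_lt_cons_iff, not_or, not_and, not_lt, not_lt] at h2
      rw [← not_lt, List.cons_lt_cons_iff, not_or, not_and, not_lt, not_lt] at h1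
      obtain rfl := le_antisymm h1.1 h2.1
      rw [List.cons_prefix_cons]
      exact ⟨rfl, ih (List.prefix_append a t) (h1.2 rfl) (h2.2 rfl)⟩

theorem le_append {α : Type*} [LinearOrder α] (a t : List α) : a ≤ a ++ t := by
  induction a with
  | nil => cases t with
    | nil => exact le_rfl
    | cons x t => exact (List.nil_lt_cons x t).le
  | cons x a ih => exact List.cons_le_cons x ih

/-- The vertices of a tree can be numbered in preorder: the paths from the root, as lists, are
ordered lexicographically. -/
theorem exists_preorder (hT : T.IsTree) (r : Fin n) : ∃ (e : Fin n ≃ Fin n) (Anc : ℕ → ℕ → Prop),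
    IsPreorder n Anc ∧ (∀ u v : Fin n, IsAncestor T r u v ↔ Anc (e u) (e v)) ∧
    ∀ a b v : Fin n, IsAncestor T r a v → IsAncestor T r b v → e b ≤ e a →
      T.dist v a ≤ T.dist v b := by
  classical
  choose q hq hq' using hT.existsUnique_path r
  have huniq : ∀ {x y} {p p' : T.Walk x y}, p.IsPath → p'.IsPath → p = p' := fun h h' =>
    (hT.existsUnique_path _ _).unique h h'
  have hanc : ∀ u v, IsAncestor T r u v ↔ u ∈ (q v).support := fun u v =>
    ⟨fun ⟨p, hp, hu⟩ => hq' v p hp ▸ hu, fun h => ⟨_, hq v, h⟩⟩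
  have htake : ∀ {u v} (h : u ∈ (q v).support), (q v).takeUntil u h = q u := fun h =>
    hq' _ _ ((hq _).takeUntil h)
  have hpre : ∀ u v, u ∈ (q v).support ↔ (q u).support <+: (q v).support := by
    refine fun u v => ⟨fun h => ?_, fun h => h.subset (q u).end_mem_support⟩
    have h1 := congrArg SimpleGraph.Walk.support ((q v).take_spec h)
    rw [htake, SimpleGraph.Walk.support_append] at h1; exact ⟨_, h1⟩
  have hinj : Function.Injective fun v => (q v).support := by
    intro u v h
    have h1 := (q u).getLast_support
    simp only [h] at h1
    rw [← h1, (q v).getLast_support]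
  have hdist : ∀ u v, u ∈ (q v).support → T.dist v u + (q u).length = (q v).length := by
    intro u v h
    obtain ⟨p, hp, hl⟩ := (hT.connected u v).exists_path_of_dist
    have h1 := congrArg SimpleGraph.Walk.length ((q v).take_spec h)
    rw [SimpleGraph.Walk.length_append, htake, huniq ((hq v).dropUntil h) hp, hl] at h1
    rw [SimpleGraph.dist_comm]; omega
  have hcard : (Finset.univ.image fun v => (q v).support).card = n := by
    rw [Finset.card_image_of_injective _ hinj, Finset.card_univ, Fintype.card_fin]
  let o := Finset.orderIsoOfFin _ hcard
  let f : Fin n → Fin n := fun v => o.symm ⟨(q v).support, Finset.mem_image_of_mem _ (by simp)⟩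
  have hf : ∀ u v, f u ≤ f v ↔ (q u).support ≤ (q v).support := fun u v =>
    o.symm.le_iff_le.trans Iff.rfl
  have hfi : Function.Injective f := fun u v h => hinj (congrArg Subtype.val (o.symm.injective h))
  let e : Fin n ≃ Fin n := Equiv.ofBijective f (Finite.injective_iff_bijective.1 hfi)
  have he : ∀ v, e v = f v := fun v => rfl
  have hle : ∀ {u v}, (q u).support <+: (q v).support → f u ≤ f v := by
    rintro u v ⟨t, ht⟩
    rw [hf, ← ht]; exact le_append _ _
  have hval : ∀ i (hi : i < n), ∃ u, (f u : ℕ) = i := fun i hi =>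
    ⟨e.symm ⟨i, hi⟩, by rw [← he, Equiv.apply_symm_apply]⟩
  have hfv : ∀ {u v}, (f u : ℕ) = f v → u = v := fun h => hfi (Fin.ext h)
  refine ⟨e, fun a v => ∃ u w, (f u : ℕ) = a ∧ (f w : ℕ) = v ∧ (q u).support <+: (q w).support,
    ⟨?_, ?_, ?_, ?_, ?_, ?_⟩, fun u v => ?_, fun a b v ha hb hab => ?_⟩
  · rintro a v ⟨u, w, -, rfl, -⟩; exact (f w).2
  · intro v hv
    obtain ⟨u, rfl⟩ := hval v hv; exact ⟨u, u, rfl, rfl, List.prefix_rfl⟩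
  · rintro a v ⟨u, w, rfl, rfl, h⟩; exact hle h
  · rintro a i v ⟨u, w, rfl, rfl, h⟩ h1 h2
    obtain ⟨x, rfl⟩ := hval i (h2.trans_lt (f w).2)
    exact ⟨u, x, rfl, rfl, prefix_of_le h ((hf u x).1 h1) ((hf x w).1 h2)⟩
  · rintro a b v ⟨u, w, rfl, rfl, h⟩ ⟨u', w', h1, rfl, h'⟩
    obtain rfl := hfv h1; exact ⟨u, w', rfl, rfl, h.trans h'⟩
  · intro v hv
    obtain ⟨w, rfl⟩ := hval v hv
    obtain ⟨u, hu⟩ := hval 0 (by omega)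
    refine ⟨u, w, hu, rfl, ?_⟩
    have hr : ∀ v, (q r).support <+: (q v).support := fun v => (hpre r v).1 (q v).start_mem_support
    have h1 := hle (hr u)
    have h2 : u = r := hfv (le_antisymm (by omega) h1); exact h2 ▸ hr w
  · rw [hanc, hpre, he, he]
    refine ⟨fun h => ⟨u, v, rfl, rfl, h⟩, ?_⟩
    rintro ⟨u', w, h1, h2, h⟩
    rwa [hfv h1, hfv h2] at h
  · rw [hanc] at ha hb
    have h1 := prefix_of_le ((hpre b v).1 hb) ((hf b a).1 hab)
      ((hf a v).1 (hle ((hpre a v).1 ha)))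
    have h2 := h1.length_le
    simp only [SimpleGraph.Walk.length_support] at h2
    have h3 := hdist a v ha
    have h4 := hdist b v hb; omega

end

open Veb Ram Trie

/-! ### The lists of the positions of each color -/

/-- The positions of the color `γ`; the color `0` of a position stands for no color. -/
def cls (n : ℕ) (col : ℕ → ℕ) (γ : ℕ) : Set ℕ := {p | p < n ∧ col p = γ + 1}

section

variable {n p γ pr su x a b : ℕ} {col : ℕ → ℕ} {C : Set ℕ}

theorem cls_update (h0 : col p = 0) (hp : p < n) : cls n (update col p (γ + 1)) =
    update (cls n col) γ (Insert.insert p (cls n col γ)) := by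
  funext γ'
  ext x
  by_cases hx : x = p <;> by_cases hγ : γ' = γ <;>
    simp_all [cls, update_apply, eq_comm]

/-- The neighbors of `x` after the insertion of `p`. -/
theorem _root_.Trie.Nbrs.insert (N : Nbrs C p pr su) (hp : p ∉ C) (hx : x ∈ C) (M : Nbrs C x a b) :
    Nbrs (Insert.insert p C) x (if su = x + 1 then p + 1 else a)
      (if pr = x + 1 then p + 1 else b) := by
  have hne : x ≠ p := fun h => hp (h ▸ hx)
  obtain ⟨n1, n2, n3, n4⟩ := N
  obtain ⟨m1, m2, m3, m4⟩ := M
  refine ⟨?_, ?_, ?_, ?_⟩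
  · grind
  · grind
  · grind
  · grind

/-- The neighbors of `x` after the removal of `p`. -/
theorem _root_.Trie.Nbrs.remove (N : Nbrs C p pr su) (hp : p ∉ C) (hx : x ∈ C)
    (M : Nbrs (Insert.insert p C) x a b) :
    Nbrs C x (if su = x + 1 then pr else a) (if pr = x + 1 then su else b) := by
  have hne : x ≠ p := fun h => hp (h ▸ hx)
  obtain ⟨n1, n2, n3, n4⟩ := N
  obtain ⟨m1, m2, m3, m4⟩ := M
  have e1 := m2 p (.inl rfl)
  have e2 := m4 p (.inl rfl)
  refine ⟨?_, ?_, ?_, ?_⟩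
  · grind
  · grind
  · grind
  · grind

/-- The element itself does not matter for its neighbors. -/
theorem _root_.Trie.Nbrs.of_insert (N : Nbrs (Insert.insert p C) p pr su) : Nbrs C p pr su :=
  ⟨fun h => ⟨(N.pred h).1.resolve_left (N.pred h).2.ne, (N.pred h).2⟩,
    fun x hx => N.pred_max x (.inr hx),
    fun h => ⟨(N.succ h).1.resolve_left (N.succ h).2.ne', (N.succ h).2⟩,
    fun x hx => N.succ_min x (.inr hx)⟩

theorem _root_.Trie.Nbrs.to_insert (N : Nbrs C p pr su) : Nbrs (Insert.insert p C) p pr su :=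
  ⟨fun h => ⟨.inr (N.pred h).1, (N.pred h).2⟩,
    fun x hx h => N.pred_max x (hx.resolve_left h.ne) h,
    fun h => ⟨.inr (N.succ h).1, (N.succ h).2⟩,
    fun x hx h => N.succ_min x (hx.resolve_left h.ne') h⟩

end

/-- The state represents the coloring `col` of the positions. The arrays `1`, `2` and `3` hold the
colors and the neighbors, plus one, of each position among those of the same color. The arrays from
`6` to `14` and the array `0` hold the static tables `st`. -/
structure Data (n D J : ℕ) (st : ℕ → ℕ → ℕ) (col : ℕ → ℕ) (nid : Node → ℕ) (s : State) : Prop where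
  trie : Holds n D J (cls n col) (inner n D J (cls n col)) (below D J (cls n col)) nid s
  colors : s.m 1 = col
  nbrs : ∀ p, col p ≠ 0 → Nbrs (cls n col (col p - 1)) p (s.m 3 p) (s.m 2 p)
  supp : ∀ p, n ≤ p → col p = 0 ∧ s.m 2 p = 0 ∧ s.m 3 p = 0
  static : ∀ k, k = 0 ∨ 6 ≤ k ∧ k ≤ 14 → s.m k = st k

/-! ### Programs for the change of colors -/

/-- Find the neighbors of the position in register `40` among those of the color in register
`41`. -/
def nbrsCmd : Cmd :=
  .ite (.eq (.cell 0 (.reg 41) 0 (.arr 0 2) 0) 0) (.set 43 0 ;; .set 44 0)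
    (searchCmd ;; .set 45 (rV - 1) ;;
     .ite (.lt (.reg 45) (.reg 40)) (.set 43 rV ;; .set 44 (.arr 2 (.reg 45)))
      (.set 44 rV ;; .set 43 (.arr 3 (.reg 45))))

/-- Write the registers `45` and `46` into the links of the neighbors. -/
def spliceCmd : Cmd :=
  .ite (.ne (.reg 43) 0) (.put 2 (.reg 43 - 1) (.reg 45)) .skip ;;
  .ite (.ne (.reg 44) 0) (.put 3 (.reg 44 - 1) (.reg 46)) .skip

/-- Give the uncolored position in register `40` the color in register `41`. -/
def addCmd : Cmd :=
  nbrsCmd ;; insertTrieCmd ;;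
  .put 1 (.reg 40) (.reg 41 + 1) ;; .put 2 (.reg 40) (.reg 44) ;; .put 3 (.reg 40) (.reg 43) ;;
  .set 45 (.reg 40 + 1) ;; .set 46 (.reg 45) ;; spliceCmd

/-- Remove the color of the position in register `40`. -/
def removeCmd : Cmd :=
  .set 41 (.arr 1 (.reg 40) - 1) ;; .set 43 (.arr 3 (.reg 40)) ;; .set 44 (.arr 2 (.reg 40)) ;;
  deleteTrieCmd ;; .set 45 (.reg 44) ;; .set 46 (.reg 43) ;; spliceCmd ;; .put 1 (.reg 40) 0

/-- The program for color reassignments. -/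
def recolorCmd : Cmd :=
  .set 40 (.arr 6 (.reg 0)) ;; .ite (.ne (.arr 1 (.reg 40)) 0) removeCmd .skip ;;
  .set 41 (.reg 1) ;; addCmd

section

variable {Y : Layout} {n D J γ p : ℕ} {st : ℕ → ℕ → ℕ} {col : ℕ → ℕ} {nid : Node → ℕ} {s : State}
  {Q : State → Prop}

theorem cls_pred {x : ℕ} (hx : x < n) (hc : col x ≠ 0) : x ∈ cls n col (col x - 1) :=
  ⟨hx, by omega⟩

theorem wp_splice (hN : n < Y.N) (h43 : s.r 43 ≤ n) (h44 : s.r 44 ≤ n)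
    (hQ : ∀ s', (∀ k, k ≠ 2 → k ≠ 3 → s'.m k = s.m k) → s'.nd = s.nd → s'.r = s.r →
      (∀ x, s'.m 2 x = if s.r 43 = x + 1 then s.r 45 else s.m 2 x) →
      (∀ x, s'.m 3 x = if s.r 44 = x + 1 then s.r 46 else s.m 3 x) → s'.t ≤ s.t + 4 → Q s') :
    Wp Y spliceCmd Q s := by
  have e1 : s.r 43 - 1 < Y.N := by omega
  have e2 : s.r 44 - 1 < Y.N := by omega
  simp [spliceCmd, e1, e2]
  refine ⟨fun h1 => ⟨fun h2 => hQ _ ?_ rfl rfl ?_ ?_ ?_, fun h2 => hQ _ ?_ rfl rfl ?_ ?_ ?_⟩,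
    fun h1 => ⟨fun h2 => hQ _ ?_ rfl rfl ?_ ?_ ?_, fun h2 => hQ _ ?_ rfl rfl ?_ ?_ ?_⟩⟩
  all_goals first | (intro k h3 h4; funext i; simp [h3, h4]) | skip
  all_goals first | (intro x; simp; grind) | simp

theorem wp_nbrs (F : Fits Y n D J) (H : Data n D J st col nid s) (hγ : γ < n) (hp : p < n)
    (h40 : s.r 40 = p) (h41 : s.r 41 = γ) (hpC : p ∉ cls n col γ)
    (hQ : ∀ s', s'.m = s.m → s'.nd = s.nd →
      (∀ i, i < 20 ∨ i = 40 ∨ i = 41 ∨ 53 ≤ i → s'.r i = s.r i) →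
      Nbrs (cls n col γ) p (s'.r 43) (s'.r 44) → s'.t ≤ s.t + 12 * D + 40 * J + 110 → Q s') :
    Wp Y nbrsCmd Q s := by
  obtain ⟨I, P, hlt⟩ := H.trie
  have hbd := F.bounds
  have hNW := F.arr
  have hsz := F.size
  have hw := F.window
  have hni := F.nodes
  have hroot := I.root γ hγ
  obtain ⟨D', rfl⟩ : ∃ D', D = D' + 1 := ⟨D - 1, by have := F.D_pos; omega⟩
  have hv := I.veb _ _ _ hroot
  rw [I.nid_root γ hγ] at hv
  have hzero := hv.cell_eq_zero
  have hD0 : ∀ x, x ∈ cls n col γ → x / (2 ^ 2 ^ J) ^ (D' + 1) = 0 := fun x hx =>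
    Nat.div_eq_of_lt (hx.1.trans_le F.n_le)
  have hpow := Nat.one_le_two_pow (n := J)
  have hI : γ < Y.I := by omega
  have hT1 : 0 < Y.T := by omega
  have hT2 : 2 ^ J < Y.T := by omega
  have hU0 : 0 < Y.U := by rw [hsz]; positivity
  have h2N : 2 < Y.N := by
    have := Nat.lt_two_pow_self (n := 2 ^ J); omega
  simp [nbrsCmd, -wp_seq, P.b, h41, Layout.HasCell, hI, hT1, hT2, hU0, h2N]
  refine ⟨fun h0 => ?_, fun h0 => ?_⟩
  · have hemp : ∀ x, x ∉ cls n col γ := by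
      intro x hx
      have h1 := hzero.1 h0
      have h2 := exists_digit (S := cls n col) (J := J) (γ := γ) (q := 0) (Nat.lt_succ_self D')
        ⟨x, hx, hD0 x hx⟩
      rw [h1] at h2; exact Set.not_nonempty_empty h2
    simp
    refine hQ _ rfl rfl (fun i hi => ?_) ⟨by simp, fun x hx => absurd hx (hemp x), by simp,
      fun x hx => absurd hx (hemp x)⟩ (by simp; omega)
    have : i ≠ 43 ∧ i ≠ 44 := by omega
    simp [this]
  · have hne : (cls n col γ).Nonempty := by
      by_contra hemp
      refine h0 (hzero.2 (Set.eq_empty_of_forall_notMem fun d hd => hemp ?_))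
      obtain ⟨-, x, hx, -⟩ := (mem_digits_below (Nat.lt_succ_self D')).1 hd; exact ⟨x, hx⟩
    rw [wp_seq]
    refine wp_search (s := s.tick) (γ := γ) (v := p) F ⟨I, ⟨P.U, P.b, P.D⟩, hlt⟩ hγ hne hp h40 h41
      fun s1 e g1 g2 g3 g4 => ?_
    obtain ⟨g5, g6, g7⟩ := g1
    simp only [State.tick_m, State.tick_nd, State.tick_r, State.tick_t] at g2 g5 g6 g7
    have heC := g4.1
    have hep : e ≠ p := fun h => hpC (h ▸ heC)
    have hN := H.nbrs e (by rw [heC.2]; omega)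
    rw [heC.2, Nat.add_sub_cancel] at hN
    have heN : e < Y.N := by have := heC.1; omega
    simp [g3, g5, g7, h40, heN]
    refine ⟨fun h1 => hQ _ (by simp [g5]) (by simp [g6]) (fun i hi => ?_) ?_ (by simp; omega),
      fun h1 => hQ _ (by simp [g5]) (by simp [g6]) (fun i hi => ?_) ?_ (by simp; omega)⟩
    · have : i ≠ 43 ∧ i ≠ 44 ∧ i ≠ 45 := by omega
      simp [this, g7 i hi]
    · have hmax := g4.2.resolve_right fun h => by omega
      simp
      refine ⟨fun _ => ⟨heC, h1⟩, fun x hx h2 => Nat.lt_succ_of_le (hmax.2 x hx h2.le),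
        fun h2 => ⟨(hN.succ h2).1, ?_⟩, fun x hx h2 => hN.succ_min x hx (by omega)⟩
      have h3 := hN.succ h2
      by_contra h4
      have := hmax.2 _ h3.1 (not_lt.1 h4); omega
    · have : i ≠ 43 ∧ i ≠ 44 ∧ i ≠ 45 := by omega
      simp [this, g7 i hi]
    · have hmin := g4.2.resolve_left fun h => by omega
      simp
      refine ⟨fun h2 => ⟨(hN.pred h2).1, ?_⟩, fun x hx h2 => hN.pred_max x hx (by omega),
        fun _ => ⟨heC, by omega⟩, fun x hx h2 => ⟨by omega, Nat.succ_le_succ (hmin.2 x hx h2.le)⟩⟩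
      have h3 := hN.pred h2
      by_contra h4
      have := hmin.2 _ h3.1 (not_lt.1 h4); omega

theorem _root_.Trie.Nbrs.le {C : Set ℕ} {pr su : ℕ} (N : Nbrs C p pr su) (hC : ∀ x ∈ C, x < n)
    (hp : p < n) : pr ≤ n ∧ su ≤ n := by
  constructor
  · by_contra h
    have := N.pred (by omega); omega
  · by_contra h
    have := hC _ (N.succ (by omega)).1; omega

/-- Holding the tries depends on some arrays only. -/
theorem _root_.Trie.Holds.congr {S : ℕ → Set ℕ} {A L : Set Node} {s' : State}
    (H : Holds n D J S A L nid s) (h15 : s'.m 15 = s.m 15) (h4 : s'.m 4 = s.m 4)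
    (h0 : s'.m 0 = s.m 0) (hnd : s'.nd = s.nd) : Holds n D J S A L nid s' :=
  ⟨by rw [h15, h4, hnd]; exact H.inv, ⟨by rw [h0]; exact H.params.U, by rw [h0]; exact H.params.b,
    by rw [h0]; exact H.params.D⟩, H.lt⟩

theorem Data.congr {s' : State} (H : Data n D J st col nid s) (hm : s'.m = s.m)
    (hnd : s'.nd = s.nd) : Data n D J st col nid s' :=
  ⟨H.trie.congr (by rw [hm]) (by rw [hm]) (by rw [hm]) hnd, by rw [hm]; exact H.colors,
    by rw [hm]; exact H.nbrs, by rw [hm]; exact H.supp, by rw [hm]; exact H.static⟩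

theorem wp_add (F : Fits Y n D J) (H : Data n D J st col nid s) (hγ : γ < n) (hp : p < n)
    (h40 : s.r 40 = p) (h41 : s.r 41 = γ) (h0 : col p = 0)
    (hQ : ∀ s' nid', Data n D J st (update col p (γ + 1)) nid' s' →
      s'.t ≤ s.t + D * (50 * J + 90) + 12 * D + 40 * J + 150 → Q s') : Wp Y addCmd Q s := by
  have hbd := F.bounds
  have hNW := F.arr
  have hpC : ∀ γ, p ∉ cls n col γ := fun γ h => by have := h.2; omega
  rw [addCmd, wp_seq]
  refine wp_nbrs F H hγ hp h40 h41 (hpC γ) fun s1 a1 a2 a3 N a5 => ?_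
  rw [wp_seq]
  obtain ⟨l1, l2⟩ := N.le (n := n) (fun x hx => hx.1) hp
  refine wp_insertTrie (γ := γ) (p := p) (col := fun x => if x = p then γ else col x - 1)
    (S := cls n col) F (H.trie.congr (by rw [a1]) (by rw [a1]) (by rw [a1]) a2) hγ hp ?_ (by simp) N
    (by rw [a3 _ (by omega), h40]) (by rw [a3 _ (by omega), h41]) rfl rfl
    (cls_update h0 hp).symm.symm fun s2 nid' b1 b2 b3 => ?_
  · intro γ' x hx
    have : x ≠ p := fun h => hpC γ' (h ▸ hx)
    simp [this, hx.2]
  obtain ⟨b4, b5⟩ := b2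
  have hpN : p < Y.N := by omega
  have hγW : γ + 1 < Y.W := by omega
  have hpW : p + 1 < Y.W := by omega
  have r40 : s2.r 40 = p := by rw [b5 _ (by omega), a3 _ (by omega), h40]
  have r41 : s2.r 41 = γ := by rw [b5 _ (by omega), a3 _ (by omega), h41]
  have r43 := b5 43 (by omega)
  have r44 := b5 44 (by omega)
  simp [r40, r41, hpN, hγW, hpW]
  refine wp_splice (n := n) (by omega) (by simpa [r43]) (by simpa [r44])
    fun s3 c1 c2 c3 c4 c5 c6 => hQ s3 nid' ?_ (by simp at c6; omega)
  simp [r43, r44] at c4 c5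
  have hm : ∀ k, k ≠ 4 → k ≠ 15 → s2.m k = s.m k := fun k h1 h2 => by rw [b4 k h1 h2, a1]
  rw [hm _ (by omega) (by omega)] at c4 c5
  have hm3 : ∀ k, k ≠ 1 → k ≠ 2 → k ≠ 3 → s3.m k = s2.m k := by
    intro k h1 h2 h3
    rw [c1 k h2 h3]
    funext i
    simp [h1, h2, h3]
  refine ⟨?_, ?_, ?_, ?_, ?_⟩
  · exact b1.congr (hm3 _ (by omega) (by omega) (by omega)) (hm3 _ (by omega) (by omega) (by omega))
      (hm3 _ (by omega) (by omega) (by omega)) (by rw [c2]; rfl)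
  · rw [c1 1 (by omega) (by omega)]
    funext x
    have h1 := congrFun (hm 1 (by omega) (by omega)) x
    rw [H.colors] at h1; simp [update_apply, h1]
  · intro x hx
    rw [cls_update h0 hp, c4, c5]
    by_cases hxp : x = p
    · subst hxp
      have h1 : s1.r 43 ≠ x + 1 := fun h => by have := N.pred (by omega); omega
      have h2 : s1.r 44 ≠ x + 1 := fun h => by have := N.succ (by omega); omega
      simpa [h1, h2] using N.to_insert
    · rw [update_of_ne hxp] at hx ⊢
      have hM := H.nbrs x hx
      have hxn : x < n := by
        by_contra h; exact hx (H.supp x (not_lt.1 h)).1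
      have hxC := cls_pred hxn hx
      simp only [hxp, if_false]
      by_cases hg : col x - 1 = γ
      · rw [hg, update_self]
        rw [hg] at hM hxC; exact N.insert (hpC γ) hxC hM
      · rw [update_of_ne hg]
        have h1 : s1.r 43 ≠ x + 1 := fun h => by
          have := (N.pred (by omega)).1.2
          rw [h, Nat.add_sub_cancel] at this; omega
        have h2 : s1.r 44 ≠ x + 1 := fun h => by
          have := (N.succ (by omega)).1.2
          rw [h, Nat.add_sub_cancel] at this; omega
        rwa [if_neg h1, if_neg h2]
  · intro x hx
    obtain ⟨h1, h2, h3⟩ := H.supp x hx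
    rw [c4, c5, if_neg (by omega), if_neg (by omega), if_neg (by omega), if_neg (by omega),
      update_of_ne (by omega)]
    exact ⟨h1, h2, h3⟩
  · intro k hk
    rw [hm3 k (by omega) (by omega) (by omega), hm k (by omega) (by omega)]; exact H.static k hk

theorem wp_remove (F : Fits Y n D J) (H : Data n D J st (update col p (γ + 1)) nid s)
    (hγ : γ < n) (hp : p < n) (h40 : s.r 40 = p) (h0 : col p = 0)
    (hQ : ∀ s', Data n D J st col nid s' → (∀ i, i < 20 ∨ i = 40 → s'.r i = s.r i) →
      s'.t ≤ s.t + D * (80 * J + 130) + 20 → Q s') : Wp Y removeCmd Q s := by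
  have hbd := F.bounds
  have hNW := F.arr
  have hpC : ∀ γ, p ∉ cls n col γ := fun γ h => by have := h.2; omega
  have hcls := cls_update (γ := γ) h0 hp
  have hpN : p < Y.N := by omega
  have hN := H.nbrs p (by simp)
  rw [update_self, Nat.add_sub_cancel, hcls, update_self] at hN
  replace hN := hN.of_insert
  obtain ⟨l1, l2⟩ := hN.le (n := n) (fun x hx => hx.1) hp
  simp [removeCmd, h40, hpN, H.colors]
  refine wp_deleteTrie (γ := γ) (p := p) (S := cls n col) (nid := nid) F hγ hp (hpC γ) hcls
    (H.trie.congr rfl rfl rfl rfl) hN (by simp [h40]) (by simp) (by simp) (by simp)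
    fun s2 b1 b2 b3 => ?_
  obtain ⟨b4, b5⟩ := b2
  simp only [State.set_m, State.set_t] at b3 b4
  have r40 : s2.r 40 = p := by rw [b5 _ (by omega)]; simp [h40]
  have r43 : s2.r 43 = s.m 3 p := by rw [b5 _ (by omega)]; simp
  have r44 : s2.r 44 = s.m 2 p := by rw [b5 _ (by omega)]; simp
  simp only [wp_seq, wp_set, val_reg, r44]
  simp
  refine wp_splice (n := n) (by omega) (by simpa [r43]) (by simpa [r44])
    fun s3 c1 c2 c3 c4 c5 c6 => ?_
  simp [r43, r44] at c4 c5
  rw [b4 _ (by omega) (by omega)] at c4 c5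
  have r3 : s3.r 40 = p := by simp [c3, r40]
  simp [r3, hpN]
  refine hQ _ ⟨?_, ?_, ?_, ?_, ?_⟩ (fun i hi => ?_) (by simp at c6 ⊢; omega)
  · refine b1.congr ?_ ?_ ?_ (by simp [c2])
    all_goals rw [put_m_of_ne _ _ _ (by omega), c1 _ (by omega) (by omega)]; rfl
  · rw [put_m_self, c1 1 (by omega) (by omega)]
    simp only [State.set_m]
    rw [b4 1 (by omega) (by omega), H.colors, update_idem, ← h0, update_eq_self]
  · intro x hx
    have hxp : x ≠ p := fun h => hx (h ▸ h0)
    rw [put_m_of_ne _ _ _ (by omega), put_m_of_ne _ _ _ (by omega), c4, c5]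
    have hM := H.nbrs x (by rwa [update_of_ne hxp])
    have hxn : x < n := by
      by_contra h
      have := (H.supp x (not_lt.1 h)).1
      rw [update_of_ne hxp] at this; exact hx this
    have hxC := cls_pred hxn hx
    rw [update_of_ne hxp, hcls] at hM
    by_cases hg : col x - 1 = γ
    · rw [hg, update_self] at hM
      rw [hg] at hxC ⊢; exact hN.remove (hpC γ) hxC hM
    · rw [update_of_ne hg] at hM
      have h1 : s.m 3 p ≠ x + 1 := fun h => by
        have := (hN.pred (by omega)).1.2
        rw [h, Nat.add_sub_cancel] at this; omega
      have h2 : s.m 2 p ≠ x + 1 := fun h => by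
        have := (hN.succ (by omega)).1.2
        rw [h, Nat.add_sub_cancel] at this; omega
      rwa [if_neg h1, if_neg h2]
  · intro x hx
    obtain ⟨h1, h2, h3⟩ := H.supp x hx
    rw [update_of_ne (by omega)] at h1
    rw [put_m_of_ne _ _ _ (by omega), put_m_of_ne _ _ _ (by omega), c4, c5, if_neg (by omega),
      if_neg (by omega)]
    exact ⟨h1, h2, h3⟩
  · intro k hk
    rw [put_m_of_ne _ _ _ (by omega), c1 k (by omega) (by omega)]
    simp only [State.set_m]
    rw [b4 k (by omega) (by omega)]; exact H.static k hk
  · have h1 : i ≠ 41 ∧ i ≠ 43 ∧ i ≠ 44 ∧ i ≠ 45 ∧ i ≠ 46 := by omega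
    simp [c3, h1]
    rw [b5 i (by omega)]; simp [h1]

theorem wp_recolor (F : Fits Y n D J) (H : Data n D J st col nid s) (hγ : γ < n) {v : ℕ}
    (hv : v < n) (hp : p < n) (hst : st 6 v = p) (h0 : s.r 0 = v) (h1 : s.r 1 = γ)
    (hcol : ∀ p < n, col p ≤ n)
    (hQ : ∀ s' nid', Data n D J st (update col p (γ + 1)) nid' s' →
      s'.t ≤ s.t + D * (50 * J + 90) + D * (80 * J + 130) + 12 * D + 40 * J + 180 → Q s') :
    Wp Y recolorCmd Q s := by
  have hbd := F.bounds
  have hpN : p < Y.N := by omega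
  have hvN : v < Y.N := by omega
  have h6 := H.static 6 (by omega)
  simp [recolorCmd, -wp_seq]
  rw [wp_seq, wp_set]
  refine ⟨by omega, by simp [h0, hvN], ?_⟩
  simp only [val_arr, val_reg, h0, h6, hst]
  rw [wp_seq, wp_ite]
  refine ⟨by simp [hpN], fun hc => ?_, fun hc => ?_⟩
  · simp [H.colors] at hc
    have hu : update (update col p 0) p (col p - 1 + 1) = col := by
      rw [update_idem, Nat.sub_add_cancel (by omega), update_eq_self]
    refine wp_remove (γ := col p - 1) (p := p) (nid := nid) (st := st) (n := n) (D := D) (J := J)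
      (col := update col p 0) F (by rw [hu]; exact H.congr rfl rfl)
      (by have := hcol p hp; omega) hp (by simp) (by simp) fun s1 b1 b2 b3 => ?_
    simp at b3
    simp [b2, h1]
    refine wp_add (γ := γ) (p := p) F (b1.congr rfl rfl) hγ hp (by simp [b2]) (by simp) (by simp) fun s2 nid' c1 c2 => hQ s2 nid' ?_ ?_
    · simpa using c1
    · simp at c2; omega
  · simp [H.colors] at hc
    simp [h1]
    refine wp_add (γ := γ) (p := p) F (H.congr rfl rfl) hγ hp (by simp) (by simp) hc fun s2 nid' c1 c2 => hQ s2 nid' c1 ?_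
    simp at c2; omega

end

/-! ### Programs for queries -/

/-- The values of the static tables: the positions of the vertices, the vertices at the positions,
and the tables for range minima of `A` with blocks of length `Nat.log 2 n + 1`: minima from the
start and to the end of a block (`8`, `9`), bit masks (`10`), lowest bits (`11`), for the difference
`i / 2` of two block numbers the size of a suitable power of two and the row for it (`12`), minima
of such a number of blocks (`13`), and `A` itself (`14`). -/
def tableVal (n : ℕ) (A pos inv : ℕ → ℕ) (k i : ℕ) : ℕ :=
  let β := Nat.log 2 n + 1
  let nb := n / β + 1
  match k with
  | 6 => pos i
  | 7 => inv i
  | 8 => minOn n A (i / β * β) (i + 1)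
  | 9 => minOn n A i ((i / β + 1) * β)
  | 10 => enc n A (i / β * β) (i % β)
  | 11 => padicValNat 2 i
  | 12 => if i % 2 = 0 then Nat.log 2 (i / 2) * nb else 2 ^ Nat.log 2 (i / 2)
  | 13 => minOn n A ((i % nb + 1) * β) ((i % nb + 2 ^ (i / nb)) * β)
  | _ => A i

/-- The static tables, cut off to linear size. All entries in use have indices and values below
`8 * n`. -/
def tables (n : ℕ) (A pos inv : ℕ → ℕ) (k i : ℕ) : ℕ :=
  if i < 8 * n then min (tableVal n A pos inv k i) (8 * n) else 0

/-- Replace register `63` by its minimum with `e`. -/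
def minCmd (e : Exp) : Cmd := .set 67 e ;; .ite (.lt (.reg 67) (.reg 63)) (.set 63 (.reg 67)) .skip

/-- Find the minimum of the table on the interval between the registers `61` and `62`. -/
def rmqCmd : Cmd :=
  .set 64 (.reg 61 / .arr 0 4) ;; .set 65 (.reg 62 / .arr 0 4) ;;
  .ite (.eq (.reg 64) (.reg 65))
    (.set 63 (.arr 14 (.reg 61 + .arr 11 (Exp.arr 10 (.reg 62) >>> (.reg 61 % .arr 0 4 : Exp)))))
    (.set 66 (2 * (.reg 65 - .reg 64)) ;; .set 63 (.arr 9 (.reg 61)) ;;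
     minCmd (.arr 8 (.reg 62)) ;; minCmd (.arr 13 (.arr 12 (.reg 66) + .reg 64)) ;;
     minCmd (.arr 13 (.arr 12 (.reg 66) + (.reg 65 - .arr 12 (.reg 66 + 1)))))

/-- The program for queries. -/
def queryCmd : Cmd :=
  .set 40 (.arr 6 (.reg 0)) ;; .set 41 (.reg 1) ;;
  .ite (.eq (.arr 1 (.reg 40)) (.reg 41 + 1)) .skip
    (nbrsCmd ;; .set 60 0 ;;
     .ite (.eq (.reg 43) 0) .skip
      (.set 61 (.reg 43) ;; .set 62 (.reg 40) ;; rmqCmd ;; .set 60 (.reg 63)) ;;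
     .ite (.eq (.reg 44) 0) .skip
      (.set 61 (.reg 40 + 1) ;; .set 62 (.reg 44 - 1) ;; rmqCmd ;;
       .ite (.lt (.reg 60) (.reg 63)) (.set 60 (.reg 63)) .skip) ;;
     .ite (.eq (.reg 43 + .reg 44) 0) (.set 0 (.arr 0 5)) (.set 0 (.arr 7 (.reg 60))))

/-- `x` is the nearest ancestor of `p` that is an ancestor of an element of `C`. -/
def IsBest (Anc : ℕ → ℕ → Prop) (C : Set ℕ) (p x : ℕ) : Prop :=
  Anc x p ∧ (∃ u ∈ C, Anc x u) ∧ ∀ c, Anc c p → (∃ u ∈ C, Anc c u) → c ≤ x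

/-- The nearest ancestor comes from one of the neighbors in preorder. -/
theorem IsPreorder.isBest {n : ℕ} {Anc : ℕ → ℕ → Prop} (h : IsPreorder n Anc) {C : Set ℕ}
    {p pr su : ℕ} (hC : ∀ x ∈ C, x < n) (hp : p < n) (N : Nbrs C p pr su) (hpC : p ∉ C)
    (h0 : pr + su ≠ 0) : IsBest Anc C p (max (if pr = 0 then 0 else minOn n (par Anc) pr (p + 1))
      (if su = 0 then 0 else minOn n (par Anc) (p + 1) su)) := by
  have key : ∀ a b : ℕ, (pr = 0 ∧ a = 0 ∨ pr ≠ 0 ∧ Anc a (pr - 1) ∧ Anc a p ∧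
      ∀ c, Anc c (pr - 1) → Anc c p → c ≤ a) → (su = 0 ∧ b = 0 ∨ su ≠ 0 ∧ Anc b p ∧
      Anc b (su - 1) ∧ ∀ c, Anc c p → Anc c (su - 1) → c ≤ b) → IsBest Anc C p (max a b) := by
    intro a b ha hb
    refine ⟨?_, ?_, ?_⟩
    · rcases max_choice a b with e | e <;> rw [e]
      · rcases ha with ⟨-, rfl⟩ | ha
        · exact h.root hp
        · exact ha.2.2.1
      · rcases hb with ⟨-, rfl⟩ | hb
        · exact h.root hp
        · exact hb.2.1
    · rcases ha with ⟨ha, rfl⟩ | ha <;> rcases hb with ⟨hb, rfl⟩ | hb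
      · omega
      · rw [Nat.zero_max]; exact ⟨_, (N.succ hb.1).1, hb.2.2.1⟩
      · rw [Nat.max_zero]; exact ⟨_, (N.pred ha.1).1, ha.2.1⟩
      · rcases max_choice a b with e | e <;> rw [e]
        · exact ⟨_, (N.pred ha.1).1, ha.2.1⟩
        · exact ⟨_, (N.succ hb.1).1, hb.2.2.1⟩
    · rintro c hc ⟨u, hu, hcu⟩
      have hup : u ≠ p := fun e => hpC (e ▸ hu)
      rcases lt_or_gt_of_ne hup with hup | hup
      · have h1 := N.pred_max u hu hup
        have h2 := ha.resolve_left (by omega)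
        exact le_max_of_le_left (h2.2.2.2 c
          (h.mid hc ((h.le hcu).trans (by omega)) (N.pred h2.1).2.le) hc)
      · have h1 := N.succ_min u hu hup
        have h2 := hb.resolve_left (by omega)
        exact le_max_of_le_right (h2.2.2.2 c hc
          (h.mid hcu ((h.le hc).trans (N.succ h2.1).2.le) (by omega)))
  refine key _ _ ?_ ?_
  · split_ifs with h1
    · exact .inl ⟨h1, rfl⟩
    · exact .inr ⟨h1, h.nca (N.pred h1).2 hp (by rw [Nat.sub_add_cancel (by omega)])⟩
  · split_ifs with h1
    · exact .inl ⟨h1, rfl⟩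
    · exact .inr ⟨h1, h.nca (N.succ h1).2 (hC _ (N.succ h1).1)
        (by rw [Nat.sub_add_cancel (by omega)])⟩

section

variable {Y : Layout} {n D J γ p : ℕ} {st : ℕ → ℕ → ℕ} {col : ℕ → ℕ} {nid : Node → ℕ} {s : State}
  {A pos inv : ℕ → ℕ} {Q : State → Prop}

theorem tables_apply {k i : ℕ} (hi : i < 8 * n) (h : tableVal n A pos inv k i ≤ 8 * n) :
    tables n A pos inv k i = tableVal n A pos inv k i := by
  rw [tables, if_pos hi, min_eq_left h]

theorem wp_minCmd {e : Exp} (he : e.Ok Y s)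
    (hQ : ∀ s', s'.m = s.m → s'.nd = s.nd → (∀ i, i ≠ 63 → i ≠ 67 → s'.r i = s.r i) →
      s'.r 63 = min (s.r 63) (e.val s) → s'.t ≤ s.t + 3 → Q s') : Wp Y (minCmd e) Q s := by
  simp [minCmd, he]
  exact ⟨fun h => hQ _ rfl rfl (fun i h1 h2 => by simp [h1, h2]) (by simp [h.le]) (by simp),
    fun h => hQ _ rfl rfl (fun i h1 h2 => by simp [h2]) (by simp [h]) (by simp)⟩

/-- An interval inside a block is treated with a bit mask; otherwise it is covered by the end of a
block, the start of a block and two intervals of `2 ^ k` blocks. -/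
theorem wp_rmq (hn : 8 * n + 16 < Y.N) (hW : Y.N < Y.W) (hA : ∀ i, A i ≤ n)
    (hst : ∀ k, 8 ≤ k → k ≤ 14 → s.m k = tables n A pos inv k) (h4 : s.m 0 4 = Nat.log 2 n + 1)
    {l r : ℕ} (h61 : s.r 61 = l) (h62 : s.r 62 = r) (hlr : l ≤ r) (hr : r < n)
    (hQ : ∀ s', s'.m = s.m → s'.nd = s.nd → (∀ i < 61, s'.r i = s.r i) →
      s'.r 63 = minOn n A l (r + 1) → s'.t ≤ s.t + 15 → Q s') : Wp Y rmqCmd Q s := by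
  have hval : ∀ k, 8 ≤ k → k ≤ 14 → ∀ i < 8 * n, tableVal n A pos inv k i ≤ 8 * n →
      s.m k i = tableVal n A pos inv k i := fun k h1 h2 i h3 h5 => by
    rw [hst k h1 h2, tables_apply h3 h5]
  have h2 : 2 ^ Nat.log 2 n ≤ n := Nat.pow_log_le_self 2 (by omega)
  have hlog : Nat.log 2 n < n := Nat.lt_two_pow_self.trans_le h2
  have hpow : 2 ^ (Nat.log 2 n + 1) ≤ 2 * n := by rw [pow_succ]; omega
  obtain ⟨β, hβ⟩ : ∃ β, β = Nat.log 2 n + 1 := ⟨_, rfl⟩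
  simp only [tableVal, ← hβ] at hval h4 hpow
  have hβ0 : 0 < β := by omega
  have e1 := Nat.div_add_mod' l β
  have e2 := Nat.div_add_mod' r β
  have e3 := Nat.div_add_mod' n β
  have hmod := Nat.mod_lt r hβ0
  have hd1 : l / β ≤ r / β := Nat.div_le_div_right hlr
  have hd2 : r / β ≤ n / β := Nat.div_le_div_right hr.le
  have hd3 : n / β ≤ n := Nat.div_le_self ..
  have m8 := hval 8 (by omega) (by omega) r (by omega) (minOn_le.trans (by omega))
  have m9 := hval 9 (by omega) (by omega) l (by omega) (minOn_le.trans (by omega))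
  have henc : enc n A (r / β * β) (r % β) < 2 * n :=
    enc_lt.trans_le ((Nat.pow_le_pow_right (by omega) (by omega)).trans hpow)
  have m10 := hval 10 (by omega) (by omega) r (by omega) (henc.le.trans (by omega))
  simp only at m8 m9 m10
  have hlN : l < Y.N := by omega
  have hrN : r < Y.N := by omega
  have h4N : 4 < Y.N := by omega
  simp [rmqCmd, h61, h62, h4, h4N, -wp_ite]
  rw [wp_ite]
  refine ⟨by simp, fun hb => ?_, fun hb => ?_⟩
  · simp at hb
    have hlm : l % β ≤ r % β := by rw [hb] at e1; omega
    have hx := enc_div (n := n) (A := A) (a := r / β * β) hlm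
    rw [show r / β * β + l % β = l by rw [← hb]; exact e1,
      show r % β - l % β = r - l by rw [hb] at e1; omega] at hx
    have hx1 : enc n A l (r - l) < 2 * n := hx ▸ (Nat.div_le_self ..).trans_lt henc
    obtain ⟨p1, p2⟩ := apply_enc (n := n) (a := l) (k := r - l) hA
    have m11 := hval 11 (by omega) (by omega) (enc n A l (r - l)) (by omega)
      (p1.trans (by omega))
    have m14 := hval 14 (by omega) (by omega) (l + padicValNat 2 (enc n A l (r - l))) (by omega)
      ((hA _).trans (by omega))
    simp only at m11 m14
    rw [p2, show l + (r - l) + 1 = r + 1 by omega] at m14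
    have a1 : enc n A l (r - l) < Y.N := by omega
    have a2 : l + padicValNat 2 (enc n A l (r - l)) < Y.N := by omega
    simp [h61, h62, h4, h4N, hrN, m10, hx, m11, m14, a1, a2, a2.trans hW]
    refine hQ _ rfl rfl (fun i hi => ?_) (by simp) (by simp)
    have : i ≠ 63 ∧ i ≠ 64 ∧ i ≠ 65 := by omega
    simp [this]
  · simp at hb
    have hmin := fun k => minOn_blocks (n := n) (A := A) (l := l) (r := r) (k := k) hβ0
    generalize l / β = lb at *
    generalize r / β = rb at *
    generalize n / β = nb at *
    obtain ⟨k, hk⟩ : ∃ k, k = Nat.log 2 (rb - lb) := ⟨_, rfl⟩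
    have k1 : 2 ^ k ≤ rb - lb := hk ▸ Nat.pow_log_le_self 2 (by omega)
    have k2 : rb - lb < 2 * 2 ^ k := by
      rw [hk, ← pow_succ']; exact Nat.lt_pow_succ_log_self (by omega) _
    have k3 : k < β := by
      have := Nat.log_mono_right (b := 2) (show rb - lb ≤ n by omega); omega
    have k4 : k * (nb + 1) + (nb + 1) ≤ n + β := by
      have := Nat.mul_le_mul_right (nb + 1) k3
      rw [Nat.succ_mul] at this
      refine this.trans ?_
      rw [mul_add, mul_comm]; omega
    have m12 := hval 12 (by omega) (by omega) (2 * (rb - lb)) (by omega)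
      (by simp [← hk]; omega)
    have m12' := hval 12 (by omega) (by omega) (2 * (rb - lb) + 1) (by omega)
      (by simp [Nat.add_mod, Nat.mul_add_div, ← hk]; omega)
    have m13 : ∀ b < nb + 1, s.m 13 (k * (nb + 1) + b) =
        minOn n A ((b + 1) * β) ((b + 2 ^ k) * β) := fun b hb => by
      rw [hval 13 (by omega) (by omega) _ (by omega) (minOn_le.trans (by omega))]
      simp only
      rw [mul_comm k, Nat.mul_add_mod, Nat.mod_eq_of_lt hb, Nat.mul_add_div (by omega),
        Nat.div_eq_of_lt hb, add_zero]
    simp [Nat.add_mod, Nat.mul_add_div, ← hk] at m12 m12'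
    have a1 := m13 (lb) (by omega)
    have a2 := m13 (rb - 2 ^ k) (by omega)
    have a3 : 2 * (rb - lb) + 1 < Y.N := by omega
    have a4 : k * (nb + 1) + lb < Y.N := by omega
    have a5 : k * (nb + 1) + (rb - 2 ^ k) < Y.N := by omega
    replace hmin := hmin k k1 k2
    generalize k * (nb + 1) = kn at *
    simp [h61, (Nat.lt_of_succ_lt a3).trans hW, hlN]
    refine wp_minCmd (by simp [h62, hrN]) fun s1 b1 b2 b3 b4 b5 => ?_
    have c1 : s1.r 66 = 2 * (rb - lb) := by rw [b3 _ (by omega) (by omega)]; simp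
    have c2 : s1.r 64 = lb := by rw [b3 _ (by omega) (by omega)]; simp
    have c3 : s1.r 65 = rb := by rw [b3 _ (by omega) (by omega)]; simp
    simp at b1
    rw [wp_seq]
    refine wp_minCmd ?_ fun s2 d1 d2 d3 d4 d5 => ?_
    · simp [b1, c1, c2, m12, a4, a4.trans hW, Nat.lt_of_succ_lt a3]
    rw [← d3 _ (by omega) (by omega)] at c1 c2 c3
    refine wp_minCmd ?_ fun s3 f1 f2 f3 f4 f5 => ?_
    · simp [d1, b1, c1, c3, m12, m12', a5, a5.trans hW, Nat.lt_of_succ_lt a3, a3, a3.trans hW]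
    rw [d3 _ (by omega) (by omega)] at c1 c2 c3
    refine hQ s3 (by simp [f1, d1, b1]) (by simp [f2, d2, b2]) (fun i hi => ?_) ?_ ?_
    · rw [f3 i (by omega) (by omega), d3 i (by omega) (by omega), b3 i (by omega) (by omega)]
      have : i ≠ 63 ∧ i ≠ 64 ∧ i ≠ 65 ∧ i ≠ 66 := by omega
      simp [this]
    · rw [f4, d4, b4, ← hmin]
      simp [d3, d1, b1, c1, c2, c3, m12, m12', a1, a2, m8, m9, h62]
    · simp at b5; omega

/-- The answer to a query is the vertex at the nearest ancestor, or `n` if the color does not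
occur. -/
theorem wp_query {Anc : ℕ → ℕ → Prop} (F : Fits Y n D J) (hn : 8 * n + 16 < Y.N)
    (H : Data n D J st col nid s) (hγ : γ < n) {v : ℕ} (hv : v < n) (hp : p < n)
    (hpos : ∀ i < n, pos i < n) (hinv : ∀ i < n, inv i < n)
    (hst : ∀ k, 6 ≤ k → k ≤ 14 → st k = tables n (par Anc) pos inv k)
    (h4 : st 0 4 = Nat.log 2 n + 1) (h5 : st 0 5 = n) (hAnc : IsPreorder n Anc)
    (hvp : pos v = p) (hpv : inv p = v) (h0 : s.r 0 = v) (h1 : s.r 1 = γ)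
    (hQ : ∀ s', s'.m = s.m → s'.nd = s.nd → (cls n col γ = ∅ ∧ s'.r 0 = n ∨
      ∃ x, IsBest Anc (cls n col γ) p x ∧ s'.r 0 = inv x) →
      s'.t ≤ s.t + 12 * D + 40 * J + 160 → Q s') : Wp Y queryCmd Q s := by
  have hbd := F.bounds
  have hNW := F.arr
  have hpN : p < Y.N := by omega
  have hvN : v < Y.N := by omega
  have h7N : 7 < Y.N := by omega
  have hpar : ∀ i, par Anc i ≤ n := fun i => by
    classical
    by_cases hi : par Anc i = 0
    · omega
    · have := Nat.findGreatest_of_ne_zero rfl hi; exact (hAnc.le this).trans (hAnc.lt this).le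
  have e6 : s.m 6 v = p := by
    rw [H.static 6 (by omega), hst 6 (by omega) (by omega), tables_apply (by omega), ← hvp]
    · rfl
    · exact (hpos v hv).le.trans (by omega)
  have e7 : ∀ x < n, s.m 7 x = inv x := fun x hx => by
    rw [H.static 7 (by omega), hst 7 (by omega) (by omega), tables_apply (by omega)]
    · rfl
    · exact (hinv x hx).le.trans (by omega)
  have e8 : ∀ k, 8 ≤ k → k ≤ 14 → s.m k = tables n (par Anc) pos inv k := fun k h2 h3 => by
    rw [H.static k (by omega), hst k (by omega) h3]
  rw [← H.static 0 (.inl rfl)] at h4 h5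
  rw [queryCmd, wp_seq, wp_set]
  refine ⟨by omega, by simp [h0, hvN], ?_⟩
  simp only [val_arr, val_reg, h0, e6]
  rw [wp_seq, wp_set]
  refine ⟨by omega, by simp, ?_⟩
  rw [wp_ite]
  refine ⟨by simp [h1, hpN]; omega, fun hc => ?_, fun hc => ?_⟩
  · simp [H.colors, h1] at hc
    rw [wp_skip]
    exact hQ _ rfl rfl (.inr ⟨p, ⟨hAnc.refl hp, ⟨p, ⟨hp, hc⟩, hAnc.refl hp⟩,
      fun c hc _ => hAnc.le hc⟩, by simp [h0, hpv]⟩) (by simp; omega)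
  have hpC : p ∉ cls n col γ := fun h => hc (by simpa [H.colors, h1] using h.2)
  rw [wp_seq]
  refine wp_nbrs F (H.congr rfl rfl) hγ hp (by simp) (by simp [h1]) hpC fun s1 a1 a2 a3 N a5 => ?_
  have r40 : s1.r 40 = p := by rw [a3 _ (by omega)]; simp
  obtain ⟨l1, l2⟩ := N.le (n := n) (fun x hx => hx.1) hp
  simp at a1 a2 a5
  rw [wp_seq, wp_set, wp_seq]
  refine ⟨by omega, by simp, Wp.mono (Q := fun s2 => s2.m = s.m ∧ s2.nd = s.nd ∧
    s2.r 40 = p ∧ s2.r 43 = s1.r 43 ∧ s2.r 44 = s1.r 44 ∧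
    s2.r 60 = (if s1.r 43 = 0 then 0 else minOn n (par Anc) (s1.r 43) (p + 1)) ∧
    s2.t ≤ s1.t + 20) ?_ ?_⟩
  · rw [wp_ite]
    refine ⟨by simp, fun h => ?_, fun h => ?_⟩
    · simp at h; simp [a1, a2, r40, h]
    · simp at h
      simp [-wp_ite, r40]
      refine wp_rmq (l := s1.r 43) hn hNW hpar (by simpa [a1] using e8) (by simpa [a1] using h4)
        (by simp) (by simp) (by have := (N.pred h).2; omega) hp fun s2 b1 b2 b3 b4 b5 => ?_
      simp at b1 b2 b5
      simp [a1, a2, r40, h, b1, b2, b3, b4]; omega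
  rintro s2 ⟨b1, b2, b3, b4, b5, b6, b7⟩
  rw [wp_seq]
  refine Wp.mono (Q := fun s3 => s3.m = s.m ∧ s3.nd = s.nd ∧ s3.r 43 = s1.r 43 ∧
    s3.r 44 = s1.r 44 ∧ s3.r 60 = max (s2.r 60)
      (if s1.r 44 = 0 then 0 else minOn n (par Anc) (p + 1) (s1.r 44)) ∧
    s3.t ≤ s1.t + 43) ?_ ?_
  · rw [wp_ite]
    refine ⟨by simp, fun h => ?_, fun h => ?_⟩
    · simp [b5] at h
      simp [b1, b2, b4, b5, h]; omega
    · simp [b5] at h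
      have := N.succ h
      simp [-wp_ite, b3, b5, show p + 1 < Y.W by omega]
      refine wp_rmq hn hNW hpar (by simpa [b1] using e8) (by simpa [b1] using h4) (by simp; rfl)
        (by simp; rfl) (by omega) (by omega) fun s3 c1 c2 c3 c4 c5 => ?_
      simp at c1 c2 c5
      rw [show s1.r 44 - 1 + 1 = s1.r 44 by omega] at c4
      simp [b1, b2, b4, b5, h, c1, c2, c3, c4]
      refine ⟨fun h => ?_, fun h => ?_⟩
      · simp [h.le]; omega
      · simp [h]; omega
  rintro s3 ⟨c1, c2, c3, c4, c5, c6⟩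
  have hbest := hAnc.isBest (fun x hx => hx.1) hp N hpC
  rw [← b6, ← c5] at hbest
  have hW : s1.r 43 + s1.r 44 < Y.W := by omega
  rw [wp_ite]
  refine ⟨by simp [c3, c4, hW], fun h => ?_, fun h => ?_⟩
  · simp [c3, c4] at h
    simp [c1, h5, show 5 < Y.N by omega]
    refine hQ _ (by simp [c1]) (by simp [c2]) (.inl ⟨?_, by simp⟩) (by simp; omega)
    refine Set.eq_empty_of_forall_notMem fun x hx => ?_
    have hxp : x ≠ p := fun h => hpC (h ▸ hx)
    rcases lt_or_gt_of_ne hxp with h2 | h2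
    · have := N.pred_max x hx h2; omega
    · have := N.succ_min x hx h2; omega
  · simp only [holds_eq, val_add, val_reg, val_ofNat, c3, c4] at h
    have hB := hbest h
    have hx : s3.r 60 < n := (hAnc.le hB.1).trans_lt hp
    simp [c1, e7 _ hx, show s3.r 60 < Y.N by omega]
    exact hQ _ (by simp [c1]) (by simp [c2]) (.inr ⟨_, hB, by simp⟩) (by simp; omega)

end

/-! ### Space -/

section

variable {Y : Layout} {n D J : ℕ} {st : ℕ → ℕ → ℕ} {col : ℕ → ℕ} {nid : Node → ℕ} {s : State}

/-- The cells in use of a trie are charged to the linked nodes. -/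
theorem exists_cover_trie {A : Set Node} {L : Finset Node} {ch fr : ℕ → ℕ} {nd : ℕ → NodeCells}
    (I : Inv n D J A L nid ch fr nd) : ∃ (G : Finset (ℕ × ℕ × ℕ × ℕ × ℕ)) (G' : Finset ℕ),
      (∀ v k, nd v k ≠ 0 → (v, k) ∈ G) ∧ (∀ i, ch i ≠ 0 → i ∈ G') ∧
        G.card ≤ 4 * L.card ∧ G'.card ≤ L.card := by
  classical
  have hU : 0 < 2 ^ 2 ^ J := by positivity
  let up : Node → Node := fun x => (x.1, x.2.1 + 1, x.2.2 / 2 ^ 2 ^ J)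
  have hup : ∀ γ h q d, d < 2 ^ 2 ^ J → up (γ, h, q * 2 ^ 2 ^ J + d) = (γ, h + 1, q) :=
    fun γ h q d hd => by
      simp only [up]
      rw [mul_comm, Nat.mul_add_div hU, Nat.div_eq_of_lt hd, add_zero]
  have hcov : ∀ x, ∃ F : Finset (ℕ × ℕ × ℕ × ℕ), F.card ≤ 4 * (L.filter (up · = x)).card ∧
      (x ∈ A → ∀ k, nd (nid x) k ≠ 0 → k ∈ F) := by
    intro x
    by_cases hx : x ∈ A
    swap
    · exact ⟨∅, by simp, fun h => absurd h hx⟩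
    obtain ⟨γ, h, q⟩ := x
    obtain ⟨h, rfl⟩ : ∃ h', h = h' + 1 := ⟨h - 1, by have := (I.height _ hx).2.1; simp at this; omega⟩
    have hfin : (digits J L γ h q).Finite := (Set.finite_Iio (2 ^ 2 ^ J)).subset fun d hd => hd.1
    have hv := I.veb _ _ _ hx
    rw [← hfin.coe_toFinset] at hv
    obtain ⟨F, h1, h2, h3⟩ := exists_cover hv
    refine ⟨F, (show F.card ≤ 4 * hfin.toFinset.card by omega).trans (Nat.mul_le_mul_left 4
      (Finset.card_le_card_of_injOn (fun d => (γ, h, q * 2 ^ 2 ^ J + d)) ?_ ?_)),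
      fun _ k hk => h1 k (by_contra fun h => hk (I.supp _ _ h)) hk⟩
    · intro d hd
      have hd := hfin.mem_toFinset.1 hd
      exact Finset.mem_coe.2 (Finset.mem_filter.2 ⟨hd.2, hup _ _ _ _ hd.1⟩)
    · intro d _ d' _ h; simpa using h
  choose F hF1 hF2 using hcov
  refine ⟨(L.image up).biUnion fun x => (F x).image fun k => (nid x, k),
    L.image fun y => nid (up y) * 2 ^ 2 ^ J + y.2.2 % 2 ^ 2 ^ J, fun v k hk => ?_, fun i hi => ?_,
    ?_, Finset.card_image_le⟩
  · obtain ⟨x, hx, rfl⟩ : v ∈ nid '' A := by_contra fun h => hk ((I.unused v h).1 k)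
    have hkF := hF2 x hx k hk
    have hpos : 0 < (L.filter (up · = x)).card := by
      have := Finset.card_pos.2 ⟨k, hkF⟩
      have := hF1 x; omega
    obtain ⟨y, hyx⟩ := Finset.card_pos.1 hpos
    obtain ⟨hy, rfl⟩ := Finset.mem_filter.1 hyx
    exact Finset.mem_biUnion.2 ⟨_, Finset.mem_image_of_mem _ hy, Finset.mem_image_of_mem _ hkF⟩
  · have hd := Nat.mod_lt i hU
    have hi' := Nat.div_add_mod' i (2 ^ 2 ^ J)
    rw [← hi'] at hi
    obtain ⟨⟨γ, h, q⟩, hx, hv⟩ : i / 2 ^ 2 ^ J ∈ nid '' A :=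
      by_contra fun h => hi ((I.unused _ h).2 _ hd)
    obtain ⟨h, rfl⟩ : ∃ h', h = h' + 1 := ⟨h - 1, by have := (I.height _ hx).2.1; simp at this; omega⟩
    rw [← hv] at hi
    refine Finset.mem_image.2 ⟨(γ, h, q * 2 ^ 2 ^ J + i % 2 ^ 2 ^ J),
      by_contra fun h => hi ((I.child _ _ _ hx _ hd).2 h), ?_⟩
    rw [hup _ _ _ _ hd, hv, mul_comm q, Nat.mul_add_mod, Nat.mod_mod, hi']
  · calc _ ≤ ∑ x ∈ L.image up, ((F x).image fun k => (nid x, k)).card := Finset.card_biUnion_le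
      _ ≤ ∑ x ∈ L.image up, 4 * (L.filter (up · = x)).card :=
        Finset.sum_le_sum fun x _ => Finset.card_image_le.trans (hF1 x)
      _ = 4 * L.card := by rw [← Finset.mul_sum, ← Finset.card_eq_sum_card_image]

/-- There are at most `n * D` linked nodes. -/
theorem exists_below : ∃ L : Finset Node, below D J (cls n col) = L ∧ L.card ≤ n * D := by
  classical
  have hsub : below D J (cls n col) ⊆ ((Finset.range n ×ˢ Finset.range D).image fun x =>
      (col x.1 - 1, x.2, x.1 / (2 ^ 2 ^ J) ^ x.2) : Finset Node) := by
    rintro ⟨γ, h, q⟩ ⟨h1, p, ⟨h2, h3⟩, h4⟩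
    simp only at h1 h2 h3 h4
    simp only [Finset.coe_image, Set.mem_image]
    exact ⟨(p, h), by simp [h1, h2], by simp [h3, h4]⟩
  have hfin := (Finset.finite_toSet _).subset hsub
  refine ⟨hfin.toFinset, hfin.coe_toFinset.symm, (Finset.card_le_card (t := _)
    (by rwa [← Finset.coe_subset, hfin.coe_toFinset])).trans (Finset.card_image_le.trans ?_)⟩
  simp

/-- The space is linear. -/
theorem Data.space_le (F : Fits Y n D J) (H : Data n D J st col nid s)
    (h0 : ∀ i, 6 ≤ i → st 0 i = 0) (hst : ∀ k, 6 ≤ k → k ≤ 14 → ∀ i, 8 * n ≤ i → st k i = 0)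
    {w : ℕ} {μ : RamMemory w} (hμ : MemRel Y μ s) : μ.space ≤ (250 + 20 * D) * n := by
  classical
  obtain ⟨L, hL, hcard⟩ := exists_below (n := n) (D := D) (J := J) (col := col)
  have I := H.trie.inv
  rw [hL] at I
  obtain ⟨G, G', g1, g2, g3, g4⟩ := exists_cover_trie I
  have hn := F.n_pos
  have harr : ∀ k, k ≠ 5 → k < 16 → ∃ B : Finset ℕ, (∀ i, s.m k i ≠ 0 → i ∈ B) ∧
      B.card ≤ 8 * n + n * D := by
    intro k h5 h16
    by_cases h15 : k = 15
    · subst h15; exact ⟨G', g2, by omega⟩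
    refine ⟨Finset.range (8 * n + n * D), fun i hi => ?_, by simp⟩
    by_contra h
    rw [Finset.mem_range, not_lt] at h
    refine hi ?_
    rcases (by omega : k = 0 ∨ k = 1 ∨ k = 2 ∨ k = 3 ∨ k = 4 ∨ 6 ≤ k ∧ k ≤ 14) with
      rfl | rfl | rfl | rfl | rfl | hk
    · rw [H.static 0 (.inl rfl)]; exact h0 i (by omega)
    · rw [H.colors]; exact (H.supp i (by omega)).1
    · exact (H.supp i (by omega)).2.1
    · exact (H.supp i (by omega)).2.2
    · exact I.free_supp i (by omega)
    · rw [H.static k (.inr hk)]; exact hst k hk.1 hk.2 i (by omega)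
  choose! B hB1 hB2 using harr
  refine (hμ.space_le (F := ((Finset.range 16).erase 5).biUnion (fun k => (B k).image (· * 16 + k)) ∪
    G.image fun x => Y.addr x.2.1 x.1 x.2.2.1 x.2.2.2.1 x.2.2.2.2) fun a ha => ?_).trans ?_
  · have hdm := Nat.div_add_mod' a 16
    rw [Finset.mem_union]
    unfold flat at ha
    split_ifs at ha with h5
    · exact .inr (Finset.mem_image.2 ⟨_, g1 _ _ ha, (eq_addr h5 rfl rfl).symm⟩)
    · have hlt := Nat.mod_lt a (show 16 > 0 by omega)
      exact .inl (Finset.mem_biUnion.2 ⟨a % 16, by simp [h5, hlt],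
        Finset.mem_image.2 ⟨a / 16, hB1 _ h5 hlt _ ha, hdm⟩⟩)
  · have h1 : (((Finset.range 16).erase 5).biUnion fun k => (B k).image (· * 16 + k)).card ≤
        ((Finset.range 16).erase 5).card * (8 * n + n * D) :=
      Finset.card_biUnion_le_card_mul _ _ _ fun k hk => by
        simp at hk
        exact Finset.card_image_le.trans (hB2 k hk.1 hk.2)
    have h2 : ((Finset.range 16).erase 5).card = 15 := rfl
    rw [h2] at h1
    refine (Finset.card_union_le _ _).trans ((Nat.add_le_add h1
      (Finset.card_image_le.trans g3)).trans ?_)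
    nlinarith

end

/-! ### The parameters -/

/-- The memory has room for the structure: tries of constant height `D`, with digits of
`O(log n / D)` bits, need `n ^ (1 + ε)` addresses. -/
theorem exists_params {ε : ℝ} (hε : 0 < ε) : ∃ D K : ℕ, ∀ n w : ℕ, 1 ≤ n →
    (1 + ε) * Real.logb 2 n + K ≤ w → ∃ (J : ℕ) (Y : Layout), Y.Fits w ∧ Fits Y n D J ∧
      8 * n + 16 < Y.N ∧ J ≤ Nat.log 2 (Nat.log 2 n) + 2 := by
  obtain ⟨D, hD⟩ := exists_nat_ge (6 / ε + 6)
  have hε6 : 0 < 6 / ε := by positivity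
  have hD6 : (6 : ℝ) ≤ D := by linarith
  have hD1 : 1 ≤ D := by exact_mod_cast (by linarith : (1 : ℝ) ≤ D)
  have hDε : 6 ≤ ε * D := by
    have : 6 / ε ≤ D := by linarith
    rwa [div_le_iff₀' hε] at this
  -- `2 ^ (D + 14)` leaves room for the constant factor `1024 * (D + 1)` and for rounding in `3 * b`
  refine ⟨D, D + 14, fun n w hn hw => ?_⟩
  obtain ⟨l, hl⟩ : ∃ l, l = Nat.log 2 n := ⟨_, rfl⟩
  obtain ⟨q, hq⟩ : ∃ q, q = (l + 1) / D := ⟨_, rfl⟩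
  obtain ⟨b0, hb0⟩ : ∃ b0, b0 = q + 1 := ⟨_, rfl⟩
  obtain ⟨J, hJ⟩ : ∃ J, J = Nat.clog 2 b0 := ⟨_, rfl⟩
  obtain ⟨b, hb⟩ : ∃ b, b = 2 ^ J := ⟨_, rfl⟩
  have hbb : b0 ≤ b := by rw [hb, hJ]; exact Nat.le_pow_clog (by omega) _
  have hb2 : b ≤ 2 * q + 1 := by
    by_cases h1 : b0 = 1
    · have : b = 1 := by rw [hb, hJ, h1]; simp
      omega
    · have h2 := Nat.pow_pred_clog_lt_self (b := 2) (by omega) (show 1 < b0 by omega)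
      have h3 := Nat.clog_pos (b := 2) (by omega) (show 2 ≤ b0 by omega)
      have : b = 2 * 2 ^ (Nat.clog 2 b0).pred := by
        rw [hb, hJ, ← pow_succ', ← Nat.succ_eq_add_one, Nat.succ_pred h3.ne']
      omega
  have hlb : l + 1 ≤ b * D := by
    have h1 := Nat.div_add_mod' (l + 1) D
    have h2 := Nat.mod_lt (l + 1) hD1
    have h3 : b0 * D = q * D + D := by rw [hb0, Nat.succ_mul]
    rw [← hq] at h1
    have := Nat.mul_le_mul_right D hbb; omega
  have hnl : n < 2 ^ (l + 1) := hl ▸ Nat.lt_pow_succ_log_self (by omega) n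
  have hln : 2 ^ l ≤ n := hl ▸ Nat.pow_log_le_self 2 (by omega)
  -- the only place where the word length matters
  have key : 1024 * (D + 1) * (n * 2 ^ (3 * b)) ≤ 2 ^ w := by
    have h1 : (3 * b : ℝ) ≤ ε * l + 4 := by
      have h2 : ((l + 1 : ℕ) : ℝ) / D ≤ (ε * l + 1) / 6 := by
        rw [div_le_div_iff₀ (by linarith) (by norm_num)]
        push_cast
        nlinarith [(Nat.cast_nonneg l : (0 : ℝ) ≤ l)]
      have h3 : (q : ℝ) ≤ ((l + 1 : ℕ) : ℝ) / D := hq ▸ Nat.cast_div_le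
      have h4 : (b : ℝ) ≤ 2 * (q : ℝ) + 1 := by exact_mod_cast hb2
      linarith
    have h2 : (l : ℝ) ≤ Real.logb 2 n := by
      rw [Real.le_logb_iff_rpow_le (by norm_num) (by exact_mod_cast hn)]
      exact_mod_cast hln
    have h3 : Real.logb 2 n + 3 * b + (D + 10) ≤ w := by
      push_cast at hw; nlinarith
    have h4 : (n : ℝ) * 2 ^ (3 * b) * 2 ^ (D + 10) ≤ 2 ^ w := by
      have h5 := Real.rpow_le_rpow_of_exponent_le (x := 2) (by norm_num) h3
      rw [Real.rpow_add (by norm_num), Real.rpow_add (by norm_num),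
        Real.rpow_logb (by norm_num) (by norm_num) (by exact_mod_cast hn)] at h5
      exact_mod_cast h5
    have h5 : n * 2 ^ (3 * b) * 2 ^ (D + 10) ≤ 2 ^ w := by exact_mod_cast h4
    have h6 : D + 1 ≤ 2 ^ D := Nat.lt_two_pow_self
    calc _ ≤ 1024 * 2 ^ D * (n * 2 ^ (3 * b)) := by gcongr
      _ = n * 2 ^ (3 * b) * 2 ^ (D + 10) := by ring
      _ ≤ _ := h5
  have hb1 : b + 1 ≤ 2 ^ b := Nat.lt_two_pow_self
  have h3b : 2 ^ (3 * b) = 2 ^ b * 2 ^ b * 2 ^ b := by ring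
  have hle : n * 2 ^ b ≤ n * 2 ^ (3 * b) := by gcongr <;> omega
  have hn3 : n ≤ n * 2 ^ (3 * b) := Nat.le_mul_of_pos_right n (by positivity)
  have hb3 : b ≤ n * 2 ^ (3 * b) := (by omega : b ≤ 2 ^ b).trans
    ((Nat.le_mul_of_pos_left _ hn).trans hle)
  obtain ⟨M, hM⟩ : ∃ M, M = n * 2 ^ (3 * b) := ⟨_, rfl⟩
  have hN : (n + n * D) * 2 ^ b ≤ (D + 1) * M := by
    rw [hM]
    calc _ = (D + 1) * (n * 2 ^ b) := by ring
      _ ≤ _ := Nat.mul_le_mul_left _ hle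
  rw [← hM] at key hn3 hb3
  have hDM : M ≤ (D + 1) * M := Nat.le_mul_of_pos_left _ (by omega)
  rw [mul_assoc] at key
  refine ⟨J, ⟨2 ^ w, (n + n * D) * 2 ^ b + 8 * n + 17, n + n * D, b + 1, 2 ^ b⟩,
    ⟨rfl, ?_, ?_, ?_⟩, ⟨by rw [hb], by rw [hb], rfl, by simp only [hb]; omega, ?_, ?_, ?_, hn, hD1⟩,
    ?_, ?_⟩
  all_goals try simp only
  · omega
  · omega
  · calc _ ≤ 32 * ((n + n * D) * 2 ^ b * 2 ^ b * 2 ^ b) := by gcongr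
      _ = 32 * ((D + 1) * M) := by rw [hM, h3b]; ring
      _ ≤ _ := by omega
  · omega
  · rw [← hb]
    have := Nat.mul_le_mul_left (D + 1) hb3; omega
  · rw [← hb, ← pow_mul]
    exact hnl.le.trans (Nat.pow_le_pow_right (by omega) hlb)
  · omega
  · rw [hJ, ← hl]
    refine Nat.clog_le_of_le_pow ?_
    have h1 := Nat.lt_pow_succ_log_self (b := 2) (by omega) l
    have h2 : q ≤ l + 1 := hq ▸ Nat.div_le_self ..
    have h3 := Nat.one_le_two_pow (n := Nat.log 2 l + 1)
    rw [pow_succ 2 (Nat.log 2 l + 1)]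
    simp only [Nat.succ_eq_add_one] at h1; omega

/-! ### The initial memory -/

/-- The state without colors. -/
def start (n D : ℕ) (st : ℕ → ℕ → ℕ) : State where
  r := 0
  m k := if k = 0 ∨ 6 ≤ k ∧ k ≤ 14 then st k else
    if k = 4 then fun i => if i = 0 then n * D else if i ≤ n * D then n + (i - 1) else 0 else 0
  nd := 0
  t := 0

theorem data_start {n D J : ℕ} {st : ℕ → ℕ → ℕ} (hD : 1 ≤ D) (h1 : st 0 1 = 2 ^ 2 ^ J)
    (h2 : st 0 2 = 2 ^ J) (h3 : st 0 3 = D) : Data n D J st 0 (fun x => x.1) (start n D st) := by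
  have hc : cls n 0 = fun _ => ∅ := by
    funext γ
    exact Set.eq_empty_of_forall_notMem fun x hx => by simpa using hx.2
  have hA : ∀ x, x ∈ inner n D J (cls n 0) ↔ x.1 < n ∧ x.2.1 = D ∧ x.2.2 = 0 := fun x => by
    simp [Trie.inner, hc]
  have hL : below D J (cls n 0) = ∅ := by simp [below, hc]
  refine ⟨⟨?_, ⟨h1, h2, h3⟩, by simp [hc]⟩, rfl, fun p hp => absurd rfl hp,
    fun _ _ => ⟨rfl, rfl, rfl⟩, fun k hk => by simp [start, hk]⟩
  rw [hL]
  refine ⟨fun γ hγ => (hA _).2 ⟨hγ, rfl, rfl⟩, fun _ _ => rfl, fun x hx => ?_, fun x hx h => ?_,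
    fun x hx y hy h => ?_, fun _ h => absurd h (Set.notMem_empty _), fun γ h q _ d _ => ⟨fun h =>
      absurd h (Set.notMem_empty _), fun _ => rfl⟩, fun γ h q _ => ?_, fun _ _ => Nat.zero_le _,
    fun _ _ _ => rfl, fun _ _ => ⟨fun _ => rfl, fun _ _ => rfl⟩, ?_, fun i hi => ?_⟩
  · rw [hA] at hx; omega
  · rw [hA] at hx; omega
  · rw [hA] at hx hy
    exact Prod.ext h (Prod.ext (by omega) (by omega))
  · rw [show digits J ∅ γ h q = ∅ by simp [digits]]; exact VebRep.of_zero fun _ _ => rfl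
  · refine ⟨List.range' n (n * D), List.nodup_range', by simp [start], fun i hi => ?_, fun v => ?_⟩
    · simp at hi; simp [start, Nat.succ_le_of_lt hi]
    · rw [List.mem_range'_1]
      refine ⟨fun h => ⟨h, ?_⟩, fun h => h.1⟩
      rintro ⟨x, hx, rfl⟩
      have := ((hA x).1 hx).1; exact absurd h.1 (by simpa using this)
  · simp [start, show i ≠ 0 by omega, not_le.2 hi]

/-! ### The data structure -/

/-- The part of the memory that never changes: the tables and, in array `0`, the parameters. -/
noncomputable def static (Y : Layout) (n D J : ℕ) (Anc : ℕ → ℕ → Prop) (pos inv : ℕ → ℕ) :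
    ℕ → ℕ → ℕ :=
  update (tables n (par Anc) pos inv) 0 fun i =>
    ([Y.T, Y.U, 2 ^ J, D, Nat.log 2 n + 1, n] : List ℕ).getD i 0

/-- The standing assumptions: there is enough room, and `pos` numbers the vertices in preorder,
with the inverse `inv`. The time `τ` suffices for all operations. -/
structure Setup (Y : Layout) (n D J w τ : ℕ) (Anc : ℕ → ℕ → Prop) (pos inv : ℕ → ℕ) : Prop where
  fits : Fits Y n D J
  mem : Y.Fits w
  size : 8 * n + 16 < Y.N
  pre : IsPreorder n Anc
  pos_lt : ∀ i < n, pos i < n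
  inv_lt : ∀ i < n, inv i < n
  inv_pos : ∀ i < n, inv (pos i) = i
  pos_inv : ∀ i < n, pos (inv i) = i
  time : D * (50 * J + 90) + D * (80 * J + 130) + 12 * D + 40 * J + 180 ≤ τ

/-- The memory represents the coloring `col` of the positions. -/
def Rep (Y : Layout) (n D J : ℕ) (Anc : ℕ → ℕ → Prop) (pos inv : ℕ → ℕ) (col : ℕ → ℕ) {w : ℕ}
    (μ : RamMemory w) : Prop :=
  ∃ s nid, MemRel Y μ s ∧ Data n D J (static Y n D J Anc pos inv) col nid s ∧ ∀ p < n, col p ≤ n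

section

variable {Y : Layout} {n D J w τ v γ S : ℕ} {Anc : ℕ → ℕ → Prop} {pos inv col : ℕ → ℕ}
  {μ : RamMemory w}

theorem static_of_ne {k : ℕ} (hk : k ≠ 0) :
    static Y n D J Anc pos inv k = tables n (par Anc) pos inv k :=
  update_of_ne hk ..

theorem Rep.space_le (X : Setup Y n D J w τ Anc pos inv) (R : Rep Y n D J Anc pos inv col μ) :
    μ.space ≤ (250 + 20 * D) * n := by
  obtain ⟨s, nid, hμ, H, -⟩ := R
  refine H.space_le X.fits (fun i hi => ?_) (fun k h1 h2 i hi => ?_) hμ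
  · simp [static, hi]
  · rw [static_of_ne (by omega), tables, if_neg (by omega)]

theorem Setup.lt (X : Setup Y n D J w τ Anc pos inv) : 8 * n < 2 ^ w := by
  have := X.mem.size
  have := X.fits.arr
  have := X.size; omega

theorem Rep.recolor (X : Setup Y n D J w τ Anc pos inv) (R : Rep Y n D J Anc pos inv col μ)
    (hv : v < n) (hγ : γ < n) (hS : (250 + 20 * D) * n + (recolorCmd.code 0).length * τ ≤ S) :
    ∃ k ≤ (recolorCmd.code 0).length * τ, ∃ y : RamConfig w,
      RamProgram.HaltsIn (recolorCmd.code 0) S k (RamConfig.call μ v γ) y ∧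
        Rep Y n D J Anc pos inv (update col (pos v) (γ + 1)) y.mem := by
  have hsp := R.space_le X
  have hlt := X.lt
  obtain ⟨s, nid, hμ, H, hc⟩ := R
  have hst : static Y n D J Anc pos inv 6 v = pos v := by
    rw [static_of_ne (by omega), tables_apply (by omega)]
    · rfl
    · exact (X.pos_lt v hv).le.trans (by omega)
  obtain ⟨s', ⟨⟨nid', H'⟩, -⟩, k, hk, y, h1, -, h3⟩ := Wp.haltsIn (S := S) X.mem hμ (i := v) (j := γ)
    (by omega) (by omega) (Q := fun s' => (∃ nid', Data n D J (static Y n D J Anc pos inv)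
      (update col (pos v) (γ + 1)) nid' s') ∧ s'.t ≤ τ)
    (wp_recolor X.fits (H.congr rfl rfl) hγ hv (X.pos_lt v hv) hst rfl rfl hc
      fun s' nid' h ht => ⟨⟨nid', h⟩, ht.trans (by simpa [State.call] using X.time)⟩)
    (fun _ h => h.2) (by omega)
  refine ⟨k, hk, y, h1, s', nid', h3, H', fun p hp => ?_⟩
  rw [update_apply]
  split_ifs
  · omega
  · exact hc p hp

theorem Rep.query (X : Setup Y n D J w τ Anc pos inv) (R : Rep Y n D J Anc pos inv col μ)
    (hv : v < n) (hγ : γ < n) (hS : (250 + 20 * D) * n + (queryCmd.code 0).length * τ ≤ S) :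
    ∃ k ≤ (queryCmd.code 0).length * τ, ∃ y : RamConfig w,
      RamProgram.HaltsIn (queryCmd.code 0) S k (RamConfig.call μ v γ) y ∧
        (cls n col γ = ∅ ∧ (y.reg 0).toNat = n ∨
          ∃ x, IsBest Anc (cls n col γ) (pos v) x ∧ (y.reg 0).toNat = inv x) ∧
        Rep Y n D J Anc pos inv col y.mem := by
  have hsp := R.space_le X
  have hlt := X.lt
  obtain ⟨s, nid, hμ, H, hc⟩ := R
  obtain ⟨s', ⟨hm, hnd, ha, -⟩, k, hk, y, h1, h2, h3⟩ := Wp.haltsIn (S := S) X.mem hμ (i := v)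
    (j := γ) (by omega) (by omega) (Q := fun s' => s'.m = s.m ∧ s'.nd = s.nd ∧
      (cls n col γ = ∅ ∧ s'.r 0 = n ∨ ∃ x, IsBest Anc (cls n col γ) (pos v) x ∧ s'.r 0 = inv x) ∧
        s'.t ≤ τ)
    (wp_query X.fits X.size (H.congr rfl rfl) hγ hv (X.pos_lt v hv) X.pos_lt X.inv_lt
      (fun k h1 h2 => static_of_ne (by omega)) (by simp [static]) (by simp [static]) X.pre rfl
      (X.inv_pos v hv) rfl rfl fun s' h1 h2 h3 h4 => ⟨h1, h2, h3, h4.trans (by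
        have := X.time
        simp [State.call]
        omega)⟩)
    (fun _ h => h.2.2.2) (by omega)
  exact ⟨k, hk, y, h1, by rwa [h2], s', nid, h3, H.congr hm hnd, hc⟩

/-- A memory without colored positions. -/
theorem exists_rep_zero (X : Setup Y n D J w τ Anc pos inv) :
    ∃ μ : RamMemory w, Rep Y n D J Anc pos inv 0 μ := by
  have hlt := X.lt
  have hbd := X.fits.bounds
  have hsz := X.mem.size
  have hN := X.size
  have hNW := X.fits.arr
  have hTW := X.fits.window
  have hD : D < Y.N := by
    have := Nat.le_mul_of_pos_left D X.fits.n_pos; omega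
  have hlog : Nat.log 2 n ≤ n := Nat.log_le_self ..
  have h0 : ∀ i, static Y n D J Anc pos inv 0 i < 2 ^ w := fun i => by
    rw [static, update_self]
    rcases i with _ | _ | _ | _ | _ | _ | i <;> simp <;> omega
  have hm : ∀ k i, (start n D (static Y n D J Anc pos inv)).m k i < 2 ^ w := fun k i => by
    simp only [start]
    split_ifs with h1
    · by_cases hk : k = 0
      · rw [hk]; exact h0 i
      · rw [static_of_ne hk, tables]
        split_ifs <;> omega
    all_goals try simp only
    · split_ifs <;> omega
    · simp
  refine ⟨fun a => BitVec.ofNat w (flat Y (start n D (static Y n D J Anc pos inv)) a.toNat),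
    start n D (static Y n D J Anc pos inv), _, ⟨fun a => ?_, ?_⟩,
    data_start X.fits.D_pos (by simp [static, X.fits.size]) (by simp [static]) (by simp [static]),
    fun p _ => Nat.zero_le _⟩
  · rw [BitVec.toNat_ofNat, Nat.mod_eq_of_lt]
    unfold flat
    split_ifs
    · exact Nat.two_pow_pos w
    · exact hm _ _
  · simp [Layout.Stored, start, static]

end

/-- The colors of the positions, plus one. -/
def colors {n σ : ℕ} (e : Fin n ≃ Fin n) (col : Fin n → Fin σ) (p : ℕ) : ℕ :=
  if h : p < n then col (e.symm ⟨p, h⟩) + 1 else 0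

section

variable {n σ : ℕ} {e : Fin n ≃ Fin n} {col : Fin n → Fin σ} {c : Fin σ}

theorem mem_cls_colors {p : ℕ} : p ∈ cls n (colors e col) c ↔ ∃ u, (e u : ℕ) = p ∧ col u = c := by
  constructor
  · rintro ⟨hp, h⟩
    rw [colors, dif_pos hp, add_left_inj] at h; exact ⟨e.symm ⟨p, hp⟩, by simp, Fin.ext h⟩
  · rintro ⟨u, rfl, rfl⟩; exact ⟨(e u).2, by simp [colors]⟩

theorem colors_update {v : Fin n} : colors e (update col v c) =
    update (colors e col) (e v) (c + 1) := by
  funext p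
  by_cases hp : p < n
  · by_cases h : p = e v
    · subst h; simp [colors]
    · rw [update_of_ne h, colors, dif_pos hp, colors, dif_pos hp, update_of_ne]
      rintro rfl; simp at h
  · rw [update_of_ne (by rintro rfl; exact hp (e v).2), colors, dif_neg hp, colors, dif_neg hp]

/-- The answer in terms of preorder numbers is the answer in terms of the tree. -/
theorem isQueryAnswer {T : SimpleGraph (Fin n)} {r v : Fin n} {Anc : ℕ → ℕ → Prop}
    {inv : ℕ → ℕ} (hA : ∀ u v : Fin n, IsAncestor T r u v ↔ Anc (e u) (e v))
    (hlt : ∀ {a v}, Anc a v → a < n)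
    (hdist : ∀ a b v : Fin n, IsAncestor T r a v → IsAncestor T r b v → e b ≤ e a →
      T.dist v a ≤ T.dist v b) (hinv : ∀ u : Fin n, inv (e u) = u) {w : ℕ} {y : BitVec w}
    (h : cls n (colors e col) c = ∅ ∧ y.toNat = n ∨
      ∃ x, IsBest Anc (cls n (colors e col) c) (e v) x ∧ y.toNat = inv x) :
    IsQueryAnswer T r col v c y := by
  rcases h with ⟨h1, h2⟩ | ⟨x, ⟨h1, ⟨u, hu, hxu⟩, h3⟩, h4⟩
  · refine .inr ⟨?_, h2⟩
    rintro ⟨a, -, u, -, hu⟩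
    have : (e u : ℕ) ∈ cls n (colors e col) c := mem_cls_colors.2 ⟨u, rfl, hu⟩
    rw [h1] at this; exact this
  · obtain ⟨u, rfl, hc⟩ := mem_cls_colors.1 hu
    obtain ⟨a, rfl⟩ : ∃ a : Fin n, (e a : ℕ) = x := ⟨e.symm ⟨x, hlt h1⟩, by simp⟩
    refine .inl ⟨a, ⟨⟨(hA _ _).2 h1, u, (hA _ _).2 hxu, hc⟩, ?_⟩, by rw [h4, hinv]⟩
    rintro b ⟨hb, u', hbu, hu'⟩
    exact hdist _ _ _ ((hA _ _).2 h1) hb (Fin.le_def.2 (h3 _ ((hA _ _).1 hb)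
      ⟨_, mem_cls_colors.2 ⟨u', rfl, hu'⟩, (hA _ _).1 hbu⟩))

end

end Nca

open Nca in
theorem mainTheorem5 (ε : ℝ) (hε : 0 < ε) : ∃ (K : ℕ) (Q U : RamProgram),
      ∀ (n σ w : ℕ), σ ≤ n → (1 + ε) * Real.logb 2 n + K ≤ w →
      ∀ (T : SimpleGraph (Fin n)), T.IsTree → ∀ (r : Fin n) (col : Fin n → Fin σ),
      ∃ m : RamMemory w, ∀ ops : List (TreeOp n σ),
        Serves T r Q U (K * (Nat.log 2 (Nat.log 2 n) + 1)) (K * n) col m ops := by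
  obtain ⟨D, K, hK⟩ := exists_params hε
  obtain ⟨len, hlen⟩ : ∃ len, len = (queryCmd.code 0).length + (recolorCmd.code 0).length :=
    ⟨_, rfl⟩
  obtain ⟨c, hc⟩ : ∃ c, c = len * (500 * D + 300) := ⟨_, rfl⟩
  refine ⟨K + (250 + 20 * D) + c, queryCmd.code 0, recolorCmd.code 0,
    fun n σ w hσ hw T hT r col => ?_⟩
  have hn : 1 ≤ n := (Nat.zero_le _).trans_lt r.2
  obtain ⟨g, hg⟩ : ∃ g, g = Nat.log 2 (Nat.log 2 n) + 1 := ⟨_, rfl⟩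
  have hgn : g ≤ n := by
    have h1 : Nat.log 2 (Nat.log 2 n) ≤ Nat.log 2 n := Nat.log_le_self ..
    have h2 : Nat.log 2 n < n := Nat.log_lt_self 2 (by omega); omega
  obtain ⟨J, Y, hY, F, hN, hJ⟩ := hK n w hn (by push_cast at hw; linarith)
  obtain ⟨e, Anc, hpre, hA, hdist⟩ := exists_preorder hT r
  obtain ⟨pos, hpos⟩ : ∃ pos : ℕ → ℕ, ∀ u : Fin n, pos u = e u :=
    ⟨fun i => if h : i < n then e ⟨i, h⟩ else 0, fun u => by simp⟩
  obtain ⟨inv, hinv⟩ : ∃ inv : ℕ → ℕ, ∀ u : Fin n, inv u = e.symm u :=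
    ⟨fun i => if h : i < n then e.symm ⟨i, h⟩ else 0, fun u => by simp⟩
  have X : Setup Y n D J w ((500 * D + 300) * g) Anc pos inv := by
    refine ⟨F, hY, hN, hpre, fun i hi => ?_, fun i hi => ?_, fun i hi => ?_, fun i hi => ?_, ?_⟩
    · rw [hpos ⟨i, hi⟩]; exact Fin.is_lt _
    · rw [hinv ⟨i, hi⟩]; exact Fin.is_lt _
    · rw [hpos ⟨i, hi⟩, hinv]; simp
    · rw [hinv ⟨i, hi⟩, hpos]; simp
    · have h1 : J ≤ g + 1 := by omega
      have h2 := Nat.mul_le_mul_left D h1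
      have h3 : D ≤ D * g := Nat.le_mul_of_pos_right D (by omega)
      rw [mul_add] at h2
      calc _ = 130 * (D * J) + 232 * D + 40 * J + 180 := by ring
        _ ≤ 500 * (D * g) + 300 * g := by omega
        _ = _ := by ring
  have hcn : c * g ≤ c * n := Nat.mul_le_mul_left c hgn
  have hS : ∀ l ≤ len, l * ((500 * D + 300) * g) ≤ (K + (250 + 20 * D) + c) * g ∧
      (250 + 20 * D) * n + l * ((500 * D + 300) * g) ≤ (K + (250 + 20 * D) + c) * n := by
    intro l hl
    have h1 : l * ((500 * D + 300) * g) ≤ c * g := by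
      rw [← mul_assoc, hc]
      gcongr
    simp only [add_mul] at *; omega
  obtain ⟨hq, hq'⟩ := hS (queryCmd.code 0).length (by omega)
  obtain ⟨hu, hu'⟩ := hS (recolorCmd.code 0).length (by omega)
  have hc_lt : ∀ c : Fin σ, (c : ℕ) < n := fun c => c.2.trans_le hσ
  have hinit : ∀ k ≤ n, ∃ μ : RamMemory w,
      Rep Y n D J Anc pos inv (fun p => if p < k then colors e col p else 0) μ := by
    intro k
    induction k with
    | zero => exact fun _ => by simpa using! exists_rep_zero X
    | succ k ih =>
      intro hk
      obtain ⟨μ, R⟩ := ih (by omega)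
      obtain ⟨-, -, y, -, R'⟩ := R.recolor X (X.inv_lt k hk)
        (hc_lt (col (e.symm ⟨k, hk⟩))) le_rfl
      refine ⟨y.mem, ?_⟩
      convert R' using 1
      funext p
      rw [X.pos_inv k hk, update_apply]
      by_cases hp : p = k
      · subst hp; simp [colors, Nat.lt_of_succ_le hk]
      · simp [hp, show p < k + 1 ↔ p < k by omega]
  obtain ⟨m, R⟩ := hinit n le_rfl
  have hcol : (fun p => if p < n then colors e col p else 0) = colors e col := by
    funext p
    by_cases hp : p < n <;> simp [colors, hp]
  rw [hcol] at R
  refine ⟨m, fun ops => ?_⟩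
  rw [← hg]
  clear hinit hcol
  induction ops generalizing col m with
  | nil => exact (R.space_le X).trans ((Nat.le_add_right ..).trans hq')
  | cons op ops ih =>
    cases op with
    | query v c =>
      obtain ⟨k, hk, y, h1, h2, h3⟩ := R.query X v.2 (hc_lt c) hq'
      rw [hpos] at h2
      exact ⟨k, hk.trans hq, y, h1, isQueryAnswer hA (fun h => (hpre.le h).trans_lt (hpre.lt h))
        hdist (fun u => by rw [hinv]; simp) h2, ih _ _ h3⟩
    | recolor v c =>
      obtain ⟨k, hk, y, h1, h2⟩ := R.recolor X v.2 (hc_lt c) hu'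
      rw [hpos, ← colors_update] at h2; exact ⟨k, hk.trans hu, y, h1, ih _ _ h2⟩
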